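/- **Theorem 1.1.** Let $N\ge 3$ and $X=H^1(\mathbb R^N)$ (real-valued functions). Assume (V) $V\in L^\infty(\mathbb R^N)$ is real-valued and $\mathbb Z^N$-periodic, and $0\notin\sigma(-\Delta+V)$, the spectrum of the self-adjoint operator $-\Delta+V$ on $L^2(\mathbb R^N)$; (F1) $f:\mathbb R^N\times\mathbb R\to\mathbb R$ is measurable in $x$, continuous in $u$ for a.e. $x$, and $\mathbb Z^N$-periodic in $x$; (F2) there are $a>0$ and $2<p<\frac{2N}{N-2}$ with $|f(x,u)|\le a(1+|u|^{p-1})$ for all $x\in\mathbb R^N$, $u\in\mathbb R$; (F3) $f(x,u)=o(u)$ as $u\to0$, uniformly in $x$; (F4) $F(x,u)/u^2\to\infty$ as $|u|\to\infty$, uniformly in $x$, where $F(x,u)=\int_0^u f(x,t)\,dt$; (F5) for every $x$, $u\mapsto f(x,u)/|u|$ is non-decreasing on $(-\infty,0)$ and on $(0,\infty)$. Let $B_0(u,v)=\int_{\mathbb R^N}\langle\nabla u,\nabla v\rangle+V(x)uv\,dx$ on $X$. Let $X^+$ (resp. $X^-$) be the positive (resp. negative) spectral subspace of $-\Delta+V$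 in $X$, that is, the largest summand $Y$ of a decomposition $X=Y\oplus Z$ orthogonal both in $L^2(\mathbb R^N)$ and with respect to $B_0$ such that $B_0(y,y)\ge0$ (resp. $\le0$) for all $y\in Y$. Put $$\mu(V)^+=\sup\Big\{M>0:\ B_0(u,u)\ge M\int_{\mathbb R^N}|\nabla u|^2\,dx\ \text{ for all }u\in X^+\Big\},$$ $$\mathcal J_\mu(u)=\frac12\int_{\mathbb R^N}|\nabla u|^2+\Big(V(x)-\frac{\mu}{|x|^2}\Big)u^2\,dx-\int_{\mathbb R^N}F(x,u)\,dx,\qquad u\in X,$$ $$\mathcal N_\mu=\{u\in X\setminus X^-:\ \mathcal J_\mu'(u)(u)=0\ \text{ and }\ \mathcal J_\mu'(u)(v)=0\ \text{ for all }v\in X^-\}.$$ Suppose $0\le\mu<\frac{(N-2)^2}{4}\,\mu(V)^+$. Then $X=X^+\oplus X^-$ is a decomposition orthogonal in $L^2(\mathbb R^N)$ and with respect to $B_0$, with $B_0$ positive definite on $X^+$ and negative definite on $X^-$; the functional $\mathcal J_\mu$ is of class $C^1$ on $X$; and the equation $$-\Delta u+\Big(V(x)-\frac{\mu}{|x|^2}\Big)u=f(x,u)\qquad\text{on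 }\mathbb R^N\setminus\{0\}$$ has a ground state solution: there is a weak solution $u\in\mathcal N_\mu$, $u\neq0$, which is a critical point of $\mathcal J_\mu$ and satisfies $$\mathcal J_\mu(u)=\min_{\mathcal N_\mu}\mathcal J_\mu>0.$$ -/

import Mathlib

open MeasureTheory Set
open scoped ENNReal ContDiff

noncomputable section

namespace HardySchrodinger

/-- `ℝᴺ` with its Euclidean norm. -/
abbrev Space (N : ℕ) : Type := EuclideanSpace ℝ (Fin N)

/-- The real Hilbert space `L²(ℝᴺ)`. -/
abbrev L2 (N : ℕ) : Type := Lp ℝ 2 (volume : Measure (Space N))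

/-- The Hilbert space `L²(ℝᴺ; ℝᴺ)` of square integrable vector fields. -/
abbrev L2Field (N : ℕ) : Type := Lp (Space N) 2 (volume : Measure (Space N))

/-- `φ ∈ C_c^∞(ℝᴺ)`. -/
def IsTestFunction {N : ℕ} (φ : Space N → ℝ) : Prop :=
  ContDiff ℝ ∞ φ ∧ HasCompactSupport φ

/-- `g` is the weak gradient of `u`: `∫ u ∂ₑφ = - ∫ ⟨g, e⟩ φ` for all test functions `φ` and all
directions `e`. -/
def IsWeakGradient {N : ℕ} (u : L2 N) (g : L2Field N) : Prop :=
  ∀ φ : Space N → ℝ, IsTestFunction φ → ∀ e : Space N,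
    ∫ x, u x * fderiv ℝ φ x e = - ∫ x, inner ℝ (g x) e * φ x

theorem IsTestFunction.memLp {N : ℕ} {φ : Space N → ℝ} (h : IsTestFunction φ) :
    MemLp φ 2 (volume : Measure (Space N)) :=
  h.1.continuous.memLp_of_hasCompactSupport h.2

theorem IsTestFunction.memLp_fderiv {N : ℕ} {φ : Space N → ℝ} (h : IsTestFunction φ)
    (e : Space N) : MemLp (fun x => fderiv ℝ φ x e) 2 (volume : Measure (Space N)) :=
  ((h.1.continuous_fderiv (by simp)).clm_apply continuous_const).memLp_of_hasCompactSupport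
    (h.2.fderiv_apply (𝕜 := ℝ) e)

theorem IsTestFunction.integrable_mul {N : ℕ} {φ : Space N → ℝ} (h : IsTestFunction φ)
    (u : L2 N) (e : Space N) : Integrable (fun x => u x * fderiv ℝ φ x e) volume :=
  (Lp.memLp u).integrable_mul (h.memLp_fderiv e)

theorem IsTestFunction.integrable_inner_mul {N : ℕ} {φ : Space N → ℝ} (h : IsTestFunction φ)
    (g : L2Field N) (e : Space N) : Integrable (fun x => inner ℝ (g x) e * φ x) volume :=
  ((Lp.memLp g).inner_const e).integrable_mul h.memLp

/-- The Sobolev space `X = H¹(ℝᴺ)`: pairs `(u, ∇u)` of a function in `L²` and its weak gradient in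
`L²`. It inherits from `L² × L²` the inner product `∫ ⟨∇u, ∇v⟩ + u v`, hence the usual norm. -/
def H1 (N : ℕ) : Submodule ℝ (WithLp 2 (L2 N × L2Field N)) where
  carrier := {w | IsWeakGradient w.fst w.snd}
  zero_mem' := by
    intro φ _ e
    simp
  add_mem' := by
    intro a b ha hb φ hφ e
    have h1 : ∫ x, (a.fst + b.fst : L2 N) x * fderiv ℝ φ x e =
        ∫ x, (a.fst x * fderiv ℝ φ x e + b.fst x * fderiv ℝ φ x e) := by
      apply integral_congr_ae
      filter_upwards [Lp.coeFn_add a.fst b.fst] with x hx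
      rw [hx, Pi.add_apply, add_mul]
    have h2 : ∫ x, inner ℝ ((a.snd + b.snd : L2Field N) x) e * φ x =
        ∫ x, (inner ℝ (a.snd x) e * φ x + inner ℝ (b.snd x) e * φ x) := by
      apply integral_congr_ae
      filter_upwards [Lp.coeFn_add a.snd b.snd] with x hx
      rw [hx, Pi.add_apply, inner_add_left, add_mul]
    rw [integral_add (hφ.integrable_mul _ e) (hφ.integrable_mul _ e)] at h1
    rw [integral_add (hφ.integrable_inner_mul _ e) (hφ.integrable_inner_mul _ e)] at h2
    simp only [WithLp.add_fst, WithLp.add_snd]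
    rw [h1, h2, ha φ hφ e, hb φ hφ e]
    ring
  smul_mem' := by
    intro c a ha φ hφ e
    have h1 : ∫ x, (c • a.fst : L2 N) x * fderiv ℝ φ x e =
        ∫ x, c * (a.fst x * fderiv ℝ φ x e) := by
      apply integral_congr_ae
      filter_upwards [Lp.coeFn_smul c a.fst] with x hx
      rw [hx, Pi.smul_apply, smul_eq_mul, mul_assoc]
    have h2 : ∫ x, inner ℝ ((c • a.snd : L2Field N) x) e * φ x =
        ∫ x, c * (inner ℝ (a.snd x) e * φ x) := by
      apply integral_congr_ae
      filter_upwards [Lp.coeFn_smul c a.snd] with x hx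
      rw [hx, Pi.smul_apply, real_inner_smul_left, mul_assoc]
    rw [integral_const_mul] at h1 h2
    simp only [WithLp.smul_fst, WithLp.smul_snd]
    rw [h1, h2, ha φ hφ e]
    ring

/-- The function underlying an element of `H¹(ℝᴺ)`. -/
def fn {N : ℕ} (u : H1 N) : L2 N := u.1.fst

/-- The weak gradient of an element of `H¹(ℝᴺ)`. -/
def grad {N : ℕ} (u : H1 N) : L2Field N := u.1.snd

/-- The bilinear form `B₀(u, v) = ∫ ⟨∇u, ∇v⟩ + V u v`. -/
def form {N : ℕ} (V : Space N → ℝ) (u v : H1 N) : ℝ :=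
  ∫ x, (inner ℝ (grad u x) (grad v x) + V x * (fn u x * fn v x))

/-- The graph of the self-adjoint operator `A = -Δ + V` on `L²(ℝᴺ)`, for bounded `V`: `u ∈ D(A)`
and `A u = g` iff `u ∈ H¹` and `B₀(u, v) = ⟨g, v⟩` for all `v ∈ H¹`. -/
def SchrodingerGraph {N : ℕ} (V : Space N → ℝ) (u g : L2 N) : Prop :=
  ∃ w : H1 N, fn w = u ∧ ∀ v : H1 N, form V w v = inner ℝ g (fn v)

/-- The spectrum `σ(-Δ + V)`, which is real by self-adjointness: `lam` is outside it iff `A - lam` maps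
`D(A)` bijectively onto `L²(ℝᴺ)` with a bounded inverse `R`. -/
def schrodingerSpectrum {N : ℕ} (V : Space N → ℝ) : Set ℝ :=
  {lam | ¬ ∃ R : L2 N →L[ℝ] L2 N, ∀ u g : L2 N,
    SchrodingerGraph V u (g + lam • u) ↔ u = R g}

/-- `H¹ = Y ⊕ Z`, where the summands are orthogonal in `L²` and with respect to `B₀`; that is,
`Y` and `Z` reduce the operator `-Δ + V`. -/
def IsReducingPair {N : ℕ} (V : Space N → ℝ) (Y Z : Submodule ℝ (H1 N)) : Prop :=
  IsCompl Y Z ∧ ∀ y ∈ Y, ∀ z ∈ Z, inner ℝ (fn y) (fn z) = 0 ∧ form V y z = 0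

/-- `X⁺`: the largest subspace of `H¹` that reduces `-Δ + V` and on which `B₀` is nonnegative. For
`0 ∉ σ(-Δ + V)` it is the spectral subspace of `(0, ∞)`. -/
def XPlus {N : ℕ} (V : Space N → ℝ) : Submodule ℝ (H1 N) :=
  sSup {Y | (∃ Z, IsReducingPair V Y Z) ∧ ∀ y ∈ Y, 0 ≤ form V y y}

/-- `X⁻`: the largest subspace of `H¹` that reduces `-Δ + V` and on which `B₀` is nonpositive. For
`0 ∉ σ(-Δ + V)` it is the spectral subspace of `(-∞, 0)`. -/
def XMinus {N : ℕ} (V : Space N → ℝ) : Submodule ℝ (H1 N) :=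
  sSup {Y | (∃ Z, IsReducingPair V Y Z) ∧ ∀ y ∈ Y, form V y y ≤ 0}

/-- `X = X⁺ ⊕ X⁻` is an orthogonal decomposition with `B₀` positive definite on `X⁺` and negative
definite on `X⁻`. -/
def IsSpectralDecomposition {N : ℕ} (V : Space N → ℝ) (Xp Xm : Submodule ℝ (H1 N)) : Prop :=
  IsReducingPair V Xp Xm ∧
    (∀ u ∈ Xp, u ≠ 0 → 0 < form V u u) ∧ (∀ u ∈ Xm, u ≠ 0 → form V u u < 0)

/-- The constant `μ(V)⁺`. -/
def muPlus {N : ℕ} (V : Space N → ℝ) : ℝ :=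
  sSup {M : ℝ | 0 < M ∧ ∀ u ∈ XPlus V, M * (∫ x, ‖grad u x‖ ^ 2) ≤ form V u u}

/-- The point of `ℤᴺ ⊆ ℝᴺ` with coordinates `z`. -/
def latticePoint {N : ℕ} (z : Fin N → ℤ) : Space N := WithLp.toLp 2 (fun i => (z i : ℝ))

/-- The assumption (V): `V ∈ L^∞(ℝᴺ)` is `ℤᴺ`-periodic and `0 ∉ σ(-Δ + V)`. -/
structure AssumptionV {N : ℕ} (V : Space N → ℝ) : Prop where
  bounded : MemLp V ∞ volume
  periodic : ∀ z : Fin N → ℤ, ∀ᵐ x, V (x + latticePoint z) = V x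
  zero_notMem : (0 : ℝ) ∉ schrodingerSpectrum V

/-- `F(x, u) = ∫₀ᵘ f(x, t) dt`. -/
def primitive {N : ℕ} (f : Space N → ℝ → ℝ) (x : Space N) (u : ℝ) : ℝ :=
  ∫ t in (0 : ℝ)..u, f x t

/-- The assumptions (F1)–(F5) on the nonlinearity. -/
structure AssumptionF {N : ℕ} (f : Space N → ℝ → ℝ) : Prop where
  /-- (F1), measurability in `x` -/
  measurable : ∀ u : ℝ, AEMeasurable (fun x => f x u) volume
  /-- (F1), continuity in `u` -/
  continuous : ∀ᵐ x, Continuous (f x)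
  /-- (F1), periodicity in `x` -/
  periodic : ∀ (z : Fin N → ℤ) (x : Space N) (u : ℝ), f (x + latticePoint z) u = f x u
  /-- (F2), subcritical growth -/
  growth : ∃ a p : ℝ, 0 < a ∧ 2 < p ∧ p < 2 * (N : ℝ) / ((N : ℝ) - 2) ∧
    ∀ (x : Space N) (u : ℝ), |f x u| ≤ a * (1 + |u| ^ (p - 1))
  /-- (F3), `f(x, u) = o(u)` as `u → 0`, uniformly in `x` -/
  small : ∀ ε : ℝ, 0 < ε → ∃ δ : ℝ, 0 < δ ∧
    ∀ (x : Space N) (u : ℝ), 0 < |u| → |u| < δ → |f x u| ≤ ε * |u|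
  /-- (F4), `F(x, u) / u² → ∞` as `|u| → ∞`, uniformly in `x` -/
  superquadratic : ∀ K : ℝ, ∃ R : ℝ, 0 < R ∧
    ∀ (x : Space N) (u : ℝ), R < |u| → K ≤ primitive f x u / u ^ 2
  /-- (F5), weak monotonicity -/
  monotone : ∀ x : Space N, MonotoneOn (fun u => f x u / |u|) (Iio 0) ∧
    MonotoneOn (fun u => f x u / |u|) (Ioi 0)

/-- The energy functional `J_μ` on `X = H¹(ℝᴺ)`. -/
def energy {N : ℕ} (V : Space N → ℝ) (f : Space N → ℝ → ℝ) (μ : ℝ) (u : H1 N) : ℝ :=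
  (1 / 2) * (∫ x, (‖grad u x‖ ^ 2 + (V x - μ / ‖x‖ ^ 2) * fn u x ^ 2))
    - ∫ x, primitive f x (fn u x)

/-- The Nehari–Pankov manifold `N_μ`. -/
def nehariPankov {N : ℕ} (V : Space N → ℝ) (f : Space N → ℝ → ℝ) (μ : ℝ) : Set (H1 N) :=
  {u | u ∉ XMinus V ∧ fderiv ℝ (energy V f μ) u u = 0 ∧
    ∀ v ∈ XMinus V, fderiv ℝ (energy V f μ) u v = 0}

/-- `u` is a weak solution of `-Δu + (V - μ/|x|²) u = f(x, u)` on `ℝᴺ ∖ {0}`. -/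
def IsWeakSolution {N : ℕ} (V : Space N → ℝ) (f : Space N → ℝ → ℝ) (μ : ℝ) (u : H1 N) : Prop :=
  ∀ φ : Space N → ℝ, IsTestFunction φ → (0 : Space N) ∉ tsupport φ →
    ∫ x, (fderiv ℝ φ x (grad u x) + (V x - μ / ‖x‖ ^ 2) * (fn u x * φ x)) =
      ∫ x, f x (fn u x) * φ x

/-- `u` is a ground state: a nontrivial critical point of `J_μ` at which `J_μ` attains its infimum
over `N_μ`, this infimum being positive. -/
structure IsGroundState {N : ℕ} (V : Space N → ℝ) (f : Space N → ℝ → ℝ) (μ : ℝ)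
    (u : H1 N) : Prop where
  nontrivial : u ≠ 0
  critical : HasFDerivAt (energy V f μ) (0 : H1 N →L[ℝ] ℝ) u
  mem_nehariPankov : u ∈ nehariPankov V f μ
  isLeast : IsLeast (energy V f μ '' nehariPankov V f μ) (energy V f μ u)
  pos : 0 < energy V f μ u

end HardySchrodinger

end

open HardySchrodinger

open MeasureTheory Set
open scoped ENNReal ContDiff

noncomputable section

namespace HardySchrodinger

open Filter Topology

/-! ### Ekeland's variational principle, and maximisation along the negative directions. -/

section Abstract

/-! Write J(u) = ½ B(u,u) − G(u), where B is the form of −Δ + V and G(u) = (μ/2) Q(u,u) + ∫ F(x,u)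
with Q(u,u) = ∫ u²/|x|². The singular term is placed in G, so that B and its spectral projection P
remain invariant under lattice translations. The variational argument rests on one inequality, the
field `key` of `IndefiniteData`: G(u) + G'(u)(t s − ((t² + 1)/2) u) ≤ G(s) for t ≥ 0. For the
potential it is a pointwise consequence of (F5) (`IsPseudoMonotone.key`); for the Hardy part it says
Q(s − t u, s − t u) ≥ 0. It makes J strongly concave along X⁻ = ker P, and it makes each point u of
the Nehari–Pankov set a maximum point of J on ℝ₊u ⊕ X⁻. It is therefore enough to find a nontrivial
critical point whose level is at most every upper bound of J on a half space ℝ₊w ⊕ X⁻ with 0 ≠ w ∈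
X⁺ (`IsRayBound`).

Since the monotonicity in (F5) is weak, the maximum point on such a half space need not be unique.
Adding (ε/4)‖u‖⁴ to G preserves `key` with a surplus (`IndefiniteData.quartic_key`), which makes the
maximum point unique; it also bounds the superlevel sets of J. Ekeland's principle for the reduced
functional w ↦ max J on ℝ₊w ⊕ X⁻ then yields almost critical points
(`IndefiniteData.exists_almost_critical`), and ε → 0 gives a Cerami-type sequence for J.

Boundedness of this sequence uses no Ambrosetti–Rabinowitz condition. Normalise to y = u/(1 + ‖u‖).
If s P y vanished in the sense of Lions, J(s P y) would exceed the minimax level for large s,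
whereas `key` and the Cerami bound keep it below. Hence translates of y have a nonzero weak limit,
and if u were unbounded, superquadraticity would force ∫ F(x,u) beyond every multiple of ‖u‖²,
against J(u) > 0.

A subsequence u_n converges weakly to some a, and translates of it to some b ≠ 0. If a ≠ 0, then a
is critical, and Fatou's lemma for ½ f(x,u)u − F(x,u) ≥ 0 bounds its level. If a = 0, the
translations escape to infinity, where the Hardy term disappears, so b is a critical point of J₀
with level at most every ray bound of J_μ. Comparing with the maximum point e of J_μ on the half
space through P b gives J_μ(e) = J₀(e) − (μ/2) Q(e,e) ≤ J₀(b) ≤ J_μ(e); hence μ Q(e,e) = 0. For μ >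
0 this forces e = 0, which is impossible as J_μ(e) > 0; for μ = 0 the point b itself is the
solution.

On the linear side, 0 ∉ σ(−Δ + V) bounds the form B below as an operator on H¹. The sign of its
representing operator, for a coercive inner product, gives P, which is identified with the
projection onto the lattice-theoretic X⁺ along X⁻ (`AssumptionV.exists_projection`). The bound on μ
and Hardy's inequality make B − μQ coercive on X⁺. -/

theorem exists_forall_le_add_dist {α : Type*} [MetricSpace α] [CompleteSpace α] {f : α → ℝ}
    (hf : LowerSemicontinuous f) {c : ℝ} (hc : ∀ x, c ≤ f x) {δ : ℝ} (hδ : 0 < δ) (x₀ : α) :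
    ∃ x, f x + δ * dist x x₀ ≤ f x₀ ∧ ∀ y, f x ≤ f y + δ * dist y x := by
  -- `S x` collects the points below x in Ekeland's order. Each iterate nearly minimises f on the
  -- current set, so the sets shrink to a point at geometric rate, and a point strictly below the
  -- limit would lie in all of them.
  let S : α → Set α := fun x => {y | f y + δ * dist y x ≤ f x}
  have hself : ∀ x, x ∈ S x := fun x => by simp [S]
  have htrans : ∀ x y, y ∈ S x → S y ⊆ S x := by
    intro x y hy z hz
    simp only [S, mem_ofPred_eq] at hy hz ⊢
    have := dist_triangle z y x
    nlinarith
  have hbdd : ∀ x, BddBelow (f '' S x) := fun x => ⟨c, by rintro _ ⟨y, -, rfl⟩; exact hc y⟩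
  have hstep : ∀ (n : ℕ) (x : α), ∃ y ∈ S x, f y < sInf (f '' S x) + (1 / 2 : ℝ) ^ n := by
    intro n x
    obtain ⟨_, ⟨y, hy, rfl⟩, hlt⟩ := exists_lt_of_csInf_lt (s := f '' S x)
      ⟨_, x, hself x, rfl⟩ (show sInf (f '' S x) < sInf (f '' S x) + (1 / 2 : ℝ) ^ n by
        have : (0 : ℝ) < (1 / 2 : ℝ) ^ n := by positivity
        linarith)
    exact ⟨y, hy, hlt⟩
  choose next hnext hlt using hstep
  let u : ℕ → α := fun n => Nat.rec x₀ (fun n x => next n x) n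
  have hu : ∀ n, u (n + 1) = next n (u n) := fun n => rfl
  have hmem : ∀ n, u (n + 1) ∈ S (u n) := fun n => by rw [hu]; exact hnext n _
  have hsub : ∀ n m, n ≤ m → S (u m) ⊆ S (u n) := by
    intro n m hnm
    induction m, hnm using Nat.le_induction with
    | base => exact subset_rfl
    | succ m _ ih => exact (htrans _ _ (hmem m)).trans ih
  have hdist : ∀ n, ∀ y ∈ S (u (n + 1)), dist y (u (n + 1)) ≤ (1 / 2 : ℝ) ^ n / δ := by
    intro n y hy
    have h1 : f (u (n + 1)) < sInf (f '' S (u n)) + (1 / 2 : ℝ) ^ n := by rw [hu]; exact hlt n _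
    have h2 : sInf (f '' S (u n)) ≤ f y := csInf_le (hbdd _) ⟨y, hsub n (n + 1) (by omega) hy, rfl⟩
    have h3 : f y + δ * dist y (u (n + 1)) ≤ f (u (n + 1)) := hy
    rw [le_div_iff₀ hδ]
    nlinarith
  have hpow : Tendsto (fun n : ℕ => 2 * ((1 / 2 : ℝ) ^ n / δ)) atTop (𝓝 0) := by
    have : Tendsto (fun n : ℕ => (1 / 2 : ℝ) ^ n) atTop (𝓝 0) :=
      tendsto_pow_atTop_nhds_zero_of_lt_one (by norm_num) (by norm_num)
    simpa using (this.div_const δ).const_mul 2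
  have hcauchy : CauchySeq (fun n => u (n + 1)) := by
    refine cauchySeq_of_le_tendsto_0 _ (fun n m k hn hm => ?_) hpow
    have h1 := hdist k (u (n + 1)) (hsub (k + 1) (n + 1) (by omega) (hself _))
    have h2 := hdist k (u (m + 1)) (hsub (k + 1) (m + 1) (by omega) (hself _))
    have := dist_triangle_right (u (n + 1)) (u (m + 1)) (u (k + 1))
    linarith
  obtain ⟨x, hx⟩ := cauchySeq_tendsto_of_complete hcauchy
  have hclosed : ∀ z, IsClosed (S z) := by
    intro z
    have : LowerSemicontinuous fun y => f y + δ * dist y z :=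
      hf.add (Continuous.lowerSemicontinuous (by fun_prop))
    exact this.isClosed_preimage (f z)
  have hxmem : ∀ n, x ∈ S (u n) := fun n =>
    (hclosed _).mem_of_tendsto hx (eventually_atTop.2 ⟨n, fun m hm =>
      hsub n (m + 1) (by omega) (hself _)⟩)
  refine ⟨x, hxmem 0, fun y => ?_⟩
  by_contra hy
  push Not at hy
  have hyS : y ∈ S x := by
    simp only [S, mem_ofPred_eq]
    linarith
  have hy' : ∀ n, y ∈ S (u n) := fun n => htrans _ _ (hxmem n) hyS
  have h0 : Tendsto (fun n : ℕ => (1 / 2 : ℝ) ^ n / δ) atTop (𝓝 0) := by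
    refine (hpow.const_mul (1 / 2)).congr' (Eventually.of_forall fun n => by ring) |>.trans ?_
    simp
  have hyx : Tendsto (fun n => u (n + 1)) atTop (𝓝 y) := by
    rw [tendsto_iff_dist_tendsto_zero]
    refine squeeze_zero (fun _ => dist_nonneg) (fun n => ?_) h0
    rw [dist_comm]
    exact hdist n y (hy' (n + 1))
  have := tendsto_nhds_unique hx hyx
  subst this
  simp at hy

variable {X : Type*} [NormedAddCommGroup X] [InnerProductSpace ℝ X]

/-- The midpoint of two near-maximisers would exceed the supremum unless they are close, so every
maximising sequence is Cauchy and no weak compactness is needed. -/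
theorem exists_isMax_of_midpoint [CompleteSpace X] {f : X → ℝ} (hf : Continuous f)
    (K : Submodule ℝ X) (hK : IsClosed (K : Set X)) {C : ℝ} (hC : ∀ v ∈ K, f v ≤ C) {β : ℝ}
    (hβ : 0 < β) (hmid : ∀ m ∈ K, ∀ d ∈ K, f (m + d) + f (m - d) + β * ‖d‖ ^ 2 ≤ 2 * f m) :
    ∃ v ∈ K, ∀ v' ∈ K, f v' ≤ f v := by
  set S := sSup (f '' (K : Set X)) with hS
  have hbdd : BddAbove (f '' (K : Set X)) := ⟨C, by rintro _ ⟨v, hv, rfl⟩; exact hC v hv⟩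
  have hle : ∀ v ∈ K, f v ≤ S := fun v hv => le_csSup hbdd ⟨v, hv, rfl⟩
  have hex : ∀ n : ℕ, ∃ v ∈ K, S - 1 / ((n : ℝ) + 1) < f v := by
    intro n
    obtain ⟨_, ⟨v, hv, rfl⟩, h⟩ := exists_lt_of_lt_csSup (s := f '' (K : Set X))
      ⟨_, 0, K.zero_mem, rfl⟩ (show S - 1 / ((n : ℝ) + 1) < S by
        have : (0 : ℝ) < 1 / ((n : ℝ) + 1) := by positivity
        linarith)
    exact ⟨v, hv, h⟩
  choose v hvK hv using hex
  -- The two values fall short of the supremum by at most 2/(k+1) in total, and the half difference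
  -- contributes a factor 4 when squared: this is the 8.
  have hb : Tendsto (fun n : ℕ => Real.sqrt (8 / β * (1 / ((n : ℝ) + 1)))) atTop (𝓝 0) := by
    have := (tendsto_one_div_add_atTop_nhds_zero_nat (𝕜 := ℝ)).const_mul (8 / β)
    simpa [Function.comp_def] using (Real.continuous_sqrt.tendsto _).comp this
  have hcauchy : CauchySeq v := by
    refine cauchySeq_of_le_tendsto_0 _ (fun n m k hn hm => ?_) hb
    apply Real.le_sqrt_of_sq_le
    have h := hmid ((1 / 2 : ℝ) • (v n + v m)) (K.smul_mem _ (K.add_mem (hvK n) (hvK m)))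
      ((1 / 2 : ℝ) • (v n - v m)) (K.smul_mem _ (K.sub_mem (hvK n) (hvK m)))
    have e1 : (1 / 2 : ℝ) • (v n + v m) + (1 / 2 : ℝ) • (v n - v m) = v n := by module
    have e2 : (1 / 2 : ℝ) • (v n + v m) - (1 / 2 : ℝ) • (v n - v m) = v m := by module
    rw [e1, e2, norm_smul] at h
    have h3 := hle _ (K.smul_mem (1 / 2 : ℝ) (K.add_mem (hvK n) (hvK m)))
    have a1 : 1 / ((n : ℝ) + 1) ≤ 1 / ((k : ℝ) + 1) := by gcongr
    have a2 : 1 / ((m : ℝ) + 1) ≤ 1 / ((k : ℝ) + 1) := by gcongr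
    have b1 := hv n
    have b2 := hv m
    rw [dist_eq_norm]
    have : β * ‖v n - v m‖ ^ 2 ≤ 8 * (1 / ((k : ℝ) + 1)) := by
      rw [Real.norm_of_nonneg (by norm_num : (0 : ℝ) ≤ 1 / 2), mul_pow] at h
      linarith
    rw [div_mul_eq_mul_div, le_div_iff₀ hβ]
    linarith
  obtain ⟨w, hw⟩ := cauchySeq_tendsto_of_complete hcauchy
  refine ⟨w, hK.mem_of_tendsto hw (Eventually.of_forall hvK), fun v' hv' => (hle v' hv').trans ?_⟩
  have h1 : Tendsto (fun n => f (v n)) atTop (𝓝 (f w)) := (hf.tendsto w).comp hw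
  have h2 : Tendsto (fun n : ℕ => S - 1 / ((n : ℝ) + 1)) atTop (𝓝 (S - 0)) :=
    tendsto_const_nhds.sub tendsto_one_div_add_atTop_nhds_zero_nat
  rw [sub_zero] at h2
  exact le_of_tendsto_of_tendsto' h2 h1 fun n => (hv n).le

/-- A continuous symmetric form `B`, positive definite on the range of the projection `P` and
negative definite on its kernel, together with a nonnegative `C¹` function `G` that satisfies the
Nehari–Pankov inequality `key`. -/
structure IndefiniteData (B : X →L[ℝ] X →L[ℝ] ℝ) (P : X →L[ℝ] X) (β : ℝ) (G : X → ℝ)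
    (G' : X → X →L[ℝ] ℝ) : Prop where
  beta_pos : 0 < β
  symm : ∀ u v, B u v = B v u
  idem : ∀ u, P (P u) = P u
  orth : ∀ u v, P u = u → P v = 0 → B u v = 0
  pos : ∀ u, P u = u → β * ‖u‖ ^ 2 ≤ B u u
  neg : ∀ v, P v = 0 → B v v ≤ -(β * ‖v‖ ^ 2)
  hasFDerivAt : ∀ u, HasFDerivAt G (G' u) u
  continuous_deriv : Continuous G'
  apply_zero : G 0 = 0
  key : ∀ (u s : X) (t : ℝ), 0 ≤ t → G u + G' u (t • s - ((t ^ 2 + 1) / 2) • u) ≤ G s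

/-- The functional `½ B(u, u) - G(u)`. -/
noncomputable def quadMinus (B : X →L[ℝ] X →L[ℝ] ℝ) (G : X → ℝ) (u : X) : ℝ :=
  1 / 2 * B u u - G u

namespace IndefiniteData

variable {B : X →L[ℝ] X →L[ℝ] ℝ} {P : X →L[ℝ] X} {β : ℝ} {G : X → ℝ} {G' : X → X →L[ℝ] ℝ}
  (D : IndefiniteData B P β G G')

include D

theorem nonneg (s : X) : 0 ≤ G s := by
  have := D.key 0 s 0 le_rfl
  simpa [D.apply_zero] using this

theorem map_sub_proj (u : X) : P (u - P u) = 0 := by simp [D.idem]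

theorem hasFDerivAt_quadMinus (u : X) : HasFDerivAt (quadMinus B G) (B u - G' u) u := by
  have h : HasFDerivAt (fun u => B u u) (B u + B.flip u) u := by
    have := B.hasFDerivAt (x := u) |>.clm_apply (hasFDerivAt_id u)
    refine this.congr_fderiv ?_
    ext v
    simp
  refine ((h.const_mul (1 / 2)).sub (D.hasFDerivAt u)).congr_fderiv ?_
  ext v
  simp only [sub_apply, smul_apply,
    add_apply, ContinuousLinearMap.flip_apply, smul_eq_mul, D.symm v u]
  ring

theorem continuous_quadMinus : Continuous (quadMinus B G) :=
  continuous_iff_continuousAt.2 fun u => (D.hasFDerivAt_quadMinus u).continuousAt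

theorem continuous_slope : Continuous fun u => B u - G' u :=
  B.continuous.sub D.continuous_deriv

/-- Apply `key` to s = t u + v and expand the quadratic part exactly; the terms linear in the
displacement combine into the slope of the functional at u. The later comparisons of levels go back
to this inequality. -/
theorem quadMinus_le (u v : X) {t : ℝ} (ht : 0 ≤ t) :
    quadMinus B G (t • u + v) ≤ quadMinus B G u +
      (B u - G' u) (((t ^ 2 - 1) / 2) • u + t • v) + 1 / 2 * B v v := by
  have h := D.key u (t • u + v) t ht
  have e : t • (t • u + v) - ((t ^ 2 + 1) / 2) • u = ((t ^ 2 - 1) / 2) • u + t • v := by module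
  rw [e] at h
  simp only [quadMinus, map_add, map_smul, add_apply,
    smul_apply, smul_eq_mul, sub_apply, D.symm v u] at h ⊢
  linarith

/-- The case t = 1: strong concavity along ker P, with a modulus that does not depend on G. -/
theorem quadMinus_add_le (u v : X) (hv : P v = 0) :
    quadMinus B G (u + v) + β / 2 * ‖v‖ ^ 2 ≤ quadMinus B G u + (B u - G' u) v := by
  have h := D.quadMinus_le u v zero_le_one
  have h2 := D.neg v hv
  simp only [one_smul, one_pow, sub_self, zero_div, zero_smul, zero_add] at h
  linarith

/-- On the Nehari–Pankov set the linear term of `quadMinus_le` vanishes, and what remains is the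
nonpositive ½ B(v,v). -/
theorem le_of_nehari {u : X} (hu : (B u - G' u) u = 0) (hv : ∀ v, P v = 0 → (B u - G' u) v = 0)
    {v : X} (hPv : P v = 0) {t : ℝ} (ht : 0 ≤ t) :
    quadMinus B G (t • u + v) ≤ quadMinus B G u := by
  have h := D.quadMinus_le u v ht
  have h2 := D.neg v hPv
  rw [map_add, map_smul, map_smul, hu, hv v hPv] at h
  have := mul_nonneg D.beta_pos.le (sq_nonneg ‖v‖)
  simp only [smul_zero, add_zero] at h
  linarith

theorem form_add (w v : X) (hw : P w = w) (hv : P v = 0) : B (w + v) (w + v) = B w w + B v v := by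
  simp [D.orth w v hw hv, D.symm v w]

theorem exists_argmax [CompleteSpace X] (y : X) :
    ∃ v, P v = 0 ∧ ∀ v', P v' = 0 → quadMinus B G (y + v') ≤ quadMinus B G (y + v) := by
  have hmid : ∀ m, P m = 0 → ∀ d, P d = 0 → quadMinus B G (y + (m + d)) +
      quadMinus B G (y + (m - d)) + β * ‖d‖ ^ 2 ≤ 2 * quadMinus B G (y + m) := by
    intro m hm d hd
    have h1 := D.quadMinus_add_le (y + m) d hd
    have h2 := D.quadMinus_add_le (y + m) (-d) (by simp [hd])
    rw [map_neg, norm_neg, ← sub_eq_add_neg] at h2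
    rw [← add_assoc, ← add_sub_assoc]
    linarith
  obtain ⟨v, hv, h⟩ := exists_isMax_of_midpoint (f := fun v => quadMinus B G (y + v))
    (D.continuous_quadMinus.comp (continuous_const.add continuous_id))
    (LinearMap.ker (P : X →ₗ[ℝ] X)) P.isClosed_ker
    -- The maximum over r of a r − (β/2) r² is a²/(2β), with a the norm of the slope at y.
    (C := quadMinus B G y + ‖B y - G' y‖ ^ 2 / (2 * β)) (fun v hv => by
      have hv : P v = 0 := by simpa using hv
      have h := D.quadMinus_add_le y v hv
      have h2 := (le_abs_self _).trans ((B y - G' y).le_opNorm v)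
      have h3 : ‖B y - G' y‖ * ‖v‖ ≤ ‖B y - G' y‖ ^ 2 / (2 * β) + β / 2 * ‖v‖ ^ 2 := by
        have hb := D.beta_pos
        rw [div_add' _ _ _ (by positivity), le_div_iff₀ (by positivity)]
        nlinarith [sq_nonneg (‖B y - G' y‖ - β * ‖v‖)]
      show quadMinus B G (y + v) ≤ _
      linarith) D.beta_pos (fun m hm d hd => hmid m (by simpa using hm) d (by simpa using hd))
  exact ⟨v, by simpa using hv, fun v' hv' => h v' (by simpa using hv')⟩

omit D in
theorem slope_eq_zero_of_max (D : IndefiniteData B P β G G') {y v : X} (hPv : P v = 0)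
    (h : ∀ v', P v' = 0 → quadMinus B G (y + v') ≤ quadMinus B G (y + v)) (z : X) (hz : P z = 0) :
    (B (y + v) - G' (y + v)) z = 0 := by
  have h1 : HasDerivAt (fun s : ℝ => quadMinus B G (y + v + s • z))
      ((B (y + v) - G' (y + v)) z) 0 := by
    have hl : HasDerivAt (fun s : ℝ => y + v + s • z) z 0 := by
      simpa using ((hasDerivAt_id (0 : ℝ)).smul_const z).const_add (y + v)
    have hq : HasFDerivAt (quadMinus B G) (B (y + v) - G' (y + v)) (y + v + (0 : ℝ) • z) := by
      simpa using D.hasFDerivAt_quadMinus (y + v)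
    exact hq.comp_hasDerivAt (0 : ℝ) hl
  refine IsLocalMax.hasDerivAt_eq_zero (Eventually.of_forall fun s => ?_) h1
  have := h (v + s • z) (by simp [hPv, hz])
  simpa [add_assoc] using this

end IndefiniteData

end Abstract

/-! ### The quartic perturbation, continuity of the fibre maximum, and passage to a slope estimate.
-/

section Perturbation

variable {X : Type*} [NormedAddCommGroup X] [InnerProductSpace ℝ X]

/-- The perturbation `G + (ε/4) ‖·‖⁴`. -/
noncomputable def quartic (G : X → ℝ) (ε : ℝ) (u : X) : ℝ := G u + ε / 4 * ‖u‖ ^ 4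

/-- The derivative of `quartic G ε`. -/
noncomputable def quarticDeriv (G' : X → X →L[ℝ] ℝ) (ε : ℝ) (u : X) : X →L[ℝ] ℝ :=
  G' u + (ε * ‖u‖ ^ 2) • innerSL ℝ u

theorem quadMinus_quartic_le (B : X →L[ℝ] X →L[ℝ] ℝ) (G : X → ℝ) {ε : ℝ} (hε : 0 ≤ ε) (u : X) :
    quadMinus B (quartic G ε) u ≤ quadMinus B G u := by
  simp only [quadMinus, quartic]
  have : 0 ≤ ε / 4 * ‖u‖ ^ 4 := by positivity
  linarith

namespace IndefiniteData

variable {B : X →L[ℝ] X →L[ℝ] ℝ} {P : X →L[ℝ] X} {β : ℝ} {G : X → ℝ} {G' : X → X →L[ℝ] ℝ}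

/-- From ‖s − t u‖² ≥ 0 the quartic term's derivative contributes at most (ε/2)‖u‖²(‖s‖² − ‖u‖²),
and the convexity defect of r ↦ (ε/4) r² between r = ‖u‖² and r = ‖s‖² is exactly the stated
surplus. The surplus is what separates two maximum points on one ray. -/
theorem quartic_key (D : IndefiniteData B P β G G') {ε : ℝ} (hε : 0 ≤ ε) (u s : X) {t : ℝ}
    (ht : 0 ≤ t) :
    quartic G ε u + quarticDeriv G' ε u (t • s - ((t ^ 2 + 1) / 2) • u)
      + ε / 4 * (‖s‖ ^ 2 - ‖u‖ ^ 2) ^ 2 ≤ quartic G ε s := by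
  have h := D.key u s t ht
  simp only [quartic, quarticDeriv, add_apply, smul_apply, innerSL_apply_apply, inner_sub_right,
    real_inner_smul_right, smul_eq_mul, real_inner_self_eq_norm_sq]
  have h2 : 0 ≤ ε / 2 * ‖u‖ ^ 2 * ‖s - t • u‖ ^ 2 := by positivity
  rw [norm_sub_sq_real, real_inner_smul_right, norm_smul, mul_pow, Real.norm_eq_abs, sq_abs,
    real_inner_comm] at h2
  nlinarith

theorem perturb (D : IndefiniteData B P β G G') {ε : ℝ} (hε : 0 ≤ ε) :
    IndefiniteData B P β (quartic G ε) (quarticDeriv G' ε) where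
  beta_pos := D.beta_pos
  symm := D.symm
  idem := D.idem
  orth := D.orth
  pos := D.pos
  neg := D.neg
  apply_zero := by simp [quartic, D.apply_zero]
  continuous_deriv := by
    unfold quarticDeriv
    exact D.continuous_deriv.add (by fun_prop)
  hasFDerivAt u := by
    have h1 : HasFDerivAt (fun u : X => ‖u‖ ^ 2) (2 • (innerSL ℝ u)) u :=
      (hasStrictFDerivAt_norm_sq u).hasFDerivAt
    have h2 := (h1.pow 2).const_mul (ε / 4)
    have h3 := (D.hasFDerivAt u).add h2
    have e : quartic G ε = G + fun y => ε / 4 * (‖y‖ ^ 2) ^ 2 := by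
      funext y
      simp only [quartic, Pi.add_apply]
      ring
    rw [e]
    refine h3.congr_fderiv ?_
    ext v
    simp [quarticDeriv]
    ring
  key u s t ht := by
    have := D.quartic_key hε u s ht
    have : 0 ≤ ε / 4 * (‖s‖ ^ 2 - ‖u‖ ^ 2) ^ 2 := by positivity
    linarith

/-- With d = h y' − h y, strong concavity used once from y' + h y and once from y' + h y' gives
β‖d‖² ≤ ⟨slope at y' + h y, d⟩. The slope at y + h y annihilates d, so ‖d‖ is bounded by a
difference of slopes at points y' + h y and y + h y. -/
theorem continuous_argmax (D : IndefiniteData B P β G G') {h : X → X} (hP : ∀ y, P (h y) = 0)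
    (hmax : ∀ y v', P v' = 0 → quadMinus B G (y + v') ≤ quadMinus B G (y + h y)) :
    Continuous h := by
  rw [continuous_iff_continuousAt]
  intro y
  have hlim : Tendsto (fun y' => ‖(B (y' + h y) - G' (y' + h y)) - (B (y + h y) - G' (y + h y))‖ / β)
      (𝓝 y) (𝓝 0) := by
    have hc : Continuous fun y' =>
        ‖(B (y' + h y) - G' (y' + h y)) - (B (y + h y) - G' (y + h y))‖ / β :=
      (((D.continuous_slope.comp (continuous_id.add continuous_const)).sub
        continuous_const).norm).div_const _
    simpa using hc.tendsto y
  rw [ContinuousAt, tendsto_iff_norm_sub_tendsto_zero]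
  refine squeeze_zero (fun _ => norm_nonneg _) (fun y' => ?_) hlim
  set d := h y' - h y with hd
  have hPd : P d = 0 := by simp [hd, hP]
  have h1 := D.quadMinus_add_le (y' + h y) d hPd
  have h2 := D.quadMinus_add_le (y' + h y') (-d) (by simp [hPd])
  have e1 : y' + h y + d = y' + h y' := by simp [hd]
  have e2 : y' + h y' + -d = y' + h y := by simp [hd, add_assoc]
  rw [e1] at h1
  rw [e2, map_neg, norm_neg, D.slope_eq_zero_of_max (hP y') (hmax y') d hPd] at h2
  have h3 := D.slope_eq_zero_of_max (hP y) (hmax y) d hPd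
  have h4 : β * ‖d‖ ^ 2 ≤
      ((B (y' + h y) - G' (y' + h y)) - (B (y + h y) - G' (y + h y))) d := by
    rw [sub_apply (B (y' + h y) - G' (y' + h y)), h3]
    linarith
  have h5 := h4.trans ((Real.le_norm_self _).trans (ContinuousLinearMap.le_opNorm _ d))
  rw [le_div_iff₀ D.beta_pos]
  rcases (norm_nonneg d).eq_or_lt with h0 | h0
  · rw [← h0, zero_mul]; positivity
  · nlinarith

/-- The reduced functional w ↦ max over t of J(t w + h(t w)) is not known to be differentiable, and
h is only continuous. In the Ekeland inequality both t and h are therefore frozen at the values that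
belong to the displaced point w + s z; the two arguments then differ by t s z alone, and strict
differentiability of J at u lets s tend to 0. -/
theorem neg_le_slope_of_ekeland (D : IndefiniteData B P β G G') {w z u : X} {t₀ δ : ℝ} (h : X → X)
    {t : ℕ → ℝ} {s : ℕ → ℝ} (ht : Tendsto t atTop (𝓝 t₀)) (ht0 : 0 < t₀) (hs : ∀ k, 0 < s k)
    (hs0 : Tendsto s atTop (𝓝 0)) (hh : Continuous h) (hu : u = t₀ • w + h (t₀ • w))
    (hle : ∀ k, quadMinus B G (t k • w + h (t k • (w + s k • z))) - δ * (s k * ‖z‖) ≤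
      quadMinus B G (t k • (w + s k • z) + h (t k • (w + s k • z)))) :
    -(δ * ‖z‖) ≤ t₀ * (B u - G' u) z := by
  have hstrict : HasStrictFDerivAt (quadMinus B G) (B u - G' u) u :=
    hasStrictFDerivAt_of_hasFDerivAt_of_continuousAt
      (Eventually.of_forall D.hasFDerivAt_quadMinus) D.continuous_slope.continuousAt
  have hw : Tendsto (fun k => w + s k • z) atTop (𝓝 w) := by
    simpa using (hs0.smul_const z).const_add w
  have htw : Tendsto (fun k => t k • (w + s k • z)) atTop (𝓝 (t₀ • w)) := ht.smul hw
  have hhk : Tendsto (fun k => h (t k • (w + s k • z))) atTop (𝓝 (h (t₀ • w))) :=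
    (hh.tendsto _).comp htw
  have ha : Tendsto (fun k => t k • (w + s k • z) + h (t k • (w + s k • z))) atTop (𝓝 u) := by
    rw [hu]; exact htw.add hhk
  have hb : Tendsto (fun k => t k • w + h (t k • (w + s k • z))) atTop (𝓝 u) := by
    rw [hu]; exact (ht.smul_const w).add hhk
  have hη : ∀ η : ℝ, 0 < η → -(δ * ‖z‖) ≤ t₀ * (B u - G' u) z + η * (t₀ * ‖z‖) := by
    intro η hη
    have hev := (hstrict.isLittleO.comp_tendsto (ha.prodMk_nhds hb)).def hη
    have hpos : ∀ᶠ k in atTop, 0 < t k := ht.eventually (lt_mem_nhds ht0)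
    have hlim : Tendsto (fun k => t k * (B u - G' u) z + η * (t k * ‖z‖)) atTop
        (𝓝 (t₀ * (B u - G' u) z + η * (t₀ * ‖z‖))) :=
      (ht.mul_const _).add ((ht.mul_const _).const_mul _)
    refine ge_of_tendsto hlim ?_
    filter_upwards [hev, hpos] with k hk hk0
    have e : t k • (w + s k • z) + h (t k • (w + s k • z)) - (t k • w + h (t k • (w + s k • z)))
        = (t k * s k) • z := by module
    simp only [Function.comp_apply, e, norm_smul, map_smul, smul_eq_mul, Real.norm_eq_abs] at hk
    rw [abs_of_pos (mul_pos hk0 (hs k))] at hk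
    have h1 := (le_abs_self _).trans hk
    have h2 := hle k
    have h3 : 0 ≤ s k * (t k * (B u - G' u) z + η * (t k * ‖z‖) + δ * ‖z‖) := by
      nlinarith
    have h4 := nonneg_of_mul_nonneg_right h3 (hs k)
    linarith
  refine le_of_forall_pos_le_add fun e he => ?_
  have h1 := hη (e / (t₀ * ‖z‖ + 1)) (by positivity)
  have h2 : e / (t₀ * ‖z‖ + 1) * (t₀ * ‖z‖) ≤ e := by
    rw [div_mul_eq_mul_div, div_le_iff₀ (by positivity)]
    nlinarith
  linarith

end IndefiniteData

end Perturbation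

/-! ### Almost critical points of the perturbed functional at the minimax level. -/

section AlmostCritical

variable {X : Type*} [NormedAddCommGroup X] [InnerProductSpace ℝ X]

namespace IndefiniteData

variable {B : X →L[ℝ] X →L[ℝ] ℝ} {P : X →L[ℝ] X} {β : ℝ} {G : X → ℝ} {G' : X → X →L[ℝ] ℝ}

theorem slope_ray_eq_zero (D : IndefiniteData B P β G G') {w v : X} {t : ℝ} (ht : 0 < t)
    (hmax : ∀ t' : ℝ, 0 ≤ t' → quadMinus B G (t' • w + v) ≤ quadMinus B G (t • w + v)) :
    (B (t • w + v) - G' (t • w + v)) w = 0 := by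
  have h1 : HasDerivAt (fun s : ℝ => quadMinus B G (s • w + v))
      ((B (t • w + v) - G' (t • w + v)) w) t := by
    have hl : HasDerivAt (fun s : ℝ => s • w + v) w t := by
      simpa using ((hasDerivAt_id t).smul_const w).add_const v
    exact (D.hasFDerivAt_quadMinus _).comp_hasDerivAt t hl
  refine IsLocalMax.hasDerivAt_eq_zero ?_ h1
  filter_upwards [lt_mem_nhds ht] with s hs using hmax s hs.le

theorem form_le (D : IndefiniteData B P β G G') (u : X) : B u u ≤ B (P u) (P u) := by
  have h := D.form_add (P u) (u - P u) (D.idem u) (D.map_sub_proj u)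
  have h2 := D.neg _ (D.map_sub_proj u)
  have := mul_nonneg D.beta_pos.le (sq_nonneg ‖u - P u‖)
  rw [add_sub_cancel] at h
  linarith

theorem quadMinus_le_form (D : IndefiniteData B P β G G') (u : X) :
    quadMinus B G u ≤ 1 / 2 * B (P u) (P u) := by
  have := D.nonneg u
  have := D.form_le u
  simp only [quadMinus]
  linarith

theorem form_self_le (B : X →L[ℝ] X →L[ℝ] ℝ) (u : X) : B u u ≤ ‖B‖ * ‖u‖ ^ 2 := by
  have := (Real.le_norm_self _).trans (B.le_opNorm₂ u u)
  rw [sq, ← mul_assoc]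
  exact this

/-- Superlevel sets of the perturbed functional are bounded. -/
theorem norm_le_of_quadMinus_quartic_nonneg (D : IndefiniteData B P β G G') {ε : ℝ} (hε : 0 < ε)
    {u : X} (hu : 0 ≤ quadMinus B (quartic G ε) u) : ‖u‖ ≤ Real.sqrt (2 * ‖B‖ / ε) := by
  apply Real.le_sqrt_of_sq_le
  rw [le_div_iff₀ hε]
  simp only [quadMinus, quartic] at hu
  have h1 := D.nonneg u
  have h2 := form_self_le B u
  rcases (norm_nonneg u).eq_or_lt with h0 | h0
  · rw [← h0]; simp [norm_nonneg B]
  · have h3 : 0 < ‖u‖ ^ 2 := by positivity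
    have : ‖u‖ ^ 2 * (‖u‖ ^ 2 * ε) ≤ ‖u‖ ^ 2 * (2 * ‖B‖) := by nlinarith
    exact le_of_mul_le_mul_left this h3

set_option maxHeartbeats 1000000 in
/-- Existence of an almost critical point of the perturbed functional, at a level that is almost
below every minimax level over the half spaces `ℝ₊ w₀ ⊕ ker P`. -/
theorem exists_almost_critical [CompleteSpace X] (D : IndefiniteData B P β G G') {ε α ρ : ℝ}
    (hε : 0 < ε) (hα : 0 < α) (hρ : 0 < ρ) (hne : ∃ w, P w = w ∧ w ≠ 0)
    (hgeo : ∀ w, P w = w → ‖w‖ = ρ → α ≤ quadMinus B (quartic G ε) w) :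
    ∃ u, α ≤ quadMinus B (quartic G ε) u ∧ (1 + ‖u‖) * ‖B u - quarticDeriv G' ε u‖ ≤ ε ∧
      ∀ w₀ C, P w₀ = w₀ → w₀ ≠ 0 → (∀ t : ℝ, 0 ≤ t → ∀ v, P v = 0 → quadMinus B G (t • w₀ + v) ≤ C) →
        quadMinus B (quartic G ε) u ≤ C + ε := by
  have DH := D.perturb hε.le
  set Φ := quadMinus B (quartic G ε) with hΦ
  -- Fibre reduction: `h y` is the maximum point on y + ker P, and I below is the functional reduced
  -- to the range of P.
  choose h hPh hmax using DH.exists_argmax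
  have hhc : Continuous h := DH.continuous_argmax hPh hmax
  set I : X → ℝ := fun w => Φ (w + h w) with hI
  have hIc : Continuous I := DH.continuous_quadMinus.comp (continuous_id.add hhc)
  set R := Real.sqrt (2 * ‖B‖ / ε) with hR
  have hR0 : 0 ≤ R := Real.sqrt_nonneg _
  -- The superlevel set at 0 has radius R, and t w is the P-component of a point of it; hence t
  -- stays bounded, uniformly for ‖w‖ ≥ 1.
  have hRay : ∀ (w : X) (t : ℝ), P w = w → 0 ≤ t → 1 ≤ ‖w‖ → 0 ≤ I (t • w) → t ≤ ‖P‖ * R := by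
    intro w t hw ht h1 h0
    have h2 := D.norm_le_of_quadMinus_quartic_nonneg hε h0
    have h3 : P (t • w + h (t • w)) = t • w := by simp [hw, hPh]
    have h4 := P.le_opNorm (t • w + h (t • w))
    rw [h3, norm_smul, Real.norm_of_nonneg ht] at h4
    have h5 : ‖P‖ * ‖t • w + h (t • w)‖ ≤ ‖P‖ * R := by gcongr
    exact (le_mul_of_one_le_right ht h1).trans (h4.trans h5)
  have hαI : ∀ w, P w = w → 1 ≤ ‖w‖ → α ≤ I ((ρ / ‖w‖) • w) := by
    intro w hw h1
    have h0 : 0 < ‖w‖ := by linarith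
    have h2 : ‖(ρ / ‖w‖) • w‖ = ρ := by
      rw [norm_smul, Real.norm_of_nonneg (by positivity), div_mul_cancel₀ _ h0.ne']
    refine (hgeo _ (by rw [map_smul, hw]) h2).trans ?_
    simpa using hmax ((ρ / ‖w‖) • w) 0 (map_zero P)
  have hexT : ∀ w, P w = w ∧ 1 ≤ ‖w‖ → ∃ t : ℝ, 0 ≤ t ∧ ∀ t' : ℝ, 0 ≤ t' → I (t' • w) ≤ I (t • w) := by
    rintro w ⟨hw, h1⟩
    have h0 : 0 < ‖w‖ := by linarith
    have hp : 0 ≤ ρ / ‖w‖ := by positivity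
    have hmem : ρ / ‖w‖ ∈ Icc 0 (‖P‖ * R) :=
      ⟨hp, hRay w _ hw hp h1 (hα.le.trans (hαI w hw h1))⟩
    obtain ⟨t, ht, htm⟩ := isCompact_Icc.exists_isMaxOn ⟨_, hmem⟩
      ((hIc.comp (continuous_id.smul continuous_const)).continuousOn (f := fun t : ℝ => I (t • w)))
    refine ⟨t, ht.1, fun t' ht' => ?_⟩
    by_cases hle : t' ≤ ‖P‖ * R
    · exact htm ⟨ht', hle⟩
    · have h3 : I (t' • w) < 0 := by
        by_contra h4
        exact hle (hRay w t' hw ht' h1 (not_lt.1 h4))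
      have h4 : I ((ρ / ‖w‖) • w) ≤ I (t • w) := htm hmem
      linarith [hαI w hw h1]
  choose! T hT0 hTmax using hexT
  have hTα : ∀ w, P w = w ∧ 1 ≤ ‖w‖ → α ≤ I (T w • w) := fun w hw =>
    (hαI w hw.1 hw.2).trans (hTmax w hw _ (by positivity))
  have hI0 : I 0 ≤ 0 := by
    have := DH.quadMinus_le_form (0 + h 0)
    simpa [hPh, hI] using this
  have hpos : ∀ (w : X) (t : ℝ), 0 ≤ t → 0 < I (t • w) → 0 < t := by
    intro w t ht hIt
    rcases ht.eq_or_lt with h0 | h0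
    · rw [← h0, zero_smul] at hIt; linarith
    · exact h0
  have hslope_w : ∀ (w : X) (t : ℝ), 0 < t → (∀ t' : ℝ, 0 ≤ t' → I (t' • w) ≤ I (t • w)) →
      (B (t • w + h (t • w)) - quarticDeriv G' ε (t • w + h (t • w))) w = 0 := by
    intro w t ht hm
    refine DH.slope_ray_eq_zero ht fun t' ht' => ?_
    exact (hmax (t' • w) _ (hPh _)).trans (hm t' ht')
  have hslope_v : ∀ y v, P v = 0 →
      (B (y + h y) - quarticDeriv G' ε (y + h y)) v = 0 := fun y v hv =>
    DH.slope_eq_zero_of_max (hPh y) (hmax y) v hv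
  -- Two maximum points u and s on the same half space satisfy s = (t₂/t₁) u + v with v ∈ ker P and
  -- have equal levels. Equality in `quartic_key` then kills both surplus terms: v = 0 and ‖s‖ =
  -- ‖u‖.
  have huniq : ∀ (w : X) (t₁ t₂ : ℝ), P w = w ∧ 1 ≤ ‖w‖ → 0 ≤ t₁ → 0 ≤ t₂ →
      (∀ t' : ℝ, 0 ≤ t' → I (t' • w) ≤ I (t₁ • w)) → (∀ t' : ℝ, 0 ≤ t' → I (t' • w) ≤ I (t₂ • w)) →
      t₂ = t₁ := by
    intro w t₁ t₂ hw h1 h2 hm1 hm2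
    have hp1 : 0 < t₁ := hpos w t₁ h1 (hα.trans_le ((hTα w hw).trans (hm1 _ (hT0 w hw))))
    have hp2 : 0 < t₂ := hpos w t₂ h2 (hα.trans_le ((hTα w hw).trans (hm2 _ (hT0 w hw))))
    set u := t₁ • w + h (t₁ • w) with hu
    set s := t₂ • w + h (t₂ • w) with hs
    set v := h (t₂ • w) - (t₂ / t₁) • h (t₁ • w) with hv
    have hPv : P v = 0 := by simp [hv, hPh]
    have hsuv : s = (t₂ / t₁) • u + v := by
      rw [hs, hu, hv, smul_add, smul_smul, div_mul_cancel₀ _ hp1.ne']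
      abel
    have hsu : (B u - quarticDeriv G' ε u) u = 0 := by
      conv_lhs => rw [hu]
      rw [← hu, map_add, map_smul, hslope_w w t₁ hp1 hm1, hslope_v _ _ (hPh _)]
      simp
    have hk := D.quartic_key hε.le u s (t := t₂ / t₁) (by positivity)
    have e : (t₂ / t₁) • s - (((t₂ / t₁) ^ 2 + 1) / 2) • u
        = (((t₂ / t₁) ^ 2 - 1) / 2) • u + (t₂ / t₁) • v := by rw [hsuv]; module
    have hB : B s s = (t₂ / t₁) ^ 2 * B u u + 2 * (t₂ / t₁) * B u v + B v v := by
      rw [hsuv]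
      simp only [map_add, map_smul, add_apply, smul_apply, smul_eq_mul, D.symm v u]
      ring
    have hsv : (B u - quarticDeriv G' ε u) v = 0 := hslope_v _ _ hPv
    rw [sub_apply] at hsu hsv
    rw [e, map_add, map_smul, map_smul, smul_eq_mul, smul_eq_mul] at hk
    have hneg := D.neg v hPv
    have hIs : Φ s = Φ u := le_antisymm (hm1 t₂ h2) (hm2 t₁ h1)
    simp only [hΦ, quadMinus] at hIs
    rw [hB] at hIs
    have hgap : β / 2 * ‖v‖ ^ 2 + ε / 4 * (‖s‖ ^ 2 - ‖u‖ ^ 2) ^ 2 ≤ 0 := by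
      have e1 : quarticDeriv G' ε u u = B u u := by linarith
      have e2 : quarticDeriv G' ε u v = B u v := by linarith
      rw [e1, e2] at hk
      linarith
    have hβ := D.beta_pos
    have hv0 : ‖v‖ = 0 := by
      have a1 : 0 ≤ ε / 4 * (‖s‖ ^ 2 - ‖u‖ ^ 2) ^ 2 := by positivity
      have a2 : β / 2 * ‖v‖ ^ 2 ≤ 0 := by linarith
      by_contra hc
      have : 0 < β / 2 * ‖v‖ ^ 2 := by positivity
      linarith
    have hn : ‖s‖ ^ 2 = ‖u‖ ^ 2 := by
      have a1 : 0 ≤ β / 2 * ‖v‖ ^ 2 := by positivity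
      by_contra hc
      have : 0 < (‖s‖ ^ 2 - ‖u‖ ^ 2) ^ 2 := by
        have := sub_ne_zero.2 hc
        positivity
      linarith [mul_pos (by linarith : 0 < ε / 4) this]
    have hu0 : u ≠ 0 := by
      intro h0
      have : α ≤ Φ u := (hTα w hw).trans (hm1 _ (hT0 w hw))
      rw [h0] at this
      have h00 : Φ 0 = 0 := by simp [hΦ, quadMinus, DH.apply_zero]
      linarith
    rw [norm_eq_zero] at hv0
    rw [hsuv, hv0, add_zero, norm_smul, mul_pow, Real.norm_eq_abs, sq_abs] at hn
    have hu2 : ‖u‖ ^ 2 ≠ 0 := by simpa using hu0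
    have h1' : (t₂ / t₁) ^ 2 = 1 := by
      field_simp at hn ⊢
      linarith
    have h2' : t₂ / t₁ = 1 := by
      have : 0 < t₂ / t₁ := by positivity
      exact (pow_eq_one_iff_of_nonneg this.le two_ne_zero).1 h1'
    rwa [div_eq_one_iff_eq hp1.ne'] at h2'
  -- Ekeland's principle on `{w | P w = w, 1 ≤ ‖w‖}`
  let S : Set X := {w | P w = w ∧ 1 ≤ ‖w‖}
  have hSclosed : IsClosed S :=
    (isClosed_eq P.continuous continuous_id).inter (isClosed_le continuous_const continuous_norm)
  have : CompleteSpace S := hSclosed.completeSpace_coe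
  let Ψ : S → ℝ := fun w => I (T w.1 • w.1)
  have hΨα : ∀ w, α ≤ Ψ w := fun w => hTα w.1 w.2
  -- Ψ is a supremum over t of the continuous functions w ↦ I(t w).
  have hΨlsc : LowerSemicontinuous Ψ := by
    intro w y hy
    have hc : Continuous fun w' : S => I (T w.1 • w'.1) :=
      hIc.comp (continuous_const.smul continuous_subtype_val)
    filter_upwards [(hc.tendsto w).eventually (lt_mem_nhds hy)] with w' hw'
    exact hw'.trans_le (hTmax w'.1 w'.2 _ (hT0 w.1 w.2))
  -- A lower bound for the maximising t: α ≤ ½‖B‖ t²‖w‖² with ‖w‖ ≤ 2.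
  set τ := Real.sqrt (α / (2 * (‖B‖ + 1))) with hτ
  have hτ0 : 0 < τ := Real.sqrt_pos.2 (by positivity)
  -- The first entry controls the loss of level; the second makes (1 + R) δ‖P‖/τ at most ε in the
  -- slope bound.
  set δ := min ε (ε * τ / ((1 + R) * (‖P‖ + 1))) with hδ
  have hδ0 : 0 < δ := lt_min hε (by positivity)
  have hnorm : ∀ w₀ : X, P w₀ = w₀ → w₀ ≠ 0 → (‖w₀‖⁻¹ • w₀) ∈ S := by
    intro w₀ h1 h2
    refine ⟨by rw [map_smul, h1], ?_⟩
    rw [norm_smul, norm_inv, norm_norm, inv_mul_cancel₀ (norm_ne_zero_iff.2 h2)]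
  have hbdd : BddBelow (range Ψ) := ⟨α, by rintro _ ⟨w, rfl⟩; exact hΨα w⟩
  obtain ⟨w₁, hw₁, hw₁0⟩ := hne
  obtain ⟨_, ⟨w₂, rfl⟩, hw₂⟩ := exists_lt_of_csInf_lt (s := range Ψ) ⟨_, ⟨_, hnorm w₁ hw₁ hw₁0⟩, rfl⟩
    (show sInf (range Ψ) < sInf (range Ψ) + δ by linarith)
  have hw₂0 : w₂.1 ≠ 0 := by
    intro h0
    have := w₂.2.2
    rw [h0, norm_zero] at this
    linarith
  -- Normalising does not increase Ψ, which depends only on the ray. Ekeland's point is then within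
  -- distance 1 of a unit vector, so its norm is at most 2.
  let w₃ : S := ⟨_, hnorm w₂.1 w₂.2.1 hw₂0⟩
  have hw₃n : ‖w₃.1‖ = 1 := by
    show ‖‖w₂.1‖⁻¹ • w₂.1‖ = 1
    rw [norm_smul, norm_inv, norm_norm, inv_mul_cancel₀ (norm_ne_zero_iff.2 hw₂0)]
  have hw₃ : Ψ w₃ ≤ Ψ w₂ := by
    show I (T w₃.1 • (‖w₂.1‖⁻¹ • w₂.1)) ≤ _
    rw [smul_smul]
    exact hTmax w₂.1 w₂.2 _ (mul_nonneg (hT0 w₃.1 w₃.2) (by positivity))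
  obtain ⟨w, hwle, hwe⟩ := exists_forall_le_add_dist hΨlsc hΨα hδ0 w₃
  have hinf : sInf (range Ψ) ≤ Ψ w := csInf_le hbdd ⟨w, rfl⟩
  have hdist : dist w w₃ ≤ 1 := by
    have : δ * dist w w₃ ≤ δ * 1 := by linarith
    exact le_of_mul_le_mul_left this hδ0
  have hw2 : ‖w.1‖ ≤ 2 := by
    have h1 : ‖w.1 - w₃.1‖ ≤ 1 := by rw [← dist_eq_norm]; exact hdist
    have h2 := norm_le_norm_add_norm_sub' w.1 w₃.1
    linarith
  set t₀ := T w.1 with ht₀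
  have ht₀0 : 0 < t₀ := hpos w.1 t₀ (hT0 _ w.2) (hα.trans_le (hΨα w))
  set u := t₀ • w.1 + h (t₀ • w.1) with hu
  have hΦu : Φ u = Ψ w := rfl
  have hτt : τ ≤ t₀ := by
    rw [hτ]
    apply Real.sqrt_le_iff.2 ⟨ht₀0.le, ?_⟩
    have h1 := DH.quadMinus_le_form u
    have h2 : P u = t₀ • w.1 := by simp [hu, hPh, w.2.1]
    rw [h2] at h1
    have h3 := form_self_le B (t₀ • w.1)
    rw [norm_smul, Real.norm_of_nonneg ht₀0.le, mul_pow] at h3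
    have h4 : α ≤ Φ u := hΨα w
    have h5 : ‖w.1‖ ^ 2 ≤ 4 := by nlinarith [norm_nonneg w.1]
    have h6 : ‖B‖ * (t₀ ^ 2 * ‖w.1‖ ^ 2) ≤ ‖B‖ * (t₀ ^ 2 * 4) := by gcongr
    rw [div_le_iff₀ (by positivity)]
    have h7 : Φ u ≤ 1 / 2 * (B (t₀ • w.1)) (t₀ • w.1) := h1
    linarith [sq_nonneg t₀]
  -- Only directions orthogonal to w are tested, since w + s z then stays in the constraint ‖·‖ ≥ 1.
  -- The maximising parameters at w + s z have a convergent subsequence whose limit maximises on the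
  -- ray of w; uniqueness identifies it with t₀.
  have hdir : ∀ z, P z = z → inner ℝ w.1 z = 0 →
      -(δ * ‖z‖) ≤ t₀ * (B u - quarticDeriv G' ε u) z := by
    intro z hz hzw
    let s : ℕ → ℝ := fun k => 1 / ((k : ℝ) + 1)
    have hs : ∀ k, 0 < s k := fun k => by positivity
    have hs0 : Tendsto s atTop (𝓝 0) := tendsto_one_div_add_atTop_nhds_zero_nat
    have hmem : ∀ k, w.1 + s k • z ∈ S := by
      intro k
      refine ⟨by rw [map_add, map_smul, w.2.1, hz], w.2.2.trans ?_⟩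
      apply le_of_sq_le_sq _ (norm_nonneg _)
      rw [norm_add_sq_real, real_inner_smul_right, hzw]
      nlinarith [sq_nonneg ‖s k • z‖]
    let t : ℕ → ℝ := fun k => T (w.1 + s k • z)
    have hΨk : ∀ k, Ψ w - δ * (s k * ‖z‖) ≤ I (t k • (w.1 + s k • z)) := by
      intro k
      have h1 := hwe ⟨_, hmem k⟩
      have h2 : dist (⟨_, hmem k⟩ : S) w = s k * ‖z‖ := by
        rw [Subtype.dist_eq, dist_eq_norm, add_sub_cancel_left, norm_smul,
          Real.norm_of_nonneg (hs k).le]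
      rw [h2] at h1
      have h3 : Ψ ⟨_, hmem k⟩ = I (t k • (w.1 + s k • z)) := rfl
      linarith
    have htIcc : ∀ k, t k ∈ Icc 0 (‖P‖ * R) := fun k =>
      ⟨hT0 _ (hmem k), hRay _ _ (hmem k).1 (hT0 _ (hmem k)) (hmem k).2
        (hα.le.trans (hTα _ (hmem k)))⟩
    obtain ⟨t', ht', φ, hφ, hlim⟩ := isCompact_Icc.tendsto_subseq htIcc
    have hw' : Tendsto (fun k => w.1 + s (φ k) • z) atTop (𝓝 w.1) := by
      simpa using ((hs0.comp hφ.tendsto_atTop).smul_const z).const_add w.1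
    have hIlim : Tendsto (fun k => I (t (φ k) • (w.1 + s (φ k) • z))) atTop (𝓝 (I (t' • w.1))) :=
      (hIc.tendsto _).comp (hlim.smul hw')
    have hle : Ψ w ≤ I (t' • w.1) := by
      have h1 : Tendsto (fun k => Ψ w - δ * (s (φ k) * ‖z‖)) atTop (𝓝 (Ψ w)) := by
        simpa using (tendsto_const_nhds (x := Ψ w)).sub
          (((hs0.comp hφ.tendsto_atTop).mul_const ‖z‖).const_mul δ)
      exact le_of_tendsto_of_tendsto' h1 hIlim fun k => hΨk (φ k)
    have htt : t' = t₀ := huniq w.1 t₀ t' w.2 ht₀0.le ht'.1 (hTmax _ w.2)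
      fun r hr => (hTmax _ w.2 r hr).trans hle
    rw [htt] at hlim
    refine DH.neg_le_slope_of_ekeland h hlim ht₀0 (fun k => hs (φ k))
      (hs0.comp hφ.tendsto_atTop) hhc hu fun k => ?_
    have h1 : Φ (t (φ k) • w.1 + h (t (φ k) • (w.1 + s (φ k) • z))) ≤ Ψ w :=
      (hmax _ _ (hPh _)).trans (hTmax _ w.2 _ (htIcc (φ k)).1)
    have h2 := hΨk (φ k)
    show Φ _ - _ ≤ Φ _
    exact (sub_le_sub_right h1 _).trans h2
  have hsw : (B u - quarticDeriv G' ε u) w.1 = 0 := hslope_w w.1 t₀ ht₀0 (hTmax _ w.2)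
  -- The slope at u annihilates ker P (fibre maximum) and w (ray maximum), so only the component z
  -- of P x orthogonal to w has to be estimated.
  have hopn : ‖B u - quarticDeriv G' ε u‖ ≤ δ * ‖P‖ / τ := by
    refine ContinuousLinearMap.opNorm_le_bound _ (by positivity) fun x => ?_
    have hw0 : ‖w.1‖ ^ 2 ≠ 0 := by
      have := w.2.2
      positivity
    set c := inner ℝ w.1 (P x) / ‖w.1‖ ^ 2 with hc
    set z := P x - c • w.1 with hz
    have hPz : P z = z := by simp [hz, D.idem, w.2.1]
    have hzw : inner ℝ w.1 z = 0 := by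
      rw [hz, inner_sub_right, real_inner_smul_right, real_inner_self_eq_norm_sq, hc,
        div_mul_cancel₀ _ hw0, sub_self]
    have hzn : ‖z‖ ≤ ‖P x‖ := by
      apply le_of_sq_le_sq _ (norm_nonneg _)
      have : P x = z + c • w.1 := by simp [hz]
      rw [this, norm_add_sq_real, real_inner_smul_right, real_inner_comm, hzw]
      nlinarith [sq_nonneg ‖c • w.1‖]
    have hx : (B u - quarticDeriv G' ε u) x = (B u - quarticDeriv G' ε u) z := by
      have h1 : x = (x - P x) + (z + c • w.1) := by simp [hz]
      have h2 : (B u - quarticDeriv G' ε u) (x - P x) = 0 := hslope_v _ _ (D.map_sub_proj x)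
      generalize B u - quarticDeriv G' ε u = L at h2 hsw ⊢
      conv_lhs => rw [h1]
      rw [map_add, map_add, map_smul, hsw, h2]
      simp
    have h1 := hdir z hPz hzw
    have h2 := hdir (-z) (by simp [hPz]) (by simp [hzw])
    rw [map_neg, norm_neg] at h2
    have h3 : t₀ * |(B u - quarticDeriv G' ε u) z| ≤ δ * ‖z‖ := by
      rcases abs_cases ((B u - quarticDeriv G' ε u) z) with ⟨h, -⟩ | ⟨h, -⟩ <;> rw [h] <;> linarith
    rw [hx, Real.norm_eq_abs, div_mul_eq_mul_div, le_div_iff₀ hτ0]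
    have h4 := P.le_opNorm x
    calc |(B u - quarticDeriv G' ε u) z| * τ ≤ |(B u - quarticDeriv G' ε u) z| * t₀ := by gcongr
      _ ≤ δ * ‖z‖ := by linarith
      _ ≤ δ * (‖P‖ * ‖x‖) := by gcongr; exact hzn.trans h4
      _ = δ * ‖P‖ * ‖x‖ := by ring
  refine ⟨u, hΨα w, ?_, ?_⟩
  · have hun : ‖u‖ ≤ R := D.norm_le_of_quadMinus_quartic_nonneg hε (hα.le.trans (hΨα w))
    have hδ2 : δ ≤ ε * τ / ((1 + R) * (‖P‖ + 1)) := min_le_right _ _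
    calc (1 + ‖u‖) * ‖B u - quarticDeriv G' ε u‖ ≤ (1 + R) * (δ * ‖P‖ / τ) := by gcongr
      _ ≤ (1 + R) * (ε * τ / ((1 + R) * (‖P‖ + 1)) * ‖P‖ / τ) := by gcongr
      _ = ε * (‖P‖ / (‖P‖ + 1)) := by
        have : (1 + R) ≠ 0 := by positivity
        field_simp
      _ ≤ ε * 1 := by
        gcongr
        rw [div_le_one (by positivity)]
        linarith
      _ = ε := mul_one ε
  · intro w₀ C hw₀ hw₀0 hC
    have h1 : sInf (range Ψ) ≤ Ψ ⟨_, hnorm w₀ hw₀ hw₀0⟩ := csInf_le hbdd ⟨_, rfl⟩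
    have h2 : Ψ ⟨_, hnorm w₀ hw₀ hw₀0⟩ ≤ C := by
      show I (T (‖w₀‖⁻¹ • w₀) • (‖w₀‖⁻¹ • w₀)) ≤ C
      rw [smul_smul]
      exact (quadMinus_quartic_le B G hε.le _).trans
        (hC _ (mul_nonneg (hT0 _ (hnorm w₀ hw₀ hw₀0)) (by positivity)) _ (hPh _))
    have h3 : δ ≤ ε := min_le_left _ _
    have h4 : Φ u ≤ Ψ w₃ := by
      have : 0 ≤ δ * dist w w₃ := by positivity
      rw [hΦu]
      linarith
    linarith

end IndefiniteData

end AlmostCritical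

/-! ### The sign of an invertible symmetric operator and the spectral projection of a form. -/

section Sign

variable {H : Type*} [NormedAddCommGroup H] [InnerProductSpace ℝ H] [CompleteSpace H]

/-- The properties of operators which are inherited by functions of the symmetric operator `T`. -/
structure IsFunctionOf (T L : H →L[ℝ] H) : Prop where
  symm : ∀ u v, inner ℝ (L u) v = inner ℝ u (L v)
  comm : L * T = T * L
  invariant : ∀ K : Submodule ℝ H, IsClosed (K : Set H) → (∀ u ∈ K, T u ∈ K) → ∀ u ∈ K, L u ∈ K

namespace IsFunctionOf

variable {T L M : H →L[ℝ] H}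

omit [CompleteSpace H]

theorem one : IsFunctionOf T 1 := ⟨by simp, by simp, fun _ _ _ _ hu => by simpa using hu⟩

theorem zero : IsFunctionOf T 0 := ⟨by simp, by simp, fun K _ _ _ _ => by simp⟩

theorem self (hT : ∀ u v, inner ℝ (T u) v = inner ℝ u (T v)) : IsFunctionOf T T :=
  ⟨hT, rfl, fun _ _ h => h⟩

theorem add (hL : IsFunctionOf T L) (hM : IsFunctionOf T M) : IsFunctionOf T (L + M) :=
  ⟨fun u v => by simp [inner_add_left, inner_add_right, hL.symm, hM.symm],
    by rw [add_mul, mul_add, hL.comm, hM.comm],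
    fun K hK h u hu => K.add_mem (hL.invariant K hK h u hu) (hM.invariant K hK h u hu)⟩

theorem smul (hL : IsFunctionOf T L) (c : ℝ) : IsFunctionOf T (c • L) :=
  ⟨fun u v => by simp [real_inner_smul_left, real_inner_smul_right, hL.symm],
    by rw [smul_mul_assoc, mul_smul_comm, hL.comm],
    fun K hK h u hu => K.smul_mem c (hL.invariant K hK h u hu)⟩

theorem mul (hL : IsFunctionOf T L) (hM : IsFunctionOf T M) (hLM : L * M = M * L) :
    IsFunctionOf T (L * M) :=
  ⟨fun u v => by
      rw [mul_apply_eq_comp, hL.symm, hM.symm, ← mul_apply_eq_comp, hLM],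
    by rw [mul_assoc, hM.comm, ← mul_assoc, hL.comm, mul_assoc],
    fun K hK h u hu => hL.invariant K hK h _ (hM.invariant K hK h u hu)⟩

theorem pow (hL : IsFunctionOf T L) (n : ℕ) : IsFunctionOf T (L ^ n) := by
  induction n with
  | zero => simpa using one
  | succ n ih => rw [pow_succ]; exact ih.mul hL (pow_mul_comm' L n)

theorem of_tendsto {ι : Type*} {l : Filter ι} [l.NeBot] {f : ι → H →L[ℝ] H}
    (hf : ∀ i, IsFunctionOf T (f i)) (h : Tendsto f l (𝓝 L)) : IsFunctionOf T L := by
  have hev : ∀ u, Tendsto (fun i => f i u) l (𝓝 (L u)) := fun u =>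
    ((ContinuousLinearMap.apply ℝ H u).continuous.tendsto L).comp h
  refine ⟨fun u v => ?_, ?_, fun K hK hT u hu => ?_⟩
  · exact tendsto_nhds_unique ((hev u).inner tendsto_const_nhds)
      ((tendsto_const_nhds.inner (hev v)).congr fun i => ((hf i).symm u v).symm)
  · exact tendsto_nhds_unique (h.mul_const T)
      ((h.const_mul T).congr fun i => ((hf i).comm).symm)
  · exact hK.mem_of_tendsto (hev u) (Eventually.of_forall fun i => (hf i).invariant K hK hT u hu)

end IsFunctionOf

/-- A square root of `1 - A` for `‖A‖ < 1`, written as `1 - C` with `‖C‖ < 1`. -/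
theorem exists_sqrt_one_sub {T A : H →L[ℝ] H} (hA : IsFunctionOf T A) (hA1 : ‖A‖ < 1) :
    ∃ C : H →L[ℝ] H, IsFunctionOf T C ∧ ‖C‖ < 1 ∧ (1 - C) * (1 - C) = 1 - A := by
  set q := ‖A‖ with hq
  -- `r` is the smaller root of x = (q + x²)/2. The iteration C ↦ ½(A + C²) started at 0 therefore
  -- stays in the ball of radius r < 1, where it contracts with factor r; its fixed points are
  -- exactly the solutions of (1 − C)² = 1 − A.
  set r := 1 - Real.sqrt (1 - q) with hr
  have hq0 : 0 ≤ q := norm_nonneg _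
  have hs : Real.sqrt (1 - q) ^ 2 = 1 - q := Real.sq_sqrt (by linarith)
  have hs0 : 0 < Real.sqrt (1 - q) := Real.sqrt_pos.2 (by linarith)
  have hs1 : Real.sqrt (1 - q) ≤ 1 := Real.sqrt_le_one.2 (by linarith)
  have hr0 : 0 ≤ r := by linarith
  have hr1 : r < 1 := by linarith
  have hrq : (q + r ^ 2) / 2 = r := by rw [hr]; nlinarith
  obtain ⟨C, hC0, hC⟩ : ∃ C : ℕ → H →L[ℝ] H, C 0 = 0 ∧
      ∀ n, C (n + 1) = (1 / 2 : ℝ) • (A + C n * C n) :=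
    ⟨fun n => Nat.rec 0 (fun _ L => (1 / 2 : ℝ) • (A + L * L)) n, rfl, fun _ => rfl⟩
  have hCf : ∀ n, IsFunctionOf T (C n) := by
    intro n
    induction n with
    | zero => rw [hC0]; exact IsFunctionOf.zero
    | succ n ih => rw [hC]; exact (hA.add (ih.mul ih rfl)).smul _
  have hCn : ∀ n, ‖C n‖ ≤ r := by
    intro n
    induction n with
    | zero => simpa [hC0] using hr0
    | succ n ih =>
      rw [hC, norm_smul, Real.norm_of_nonneg (by norm_num)]
      have h1 := norm_add_le A (C n * C n)
      have h2 := norm_mul_le (C n) (C n)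
      have h3 : ‖C n‖ * ‖C n‖ ≤ r * r := by gcongr
      nlinarith
  have hdiff : ∀ n, dist (C n) (C (n + 1)) ≤ 1 * r ^ n := by
    intro n
    induction n with
    | zero =>
      rw [dist_comm, hC0, dist_zero_right, pow_zero, mul_one]
      exact (hCn 1).trans hr1.le
    | succ n ih =>
      rw [dist_eq_norm] at ih ⊢
      have e : C (n + 1) - C (n + 1 + 1) = (1 / 2 : ℝ) •
          (C n * (C n - C (n + 1)) + (C n - C (n + 1)) * C (n + 1)) := by
        rw [hC (n + 1), mul_sub, sub_mul]
        have h1 : C (n + 1) - (1 / 2 : ℝ) • (A + C (n + 1) * C (n + 1)) =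
          (1 / 2 : ℝ) • (A + C n * C n) - (1 / 2 : ℝ) • (A + C (n + 1) * C (n + 1)) := by rw [hC n]
        rw [h1, ← smul_sub]
        congr 1
        abel
      rw [e, norm_smul, Real.norm_of_nonneg (by norm_num)]
      have h1 := norm_add_le (C n * (C n - C (n + 1))) ((C n - C (n + 1)) * C (n + 1))
      have h2 := norm_mul_le (C n) (C n - C (n + 1))
      have h3 := norm_mul_le (C n - C (n + 1)) (C (n + 1))
      have h4 : ‖C n‖ * ‖C n - C (n + 1)‖ ≤ r * (1 * r ^ n) := by gcongr; exact hCn n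
      have h5 : ‖C n - C (n + 1)‖ * ‖C (n + 1)‖ ≤ (1 * r ^ n) * r := by gcongr; exact hCn _
      rw [pow_succ]
      linarith
  obtain ⟨C₀, hC₀⟩ := cauchySeq_tendsto_of_complete (cauchySeq_of_le_geometric r 1 hr1 hdiff)
  refine ⟨C₀, IsFunctionOf.of_tendsto hCf hC₀,
    (le_of_tendsto' hC₀.norm hCn).trans_lt hr1, ?_⟩
  have h1 : Tendsto (fun n => C (n + 1)) atTop (𝓝 C₀) := hC₀.comp (tendsto_add_atTop_nat 1)
  have h2 : Tendsto (fun n => C (n + 1)) atTop (𝓝 ((1 / 2 : ℝ) • (A + C₀ * C₀))) :=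
    (((hC₀.mul hC₀).const_add A).const_smul _).congr fun n => (hC n).symm
  have h3 := tendsto_nhds_unique h1 h2
  have h4 : C₀ + C₀ = A + C₀ * C₀ := by
    have h5 : (2 : ℝ) • C₀ = A + C₀ * C₀ := by
      have h6 : (2 : ℝ) • C₀ = (2 : ℝ) • ((1 / 2 : ℝ) • (A + C₀ * C₀)) := congrArg _ h3
      rwa [smul_smul, mul_one_div_cancel two_ne_zero, one_smul] at h6
    rwa [two_smul] at h5
  rw [mul_sub, sub_mul, mul_one, sub_mul, one_mul]
  have : (1 : H →L[ℝ] H) - C₀ - (C₀ - C₀ * C₀) = 1 - (C₀ + C₀) + C₀ * C₀ := by abel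
  rw [mul_one, this, h4]
  abel

/-- The sign of a symmetric operator that is bounded below. -/
theorem exists_sign {T : H →L[ℝ] H} (hT : ∀ u v, inner ℝ (T u) v = inner ℝ u (T v)) {δ : ℝ}
    (hδ : 0 < δ) (hlow : ∀ u, δ * ‖u‖ ≤ ‖T u‖) :
    ∃ (S : H →L[ℝ] H) (β : ℝ), 0 < β ∧ IsFunctionOf T S ∧ S * S = 1 ∧
      (∀ u, S u = u → β * ‖u‖ ^ 2 ≤ inner ℝ (T u) u) ∧
      (∀ u, S u = -u → inner ℝ (T u) u ≤ -(β * ‖u‖ ^ 2)) := by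
  set m := ‖T‖ + 1 with hm
  have hm0 : 0 < m := by positivity
  set T₁ : H →L[ℝ] H := m⁻¹ • T with hT₁
  have hT₁f : IsFunctionOf T T₁ := (IsFunctionOf.self hT).smul _
  have hT₁n : ∀ u, ‖T₁ u‖ ≤ ‖u‖ := by
    intro u
    have h1 := T.le_opNorm u
    rw [hT₁, smul_apply, norm_smul, Real.norm_of_nonneg (by positivity), inv_mul_le_iff₀ hm0]
    nlinarith [norm_nonneg u]
  have hT₁low : ∀ u, δ / m * ‖u‖ ≤ ‖T₁ u‖ := by
    intro u
    rw [hT₁, smul_apply, norm_smul, Real.norm_of_nonneg (by positivity), div_eq_inv_mul, mul_assoc]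
    gcongr
    exact hlow u
  -- As T₁ is a symmetric contraction bounded below by δ/m, ‖A u‖² = ‖u‖² − 2‖T₁u‖² + ‖T₁²u‖² ≤ (1 −
  -- (δ/m)²)‖u‖². So T₁² = 1 − A has the square root 1 − C, which plays the role of |T₁|.
  set A : H →L[ℝ] H := 1 - T₁ * T₁ with hA
  have hAf : IsFunctionOf T A := by
    have := (IsFunctionOf.one (T := T)).add ((hT₁f.mul hT₁f rfl).smul (-1))
    rwa [neg_one_smul, ← sub_eq_add_neg] at this
  have hAu : ∀ u, ‖A u‖ ^ 2 ≤ (1 - (δ / m) ^ 2) * ‖u‖ ^ 2 := by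
    intro u
    have e : A u = u - T₁ (T₁ u) := by simp [hA]
    have h1 : ‖T₁ (T₁ u)‖ ^ 2 ≤ ‖T₁ u‖ ^ 2 := by gcongr; exact hT₁n _
    have h2 : (δ / m * ‖u‖) ^ 2 ≤ ‖T₁ u‖ ^ 2 := by gcongr; exact hT₁low u
    rw [e, norm_sub_sq_real, ← hT₁f.symm, real_inner_self_eq_norm_sq]
    nlinarith
  have hq : ‖A‖ < 1 := by
    have h0 : ‖A‖ ≤ Real.sqrt (1 - (δ / m) ^ 2) := by
      refine ContinuousLinearMap.opNorm_le_bound _ (Real.sqrt_nonneg _) fun u => ?_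
      have h1 : 0 ≤ (1 - (δ / m) ^ 2) * ‖u‖ ^ 2 := (sq_nonneg _).trans (hAu u)
      have h2 := Real.le_sqrt_of_sq_le (hAu u)
      rwa [Real.sqrt_mul' _ (sq_nonneg _), Real.sqrt_sq (norm_nonneg _)] at h2
    refine h0.trans_lt ?_
    rw [Real.sqrt_lt' one_pos]
    have : 0 < (δ / m) ^ 2 := by positivity
    linarith
  obtain ⟨C, hCf, hC1, hC⟩ := exists_sqrt_one_sub hAf hq
  -- The Neumann series inverts |T₁| = 1 − C while remaining a limit of functions of T; the sign is
  -- |T₁|⁻¹T₁.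
  set D : H →L[ℝ] H := ∑' n : ℕ, C ^ n with hD
  have hsum : HasSum (fun n : ℕ => C ^ n) D := (summable_geometric_of_norm_lt_one hC1).hasSum
  have hDf : IsFunctionOf T D := IsFunctionOf.of_tendsto (f := fun s : Finset ℕ => ∑ n ∈ s, C ^ n)
    (fun s => by
      induction s using Finset.cons_induction with
      | empty => simpa using IsFunctionOf.zero
      | cons a s ha ih => rw [Finset.sum_cons]; exact (hCf.pow a).add ih) hsum
  have hDE : D * (1 - C) = 1 := geom_series_mul_neg C hC1
  have hED : (1 - C) * D = 1 := mul_neg_geom_series C hC1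
  have hDT : D * T₁ = T₁ * D := by rw [hT₁, smul_mul_assoc, mul_smul_comm, hDf.comm]
  obtain ⟨S, hS⟩ : ∃ S, S = D * T₁ := ⟨_, rfl⟩
  have hSS : S * S = 1 := by
    have : T₁ * T₁ = (1 - C) * (1 - C) := by rw [hC, hA]; abel
    calc S * S = D * (T₁ * D) * T₁ := by rw [hS]; simp only [mul_assoc]
      _ = D * D * (T₁ * T₁) := by rw [← hDT]; simp only [mul_assoc]
      _ = D * (D * (1 - C)) * (1 - C) := by rw [this]; simp only [mul_assoc]
      _ = 1 := by rw [hDE, mul_one, hDE]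
  have hES : ∀ u, T₁ u = S u - C (S u) := by
    intro u
    have : (1 - C) * S = T₁ := by rw [hS, ← mul_assoc, hED, one_mul]
    rw [← this]
    simp
  have hTT : ∀ u, T u = m • T₁ u := by
    intro u
    rw [hT₁, smul_apply, smul_smul, mul_inv_cancel₀ hm0.ne', one_smul]
  have hCle : ∀ u, inner ℝ (C u) u ≤ ‖C‖ * ‖u‖ ^ 2 := by
    intro u
    have h1 := real_inner_le_norm (C u) u
    have h2 := C.le_opNorm u
    nlinarith [norm_nonneg u]
  -- Since T = m(1 − C)S, the operator T acts as ±m(1 − C) on the eigenspaces of S, and 1 − C ≥ 1 −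
  -- ‖C‖.
  refine ⟨S, m * (1 - ‖C‖), mul_pos hm0 (by linarith), by rw [hS]; exact hDf.mul hT₁f hDT, hSS, fun u hu => ?_,
    fun u hu => ?_⟩
  · rw [hTT, hES, hu, real_inner_smul_left, inner_sub_left, real_inner_self_eq_norm_sq, mul_assoc]
    have := hCle u
    gcongr
    linarith
  · rw [hTT, hES, hu, real_inner_smul_left, map_neg, inner_sub_left, inner_neg_left, inner_neg_left,
      real_inner_self_eq_norm_sq]
    have := hCle u
    nlinarith

/-- A copy of `H` without its norm. -/
def Renorm (H : Type*) : Type _ := H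

instance {H : Type*} [h : AddCommGroup H] : AddCommGroup (Renorm H) := h

instance {H : Type*} [AddCommGroup H] [h : Module ℝ H] : Module ℝ (Renorm H) := h

universe v

variable {E : Type v} [NormedAddCommGroup E] [InnerProductSpace ℝ E] [CompleteSpace E]

/-- A coercive symmetric form is the inner product of an isomorphic Hilbert space. -/
theorem exists_renorm {C : E →L[ℝ] E →L[ℝ] ℝ} (hsymm : ∀ u v, C u v = C v u) {γ : ℝ} (hγ : 0 < γ)
    (hC : ∀ u, γ * ‖u‖ ^ 2 ≤ C u u) :
    ∃ (Y : Type v) (_ : NormedAddCommGroup Y) (_ : InnerProductSpace ℝ Y) (_ : CompleteSpace Y)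
      (e : E ≃L[ℝ] Y), ∀ u v, inner ℝ (e u) (e v) = C u v := by
  let core : InnerProductSpace.Core ℝ (Renorm E) :=
    { inner := fun u v => C (show E from u) (show E from v)
      conj_inner_symm := fun u v => hsymm _ _
      re_inner_nonneg := fun u => (mul_nonneg hγ.le (sq_nonneg _)).trans (hC (show E from u))
      add_left := fun u v w => by
        have : C (show E from (u + v)) (show E from w) = (C (show E from u) + C (show E from v))
          (show E from w) := by rw [← map_add]; rfl
        exact this
      smul_left := fun u v r => by
        have : C (show E from (r • u)) (show E from v) = (r • C (show E from u))
          (show E from v) := by rw [← map_smul]; rfl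
        exact this
      definite := fun u hu => by
        have h1 := hC (show E from u)
        have h2 : C (show E from u) (show E from u) = 0 := hu
        rw [h2] at h1
        have h3 : ‖(show E from u)‖ = 0 := by
          by_contra h
          have : 0 < ‖(show E from u)‖ := lt_of_le_of_ne (norm_nonneg _) (Ne.symm h)
          have : 0 < γ * ‖(show E from u)‖ ^ 2 := by positivity
          linarith
        exact norm_eq_zero.1 h3 }
  let : NormedAddCommGroup (Renorm E) := core.toNormedAddCommGroup
  let : InnerProductSpace ℝ (Renorm E) := InnerProductSpace.ofCore core.toCore
  have hin : ∀ u v : E, inner ℝ (show Renorm E from u) (show Renorm E from v) = C u v :=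
    fun u v => rfl
  have hnorm : ∀ u : E, ‖(show Renorm E from u)‖ ^ 2 = C u u := fun u => by
    rw [← real_inner_self_eq_norm_sq, hin]
  let e₀ : E ≃ₗ[ℝ] Renorm E :=
    { toFun := fun u => u, invFun := fun u => u, map_add' := fun _ _ => rfl,
      map_smul' := fun _ _ => rfl, left_inv := fun _ => rfl, right_inv := fun _ => rfl }
  let e : E ≃L[ℝ] Renorm E := e₀.toContinuousLinearEquivOfBounds (Real.sqrt ‖C‖) (Real.sqrt γ⁻¹)
    (fun u => by
      apply le_of_sq_le_sq _ (by positivity)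
      rw [mul_pow, Real.sq_sqrt (norm_nonneg C)]
      exact (hnorm u).le.trans (IndefiniteData.form_self_le C u))
    (fun u => by
      apply le_of_sq_le_sq _ (by positivity)
      rw [mul_pow, Real.sq_sqrt (by positivity), inv_mul_eq_div, le_div_iff₀ hγ]
      have := (hC (show E from u)).trans (hnorm (show E from u)).ge
      exact (mul_comm _ _).le.trans this)
  exact ⟨Renorm E, inferInstance, inferInstance,
    (completeSpace_congr (e := e.toEquiv) e.isUniformEmbedding).1 inferInstance, e, fun u v => rfl⟩

/-- The projection onto the positive spectral subspace of a nondegenerate form `B` with respect to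
a coercive form `C`. -/
theorem exists_spectral_projection {B C : E →L[ℝ] E →L[ℝ] ℝ} (hB : ∀ u v, B u v = B v u)
    (hC : ∀ u v, C u v = C v u) {γ : ℝ} (hγ : 0 < γ) (hCγ : ∀ u, γ * ‖u‖ ^ 2 ≤ C u u) {δ : ℝ}
    (hδ : 0 < δ) (hlow : ∀ u, δ * ‖u‖ ≤ ‖B u‖) :
    ∃ (P : E →L[ℝ] E) (β : ℝ), 0 < β ∧ (∀ u, P (P u) = P u) ∧
      (∀ u v, P u = u → P v = 0 → B u v = 0 ∧ C u v = 0) ∧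
      (∀ u, P u = u → β * ‖u‖ ^ 2 ≤ B u u) ∧ (∀ v, P v = 0 → B v v ≤ -(β * ‖v‖ ^ 2)) ∧
      ∀ Y Z : Submodule ℝ E, IsCompl Y Z → (∀ y ∈ Y, ∀ z ∈ Z, B y z = 0 ∧ C y z = 0) →
        ∀ y ∈ Y, P y ∈ Y := by
  obtain ⟨W, _, _, _, e, he⟩ := exists_renorm hC hγ hCγ
  let B' : W →L[ℝ] W →L[ℝ] ℝ := B.bilinearComp (e.symm : W →L[ℝ] E) (e.symm : W →L[ℝ] E)
  -- With C as inner product, B is represented by a symmetric operator whose sign respects both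
  -- forms at once.
  let T : W →L[ℝ] W := InnerProductSpace.continuousLinearMapOfBilin B'
  have hT : ∀ u v, inner ℝ (T (e u)) (e v) = B u v := by
    intro u v
    have : inner ℝ (T (e u)) (e v) = B' (e u) (e v) :=
      InnerProductSpace.continuousLinearMapOfBilin_apply B' (e u) (e v)
    rw [this]
    simp [B']
  have hT' : ∀ x y, inner ℝ (T x) y = B (e.symm x) (e.symm y) := by
    intro x y
    simpa using hT (e.symm x) (e.symm y)
  have hTs : ∀ x y, inner ℝ (T x) y = inner ℝ x (T y) := by
    intro x y
    rw [hT', real_inner_comm, hT', hB]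
  set κ := ‖(e : E →L[ℝ] W)‖ + 1 with hκ
  have hκ0 : 0 < κ := by positivity
  have hκe : ∀ u, ‖e u‖ ≤ κ * ‖u‖ := fun u => by
    have := (e : E →L[ℝ] W).le_opNorm u
    have h2 : ‖e u‖ ≤ ‖(e : E →L[ℝ] W)‖ * ‖u‖ := this
    nlinarith [norm_nonneg u]
  have hTlow : ∀ x, δ / κ ^ 2 * ‖x‖ ≤ ‖T x‖ := by
    intro x
    obtain ⟨u, rfl⟩ := e.surjective x
    have h1 : ‖B u‖ ≤ κ * ‖T (e u)‖ := by
      refine ContinuousLinearMap.opNorm_le_bound _ (by positivity) fun v => ?_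
      rw [← hT]
      refine (norm_inner_le_norm _ _).trans ?_
      have := hκe v
      calc ‖T (e u)‖ * ‖e v‖ ≤ ‖T (e u)‖ * (κ * ‖v‖) := by gcongr
        _ = κ * ‖T (e u)‖ * ‖v‖ := by ring
    have h2 := hlow u
    have h3 := hκe u
    rw [div_mul_eq_mul_div, div_le_iff₀ (by positivity)]
    calc δ * ‖e u‖ ≤ δ * (κ * ‖u‖) := by gcongr
      _ = κ * (δ * ‖u‖) := by ring
      _ ≤ κ * (κ * ‖T (e u)‖) := mul_le_mul_of_nonneg_left (h2.trans h1) hκ0.le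
      _ = _ := by ring
  obtain ⟨S, β, hβ, hSf, hSS, hpos, hneg⟩ := exists_sign hTs (by positivity) hTlow
  have hSS' : ∀ x, S (S x) = x := fun x => by
    rw [← mul_apply_eq_comp, hSS]; rfl
  let P : E →L[ℝ] E := (1 / 2 : ℝ) • (1 + (e.symm : W →L[ℝ] E) ∘L S ∘L (e : E →L[ℝ] W))
  have hP : ∀ u, P u = (1 / 2 : ℝ) • (u + e.symm (S (e u))) := fun u => rfl
  have hP1 : ∀ u, P u = u → S (e u) = e u := by
    intro u hu
    rw [hP] at hu
    have h1 : e.symm (S (e u)) = u := by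
      have h2 := congrArg (fun x => (2 : ℝ) • x) hu
      simp only [smul_smul] at h2
      norm_num [two_smul] at h2
      exact h2
    rw [← e.apply_symm_apply (S (e u)), h1]
  have hP0 : ∀ u, P u = 0 → S (e u) = -e u := by
    intro u hu
    rw [hP] at hu
    have h1 : e.symm (S (e u)) = -u := by
      have h2 := congrArg (fun x => (2 : ℝ) • x) hu
      simp only [smul_smul] at h2
      norm_num at h2
      exact (neg_eq_of_add_eq_zero_right h2).symm
    rw [← e.apply_symm_apply (S (e u)), h1, map_neg]
  set κ' := ‖(e.symm : W →L[ℝ] E)‖ + 1 with hκ'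
  have hκ'0 : 0 < κ' := by positivity
  have hκ'e : ∀ u, ‖u‖ ^ 2 ≤ κ' ^ 2 * ‖e u‖ ^ 2 := fun u => by
    have := (e.symm : W →L[ℝ] E).le_opNorm (e u)
    have h2 : ‖u‖ ≤ ‖(e.symm : W →L[ℝ] E)‖ * ‖e u‖ := by simpa using this
    rw [← mul_pow]
    gcongr
    nlinarith [norm_nonneg (e u)]
  have hβ' : ∀ u, β / κ' ^ 2 * ‖u‖ ^ 2 ≤ β * ‖e u‖ ^ 2 := fun u => by
    rw [div_mul_eq_mul_div, div_le_iff₀ (by positivity)]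
    have := hκ'e u
    nlinarith
  refine ⟨P, β / κ' ^ 2, by positivity, fun u => ?_, fun u v hu hv => ⟨?_, ?_⟩, fun u hu => ?_,
    fun v hv => ?_, fun Y Z hYZ horth y hy => ?_⟩
  · rw [hP (P u), hP u]
    simp only [map_smul, map_add, ContinuousLinearEquiv.apply_symm_apply, hSS',
      ContinuousLinearEquiv.symm_apply_apply]
    module
  · have h1 : inner ℝ (T (e u)) (e v) = -inner ℝ (T (e u)) (e v) := by
      conv_lhs => rw [← hP1 u hu]
      rw [← mul_apply_eq_comp, ← hSf.comm, mul_apply_eq_comp, hSf.symm, hP0 v hv, inner_neg_right]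
    rw [← hT]
    linarith
  · have h1 : inner ℝ (e u) (e v) = -inner ℝ (e u) (e v) := by
      conv_lhs => rw [← hP1 u hu]
      rw [hSf.symm, hP0 v hv, inner_neg_right]
    rw [← he]
    linarith
  · rw [← hT]
    exact (hβ' u).trans (hpos _ (hP1 u hu))
  · rw [← hT]
    have h1 := hneg _ (hP0 v hv)
    linarith [hβ' v]
  -- `Y` is not assumed closed. Coercivity of C and `IsCompl Y Z` show that Y is the C-orthogonal
  -- complement of Z; hence it corresponds to the closed subspace K, which is T-invariant by
  -- B-orthogonality and therefore invariant under the sign.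
  · let K : Submodule ℝ W := (Z.map (e : E →ₗ[ℝ] W))ᗮ
    have hK : ∀ x, e x ∈ K ↔ x ∈ Y := by
      intro x
      have hmem : e x ∈ K ↔ ∀ z ∈ Z, C x z = 0 := by
        simp only [K, Submodule.mem_orthogonal']
        constructor
        · intro h z hz
          rw [← he]
          exact h _ ⟨z, hz, rfl⟩
        · rintro h _ ⟨z, hz, rfl⟩
          exact (he x z).trans (h z hz)
      rw [hmem]
      refine ⟨fun h => ?_, fun h z hz => (horth x h z hz).2⟩
      obtain ⟨y, hy, z, hz, rfl⟩ := Submodule.mem_sup.1 (hYZ.sup_eq_top ▸ Submodule.mem_top : x ∈ Y ⊔ Z)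
      have h1 := h z hz
      rw [map_add, add_apply, (horth y hy z hz).2, zero_add] at h1
      have h2 := hCγ z
      rw [h1] at h2
      have h3 : z = 0 := by
        by_contra h
        have : 0 < γ * ‖z‖ ^ 2 := by
          have := norm_pos_iff.2 h
          positivity
        linarith
      simpa [h3] using hy
    have hKT : ∀ x ∈ K, T x ∈ K := by
      intro x hx
      obtain ⟨y, rfl⟩ := e.surjective x
      have hy := (hK y).1 hx
      simp only [K, Submodule.mem_orthogonal']
      rintro _ ⟨z, hz, rfl⟩
      exact (hT y z).trans (horth y hy z hz).1
    have h1 := hSf.invariant K (Submodule.isClosed_orthogonal _) hKT _ ((hK y).2 hy)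
    have h2 : e.symm (S (e y)) ∈ Y := (hK _).1 (by simpa using h1)
    rw [hP]
    exact Y.smul_mem _ (Y.add_mem hy h2)

end Sign

/-! ### The Hilbert space structure of H¹ and bounded forms on it. -/

section Basics

variable {N : ℕ}

theorem L2.inner_eq (u v : L2 N) : inner ℝ u v = ∫ x, u x * v x := by
  rw [MeasureTheory.L2.inner_def]
  refine integral_congr_ae (Eventually.of_forall fun x => ?_)
  simp [mul_comm]

theorem L2.norm_sq_eq (u : L2 N) : ‖u‖ ^ 2 = ∫ x, u x ^ 2 := by
  rw [← real_inner_self_eq_norm_sq, L2.inner_eq]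
  simp only [sq]

theorem L2Field.inner_eq (u v : L2Field N) : inner ℝ u v = ∫ x, inner ℝ (u x) (v x) :=
  MeasureTheory.L2.inner_def u v

theorem L2Field.norm_sq_eq (u : L2Field N) : ‖u‖ ^ 2 = ∫ x, ‖u x‖ ^ 2 := by
  rw [← real_inner_self_eq_norm_sq, L2Field.inner_eq]
  simp only [real_inner_self_eq_norm_sq]

theorem L2.integrable_mul (u v : L2 N) : Integrable (fun x => u x * v x) volume :=
  (Lp.memLp u).integrable_mul (Lp.memLp v)

theorem L2.inner_toLp (u : L2 N) {g : Space N → ℝ} (hg : MemLp g 2 volume) :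
    inner ℝ u (hg.toLp g) = ∫ x, u x * g x := by
  rw [L2.inner_eq]
  refine integral_congr_ae ?_
  filter_upwards [hg.coeFn_toLp] with x hx
  rw [hx]

theorem IsTestFunction.memLp_smul {φ : Space N → ℝ} (h : IsTestFunction φ) (e : Space N) :
    MemLp (fun x => φ x • e) 2 (volume : Measure (Space N)) :=
  (h.1.continuous.smul continuous_const).memLp_of_hasCompactSupport h.2.smul_right

theorem L2Field.inner_toLp (g : L2Field N) {φ : Space N → ℝ} (h : IsTestFunction φ) (e : Space N) :
    inner ℝ g ((h.memLp_smul e).toLp _) = ∫ x, inner ℝ (g x) e * φ x := by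
  rw [L2Field.inner_eq]
  refine integral_congr_ae ?_
  filter_upwards [(h.memLp_smul e).coeFn_toLp] with x hx
  rw [hx, real_inner_smul_right, mul_comm]

theorem isClosed_H1 : IsClosed (H1 N : Set (WithLp 2 (L2 N × L2Field N))) := by
  have : (H1 N : Set (WithLp 2 (L2 N × L2Field N))) = ⋂ (φ : Space N → ℝ) (h : IsTestFunction φ)
      (e : Space N), {w | inner ℝ w.fst ((h.memLp_fderiv e).toLp _) =
        - inner ℝ w.snd ((h.memLp_smul e).toLp _)} := by
    ext w
    simp only [mem_iInter, mem_ofPred_eq]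
    refine forall_congr' fun φ => forall_congr' fun h => forall_congr' fun e => ?_
    rw [L2.inner_toLp, L2Field.inner_toLp _ h]
  rw [this]
  refine isClosed_iInter fun φ => isClosed_iInter fun h => isClosed_iInter fun e => ?_
  have hf : Continuous fun w : WithLp 2 (L2 N × L2Field N) => w.fst :=
    (WithLp.fstL 2 ℝ (L2 N) (L2Field N)).continuous
  have hs : Continuous fun w : WithLp 2 (L2 N × L2Field N) => w.snd :=
    (WithLp.sndL 2 ℝ (L2 N) (L2Field N)).continuous
  exact isClosed_eq (hf.inner continuous_const) (hs.inner continuous_const).neg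

instance : CompleteSpace (H1 N) := isClosed_H1.completeSpace_coe

instance : SecondCountableTopology (H1 N) := by
  have : Fact ((2 : ℝ≥0∞) ≠ ⊤) := ⟨by simp⟩
  have h₁ : SecondCountableTopology (L2 N) := Lp.SecondCountableTopology
  have h₂ : SecondCountableTopology (L2Field N) := Lp.SecondCountableTopology
  have h : SecondCountableTopology (WithLp 2 (L2 N × L2Field N)) :=
    WithLp.secondCountableTopology 2 (L2 N) (L2Field N)
  exact TopologicalSpace.Subtype.secondCountableTopology _

/-- `fn` as a continuous linear map. -/
def fnL : H1 N →L[ℝ] L2 N := (WithLp.fstL 2 ℝ (L2 N) (L2Field N)).comp (H1 N).subtypeL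

/-- `grad` as a continuous linear map. -/
def gradL : H1 N →L[ℝ] L2Field N := (WithLp.sndL 2 ℝ (L2 N) (L2Field N)).comp (H1 N).subtypeL

theorem fnL_apply (u : H1 N) : fnL u = fn u := rfl

theorem fn_sub (u v : H1 N) : fn (u - v) = fn u - fn v := rfl

theorem fn_zero : fn (0 : H1 N) = 0 := rfl

theorem fn_add_ae (u v : H1 N) : fn (u + v) =ᵐ[volume] fun x => fn u x + fn v x :=
  Lp.coeFn_add (fn u) (fn v)

theorem fn_sub_ae (u v : H1 N) : fn (u - v) =ᵐ[volume] fun x => fn u x - fn v x :=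
  Lp.coeFn_sub (fn u) (fn v)

theorem fn_smul_ae (c : ℝ) (u : H1 N) : fn (c • u) =ᵐ[volume] fun x => c * fn u x :=
  Lp.coeFn_smul c (fn u)

theorem fn_memLp (u : H1 N) : MemLp (fn u) 2 volume := Lp.memLp (fn u)

theorem fn_aesm (u : H1 N) : AEStronglyMeasurable (fn u) volume := Lp.aestronglyMeasurable (fn u)

theorem H1.inner_eq (u v : H1 N) :
    inner ℝ u v = inner ℝ (fn u) (fn v) + inner ℝ (grad u) (grad v) :=
  WithLp.prod_inner_apply u.1 v.1

theorem H1.norm_sq_eq (u : H1 N) : ‖u‖ ^ 2 = ‖fn u‖ ^ 2 + ‖grad u‖ ^ 2 :=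
  WithLp.prod_norm_sq_eq_of_L2 u.1

theorem norm_fn_le (u : H1 N) : ‖fn u‖ ≤ ‖u‖ := by
  apply le_of_sq_le_sq _ (norm_nonneg _)
  rw [H1.norm_sq_eq]
  linarith [sq_nonneg ‖grad u‖]

theorem norm_grad_le (u : H1 N) : ‖grad u‖ ≤ ‖u‖ := by
  apply le_of_sq_le_sq _ (norm_nonneg _)
  rw [H1.norm_sq_eq]
  linarith [sq_nonneg ‖fn u‖]

/-- A weak gradient is determined by the function. -/
theorem fn_injective : Function.Injective (fn : H1 N → L2 N) := by
  intro u v h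
  rw [← sub_eq_zero]
  set w := u - v with hw
  have hw0 : fn w = 0 := by rw [hw, fn_sub, h, sub_self]
  have hg : ∀ e : Space N, ∀ᵐ x, inner ℝ (grad w x) e = 0 := by
    intro e
    refine ae_eq_zero_of_integral_contDiff_smul_eq_zero
      (((Lp.memLp (grad w)).inner_const e).locallyIntegrable (by norm_num)) fun φ hφ hφc => ?_
    have h1 := w.2 φ ⟨hφ, hφc⟩ e
    have h2 : ∫ x, fn w x * fderiv ℝ φ x e = 0 := by
      rw [hw0, integral_eq_zero_of_ae]
      filter_upwards [Lp.coeFn_zero ℝ 2 (volume : Measure (Space N))] with x hx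
      rw [hx]
      simp
    have h3 : (0 : ℝ) = -∫ x, inner ℝ (grad w x) e * φ x := h2.symm.trans h1
    simp only [smul_eq_mul, mul_comm (φ _)]
    linarith
  have hg0 : grad w = 0 := by
    rw [Lp.eq_zero_iff_ae_eq_zero]
    have h1 : ∀ᵐ x, ∀ i : Fin N, inner ℝ (grad w x) (EuclideanSpace.single i (1 : ℝ)) = 0 :=
      ae_all_iff.2 fun i => hg _
    filter_upwards [h1] with x hx
    ext i
    simpa [EuclideanSpace.inner_single_right] using hx i
  have : ‖w‖ ^ 2 = 0 := by rw [H1.norm_sq_eq, hw0, hg0]; simp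
  simpa using this

section Pairing

variable {E F : Type*} [NormedAddCommGroup E] [NormedSpace ℝ E] [NormedAddCommGroup F]
  [InnerProductSpace ℝ F]

/-- The form `(u, v) ↦ ⟨S u, T v⟩`. -/
def pairL (S T : E →L[ℝ] F) : E →L[ℝ] E →L[ℝ] ℝ :=
  LinearMap.mkContinuous₂ (LinearMap.mk₂ ℝ (fun u v => inner ℝ (S u) (T v))
    (fun u u' v => by simp [inner_add_left]) (fun c u v => by simp [real_inner_smul_left])
    (fun u v v' => by simp [inner_add_right]) (fun c u v => by simp [real_inner_smul_right]))
    (‖S‖ * ‖T‖) fun u v => by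
      refine (norm_inner_le_norm (𝕜 := ℝ) (S u) (T v)).trans ?_
      calc ‖S u‖ * ‖T v‖ ≤ (‖S‖ * ‖u‖) * (‖T‖ * ‖v‖) := by
            gcongr
            exacts [S.le_opNorm u, T.le_opNorm v]
        _ = ‖S‖ * ‖T‖ * ‖u‖ * ‖v‖ := by ring

end Pairing

section Weight

variable {E : Type*} [NormedAddCommGroup E] [NormedSpace ℝ E]

/-- The operator `u ↦ k ι(u)`, where `ι : E → L²` and `k` is a weight. -/
def weightL (ι : E →L[ℝ] L2 N) (k : Space N → ℝ) (C : ℝ)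
    (hk : ∀ u, MemLp (fun x => k x * ι u x) 2 volume)
    (hC : ∀ u, ‖(hk u).toLp _‖ ≤ C * ‖u‖) : E →L[ℝ] L2 N :=
  LinearMap.mkContinuous
    { toFun := fun u => (hk u).toLp _
      map_add' := fun u v => by
        rw [← MemLp.toLp_add]
        refine MemLp.toLp_congr _ _ ?_
        rw [map_add]
        filter_upwards [Lp.coeFn_add (ι u) (ι v)] with x hx
        rw [hx, Pi.add_apply, Pi.add_apply, mul_add]
      map_smul' := fun c u => by
        rw [RingHom.id_apply, ← MemLp.toLp_const_smul]
        refine MemLp.toLp_congr _ _ ?_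
        rw [map_smul]
        filter_upwards [Lp.coeFn_smul c (ι u)] with x hx
        rw [hx, Pi.smul_apply, Pi.smul_apply, smul_eq_mul, smul_eq_mul]
        ring } C hC

theorem weightL_ae {ι : E →L[ℝ] L2 N} {k : Space N → ℝ} {C : ℝ}
    {hk : ∀ u, MemLp (fun x => k x * ι u x) 2 volume}
    {hC : ∀ u, ‖(hk u).toLp _‖ ≤ C * ‖u‖} (u : E) :
    weightL ι k C hk hC u =ᵐ[volume] fun x => k x * ι u x :=
  (hk u).coeFn_toLp

end Weight

end Basics

/-! ### The form of −Δ + V and the consequences of the spectral gap. -/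

section Form

variable {N : ℕ} {V : Space N → ℝ}

theorem exists_mulL (hV : MemLp V ∞ volume) :
    ∃ (M : L2 N →L[ℝ] L2 N) (K : ℝ), 0 ≤ K ∧ (∀ u, M u =ᵐ[volume] fun x => V x * u x) ∧
      ∀ᵐ x, |V x| ≤ K := by
  have hK : ∀ᵐ x, |V x| ≤ (eLpNorm V ∞ volume).toReal := by
    have h : ∀ᵐ x, ‖V x‖ₑ ≤ eLpNorm V ∞ volume := by
      rw [eLpNorm_exponent_top]; exact ae_le_eLpNormEssSup
    filter_upwards [h] with x hx
    rw [← Real.norm_eq_abs, ← toReal_enorm]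
    exact ENNReal.toReal_mono hV.2.ne hx
  set K := (eLpNorm V ∞ volume).toReal with hKdef
  have hK0 : 0 ≤ K := ENNReal.toReal_nonneg
  have hbound : ∀ u : L2 N, ∀ᵐ x, ‖V x * u x‖ ≤ K * ‖u x‖ := fun u => by
    filter_upwards [hK] with x hx
    rw [norm_mul, Real.norm_eq_abs]
    gcongr
  have hmem : ∀ u : L2 N, MemLp (fun x => V x * u x) 2 volume := fun u =>
    (Lp.memLp u).of_le_mul (hV.1.mul (Lp.aestronglyMeasurable u)) (hbound u)
  refine ⟨weightL (ContinuousLinearMap.id ℝ (L2 N)) V K hmem fun u => ?_, K, hK0,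
    fun u => weightL_ae u, hK⟩
  refine Lp.norm_le_mul_norm_of_ae_le_mul ?_
  filter_upwards [(hmem u).coeFn_toLp, hbound u] with x hx h
  exact (congrArg norm hx).le.trans h

theorem exists_formL (hV : MemLp V ∞ volume) :
    ∃ (B : H1 N →L[ℝ] H1 N →L[ℝ] ℝ) (K : ℝ), 0 ≤ K ∧ (∀ u v, B u v = form V u v) ∧
      (∀ u, ‖grad u‖ ^ 2 - K * ‖fn u‖ ^ 2 ≤ form V u u) ∧
      (∀ u v, Integrable fun x => V x * (fn u x * fn v x)) := by
  obtain ⟨M, K, hK0, hM, hK⟩ := exists_mulL hV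
  obtain ⟨B, hB⟩ : ∃ B : H1 N →L[ℝ] H1 N →L[ℝ] ℝ,
      ∀ u v, B u v = inner ℝ (grad u) (grad v) + inner ℝ (M (fn u)) (fn v) :=
    ⟨pairL gradL gradL + pairL (M.comp fnL) fnL, fun u v => rfl⟩
  have hint : ∀ u v : H1 N, Integrable fun x => V x * (fn u x * fn v x) := fun u v => by
    refine (L2.integrable_mul (M (fn u)) (fn v)).congr ?_
    filter_upwards [hM (fn u)] with x hx
    rw [hx, mul_assoc]
  have hform : ∀ u v, B u v = form V u v := fun u v => by
    rw [hB, form, integral_add (MeasureTheory.L2.integrable_inner (grad u) (grad v)) (hint u v),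
      L2Field.inner_eq, L2.inner_eq]
    congr 1
    refine integral_congr_ae ?_
    filter_upwards [hM (fn u)] with x hx
    rw [hx, mul_assoc]
  refine ⟨B, K, hK0, hform, fun u => ?_, hint⟩
  rw [form, integral_add (MeasureTheory.L2.integrable_inner (grad u) (grad u)) (hint u u),
    ← L2Field.inner_eq, real_inner_self_eq_norm_sq, L2.norm_sq_eq, ← integral_const_mul,
    sub_eq_add_neg, ← integral_neg]
  refine add_le_add_right (integral_mono_ae ?_ (hint u u) ?_) _
  · exact ((Lp.memLp (fn u)).integrable_sq.const_mul K).neg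
  · filter_upwards [hK] with x hx
    have := neg_le_of_abs_le hx
    show -(K * fn u x ^ 2) ≤ _
    nlinarith [sq_nonneg (fn u x)]

theorem form_symm (u v : H1 N) : form V u v = form V v u := by
  simp only [form]
  congr 1
  funext x
  rw [real_inner_comm, mul_comm (fn u x)]

set_option maxHeartbeats 1000000 in
/-- The consequences of `0 ∉ σ(-Δ + V)`. -/
theorem AssumptionV.exists_projection (hV : AssumptionV V) :
    ∃ (B : H1 N →L[ℝ] H1 N →L[ℝ] ℝ) (P : H1 N →L[ℝ] H1 N) (β : ℝ), 0 < β ∧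
      (∀ u v, B u v = form V u v) ∧ (∀ u, P (P u) = P u) ∧
      (∀ u v, P u = u → P v = 0 → B u v = 0) ∧
      (∀ u, P u = u → β * ‖u‖ ^ 2 ≤ B u u) ∧ (∀ v, P v = 0 → B v v ≤ -(β * ‖v‖ ^ 2)) ∧
      (∀ u, u ∈ XPlus V ↔ P u = u) ∧ (∀ u, u ∈ XMinus V ↔ P u = 0) ∧
      IsReducingPair V (XPlus V) (XMinus V) := by
  obtain ⟨B, K, hK0, hB, hlow, -⟩ := exists_formL hV.bounded
  -- The shift for which the lower bound ‖∇u‖² − K‖u‖² of the form becomes coercivity in H¹ with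
  -- constant 1.
  set c := K + 1 with hc
  have hc0 : 0 < c := by positivity
  obtain ⟨C, hC⟩ : ∃ C : H1 N →L[ℝ] H1 N →L[ℝ] ℝ,
      ∀ u v, C u v = form V u v + c * inner ℝ (fn u) (fn v) :=
    ⟨B + c • pairL fnL fnL, fun u v => by rw [← hB]; rfl⟩
  have hBs : ∀ u v, B u v = B v u := fun u v => by rw [hB, hB, form_symm]
  have hCs : ∀ u v, C u v = C v u := fun u v => by rw [hC, hC, form_symm, real_inner_comm]
  have hCγ : ∀ u, 1 * ‖u‖ ^ 2 ≤ C u u := fun u => by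
    rw [hC, H1.norm_sq_eq, real_inner_self_eq_norm_sq]
    have := hlow u
    nlinarith [sq_nonneg ‖fn u‖]
  have hcoer : IsCoercive C := ⟨1, one_pos, fun u => by
    have := hCγ u
    rw [sq, ← mul_assoc] at this
    exact this⟩
  have h0 := hV.zero_notMem
  simp only [schrodingerSpectrum, mem_ofPred_eq, not_not, zero_smul, add_zero] at h0
  obtain ⟨R, hR⟩ := h0
  set κ := Real.sqrt (c * (c * ‖R‖) + c * (c * ‖R‖) ^ 2) with hκ
  -- The spectral gap concerns L², but the bound is needed in H¹. Lax–Milgram gives x with C(x,·) =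
  -- B(u,·) and ‖x‖ ≤ ‖B u‖. The difference u − x solves (−Δ + V)(u − x) = c x, so its L² norm is
  -- controlled by the resolvent R, and coercivity of C upgrades this to H¹.
  have hBlow : ∀ u, (1 + κ)⁻¹ * ‖u‖ ≤ ‖B u‖ := by
    intro u
    obtain ⟨x, hx⟩ := hcoer.continuousLinearEquivOfBilin.surjective
      ((InnerProductSpace.toDual ℝ (H1 N)).symm (B u))
    have hxv : ∀ v, C x v = B u v := fun v => by
      rw [← hcoer.continuousLinearEquivOfBilin_apply, hx, InnerProductSpace.toDual_symm_apply]
    have hxn : ‖x‖ ≤ ‖B u‖ := by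
      have h1 := hCγ x
      rw [hxv] at h1
      have h2 := (Real.le_norm_self _).trans ((B u).le_opNorm x)
      rcases (norm_nonneg x).eq_or_lt with h | h
      · rw [← h]; positivity
      · nlinarith
    have hgr : ∀ v, form V (u - x) v = inner ℝ (c • fn x) (fn v) := fun v => by
      have := hxv v
      rw [hC, ← hB] at this
      rw [← hB, map_sub, sub_apply, real_inner_smul_left]
      linarith
    have hRx : fn (u - x) = R (c • fn x) := (hR _ _).1 ⟨u - x, rfl, hgr⟩
    have hn : ‖fn (u - x)‖ ≤ (c * ‖R‖) * ‖B u‖ := by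
      rw [hRx]
      refine (R.le_opNorm _).trans ?_
      rw [norm_smul, Real.norm_of_nonneg hc0.le]
      have := (norm_fn_le x).trans hxn
      calc ‖R‖ * (c * ‖fn x‖) ≤ ‖R‖ * (c * ‖B u‖) := by gcongr
        _ = _ := by ring
    have hux : ‖u - x‖ ≤ κ * ‖B u‖ := by
      apply le_of_sq_le_sq _ (by positivity)
      rw [mul_pow, Real.sq_sqrt (by positivity)]
      have h1 := hCγ (u - x)
      rw [hC, hgr, real_inner_smul_left, real_inner_self_eq_norm_sq] at h1
      have h2 := real_inner_le_norm (fn x) (fn (u - x))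
      have h3 : ‖fn x‖ * ‖fn (u - x)‖ ≤ ‖B u‖ * ((c * ‖R‖) * ‖B u‖) := by
        gcongr
        exact (norm_fn_le x).trans hxn
      have h4 : ‖fn (u - x)‖ ^ 2 ≤ ((c * ‖R‖) * ‖B u‖) ^ 2 := by gcongr
      have h5 : c * inner ℝ (fn x) (fn (u - x)) ≤ c * (‖B u‖ * ((c * ‖R‖) * ‖B u‖)) := by
        gcongr; exact h2.trans h3
      have h6 : c * ‖fn (u - x)‖ ^ 2 ≤ c * ((c * ‖R‖) * ‖B u‖) ^ 2 := by gcongr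
      nlinarith
    have hκ0 : 0 ≤ κ := Real.sqrt_nonneg _
    rw [inv_mul_le_iff₀ (by positivity)]
    have := norm_le_norm_add_norm_sub x u
    rw [norm_sub_rev] at this
    linarith
  obtain ⟨P, β, hβ, hidem, horth, hpos, hneg, hmax⟩ := exists_spectral_projection hBs hCs one_pos
    hCγ (by positivity) hBlow
  let Yp : Submodule ℝ (H1 N) := LinearMap.ker ((P - 1 : H1 N →L[ℝ] H1 N) : H1 N →ₗ[ℝ] H1 N)
  let Ym : Submodule ℝ (H1 N) := LinearMap.ker (P : H1 N →ₗ[ℝ] H1 N)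
  have hYp : ∀ u, u ∈ Yp ↔ P u = u := fun u => by
    simp [Yp, sub_eq_zero]
  have hYm : ∀ u, u ∈ Ym ↔ P u = 0 := fun u => by simp [Ym]
  -- C − B is c times the L² inner product, so orthogonality for B and C includes orthogonality in
  -- L².
  have horthL : ∀ u v, B u v = 0 → C u v = 0 → inner ℝ (fn u) (fn v) = 0 := by
    intro u v h1 h2
    rw [hC, ← hB, h1, zero_add] at h2
    exact (mul_eq_zero.1 h2).resolve_left hc0.ne'
  have hred : IsReducingPair V Yp Ym := by
    refine ⟨⟨?_, ?_⟩, fun y hy z hz => ?_⟩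
    · rw [Submodule.disjoint_def]
      intro u h1 h2
      rw [← (hYp u).1 h1, (hYm u).1 h2]
    · rw [codisjoint_iff, eq_top_iff]
      intro u _
      refine Submodule.mem_sup.2 ⟨P u, (hYp _).2 (hidem u), u - P u, (hYm _).2 ?_, by abel⟩
      simp [hidem]
    · obtain ⟨h1, h2⟩ := horth y z ((hYp y).1 hy) ((hYm z).1 hz)
      exact ⟨horthL y z h1 h2, by rw [← hB, h1]⟩
  have hinv : ∀ Y Z, IsReducingPair V Y Z → ∀ y ∈ Y, P y ∈ Y := fun Y Z h =>
    hmax Y Z h.1 fun y hy z hz => by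
      obtain ⟨h1, h2⟩ := h.2 y hy z hz
      exact ⟨by rw [hB, h2], by rw [hC, h1, h2]; simp⟩
  have hpos0 : ∀ u : H1 N, β * ‖u‖ ^ 2 ≤ 0 → u = 0 := by
    intro u h
    by_contra hu
    have := norm_pos_iff.2 hu
    have : 0 < β * ‖u‖ ^ 2 := by positivity
    linarith
  -- A competitor Y contains y − P y by invariance; there B is nonnegative because of Y and at most
  -- −β‖·‖² because of ker P, so y = P y.
  have hp : XPlus V = Yp := by
    refine le_antisymm (sSup_le ?_) (le_sSup ⟨⟨Ym, hred⟩, fun y hy => ?_⟩)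
    · rintro Y ⟨⟨Z, hYZ⟩, hY⟩ y hy
      have h1 : y - P y ∈ Y := Y.sub_mem hy (hinv Y Z hYZ y hy)
      have h2 := hneg (y - P y) (by simp [hidem])
      have h3 := hY _ h1
      rw [← hB] at h3
      rw [hYp]
      exact (sub_eq_zero.1 (hpos0 _ (by linarith))).symm
    · rw [← hB]
      exact (by positivity : (0 : ℝ) ≤ β * ‖y‖ ^ 2).trans (hpos y ((hYp y).1 hy))
  have hm : XMinus V = Ym := by
    have hred' : IsReducingPair V Ym Yp := ⟨hred.1.symm, fun y hy z hz => by
      obtain ⟨h1, h2⟩ := hred.2 z hz y hy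
      exact ⟨by rw [real_inner_comm, h1], by rw [form_symm, h2]⟩⟩
    refine le_antisymm (sSup_le ?_) (le_sSup ⟨⟨Yp, hred'⟩, fun y hy => ?_⟩)
    · rintro Y ⟨⟨Z, hYZ⟩, hY⟩ y hy
      have h1 : P y ∈ Y := hinv Y Z hYZ y hy
      have h2 := hpos (P y) (hidem y)
      have h3 := hY _ h1
      rw [← hB] at h3
      rw [hYm]
      exact hpos0 _ (by linarith)
    · rw [← hB]
      have := hneg y ((hYm y).1 hy)
      have : (0 : ℝ) ≤ β * ‖y‖ ^ 2 := by positivity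
      linarith
  refine ⟨B, P, β, hβ, hB, hidem, fun u v hu hv => (horth u v hu hv).1, hpos, hneg,
    fun u => by rw [hp, hYp], fun u => by rw [hm, hYm], by rw [hp, hm]; exact hred⟩

end Form

/-! ### Test functions and translations in H¹. -/

section TestFunctions

variable {N : ℕ}

theorem inner_gradient (φ : Space N → ℝ) (x e : Space N) :
    inner ℝ (gradient φ x) e = fderiv ℝ φ x e := by
  rw [gradient, InnerProductSpace.toDual_symm_apply]

theorem norm_gradient (φ : Space N → ℝ) (x : Space N) : ‖gradient φ x‖ = ‖fderiv ℝ φ x‖ := by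
  rw [gradient, LinearIsometryEquiv.norm_map]

theorem IsTestFunction.continuous_gradient {φ : Space N → ℝ} (h : IsTestFunction φ) :
    Continuous (gradient φ) :=
  (InnerProductSpace.toDual ℝ (Space N)).symm.continuous.comp (h.1.continuous_fderiv (by simp))

theorem IsTestFunction.memLp_gradient {φ : Space N → ℝ} (h : IsTestFunction φ) :
    MemLp (gradient φ) 2 (volume : Measure (Space N)) :=
  h.continuous_gradient.memLp_of_hasCompactSupport
    ((h.2.fderiv ℝ).comp_left (map_zero (InnerProductSpace.toDual ℝ (Space N)).symm))

theorem IsTestFunction.differentiable {φ : Space N → ℝ} (h : IsTestFunction φ) :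
    Differentiable ℝ φ := h.1.differentiable (by simp)

/-- Integration by parts of a smooth function against a test function. -/
theorem integral_mul_fderiv_test {m φ : Space N → ℝ} (hm : ContDiff ℝ 1 m) (h : IsTestFunction φ)
    (e : Space N) : ∫ x, m x * fderiv ℝ φ x e = - ∫ x, fderiv ℝ m x e * φ x := by
  have hc : Continuous fun x => fderiv ℝ m x e :=
    (hm.continuous_fderiv one_ne_zero).clm_apply continuous_const
  have hc' : Continuous fun x => fderiv ℝ φ x e :=
    (h.1.continuous_fderiv (by simp)).clm_apply continuous_const
  refine integral_mul_fderiv_eq_neg_fderiv_mul_of_integrable ?_ ?_ ?_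
    (fun x _ => (hm.differentiable one_ne_zero) x) (fun x _ => h.differentiable x)
  · exact (hc.mul h.1.continuous).integrable_of_hasCompactSupport h.2.mul_left
  · exact (hm.continuous.mul hc').integrable_of_hasCompactSupport
      (h.2.fderiv_apply (𝕜 := ℝ) e).mul_left
  · exact (hm.continuous.mul h.1.continuous).integrable_of_hasCompactSupport h.2.mul_left

/-- A test function as an element of `H¹`. -/
def IsTestFunction.toH1 {φ : Space N → ℝ} (h : IsTestFunction φ) : H1 N :=
  ⟨WithLp.toLp 2 (h.memLp.toLp φ, h.memLp_gradient.toLp (gradient φ)), by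
    intro ψ hψ e
    have h1 : ∫ x, (h.memLp.toLp φ) x * fderiv ℝ ψ x e = ∫ x, φ x * fderiv ℝ ψ x e := by
      refine integral_congr_ae ?_
      filter_upwards [h.memLp.coeFn_toLp] with x hx
      rw [hx]
    have h2 : ∫ x, inner ℝ ((h.memLp_gradient.toLp (gradient φ)) x) e * ψ x =
        ∫ x, fderiv ℝ φ x e * ψ x := by
      refine integral_congr_ae ?_
      filter_upwards [h.memLp_gradient.coeFn_toLp] with x hx
      rw [hx, inner_gradient]
    show ∫ x, (h.memLp.toLp φ) x * fderiv ℝ ψ x e =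
      - ∫ x, inner ℝ ((h.memLp_gradient.toLp (gradient φ)) x) e * ψ x
    rw [h1, h2]
    exact integral_mul_fderiv_test (h.1.of_le (by simp)) hψ e⟩

theorem IsTestFunction.fn_toH1 {φ : Space N → ℝ} (h : IsTestFunction φ) :
    fn h.toH1 =ᵐ[volume] φ := h.memLp.coeFn_toLp

theorem IsTestFunction.grad_toH1 {φ : Space N → ℝ} (h : IsTestFunction φ) :
    grad h.toH1 =ᵐ[volume] gradient φ := h.memLp_gradient.coeFn_toLp

theorem IsTestFunction.comp_sub {φ : Space N → ℝ} (h : IsTestFunction φ) (y : Space N) :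
    IsTestFunction fun x => φ (x - y) :=
  ⟨h.1.comp (contDiff_id.sub contDiff_const), h.2.comp_homeomorph (Homeomorph.subRight y)⟩

theorem IsTestFunction.comp_const_sub {φ : Space N → ℝ} (h : IsTestFunction φ) (y : Space N) :
    IsTestFunction fun x => φ (y - x) :=
  ⟨h.1.comp (contDiff_const.sub contDiff_id), h.2.comp_homeomorph (Homeomorph.subLeft y)⟩

theorem IsTestFunction.add {φ ψ : Space N → ℝ} (h : IsTestFunction φ) (h' : IsTestFunction ψ) :
    IsTestFunction (φ + ψ) := ⟨h.1.add h'.1, h.2.add h'.2⟩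

theorem IsTestFunction.const_smul {φ : Space N → ℝ} (h : IsTestFunction φ) (c : ℝ) :
    IsTestFunction (c • φ) := ⟨h.1.const_smul c, HasCompactSupport.smul_left (f := fun _ => c) h.2⟩

theorem measurePreserving_shift (y : Space N) :
    MeasurePreserving (fun x : Space N => x + y) volume volume :=
  measurePreserving_add_right volume y

/-- Translation of `H¹` functions: `(τ_y u)(x) = u(x + y)`. -/
def translateFun (y : Space N) (u : H1 N) : H1 N :=
  ⟨WithLp.toLp 2 (Lp.compMeasurePreserving _ (measurePreserving_shift y) (fn u),
    Lp.compMeasurePreserving _ (measurePreserving_shift y) (grad u)), by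
      intro ψ hψ e
      have h := u.2 _ (hψ.comp_sub y) e
      have h1 : ∫ x, (Lp.compMeasurePreserving _ (measurePreserving_shift y) (fn u)) x *
          fderiv ℝ ψ x e = ∫ x, fn u x * fderiv ℝ (fun x => ψ (x - y)) x e := by
        rw [← integral_add_right_eq_self (fun x => fn u x * fderiv ℝ (fun x => ψ (x - y)) x e) y]
        refine integral_congr_ae ?_
        filter_upwards [Lp.coeFn_compMeasurePreserving (fn u) (measurePreserving_shift y)] with x hx
        rw [fderiv_comp_sub, add_sub_cancel_right, hx]
        rfl
      have h2 : ∫ x, inner ℝ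
          ((Lp.compMeasurePreserving _ (measurePreserving_shift y) (grad u)) x) e * ψ x =
          ∫ x, inner ℝ (grad u x) e * ψ (x - y) := by
        rw [← integral_add_right_eq_self (fun x => inner ℝ (grad u x) e * ψ (x - y)) y]
        refine integral_congr_ae ?_
        filter_upwards [Lp.coeFn_compMeasurePreserving (grad u) (measurePreserving_shift y)]
          with x hx
        rw [add_sub_cancel_right, hx]
        rfl
      exact h1.trans (h.trans (congrArg Neg.neg h2.symm))⟩

theorem fn_translateFun (y : Space N) (u : H1 N) :
    fn (translateFun y u) =ᵐ[volume] fun x => fn u (x + y) :=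
  Lp.coeFn_compMeasurePreserving (fn u) (measurePreserving_shift y)

theorem ae_shift {p : Space N → Prop} (h : ∀ᵐ x, p x) (y : Space N) : ∀ᵐ x, p (x + y) :=
  (measurePreserving_shift y).quasiMeasurePreserving.ae h

theorem fn_ext {u v : H1 N} (h : fn u =ᵐ[volume] fn v) : u = v := fn_injective (Lp.ext h)

/-- Translation as a linear isometry of `H¹`. -/
def translate (y : Space N) : H1 N →ₗᵢ[ℝ] H1 N where
  toFun := translateFun y
  map_add' u v := by
    apply fn_ext
    filter_upwards [fn_translateFun y (u + v), fn_add_ae (translateFun y u) (translateFun y v),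
      fn_translateFun y u, fn_translateFun y v, ae_shift (fn_add_ae u v) y] with x h1 h2 h3 h4 h5
    rw [h1, h2, h3, h4, h5]
  map_smul' c u := by
    apply fn_ext
    filter_upwards [fn_translateFun y (c • u), fn_smul_ae c (translateFun y u),
      fn_translateFun y u, ae_shift (fn_smul_ae c u) y] with x h1 h2 h3 h4
    rw [RingHom.id_apply, h1, h2, h3, h4]
  norm_map' u := by
    have h1 : ‖fn (translateFun y u)‖ = ‖fn u‖ :=
      Lp.norm_compMeasurePreserving (fn u) (measurePreserving_shift y)
    have h2 : ‖grad (translateFun y u)‖ = ‖grad u‖ :=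
      Lp.norm_compMeasurePreserving (grad u) (measurePreserving_shift y)
    rw [← sq_eq_sq₀ (norm_nonneg _) (norm_nonneg _), H1.norm_sq_eq u, ← h1, ← h2]
    exact H1.norm_sq_eq (translateFun y u)

theorem fn_translate (y : Space N) (u : H1 N) : fn (translate y u) =ᵐ[volume] fun x => fn u (x + y) :=
  Lp.coeFn_compMeasurePreserving (fn u) (measurePreserving_shift y)

theorem grad_translate (y : Space N) (u : H1 N) :
    grad (translate y u) =ᵐ[volume] fun x => grad u (x + y) :=
  Lp.coeFn_compMeasurePreserving (grad u) (measurePreserving_shift y)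

theorem translate_translate (y z : Space N) (u : H1 N) : translate y (translate z u) = translate (y + z) u := by
  apply fn_ext
  filter_upwards [fn_translate y (translate z u), fn_translate (y + z) u, ae_shift (fn_translate z u) y]
    with x h1 h2 h3
  rw [h1, h2, h3, add_assoc]

theorem translate_zero (u : H1 N) : translate 0 u = u := by
  apply fn_ext
  filter_upwards [fn_translate 0 u] with x h1
  rw [h1, add_zero]

theorem translate_neg_translate (y : Space N) (u : H1 N) : translate (-y) (translate y u) = u := by
  rw [translate_translate, neg_add_cancel, translate_zero]

theorem translate_translate_neg (y : Space N) (u : H1 N) : translate y (translate (-y) u) = u := by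
  rw [translate_translate, add_neg_cancel, translate_zero]

theorem continuous_translate (u : H1 N) : Continuous fun y => translate y u := by
  let g : Space N → C(Space N, Space N) := fun y => ⟨fun x => x + y, by fun_prop⟩
  have hg : Continuous g := ContinuousMap.continuous_of_continuous_uncurry _ (by
    show Continuous fun p : Space N × Space N => p.2 + p.1
    fun_prop)
  have h1 : Continuous fun y => Lp.compMeasurePreserving (g y) (measurePreserving_shift y) (fn u) :=
    Continuous.compMeasurePreservingLp continuous_const hg _ (by simp)
  have h2 : Continuous fun y =>
      Lp.compMeasurePreserving (g y) (measurePreserving_shift y) (grad u) :=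
    Continuous.compMeasurePreservingLp continuous_const hg _ (by simp)
  exact ((WithLp.prod_continuous_toLp 2 (L2 N) (L2Field N)).comp (h1.prodMk h2)).subtype_mk _

end TestFunctions

/-! ### Mollification, products with cutoffs, and density of test functions. -/

section Mollify

variable {N : ℕ}

theorem fn_locallyIntegrable (u : H1 N) : LocallyIntegrable (fn u) volume :=
  (fn_memLp u).locallyIntegrable (by norm_num)

/-- The convolution `u ⋆ ρ`. -/
def conv (u : H1 N) (ρ : Space N → ℝ) (x : Space N) : ℝ := ∫ t, fn u t * ρ (x - t)

theorem conv_eq (u : H1 N) (ρ : Space N → ℝ) :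
    conv u ρ = convolution (fn u) ρ (ContinuousLinearMap.mul ℝ ℝ) volume := rfl

theorem contDiff_conv (u : H1 N) {ρ : Space N → ℝ} (hρ : IsTestFunction ρ) :
    ContDiff ℝ ∞ (conv u ρ) := by
  rw [conv_eq]
  exact hρ.2.contDiff_convolution_right _ (fn_locallyIntegrable u) hρ.1

/-- The derivative first falls on ρ; the weak gradient identity with the test function t ↦ ρ(x − t)
moves it to u. -/
theorem fderiv_conv (u : H1 N) {ρ : Space N → ℝ} (hρ : IsTestFunction ρ) (x e : Space N) :
    fderiv ℝ (conv u ρ) x e = ∫ t, inner ℝ (grad u t) e * ρ (x - t) := by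
  have hρ1 : ContDiff ℝ 1 ρ := hρ.1.of_le (by simp)
  have h := hρ.2.hasFDerivAt_convolution_right (ContinuousLinearMap.mul ℝ ℝ)
    (fn_locallyIntegrable u) hρ1 x
  rw [conv_eq, h.fderiv, convolution_precompR_apply _ (fn_locallyIntegrable u)
    (hρ.2.fderiv ℝ) (hρ1.continuous_fderiv one_ne_zero)]
  have h1 := u.2 _ (hρ.comp_const_sub x) e
  have h2 : ∀ t, fderiv ℝ (fun t => ρ (x - t)) t e = - fderiv ℝ ρ (x - t) e := by
    intro t
    have h3 : HasFDerivAt (fun t => ρ (x - t)) ((fderiv ℝ ρ (x - t)).comp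
        (-ContinuousLinearMap.id ℝ (Space N))) t :=
      (hρ.differentiable (x - t)).hasFDerivAt.comp t ((hasFDerivAt_id t).const_sub x)
    rw [h3.fderiv]
    simp
  simp only [h2, mul_neg, integral_neg, neg_inj] at h1
  exact h1

theorem abs_integral_inner_mul_le (u : H1 N) {ψ : Space N → ℝ} (hψ : IsTestFunction ψ)
    (e : Space N) : |∫ t, inner ℝ (grad u t) e * ψ t| ≤ ‖grad u‖ * ‖hψ.memLp.toLp ψ‖ * ‖e‖ := by
  rw [← L2Field.inner_toLp (grad u) hψ e]
  refine (abs_real_inner_le_norm _ _).trans ?_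
  rw [mul_assoc]
  gcongr
  rw [mul_comm]
  refine Lp.norm_le_mul_norm_of_ae_le_mul ?_
  filter_upwards [hψ.memLp.coeFn_toLp, (hψ.memLp_smul e).coeFn_toLp] with x h1 h2
  rw [h1, h2, norm_smul, mul_comm]

theorem norm_toLp_comp_sub {ψ : Space N → ℝ} (hψ : IsTestFunction ψ) (y : Space N) :
    ‖(hψ.comp_sub y).memLp.toLp _‖ = ‖hψ.memLp.toLp ψ‖ := by
  rw [← sq_eq_sq₀ (norm_nonneg _) (norm_nonneg _), L2.norm_sq_eq, L2.norm_sq_eq]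
  have h1 : ∫ x, ((hψ.comp_sub y).memLp.toLp _) x ^ 2 = ∫ x, ψ (x - y) ^ 2 := by
    refine integral_congr_ae ?_
    filter_upwards [(hψ.comp_sub y).memLp.coeFn_toLp] with x hx
    rw [hx]
  have h2 : ∫ x, (hψ.memLp.toLp ψ) x ^ 2 = ∫ x, ψ x ^ 2 := by
    refine integral_congr_ae ?_
    filter_upwards [hψ.memLp.coeFn_toLp] with x hx
    rw [hx]
  rw [h1, h2]
  exact integral_sub_right_eq_self (fun x => ψ x ^ 2) y

theorem integral_translate_mul (u : H1 N) (ψ : Space N → ℝ) (y : Space N) :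
    ∫ x, fn (translate y u) x * ψ x = ∫ x, fn u x * ψ (x - y) := by
  rw [← integral_add_right_eq_self (fun x => fn u x * ψ (x - y)) y]
  refine integral_congr_ae ?_
  filter_upwards [fn_translate y u] with x hx
  rw [hx, add_sub_cancel_right]

theorem L2.norm_le_of_test {w : L2 N} {C : ℝ} (hC : 0 ≤ C)
    (h : ∀ ψ (hψ : IsTestFunction ψ), inner ℝ w (hψ.memLp.toLp ψ) ≤ C * ‖hψ.memLp.toLp ψ‖) :
    ‖w‖ ≤ C := by
  have hd := Lp.dense_hasCompactSupport_contDiff (F := ℝ) (p := 2) (by simp)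
    (μ := (volume : Measure (Space N)))
  have h1 : ∀ v : L2 N, inner ℝ w v ≤ C * ‖v‖ := by
    intro v
    refine hd.induction (P := fun v => inner ℝ w v ≤ C * ‖v‖) ?_ ?_ v
    · rintro v ⟨g, hvg, hgc, hg⟩
      have hψ : IsTestFunction g := ⟨hg, hgc⟩
      have : v = hψ.memLp.toLp g := Lp.ext (hvg.trans hψ.memLp.coeFn_toLp.symm)
      rw [this]
      exact h g hψ
    · exact isClosed_le (by fun_prop) (by fun_prop)
  have h2 := h1 w
  rw [real_inner_self_eq_norm_sq] at h2
  rcases (norm_nonneg w).eq_or_lt with h0 | h0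
  · rwa [← h0]
  · nlinarith

/-- By duality it suffices to pair with a test function ψ. The pairing y ↦ ∫ u ψ(· − y) is a smooth
convolution whose derivative is bounded by ‖∇u‖‖ψ‖, and the mean value inequality finishes. -/
theorem norm_translate_sub_le (u : H1 N) (y : Space N) :
    ‖fn (translate y u) - fn u‖ ≤ ‖grad u‖ * ‖y‖ := by
  refine L2.norm_le_of_test (by positivity) fun ψ hψ => ?_
  have hρ : IsTestFunction fun s => ψ (-s) :=
    ⟨hψ.1.comp contDiff_neg, hψ.2.comp_homeomorph (Homeomorph.neg _)⟩
  set k := conv u fun s => ψ (-s) with hk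
  have hk1 : ∀ y, k y = ∫ x, fn u x * ψ (x - y) := fun y => by simp [hk, conv]
  have hkd : Differentiable ℝ k := (contDiff_conv u hρ).differentiable (by simp)
  have hbound : ∀ x, ‖fderiv ℝ k x‖ ≤ ‖grad u‖ * ‖hψ.memLp.toLp ψ‖ := fun x => by
    refine ContinuousLinearMap.opNorm_le_bound _ (by positivity) fun e => ?_
    rw [fderiv_conv u hρ, Real.norm_eq_abs]
    have := abs_integral_inner_mul_le u (hψ.comp_sub x) e
    rw [norm_toLp_comp_sub hψ] at this
    simpa using this
  have hmv := Convex.norm_image_sub_le_of_norm_fderiv_le (𝕜 := ℝ) (s := univ)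
    (fun x _ => hkd x) (fun x _ => hbound x) convex_univ (mem_univ 0) (mem_univ y)
  rw [inner_sub_left, L2.inner_toLp, L2.inner_toLp, integral_translate_mul, ← hk1]
  have h0 : k 0 = ∫ x, fn u x * ψ x := by simp [hk1]
  rw [← h0]
  rw [sub_zero] at hmv
  exact ((Real.le_norm_self _).trans hmv).trans (by apply le_of_eq; ring)

/-- The mollification `∫ ρ(t) τ_{-t} u dt`, as a Bochner integral in `H¹`. -/
def mollify (ρ : Space N → ℝ) (u : H1 N) : H1 N := ∫ t, ρ t • translate (-t) u

theorem integrable_mollify {ρ : Space N → ℝ} (hρ : IsTestFunction ρ) (u : H1 N) :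
    Integrable (fun t => ρ t • translate (-t) u) volume :=
  (hρ.1.continuous.smul ((continuous_translate u).comp continuous_neg)).integrable_of_hasCompactSupport
    hρ.2.smul_right

/-- Identifies the H¹-valued average of translates with the classical convolution. Convergence of
mollifications in H¹ then follows from continuity of translations, and their smoothness from the
convolution formula. The proof tests with ψ and interchanges integrals twice. -/
theorem fn_mollify {ρ : Space N → ℝ} (hρ : IsTestFunction ρ) (u : H1 N) :
    fn (mollify ρ u) =ᵐ[volume] conv u ρ := by
  refine ae_eq_of_integral_contDiff_smul_eq (fn_locallyIntegrable _)
    (contDiff_conv u hρ).continuous.locallyIntegrable fun ψ hψ hψc => ?_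
  have hψ' : IsTestFunction ψ := ⟨hψ, hψc⟩
  have h1 : ∫ x, ψ x • fn (mollify ρ u) x = inner ℝ (hψ'.memLp.toLp ψ) (fnL (mollify ρ u)) := by
    rw [real_inner_comm, fnL_apply, L2.inner_toLp]
    simp only [smul_eq_mul, mul_comm]
  have h2 : inner ℝ (hψ'.memLp.toLp ψ) (fnL (mollify ρ u)) =
      ∫ t, inner ℝ (hψ'.memLp.toLp ψ) (fnL (ρ t • translate (-t) u)) := by
    rw [mollify, ← ContinuousLinearMap.integral_comp_comm _ (integrable_mollify hρ u)]
    exact (integral_inner (𝕜 := ℝ) ((fnL (N := N)).integrable_comp (integrable_mollify hρ u)) _).symm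
  have h3 : ∀ t, inner ℝ (hψ'.memLp.toLp ψ) (fnL (ρ t • translate (-t) u)) =
      ∫ x, fn u x * (ρ t * ψ (x + t)) := by
    intro t
    rw [map_smul, inner_smul_right, fnL_apply, real_inner_comm, L2.inner_toLp,
      integral_translate_mul, ← integral_const_mul]
    refine integral_congr_ae (Eventually.of_forall fun x => ?_)
    simp only [sub_neg_eq_add]
    ring
  -- If ρ(t)ψ(x + t) ≠ 0 then x lies in this compact set, so the locally integrable u may be cut off
  -- there and the double integral converges absolutely.
  have hK : IsCompact ((fun p : Space N × Space N => p.1 - p.2) '' (tsupport ψ ×ˢ tsupport ρ)) :=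
    (IsCompact.prod hψc hρ.2).image (by fun_prop)
  obtain ⟨K, hKe⟩ : ∃ K, K = (fun p : Space N × Space N => p.1 - p.2) '' (tsupport ψ ×ˢ tsupport ρ) := ⟨_, rfl⟩
  rw [← hKe] at hK
  obtain ⟨M, hM⟩ := hψ'.1.continuous.bounded_above_of_compact_support hψc
  have hint : Integrable (fun p : Space N × Space N => fn u p.2 * (ρ p.1 * ψ (p.2 + p.1)))
      (volume.prod volume) := by
    have h4 : Integrable (K.indicator (fn u)) volume :=
      (integrable_indicator_iff hK.measurableSet).2 ((fn_locallyIntegrable u).integrableOn_isCompact hK)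
    have h5 : Integrable ρ volume := hρ.1.continuous.integrable_of_hasCompactSupport hρ.2
    have h6 := ((h5.mul_prod h4).mul_bdd (g := fun p : Space N × Space N => ψ (p.2 + p.1)) (c := M)
      (hψ'.1.continuous.comp (continuous_snd.add continuous_fst)).aestronglyMeasurable
      (Eventually.of_forall fun p => hM _))
    refine h6.congr (Eventually.of_forall fun p => ?_)
    simp only [indicator]
    split_ifs with hp
    · ring
    · by_cases h7 : ρ p.1 = 0
      · simp [h7]
      · have h8 : ψ (p.2 + p.1) = 0 := by
          by_contra h8
          refine hp ?_
          rw [hKe]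
          exact ⟨(p.2 + p.1, p.1), ⟨subset_tsupport _ h8, subset_tsupport _ h7⟩, by simp⟩
        simp [h8]
  rw [h1, h2]
  simp only [h3]
  rw [integral_integral_swap hint]
  have h9 : ∀ x, ∫ t, fn u x * (ρ t * ψ (x + t)) = ∫ s, fn u x * (ρ (s - x) * ψ s) := by
    intro x
    rw [← integral_sub_right_eq_self (fun t => fn u x * (ρ t * ψ (x + t))) x]
    simp
  simp only [h9]
  rw [integral_integral_swap]
  · refine integral_congr_ae (Eventually.of_forall fun x => ?_)
    simp only [conv, smul_eq_mul]
    rw [← integral_const_mul]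
    refine integral_congr_ae (Eventually.of_forall fun t => ?_)
    simp only
    ring
  · have h10 := (measurePreserving_prod_sub (G := Space N) volume volume).integrable_comp_of_integrable
      hint.swap
    refine h10.congr (Eventually.of_forall fun p => ?_)
    simp [Function.uncurry]

/-- The product of an `H¹` function with a smooth function that is bounded with its gradient. -/
theorem exists_mul {χ : Space N → ℝ} (hχ : ContDiff ℝ ∞ χ) {C D : ℝ} (hC : ∀ x, ‖χ x‖ ≤ C)
    (hD : ∀ x, ‖fderiv ℝ χ x‖ ≤ D) (u : H1 N) : ∃ w : H1 N, fn w =ᵐ[volume] (fun x => χ x * fn u x) ∧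
      grad w =ᵐ[volume] fun x => χ x • grad u x + fn u x • gradient χ x := by
  have hgc : Continuous (gradient χ) :=
    (InnerProductSpace.toDual ℝ (Space N)).symm.continuous.comp (hχ.continuous_fderiv (by simp))
  have hm1 : MemLp (fun x => χ x * fn u x) 2 volume := by
    refine (fn_memLp u).of_le_mul (c := C)
      (hχ.continuous.aestronglyMeasurable.mul (fn_aesm u)) (Eventually.of_forall fun x => ?_)
    rw [norm_mul]
    gcongr
    exact hC x
  have hm2 : MemLp (fun x => χ x • grad u x) 2 volume := by
    refine (Lp.memLp (grad u)).of_le_mul (c := C)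
      (hχ.continuous.aestronglyMeasurable.smul (Lp.aestronglyMeasurable _))
      (Eventually.of_forall fun x => ?_)
    rw [norm_smul]
    gcongr
    exact hC x
  have hm3 : MemLp (fun x => fn u x • gradient χ x) 2 volume := by
    refine (fn_memLp u).of_le_mul (c := D)
      ((fn_aesm u).smul hgc.aestronglyMeasurable) (Eventually.of_forall fun x => ?_)
    rw [norm_smul, norm_gradient, mul_comm]
    gcongr
    exact hD x
  refine ⟨⟨WithLp.toLp 2 (hm1.toLp _, (hm2.add hm3).toLp _), ?_⟩, hm1.coeFn_toLp,
    (hm2.add hm3).coeFn_toLp⟩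
  intro φ hφ e
  have hχφ : IsTestFunction fun x => χ x * φ x := ⟨hχ.mul hφ.1, hφ.2.mul_left⟩
  have h := u.2 _ hχφ e
  have h1 : ∫ x, (hm1.toLp _) x * fderiv ℝ φ x e = ∫ x, χ x * fn u x * fderiv ℝ φ x e := by
    refine integral_congr_ae ?_
    filter_upwards [hm1.coeFn_toLp] with x hx
    rw [hx]
  have h2 : ∫ x, inner ℝ (((hm2.add hm3).toLp _) x) e * φ x =
      ∫ x, (inner ℝ (grad u x) e * (χ x * φ x) + fn u x * (fderiv ℝ χ x e * φ x)) := by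
    refine integral_congr_ae ?_
    filter_upwards [(hm2.add hm3).coeFn_toLp] with x hx
    rw [hx, Pi.add_apply, inner_add_left, real_inner_smul_left, real_inner_smul_left,
      inner_gradient]
    ring
  have hi : IsTestFunction fun x => fderiv ℝ χ x e * φ x :=
    ⟨((hχ.fderiv_right (m := ∞) (by simp)).clm_apply contDiff_const).mul hφ.1, hφ.2.mul_left⟩
  have hi' : Integrable (fun x => fn u x * (fderiv ℝ χ x e * φ x)) volume :=
    (fn_memLp u).integrable_mul hi.memLp
  rw [integral_add (hχφ.integrable_inner_mul (grad u) e) hi'] at h2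
  have h3 : ∫ x, fn u x * fderiv ℝ (fun x => χ x * φ x) x e =
      ∫ x, (χ x * fn u x * fderiv ℝ φ x e + fn u x * (fderiv ℝ χ x e * φ x)) := by
    refine integral_congr_ae (Eventually.of_forall fun x => ?_)
    simp only
    rw [fderiv_fun_mul (hχ.differentiable (by simp) x) (hφ.differentiable x)]
    simp only [add_apply, smul_apply, smul_eq_mul]
    ring
  rw [integral_add ?_ hi'] at h3
  · show ∫ x, (hm1.toLp _) x * fderiv ℝ φ x e = - ∫ x, inner ℝ (((hm2.add hm3).toLp _) x) e * φ x
    rw [h1, h2]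
    have h4 : ∫ x, fn u x * fderiv ℝ (fun x => χ x * φ x) x e =
        - ∫ x, inner ℝ (grad u x) e * (χ x * φ x) := h
    linarith
  · exact hm1.integrable_mul (hφ.memLp_fderiv e)

theorem IsTestFunction.exists_bound {χ : Space N → ℝ} (hχ : IsTestFunction χ) :
    ∃ C : ℝ, 0 ≤ C ∧ (∀ x, ‖χ x‖ ≤ C) ∧ ∀ x, ‖fderiv ℝ χ x‖ ≤ C := by
  obtain ⟨C, hC⟩ := hχ.1.continuous.bounded_above_of_compact_support hχ.2
  obtain ⟨D, hD⟩ := (hχ.1.continuous_fderiv (by simp)).bounded_above_of_compact_support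
    (hχ.2.fderiv ℝ)
  exact ⟨max C D, (norm_nonneg _).trans ((hC 0).trans (le_max_left _ _)),
    fun x => (hC x).trans (le_max_left _ _), fun x => (hD x).trans (le_max_right _ _)⟩

theorem mollify_eq_toH1 {χ ρ : Space N → ℝ} (hχ : HasCompactSupport χ) (hρ : IsTestFunction ρ)
    {g : Space N → ℝ} {w : H1 N} (hw : fn w =ᵐ[volume] fun x => χ x * g x) :
    ∃ (φ : Space N → ℝ) (hφ : IsTestFunction φ), mollify ρ w = hφ.toH1 := by
  have h1 : HasCompactSupport (conv w ρ) := by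
    have : conv w ρ = convolution (fun x => χ x * g x) ρ (ContinuousLinearMap.mul ℝ ℝ) volume := by
      funext x
      refine integral_congr_ae ?_
      filter_upwards [hw] with t ht
      simp [ht]
    rw [this]
    have h2 : HasCompactSupport fun x => χ x * g x := hχ.mul_right
    exact HasCompactSupport.convolution _ h2 hρ.2
  refine ⟨conv w ρ, ⟨contDiff_conv w hρ, h1⟩, fn_ext ?_⟩
  exact (fn_mollify hρ w).trans (IsTestFunction.fn_toH1 _).symm

/-- An approximate identity. -/
theorem exists_mollifier {r : ℝ} (hr : 0 < r) : ∃ ρ : Space N → ℝ, IsTestFunction ρ ∧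
    (∀ x, 0 ≤ ρ x) ∧ (∫ x, ρ x = 1) ∧ ∀ x, ρ x ≠ 0 → ‖x‖ < r := by
  let b : ContDiffBump (0 : Space N) := ⟨r / 2, r, by positivity, by linarith⟩
  refine ⟨b.normed volume, ⟨b.contDiff_normed, b.hasCompactSupport_normed⟩, b.nonneg_normed,
    b.integral_normed, fun x hx => ?_⟩
  have : x ∈ Function.support (b.normed volume) := hx
  rw [b.support_normed_eq] at this
  simpa using this

theorem norm_integral_smul_sub_le {E : Type*} [NormedAddCommGroup E] [NormedSpace ℝ E]
    [CompleteSpace E] {ρ : Space N → ℝ} {r δ : ℝ} (hρ : IsTestFunction ρ) (h0 : ∀ x, 0 ≤ ρ x)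
    (h1 : ∫ x, ρ x = 1) (hr : ∀ x, ρ x ≠ 0 → ‖x‖ < r) {k : Space N → E} (hk : Continuous k) (a : E)
    (hδ : ∀ t, ‖t‖ < r → ‖k t - a‖ ≤ δ) : ‖(∫ t, ρ t • k t) - a‖ ≤ δ := by
  have hi : Integrable ρ volume := hρ.1.continuous.integrable_of_hasCompactSupport hρ.2
  have hi2 : Integrable (fun t => ρ t • k t) volume :=
    (hρ.1.continuous.smul hk).integrable_of_hasCompactSupport hρ.2.smul_right
  have h2 : (∫ t, ρ t • k t) - a = ∫ t, ρ t • (k t - a) := by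
    simp only [smul_sub]
    rw [integral_sub hi2 (hi.smul_const a), integral_smul_const, h1, one_smul]
  rw [h2]
  refine (norm_integral_le_of_norm_le (hi.mul_const δ) (Eventually.of_forall fun t => ?_)).trans
    (by rw [integral_mul_const, h1, one_mul])
  rw [norm_smul, Real.norm_of_nonneg (h0 t)]
  by_cases ht : ρ t = 0
  · simp [ht]
  · exact mul_le_mul_of_nonneg_left (hδ t (hr t ht)) (h0 t)

/-- Test functions, as a set in `H¹`. -/
def testSet (N : ℕ) : Set (H1 N) := {u | ∃ (φ : Space N → ℝ) (hφ : IsTestFunction φ), u = hφ.toH1}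

theorem mem_closure_testSet_of_mul {χ : Space N → ℝ} (hχ : HasCompactSupport χ)
    {g : Space N → ℝ} {w : H1 N} (hw : fn w =ᵐ[volume] fun x => χ x * g x) :
    w ∈ closure (testSet N) := by
  rw [Metric.mem_closure_iff]
  intro ε hε
  have hc : Continuous fun t : Space N => translate (-t) w := (continuous_translate w).comp continuous_neg
  obtain ⟨r, hr, hrε⟩ := Metric.continuousAt_iff.1 (hc.continuousAt (x := 0)) (ε / 2) (by positivity)
  obtain ⟨ρ, hρ, h0, h1, hs⟩ := exists_mollifier (N := N) hr
  refine ⟨mollify ρ w, mollify_eq_toH1 hχ hρ hw, ?_⟩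
  rw [dist_comm, dist_eq_norm]
  refine (norm_integral_smul_sub_le hρ h0 h1 hs hc w (δ := ε / 2) fun t ht => ?_).trans_lt (by linarith)
  have := hrε (x := t) (by simpa using ht)
  rw [dist_eq_norm, neg_zero, translate_zero] at this
  exact this.le

theorem IsTestFunction.toH1_add {φ ψ : Space N → ℝ} (h : IsTestFunction φ) (h' : IsTestFunction ψ) :
    (h.add h').toH1 = h.toH1 + h'.toH1 := by
  apply fn_ext
  filter_upwards [(h.add h').fn_toH1, h.fn_toH1, h'.fn_toH1, fn_add_ae h.toH1 h'.toH1] with x h1 h2 h3 h4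
  rw [h1, h4, h2, h3, Pi.add_apply]

theorem IsTestFunction.toH1_smul {φ : Space N → ℝ} (h : IsTestFunction φ) (c : ℝ) :
    (h.const_smul c).toH1 = c • h.toH1 := by
  apply fn_ext
  filter_upwards [(h.const_smul c).fn_toH1, h.fn_toH1, fn_smul_ae c h.toH1] with x h1 h2 h3
  rw [h1, h3, h2, Pi.smul_apply, smul_eq_mul]

theorem isTestFunction_zero : IsTestFunction (0 : Space N → ℝ) :=
  ⟨contDiff_const, HasCompactSupport.zero⟩

/-- Cutoff functions `χ(x / R)`. -/
theorem exists_cutoff : ∃ (χ : ℕ → Space N → ℝ) (C : ℝ), 0 ≤ C ∧ (∀ n, IsTestFunction (χ n)) ∧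
    (∀ n x, 0 ≤ χ n x) ∧ (∀ n x, χ n x ≤ 1) ∧
    (∀ n x, ‖fderiv ℝ (χ n) x‖ ≤ C / ((n : ℝ) + 1)) ∧
    (∀ (n : ℕ) (x : Space N), ‖x‖ ≤ (n : ℝ) + 1 → χ n x = 1) := by
  let b : ContDiffBump (0 : Space N) := ⟨1, 2, by norm_num, by norm_num⟩
  have hb : IsTestFunction b := ⟨b.contDiff, b.hasCompactSupport⟩
  obtain ⟨C, hC0, -, hC⟩ := hb.exists_bound
  have hn : ∀ n : ℕ, (0 : ℝ) < (n : ℝ) + 1 := fun n => by positivity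
  refine ⟨fun n x => b (((n : ℝ) + 1)⁻¹ • x), C, hC0, fun n => ⟨?_, ?_⟩, fun n x => b.nonneg,
    fun n x => b.le_one, fun n x => ?_, fun n x hx => ?_⟩
  · exact b.contDiff.comp (contDiff_const_smul _)
  · exact hb.2.comp_homeomorph (Homeomorph.smulOfNeZero _ (inv_ne_zero (hn n).ne'))
  · have h1 : HasFDerivAt (fun x => b (((n : ℝ) + 1)⁻¹ • x))
        ((fderiv ℝ b (((n : ℝ) + 1)⁻¹ • x)).comp
          (((n : ℝ) + 1)⁻¹ • ContinuousLinearMap.id ℝ (Space N))) x :=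
      (hb.differentiable _).hasFDerivAt.comp x ((hasFDerivAt_id (𝕜 := ℝ) x).fun_const_smul _)
    rw [h1.fderiv, ContinuousLinearMap.comp_smul, ContinuousLinearMap.comp_id, norm_smul,
      norm_inv, Real.norm_of_nonneg (hn n).le, div_eq_inv_mul]
    gcongr
    exact hC _
  · apply b.one_of_mem_closedBall
    rw [mem_closedBall_zero_iff, norm_smul, norm_inv, Real.norm_of_nonneg (hn n).le,
      inv_mul_le_iff₀ (hn n)]
    simpa [b] using hx

/-- A vector y orthogonal to all test functions is orthogonal to the truncations χ_n y, which lie in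
their closure by mollification. As ⟨χ_n y, y⟩ → ‖y‖² by dominated convergence, y = 0; norm
convergence of the truncations is not needed. -/
theorem dense_testSet : Dense (testSet N) := by
  let S : Submodule ℝ (H1 N) :=
    { carrier := testSet N
      add_mem' := by
        rintro a b ⟨φ, hφ, rfl⟩ ⟨ψ, hψ, rfl⟩
        exact ⟨_, hφ.add hψ, (hφ.toH1_add hψ).symm⟩
      zero_mem' := ⟨_, isTestFunction_zero, fn_ext (by
        filter_upwards [isTestFunction_zero.fn_toH1 (N := N), Lp.coeFn_zero ℝ 2 volume] with x h1 h2
        rw [h1, fn_zero, h2])⟩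
      smul_mem' := by
        rintro c a ⟨φ, hφ, rfl⟩
        exact ⟨_, hφ.const_smul c, (hφ.toH1_smul c).symm⟩ }
  suffices hS : S.topologicalClosure = ⊤ from
    (Submodule.dense_iff_topologicalClosure_eq_top (s := S)).2 hS
  rw [Submodule.topologicalClosure_eq_top_iff, Submodule.eq_bot_iff]
  intro y hy
  rw [← Submodule.orthogonal_closure] at hy
  obtain ⟨χ, C, hC0, hχ, hχ0, hχ1, hχd, hχe⟩ := exists_cutoff (N := N)
  have hn1 : ∀ n x, ‖χ n x‖ ≤ 1 := fun n x => by
    rw [Real.norm_of_nonneg (hχ0 n x)]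
    exact hχ1 n x
  have hCn : ∀ n : ℕ, C / ((n : ℝ) + 1) ≤ C := fun n => div_le_self hC0 (by simp)
  choose w hw1 hw2 using fun n => exists_mul (hχ n).1 (hn1 n) (hχd n) y
  have h0 : ∀ n, inner ℝ (w n) y = 0 := fun n => hy _ (by
    exact mem_closure_testSet_of_mul (hχ n).2 (hw1 n))
  have hlim : Tendsto (fun n => inner ℝ (w n) y) atTop (𝓝 (inner ℝ y y)) := by
    simp only [H1.inner_eq, L2.inner_eq, L2Field.inner_eq]
    refine Tendsto.add ?_ ?_
    · refine tendsto_integral_of_dominated_convergence (fun x => |fn y x * fn y x|)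
        (fun n => ((fn_aesm _).mul (fn_aesm _))) (L2.integrable_mul _ _).abs (fun n => ?_) ?_
      · filter_upwards [hw1 n] with x hx
        rw [hx, mul_assoc, norm_mul]
        exact mul_le_of_le_one_left (abs_nonneg _) (hn1 n x)
      · filter_upwards [ae_all_iff.2 hw1] with x hx
        refine tendsto_const_nhds.congr' ?_
        filter_upwards [eventually_ge_atTop ⌈‖x‖⌉₊] with n hn
        rw [hx, hχe n x ((Nat.le_ceil _).trans (by exact_mod_cast Nat.le_succ_of_le hn)), one_mul]
    · refine tendsto_integral_of_dominated_convergence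
        (fun x => ‖grad y x‖ ^ 2 + C * (|fn y x| * ‖grad y x‖))
        (fun n => ((Lp.aestronglyMeasurable _).inner (Lp.aestronglyMeasurable _))) ?_ (fun n => ?_) ?_
      · refine Integrable.add ((Lp.memLp (grad y)).integrable_norm_pow two_ne_zero) ?_
        exact ((fn_memLp y).norm.integrable_mul (Lp.memLp (grad y)).norm).const_mul C
      · filter_upwards [hw2 n] with x hx
        rw [hx, inner_add_left, real_inner_smul_left, real_inner_smul_left,
          real_inner_self_eq_norm_sq]
        refine (norm_add_le _ _).trans (add_le_add ?_ ?_)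
        · rw [norm_mul, Real.norm_of_nonneg (sq_nonneg ‖grad y x‖)]
          exact mul_le_of_le_one_left (sq_nonneg _) (hn1 n x)
        · rw [norm_mul, mul_left_comm, Real.norm_eq_abs]
          gcongr
          refine (norm_inner_le_norm _ _).trans ?_
          gcongr
          rw [norm_gradient]
          exact (hχd n x).trans (hCn n)
      · filter_upwards [ae_all_iff.2 hw2] with x hx
        have hz : Tendsto (fun n : ℕ => C / ((n : ℝ) + 1)) atTop (𝓝 0) :=
          tendsto_const_nhds.div_atTop (tendsto_natCast_atTop_atTop.atTop_add tendsto_const_nhds)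
        have h2 : Tendsto (fun n => gradient (χ n) x) atTop (𝓝 0) :=
          squeeze_zero_norm (fun n => by rw [norm_gradient]; exact hχd n x) hz
        have h3 : Tendsto (fun n => χ n x) atTop (𝓝 1) := by
          refine tendsto_const_nhds.congr' ?_
          filter_upwards [eventually_ge_atTop ⌈‖x‖⌉₊] with n hn
          rw [hχe n x ((Nat.le_ceil _).trans (by exact_mod_cast Nat.le_succ_of_le hn))]
        have h4 := (((h3.smul_const (grad y x)).add (h2.const_smul (fn y x))).inner
          (tendsto_const_nhds (x := grad y x)) (𝕜 := ℝ))
        simp only [one_smul, smul_zero, add_zero] at h4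
        simpa only [hx] using h4
  simp only [h0] at hlim
  have := tendsto_nhds_unique hlim tendsto_const_nhds
  exact inner_self_eq_zero.1 this

end Mollify

open scoped NNReal

/-! ### The Sobolev and Hardy inequalities. -/

section Inequalities

variable {N : ℕ}

theorem integrable_of_lintegral_ofReal_le {g : Space N → ℝ} {c : ℝ}
    (hg : AEStronglyMeasurable g volume) (h0 : ∀ x, 0 ≤ g x) (hc : 0 ≤ c)
    (h : ∫⁻ x, ENNReal.ofReal (g x) ≤ ENNReal.ofReal c) :
    Integrable g volume ∧ ∫ x, g x ≤ c := by
  have hi : Integrable g volume := by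
    refine ⟨hg, ?_⟩
    rw [hasFiniteIntegral_iff_ofReal (Eventually.of_forall h0)]
    exact h.trans_lt ENNReal.ofReal_lt_top
  refine ⟨hi, ?_⟩
  rw [← ofReal_integral_eq_lintegral_ofReal hi (Eventually.of_forall h0)] at h
  exact (ENNReal.ofReal_le_ofReal_iff hc).1 h

/-- Every `H¹` function is the limit, in `H¹` and almost everywhere, of test functions. -/
theorem exists_seq_test (u : H1 N) : ∃ (φ : ℕ → Space N → ℝ) (hφ : ∀ n, IsTestFunction (φ n)),
    Tendsto (fun n => (hφ n).toH1) atTop (𝓝 u) ∧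
    ∀ᵐ x, Tendsto (fun n => φ n x) atTop (𝓝 (fn u x)) := by
  obtain ⟨s, hs, hlim⟩ := mem_closure_iff_seq_limit.1 (dense_testSet u)
  choose φ hφ hs using hs
  have h1 : Tendsto (fun n => fn (s n)) atTop (𝓝 (fn u)) :=
    ((fnL (N := N)).continuous.tendsto u).comp hlim
  have h2 := tendstoInMeasure_of_tendsto_Lp h1
  obtain ⟨ns, hns, hae⟩ := h2.exists_seq_tendsto_ae
  refine ⟨fun n => φ (ns n), fun n => hφ (ns n), ?_, ?_⟩
  · simp only [← hs]
    exact hlim.comp hns.tendsto_atTop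
  · filter_upwards [hae, ae_all_iff.2 fun n => (hφ n).fn_toH1] with x hx1 hx2
    simpa only [hs, hx2] using hx1

/-- An integral inequality passes from test functions to `H¹`. -/
theorem lintegral_le_of_test {k : Space N → ℝ → ℝ≥0∞} (hk : ∀ x, Continuous (k x))
    (hm : Measurable (Function.uncurry k)) {Φ : H1 N → ℝ≥0∞} (hΦ : Continuous Φ)
    (h : ∀ φ (hφ : IsTestFunction φ), ∫⁻ x, k x (φ x) ≤ Φ hφ.toH1) (u : H1 N) :
    ∫⁻ x, k x (fn u x) ≤ Φ u := by
  obtain ⟨φ, hφ, hlim, hae⟩ := exists_seq_test u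
  calc ∫⁻ x, k x (fn u x) = ∫⁻ x, liminf (fun n => k x (φ n x)) atTop := by
        refine lintegral_congr_ae ?_
        filter_upwards [hae] with x hx
        exact (((hk x).tendsto _).comp hx).liminf_eq.symm
    _ ≤ liminf (fun n => ∫⁻ x, k x (φ n x)) atTop :=
        lintegral_liminf_le fun n => hm.comp (measurable_id.prodMk (hφ n).1.continuous.measurable)
    _ ≤ liminf (fun n => Φ (hφ n).toH1) atTop :=
        liminf_le_liminf (Eventually.of_forall fun n => h _ (hφ n))
    _ = Φ u := ((hΦ.tendsto u).comp hlim).liminf_eq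

/-- The critical Sobolev exponent `2N/(N-2)`. -/
def critExp (N : ℕ) : ℝ := 2 * (N : ℝ) / ((N : ℝ) - 2)

theorem two_lt_critExp (hN : 3 ≤ N) : 2 < critExp N := by
  have h : (3 : ℝ) ≤ N := by exact_mod_cast hN
  rw [critExp, lt_div_iff₀ (by linarith)]
  linarith

theorem norm_grad_toH1 {φ : Space N → ℝ} (hφ : IsTestFunction φ) :
    eLpNorm (fderiv ℝ φ) 2 volume = ENNReal.ofReal ‖grad hφ.toH1‖ := by
  have h1 : eLpNorm (fderiv ℝ φ) 2 volume = eLpNorm (grad hφ.toH1) 2 volume := by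
    refine eLpNorm_congr_norm_ae ?_
    filter_upwards [hφ.grad_toH1] with x hx
    rw [hx, norm_gradient]
  rw [h1, Lp.norm_def, ENNReal.ofReal_toReal (Lp.eLpNorm_ne_top _)]

theorem sobolev_test (hN : 3 ≤ N) : ∃ S : ℝ, 0 ≤ S ∧ ∀ φ (hφ : IsTestFunction (N := N) φ),
    ∫⁻ x, ENNReal.ofReal (|φ x| ^ critExp N) ≤
      ENNReal.ofReal (S * ‖grad hφ.toH1‖ ^ critExp N) := by
  have h3 : (3 : ℝ) ≤ N := by exact_mod_cast hN
  have hq0 : 0 < critExp N := by linarith [two_lt_critExp hN]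
  set S := SNormLESNormFDerivOfEqConst ℝ (volume : Measure (Space N)) ((2 : ℝ≥0) : ℝ) with hS
  refine ⟨(S : ℝ) ^ critExp N, by positivity, fun φ hφ => ?_⟩
  have h := eLpNorm_le_eLpNorm_fderiv_of_eq (volume : Measure (Space N)) (hφ.1.of_le (by simp)) hφ.2
    (p := 2) (p' := (critExp N).toNNReal) (by norm_num) (by simp; omega) (by
      rw [Real.coe_toNNReal _ hq0.le, critExp]
      have h4 : (N : ℝ) - 2 ≠ 0 := by linarith
      have h5 : (N : ℝ) ≠ 0 := by linarith
      simp only [finrank_euclideanSpace, Fintype.card_fin]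
      push_cast
      field_simp)
  have h6 : (((critExp N).toNNReal : ℝ≥0) : ℝ≥0∞) = ENNReal.ofReal (critExp N) := rfl
  rw [h6, ENNReal.coe_ofNat, norm_grad_toH1 hφ, ← hS] at h
  have h7 : (S : ℝ≥0∞) * ENNReal.ofReal ‖grad hφ.toH1‖ = ENNReal.ofReal (S * ‖grad hφ.toH1‖) := by
    rw [ENNReal.ofReal_mul (NNReal.coe_nonneg S), ENNReal.ofReal_coe_nnreal]
  rw [h7, eLpNorm_eq_lintegral_rpow_enorm_toReal (by simpa using hq0) (by simp),
    ENNReal.toReal_ofReal hq0.le, one_div, ENNReal.rpow_inv_le_iff hq0,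
    ENNReal.ofReal_rpow_of_nonneg (by positivity) hq0.le,
    Real.mul_rpow (NNReal.coe_nonneg S) (norm_nonneg _)] at h
  refine le_trans (le_of_eq ?_) h
  refine lintegral_congr fun x => ?_
  rw [← ofReal_norm, ENNReal.ofReal_rpow_of_nonneg (norm_nonneg _) hq0.le, Real.norm_eq_abs]

/-- The Sobolev inequality in `H¹(ℝᴺ)`. -/
theorem exists_sobolev (hN : 3 ≤ N) : ∃ S : ℝ, 0 ≤ S ∧ ∀ u : H1 N,
    Integrable (fun x => |fn u x| ^ critExp N) volume ∧
      ∫ x, |fn u x| ^ critExp N ≤ S * ‖grad u‖ ^ critExp N := by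
  have hq0 : 0 ≤ critExp N := by linarith [two_lt_critExp hN]
  obtain ⟨S, hS0, hS⟩ := sobolev_test hN
  refine ⟨S, hS0, fun u => integrable_of_lintegral_ofReal_le ?_ (fun x => by positivity)
    (by positivity) ?_⟩
  · exact ((Real.continuous_rpow_const hq0).comp continuous_abs).comp_aestronglyMeasurable
      (fn_aesm u)
  · have hc : Continuous fun s : ℝ => ENNReal.ofReal (|s| ^ critExp N) :=
      ENNReal.continuous_ofReal.comp ((Real.continuous_rpow_const hq0).comp continuous_abs)
    refine lintegral_le_of_test (k := fun _ s => ENNReal.ofReal (|s| ^ critExp N))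
      (Φ := fun u => ENNReal.ofReal (S * ‖grad u‖ ^ critExp N)) (fun _ => hc)
      (hc.measurable.comp measurable_snd) ?_ hS u
    exact ENNReal.continuous_ofReal.comp (continuous_const.mul
      ((Real.continuous_rpow_const hq0).comp (gradL (N := N)).continuous.norm))

/-- Integrate φ² against the divergence of m(x) = x/(|x|² + ε), which is at least (N − 2)/(|x|² +
ε). After integration by parts, Young's inequality with weights (N − 2)/2 and 2/(N − 2) lets half of
the left side absorb the term in φ². The parameter ε keeps m smooth at the origin and does not enter
the constant. -/
theorem hardy_test (hN : 3 ≤ N) {φ : Space N → ℝ} (hφ : IsTestFunction φ) {ε : ℝ} (hε : 0 < ε) :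
    Integrable (fun x => φ x ^ 2 / (‖x‖ ^ 2 + ε)) volume ∧
    ∫ x, φ x ^ 2 / (‖x‖ ^ 2 + ε) ≤ 4 / ((N : ℝ) - 2) ^ 2 * ‖grad hφ.toH1‖ ^ 2 := by
  have h3 : (3 : ℝ) ≤ N := by exact_mod_cast hN
  have hpos : ∀ x : Space N, 0 < ‖x‖ ^ 2 + ε := fun x => by positivity
  let e : Fin N → Space N := fun i => EuclideanSpace.single i 1
  let m : Fin N → Space N → ℝ := fun i x => x i / (‖x‖ ^ 2 + ε)
  have hm : ∀ i, ContDiff ℝ 1 (m i) := fun i =>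
    ContDiff.div (by fun_prop) ((contDiff_norm_sq ℝ).add contDiff_const) fun x => (hpos x).ne'
  have hmd : ∀ i x, fderiv ℝ (m i) x (e i) =
      1 / (‖x‖ ^ 2 + ε) - 2 * x i ^ 2 / (‖x‖ ^ 2 + ε) ^ 2 := by
    intro i x
    have h1 : HasFDerivAt (fun x : Space N => x i) (EuclideanSpace.proj (𝕜 := ℝ) i) x :=
      (EuclideanSpace.proj (𝕜 := ℝ) i).hasFDerivAt
    have h2 : HasFDerivAt (fun x : Space N => ‖x‖ ^ 2 + ε) (2 • innerSL ℝ x) x :=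
      (hasStrictFDerivAt_norm_sq x).hasFDerivAt.add_const ε
    have h4 := (h1.fun_mul ((hasDerivAt_inv (hpos x).ne').comp_hasFDerivAt x h2)).fderiv
    have h4' : m i = fun y : Space N => y i * (Inv.inv ∘ fun x : Space N => ‖x‖ ^ 2 + ε) y := rfl
    rw [h4', h4]
    have h5 : inner ℝ x (e i) = x i := by simp [e, EuclideanSpace.inner_single_right]
    have h6 : (e i) i = 1 := by simp [e]
    simp only [smul_apply, add_apply, PiLp.proj_apply, h6, innerSL_apply_apply, h5, smul_eq_mul,
      nsmul_eq_mul, Function.comp_apply]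
    have := (hpos x).ne'
    field_simp
    norm_num
    ring
  have hφ2 : IsTestFunction fun x => φ x * φ x := ⟨hφ.1.mul hφ.1, hφ.2.mul_left⟩
  have hI : Integrable (fun x => φ x ^ 2 / (‖x‖ ^ 2 + ε)) volume := by
    refine Continuous.integrable_of_hasCompactSupport ?_ ?_
    · exact (hφ.1.continuous.pow 2).div (by fun_prop) fun x => (hpos x).ne'
    · have : (fun x => φ x ^ 2 / (‖x‖ ^ 2 + ε)) = fun x => φ x * (φ x / (‖x‖ ^ 2 + ε)) := by
        funext x; ring
      rw [this]
      exact hφ.2.mul_right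
  refine ⟨hI, ?_⟩
  have hG : Integrable (fun x => ‖gradient φ x‖ ^ 2) volume :=
    hφ.memLp_gradient.integrable_norm_pow two_ne_zero
  have hg : ‖grad hφ.toH1‖ ^ 2 = ∫ x, ‖gradient φ x‖ ^ 2 := by
    rw [L2Field.norm_sq_eq]
    refine integral_congr_ae ?_
    filter_upwards [hφ.grad_toH1] with x hx
    rw [hx]
  have hibp : ∑ i, ∫ x, m i x * fderiv ℝ (fun x => φ x * φ x) x (e i) =
      - ∑ i, ∫ x, fderiv ℝ (m i) x (e i) * (φ x * φ x) := by
    rw [← Finset.sum_neg_distrib]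
    exact Finset.sum_congr rfl fun i _ => integral_mul_fderiv_test (hm i) hφ2 (e i)
  rw [← integral_finsetSum, ← integral_finsetSum] at hibp
  rotate_left
  · intro i _
    refine Continuous.integrable_of_hasCompactSupport ?_ hφ2.2.mul_left
    exact (((hm i).continuous_fderiv one_ne_zero).clm_apply continuous_const).mul hφ2.1.continuous
  · intro i _
    refine Continuous.integrable_of_hasCompactSupport ?_ (hφ2.2.fderiv_apply (𝕜 := ℝ) _).mul_left
    exact (hm i).continuous.mul ((hφ2.1.continuous_fderiv (by simp)).clm_apply continuous_const)
  have hL : ∀ x, -(((N : ℝ) - 2) / 2 * (φ x ^ 2 / (‖x‖ ^ 2 + ε)) +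
      2 / ((N : ℝ) - 2) * ‖gradient φ x‖ ^ 2) ≤
      ∑ i, m i x * fderiv ℝ (fun x => φ x * φ x) x (e i) := by
    intro x
    have h1 : ∑ i, m i x * fderiv ℝ (fun x => φ x * φ x) x (e i) =
        2 * φ x * fderiv ℝ φ x x / (‖x‖ ^ 2 + ε) := by
      rw [fderiv_fun_mul (hφ.differentiable x) (hφ.differentiable x)]
      have h2 : x = ∑ i, x i • e i := by
        ext j
        simp [e, Pi.single_apply]
      have h3 : fderiv ℝ φ x x = ∑ i, x i * fderiv ℝ φ x (e i) := by
        refine (congrArg (fderiv ℝ φ x) h2).trans ?_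
        simp only [map_sum, map_smul, smul_eq_mul]
      rw [h3, mul_div_assoc, Finset.sum_div, Finset.mul_sum]
      refine Finset.sum_congr rfl fun i _ => ?_
      simp only [m, add_apply, smul_apply, smul_eq_mul]
      ring
    rw [h1]
    have h2 : |fderiv ℝ φ x x| ≤ ‖gradient φ x‖ * ‖x‖ := by
      rw [norm_gradient]
      exact (fderiv ℝ φ x).le_opNorm x
    have hc : (0 : ℝ) < (N : ℝ) - 2 := by linarith
    obtain ⟨c, hce⟩ : ∃ c, c = (N : ℝ) - 2 := ⟨_, rfl⟩
    obtain ⟨d, hde⟩ : ∃ d, d = ‖x‖ ^ 2 + ε := ⟨_, rfl⟩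
    have hd : 0 < d := hde ▸ hpos x
    rw [← hce] at hc ⊢
    rw [← hde]
    have h4 : |2 * φ x * fderiv ℝ φ x x / d| ≤ 2 * (|φ x| * ‖x‖ / d) * ‖gradient φ x‖ := by
      rw [abs_div, abs_mul, abs_mul, abs_two, abs_of_pos hd]
      calc 2 * |φ x| * |fderiv ℝ φ x x| / d ≤ 2 * |φ x| * (‖gradient φ x‖ * ‖x‖) / d := by gcongr
        _ = _ := by ring
    have h5 : (|φ x| * ‖x‖ / d) ^ 2 ≤ φ x ^ 2 / d := by
      rw [div_pow, mul_pow, sq_abs, div_le_div_iff₀ (by positivity) hd]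
      have : ‖x‖ ^ 2 ≤ d := by linarith
      nlinarith [mul_le_mul_of_nonneg_left this (mul_nonneg (sq_nonneg (φ x)) hd.le)]
    have h6 : 2 * (|φ x| * ‖x‖ / d) * ‖gradient φ x‖ ≤
        c / 2 * (|φ x| * ‖x‖ / d) ^ 2 + 2 / c * ‖gradient φ x‖ ^ 2 := by
      have h7 : 0 ≤ 2 / c * (c / 2 * (|φ x| * ‖x‖ / d) - ‖gradient φ x‖) ^ 2 := by positivity
      have h8 : 2 / c * (c / 2 * (|φ x| * ‖x‖ / d) - ‖gradient φ x‖) ^ 2 =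
        c / 2 * (|φ x| * ‖x‖ / d) ^ 2 + 2 / c * ‖gradient φ x‖ ^ 2 -
          2 * (|φ x| * ‖x‖ / d) * ‖gradient φ x‖ := by
        field_simp
        ring
      linarith
    have h9 := mul_le_mul_of_nonneg_left h5 (by positivity : 0 ≤ c / 2)
    linarith [neg_abs_le (2 * φ x * fderiv ℝ φ x x / d)]
  have hR : ∀ x, ((N : ℝ) - 2) * (φ x ^ 2 / (‖x‖ ^ 2 + ε)) ≤
      ∑ i, fderiv ℝ (m i) x (e i) * (φ x * φ x) := by
    intro x
    have h1 : ∑ i, fderiv ℝ (m i) x (e i) * (φ x * φ x) =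
        (N / (‖x‖ ^ 2 + ε) - 2 * ‖x‖ ^ 2 / (‖x‖ ^ 2 + ε) ^ 2) * φ x ^ 2 := by
      simp only [hmd]
      rw [← Finset.sum_mul, Finset.sum_sub_distrib, EuclideanSpace.real_norm_sq_eq]
      simp only [Finset.sum_const, Finset.card_univ, Fintype.card_fin, nsmul_eq_mul]
      rw [← Finset.sum_div, ← Finset.mul_sum]
      ring
    rw [h1, mul_div_assoc', mul_comm ((N : ℝ) - 2), mul_div_assoc, mul_comm (φ x ^ 2)]
    refine mul_le_mul_of_nonneg_right ?_ (sq_nonneg _)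
    rw [sub_div]
    refine sub_le_sub_left ?_ _
    rw [div_le_div_iff₀ (by positivity) (hpos x)]
    nlinarith [hpos x, mul_nonneg hε.le (hpos x).le]
  have hiS : Integrable (fun x => ∑ i, fderiv ℝ (m i) x (e i) * (φ x * φ x)) volume := by
    refine integrable_finsetSum _ fun i _ => ?_
    refine Continuous.integrable_of_hasCompactSupport ?_ hφ2.2.mul_left
    exact (((hm i).continuous_fderiv one_ne_zero).clm_apply continuous_const).mul hφ2.1.continuous
  have hiT : Integrable (fun x => ∑ i, m i x * fderiv ℝ (fun x => φ x * φ x) x (e i)) volume := by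
    refine integrable_finsetSum _ fun i _ => ?_
    refine Continuous.integrable_of_hasCompactSupport ?_ (hφ2.2.fderiv_apply (𝕜 := ℝ) _).mul_left
    exact (hm i).continuous.mul ((hφ2.1.continuous_fderiv (by simp)).clm_apply continuous_const)
  have h8 := integral_mono (hI.const_mul ((N : ℝ) - 2)) hiS hR
  have h9 := integral_mono ((hI.const_mul (((N : ℝ) - 2) / 2)).add
    (hG.const_mul (2 / ((N : ℝ) - 2)))).neg hiT hL
  simp only [Pi.neg_apply, Pi.add_apply] at h9
  rw [integral_neg, integral_add (hI.const_mul (((N : ℝ) - 2) / 2))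
    (hG.const_mul (2 / ((N : ℝ) - 2))), integral_const_mul, integral_const_mul, ← hg] at h9
  rw [integral_const_mul] at h8
  have h10 : ((N : ℝ) - 2) / 2 * (∫ x, φ x ^ 2 / (‖x‖ ^ 2 + ε)) ≤
      2 / ((N : ℝ) - 2) * ‖grad hφ.toH1‖ ^ 2 := by linarith
  have h11 : (0 : ℝ) < (N : ℝ) - 2 := by linarith
  have h12 : 4 / ((N : ℝ) - 2) ^ 2 * ‖grad hφ.toH1‖ ^ 2 =
      (2 / ((N : ℝ) - 2)) * (2 / ((N : ℝ) - 2) * ‖grad hφ.toH1‖ ^ 2) := by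
    field_simp
    norm_num
  rw [h12]
  refine le_trans (le_of_eq ?_) (mul_le_mul_of_nonneg_left h10 (by positivity))
  field_simp

/-- Hardy's inequality in `H¹(ℝᴺ)`. -/
theorem hardy (hN : 3 ≤ N) (u : H1 N) :
    Integrable (fun x => fn u x ^ 2 / ‖x‖ ^ 2) volume ∧
      ∫ x, fn u x ^ 2 / ‖x‖ ^ 2 ≤ 4 / ((N : ℝ) - 2) ^ 2 * ‖grad u‖ ^ 2 := by
  have hm : Measurable fun x : Space N => ‖x‖ ^ 2 := by fun_prop
  refine integrable_of_lintegral_ofReal_le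
    (((fn_aesm u).aemeasurable.pow_const 2).div hm.aemeasurable).aestronglyMeasurable
    (fun x => by positivity) (by positivity) ?_
  refine lintegral_le_of_test (k := fun x s => ENNReal.ofReal (s ^ 2 / ‖x‖ ^ 2))
    (Φ := fun u => ENNReal.ofReal (4 / ((N : ℝ) - 2) ^ 2 * ‖grad u‖ ^ 2)) (fun x => ?_) ?_ ?_
    (fun φ hφ => ?_) u
  · exact ENNReal.continuous_ofReal.comp (by fun_prop)
  · exact ENNReal.measurable_ofReal.comp ((measurable_snd.pow_const 2).div (hm.comp measurable_fst))
  · exact ENNReal.continuous_ofReal.comp (continuous_const.mul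
      ((gradL (N := N)).continuous.norm.pow 2))
  · have hn : ∀ n : ℕ, (0 : ℝ) < 1 / ((n : ℝ) + 1) := fun n => by positivity
    calc ∫⁻ x, ENNReal.ofReal (φ x ^ 2 / ‖x‖ ^ 2)
        ≤ ∫⁻ x, liminf (fun n : ℕ => ENNReal.ofReal (φ x ^ 2 / (‖x‖ ^ 2 + 1 / ((n : ℝ) + 1)))) atTop := by
          refine lintegral_mono fun x => ?_
          by_cases hx : x = 0
          · simp [hx]
          · have h1 : Tendsto (fun n : ℕ => φ x ^ 2 / (‖x‖ ^ 2 + 1 / ((n : ℝ) + 1))) atTop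
                (𝓝 (φ x ^ 2 / (‖x‖ ^ 2 + 0))) :=
              tendsto_const_nhds.div (tendsto_const_nhds.add tendsto_one_div_add_atTop_nhds_zero_nat)
                (by simpa using hx)
            rw [add_zero] at h1
            exact ((ENNReal.continuous_ofReal.tendsto _).comp h1).liminf_eq.ge
      _ ≤ liminf (fun n : ℕ => ∫⁻ x, ENNReal.ofReal (φ x ^ 2 / (‖x‖ ^ 2 + 1 / ((n : ℝ) + 1)))) atTop := by
          refine lintegral_liminf_le fun n => ENNReal.measurable_ofReal.comp ?_
          exact (hφ.1.continuous.measurable.pow_const 2).div (hm.add_const _)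
      _ ≤ liminf (fun _ : ℕ => ENNReal.ofReal (4 / ((N : ℝ) - 2) ^ 2 * ‖grad hφ.toH1‖ ^ 2)) atTop := by
          refine liminf_le_liminf (Eventually.of_forall fun n => ?_)
          obtain ⟨h1, h2⟩ := hardy_test hN hφ (hn n)
          rw [← ofReal_integral_eq_lintegral_ofReal h1 (Eventually.of_forall fun x => by positivity)]
          exact ENNReal.ofReal_le_ofReal h2
      _ = _ := by rw [liminf_const]

end Inequalities

/-! ### Weak convergence in Hilbert spaces. -/

section Weak

variable {E : Type*} [NormedAddCommGroup E] [InnerProductSpace ℝ E]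

/-- Weak convergence of sequences in a Hilbert space. -/
def WeakTendsto (u : ℕ → E) (a : E) : Prop :=
  ∀ v : E, Tendsto (fun n => inner ℝ (u n) v) atTop (𝓝 (inner ℝ a v))

theorem WeakTendsto.comp {u : ℕ → E} {a : E} (h : WeakTendsto u a) {φ : ℕ → ℕ}
    (hφ : Tendsto φ atTop atTop) : WeakTendsto (u ∘ φ) a := fun v => (h v).comp hφ

theorem WeakTendsto.sub {u w : ℕ → E} {a b : E} (h : WeakTendsto u a) (h' : WeakTendsto w b) :
    WeakTendsto (fun n => u n - w n) (a - b) := fun v => by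
  simp only [inner_sub_left]
  exact (h v).sub (h' v)

theorem weakTendsto_const (a : E) : WeakTendsto (fun _ => a) a := fun _ => tendsto_const_nhds

theorem WeakTendsto.unique {u : ℕ → E} {a b : E} (h : WeakTendsto u a) (h' : WeakTendsto u b) :
    a = b := ext_inner_right ℝ fun v => tendsto_nhds_unique (h v) (h' v)

theorem WeakTendsto.apply [CompleteSpace E] {u : ℕ → E} {a : E} (h : WeakTendsto u a)
    (ℓ : E →L[ℝ] ℝ) : Tendsto (fun n => ℓ (u n)) atTop (𝓝 (ℓ a)) := by
  have h1 : ∀ x, ℓ x = inner ℝ x ((InnerProductSpace.toDual ℝ E).symm ℓ) := fun x => by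
    rw [real_inner_comm, InnerProductSpace.toDual_symm_apply]
  simp only [h1]
  exact h _

theorem WeakTendsto.map [CompleteSpace E] {E' : Type*} [NormedAddCommGroup E']
    [InnerProductSpace ℝ E'] {u : ℕ → E} {a : E}
    (h : WeakTendsto u a) (T : E →L[ℝ] E') : WeakTendsto (fun n => T (u n)) (T a) := fun v => by
  have := h.apply ((innerSL ℝ v).comp T)
  simpa only [ContinuousLinearMap.comp_apply, innerSL_apply_apply, real_inner_comm] using this

theorem exists_weak_subseq [CompleteSpace E] [TopologicalSpace.SeparableSpace E] {u : ℕ → E} {M : ℝ}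
    (h : ∀ n, ‖u n‖ ≤ M) : ∃ (a : E) (φ : ℕ → ℕ), StrictMono φ ∧ WeakTendsto (u ∘ φ) a := by
  let d : ℕ → WeakDual ℝ E := fun n =>
    WeakDual.toStrongDual.symm (InnerProductSpace.toDual ℝ E (u n))
  have hd : ∀ n, d n ∈ WeakDual.toStrongDual ⁻¹' Metric.closedBall (0 : StrongDual ℝ E) M := by
    intro n
    simpa [d] using h n
  obtain ⟨ℓ, -, φ, hφ, hlim⟩ := WeakDual.isSeqCompact_closedBall ℝ E 0 M hd
  refine ⟨(InnerProductSpace.toDual ℝ E).symm (WeakDual.toStrongDual ℓ), φ, hφ, fun v => ?_⟩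
  rw [InnerProductSpace.toDual_symm_apply]
  exact ((WeakDual.eval_continuous v).tendsto ℓ).comp hlim

end Weak

/-! ### Local compactness and almost everywhere convergence. -/

section Rellich

variable {N : ℕ}

theorem norm_fn_sub_mollify_le {ρ : Space N → ℝ} {r : ℝ} (hρ : IsTestFunction ρ)
    (h0 : ∀ x, 0 ≤ ρ x) (h1 : ∫ x, ρ x = 1) (hr : ∀ x, ρ x ≠ 0 → ‖x‖ < r) (u : H1 N) :
    ‖fn (mollify ρ u) - fn u‖ ≤ ‖grad u‖ * r := by
  have h2 : fn (mollify ρ u) = ∫ t, ρ t • fn (translate (-t) u) := by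
    rw [← fnL_apply, mollify, ← ContinuousLinearMap.integral_comp_comm _ (integrable_mollify hρ u)]
    simp only [map_smul, fnL_apply]
  rw [h2]
  refine norm_integral_smul_sub_le hρ h0 h1 hr
    ((fnL (N := N)).continuous.comp ((continuous_translate u).comp continuous_neg)) _ fun t ht => ?_
  refine (norm_translate_sub_le u (-t)).trans ?_
  rw [norm_neg]
  gcongr

theorem abs_conv_le (u : H1 N) {ρ : Space N → ℝ} (hρ : IsTestFunction ρ) (x : Space N) :
    |conv u ρ x| ≤ ‖fn u‖ * ‖(hρ.comp_const_sub x).memLp.toLp _‖ := by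
  have : conv u ρ x = inner ℝ (fn u) ((hρ.comp_const_sub x).memLp.toLp _) :=
    (L2.inner_toLp _ _).symm
  rw [this]
  exact abs_real_inner_le_norm _ _

theorem norm_toLp_comp_const_sub {ψ : Space N → ℝ} (hψ : IsTestFunction ψ) (y : Space N) :
    ‖(hψ.comp_const_sub y).memLp.toLp _‖ = ‖hψ.memLp.toLp ψ‖ := by
  rw [← sq_eq_sq₀ (norm_nonneg _) (norm_nonneg _), L2.norm_sq_eq, L2.norm_sq_eq]
  have h1 : ∫ x, ((hψ.comp_const_sub y).memLp.toLp _) x ^ 2 = ∫ x, ψ (y - x) ^ 2 := by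
    refine integral_congr_ae ?_
    filter_upwards [(hψ.comp_const_sub y).memLp.coeFn_toLp] with x hx
    rw [hx]
  have h2 : ∫ x, (hψ.memLp.toLp ψ) x ^ 2 = ∫ x, ψ x ^ 2 := by
    refine integral_congr_ae ?_
    filter_upwards [hψ.memLp.coeFn_toLp] with x hx
    rw [hx]
  rw [h1, h2]
  exact integral_sub_left_eq_self (fun x => ψ x ^ 2) volume y

theorem integrable_weight_mul_sq {w : Space N → ℝ} (hw : Integrable w volume) (hw0 : ∀ x, 0 ≤ w x)
    (hw1 : ∀ x, w x ≤ 1) (u : L2 N) : Integrable (fun x => w x * u x ^ 2) volume := by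
  refine ((L2.integrable_mul u u)).mono (hw.1.mul ((Lp.aestronglyMeasurable u).pow 2))
    (Eventually.of_forall fun x => ?_)
  rw [norm_mul, Real.norm_of_nonneg (hw0 x), ← sq]
  exact mul_le_of_le_one_left (norm_nonneg _) (hw1 x)

/-- Rellich's theorem, with an integrable weight. -/
theorem rellich {u : ℕ → H1 N} (hu : WeakTendsto u 0) {M : ℝ} (hM : ∀ n, ‖u n‖ ≤ M)
    {w : Space N → ℝ} (hw : Integrable w volume) (hw0 : ∀ x, 0 ≤ w x) (hw1 : ∀ x, w x ≤ 1) :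
    Tendsto (fun n => ∫ x, w x * fn (u n) x ^ 2) atTop (𝓝 0) := by
  have hM0 : 0 ≤ M := (norm_nonneg _).trans (hM 0)
  rw [Metric.tendsto_atTop]
  intro ε hε
  obtain ⟨r, hr, hrε⟩ : ∃ r > 0, 2 * (M * r) ^ 2 < ε / 2 := by
    have hc : Tendsto (fun r : ℝ => 2 * (M * r) ^ 2) (𝓝[>] 0) (𝓝 (2 * (M * 0) ^ 2)) :=
      (Continuous.tendsto (by fun_prop) _).mono_left nhdsWithin_le_nhds
    have h2 := hc.eventually_lt_const (u := ε / 2) (by simp; positivity)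
    obtain ⟨r, hr1, hr2⟩ := (h2.and self_mem_nhdsWithin).exists
    exact ⟨r, hr2, hr1⟩
  -- Mollifying at scale r changes u_n in L² by at most M r, uniformly in n. For fixed ρ the
  -- mollified functions are uniformly bounded and tend to 0 pointwise, being weakly continuous
  -- functionals of u_n, so dominated convergence with the integrable weight applies.
  obtain ⟨ρ, hρ, h0, h1, hs⟩ := exists_mollifier (N := N) hr
  have hlim : Tendsto (fun n => ∫ x, w x * conv (u n) ρ x ^ 2) atTop (𝓝 0) := by
    have h2 : ∀ n x, |conv (u n) ρ x| ≤ M * ‖hρ.memLp.toLp ρ‖ := fun n x => by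
      refine (abs_conv_le (u n) hρ x).trans ?_
      rw [norm_toLp_comp_const_sub hρ]
      gcongr
      exact (norm_fn_le _).trans (hM n)
    have h3 := tendsto_integral_of_dominated_convergence (f := fun _ => (0 : ℝ))
      (F := fun n x => w x * conv (u n) ρ x ^ 2) (μ := volume)
      (fun x => w x * (M * ‖hρ.memLp.toLp ρ‖) ^ 2)
      (fun n => hw.1.mul ((contDiff_conv (u n) hρ).continuous.pow 2).aestronglyMeasurable)
      (hw.mul_const _) (fun n => Eventually.of_forall fun x => ?_)
      (Eventually.of_forall fun x => ?_)
    · simpa using h3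
    · rw [norm_mul, Real.norm_of_nonneg (hw0 x), Real.norm_of_nonneg (sq_nonneg _), ← sq_abs]
      exact mul_le_mul_of_nonneg_left (pow_le_pow_left₀ (abs_nonneg _) (h2 n x) 2) (hw0 x)
    · have h4 : Tendsto (fun n => conv (u n) ρ x) atTop (𝓝 0) := by
        have h5 := hu.apply ((innerSL ℝ ((hρ.comp_const_sub x).memLp.toLp _)).comp fnL)
        rw [map_zero] at h5
        refine h5.congr fun n => ?_
        rw [ContinuousLinearMap.comp_apply, innerSL_apply_apply, fnL_apply, real_inner_comm,
          L2.inner_toLp]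
        rfl
      simpa using (h4.pow 2).const_mul (w x)
  obtain ⟨n₀, hn₀⟩ := (Metric.tendsto_atTop.1 hlim) (ε / 4) (by positivity)
  refine ⟨n₀, fun n hn => ?_⟩
  have h2 := hn₀ n hn
  rw [Real.dist_eq, sub_zero] at h2 ⊢
  have hi := integrable_weight_mul_sq hw hw0 hw1
  rw [abs_of_nonneg (integral_nonneg fun x => mul_nonneg (hw0 x) (sq_nonneg _))]
  have h3 : ∫ x, w x * fn (u n) x ^ 2 ≤ ∫ x, (2 * (fn (mollify ρ (u n)) - fn (u n)) x ^ 2 +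
      2 * (w x * fn (mollify ρ (u n)) x ^ 2)) := by
    refine integral_mono_ae (hi _) ?_ ?_
    · refine Integrable.add (Integrable.const_mul ?_ 2) ((hi _).const_mul 2)
      simpa only [sq] using L2.integrable_mul _ _
    · filter_upwards [Lp.coeFn_sub (fn (mollify ρ (u n))) (fn (u n))] with x hx
      rw [hx, Pi.sub_apply]
      have h4 := hw0 x
      have h5 := hw1 x
      nlinarith [mul_nonneg h4 (sq_nonneg (2 * fn (mollify ρ (u n)) x - fn (u n) x)),
        mul_nonneg (sub_nonneg.2 h5) (sq_nonneg (fn (mollify ρ (u n)) x - fn (u n) x))]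
  rw [integral_add, integral_const_mul, integral_const_mul, ← L2.norm_sq_eq] at h3
  · have h6 : ∫ x, w x * fn (mollify ρ (u n)) x ^ 2 = ∫ x, w x * conv (u n) ρ x ^ 2 := by
      refine integral_congr_ae ?_
      filter_upwards [fn_mollify hρ (u n)] with x hx
      rw [hx]
    rw [h6] at h3
    have h7 := norm_fn_sub_mollify_le hρ h0 h1 hs (u n)
    have h8 : ‖fn (mollify ρ (u n)) - fn (u n)‖ ^ 2 ≤ (M * r) ^ 2 := by
      refine pow_le_pow_left₀ (norm_nonneg _) (h7.trans ?_) 2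
      gcongr
      exact (norm_grad_le _).trans (hM n)
    have h9 := (abs_lt.1 h2).2
    linarith
  · refine Integrable.const_mul ?_ 2
    simpa only [sq] using L2.integrable_mul _ _
  · exact (hi _).const_mul 2

theorem exists_weight : ∃ w : Space N → ℝ, Integrable w volume ∧ (∀ x, 0 < w x) ∧ ∀ x, w x ≤ 1 := by
  refine ⟨fun x => (1 + ‖x‖) ^ (-((N : ℝ) + 1)), integrable_one_add_norm (by simp),
    fun x => by positivity, fun x => ?_⟩
  exact Real.rpow_le_one_of_one_le_of_nonpos (by simp) (by linarith [(Nat.cast_nonneg N : (0 : ℝ) ≤ N)])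

/-- A weakly convergent sequence in `H¹` has a subsequence that converges almost everywhere. -/
theorem WeakTendsto.exists_subseq_ae {u : ℕ → H1 N} {a : H1 N} (hu : WeakTendsto u a) {M : ℝ}
    (hM : ∀ n, ‖u n‖ ≤ M) : ∃ φ : ℕ → ℕ, StrictMono φ ∧
      ∀ᵐ x, Tendsto (fun n => fn (u (φ n)) x) atTop (𝓝 (fn a x)) := by
  obtain ⟨w, hw, hw0, hw1⟩ := exists_weight (N := N)
  have h1 : WeakTendsto (fun n => u n - a) 0 := by
    simpa using hu.sub (weakTendsto_const a)
  have h2 := rellich h1 (M := M + ‖a‖)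
    (fun n => (norm_sub_le _ _).trans (add_le_add_left (hM n) _)) hw (fun x => (hw0 x).le) hw1
  have hi := integrable_weight_mul_sq hw (fun x => (hw0 x).le) hw1
  have h3 : Tendsto (fun n => eLpNorm ((fun x => w x * fn (u n - a) x ^ 2) - fun _ => (0 : ℝ)) 1
      volume) atTop (𝓝 0) := by
    have h4 := (ENNReal.continuous_ofReal.tendsto _).comp h2
    rw [ENNReal.ofReal_zero] at h4
    refine h4.congr fun n => ?_
    simp only [Function.comp_apply]
    rw [show ((fun x => w x * fn (u n - a) x ^ 2) - fun _ => (0 : ℝ)) =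
      fun x => w x * fn (u n - a) x ^ 2 from by funext x; simp, eLpNorm_one_eq_lintegral_enorm,
      ofReal_integral_eq_lintegral_ofReal (hi _)
        (Eventually.of_forall fun x => mul_nonneg (hw0 x).le (sq_nonneg _))]
    refine lintegral_congr fun x => ?_
    rw [← ofReal_norm, Real.norm_of_nonneg (mul_nonneg (hw0 x).le (sq_nonneg _))]
  have h5 := tendstoInMeasure_of_tendsto_eLpNorm one_ne_zero (fun n => (hi _).1)
    aestronglyMeasurable_const h3
  obtain ⟨φ, hφ, hae⟩ := h5.exists_seq_tendsto_ae
  refine ⟨φ, hφ, ?_⟩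
  filter_upwards [hae, ae_all_iff.2 fun n => fn_sub_ae (u n) a] with x hx1 hx2
  have h6 : Tendsto (fun n => (fn (u (φ n)) x - fn a x) ^ 2) atTop (𝓝 0) := by
    have h7 := hx1.const_mul (w x)⁻¹
    rw [mul_zero] at h7
    refine h7.congr fun n => ?_
    rw [inv_mul_cancel_left₀ (hw0 x).ne', hx2]
  have h8 := h6.sqrt
  simp only [Real.sqrt_sq_eq_abs, Real.sqrt_zero] at h8
  exact tendsto_sub_nhds_zero_iff.1 ((tendsto_zero_iff_abs_tendsto_zero _).2 h8)

end Rellich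

/-! ### Lᵖ embeddings and interpolation. -/

section LpBounds

variable {N : ℕ}

theorem rpow_le_sq_add {p q s : ℝ} (hp : 2 ≤ p) (hpq : p ≤ q) (hs : 0 ≤ s) :
    s ^ p ≤ s ^ 2 + s ^ q := by
  rcases le_total s 1 with h | h
  · have h1 : s ^ p ≤ s ^ (2 : ℝ) := 
      Real.rpow_le_rpow_of_exponent_ge_of_imp hs h hp fun _ h0 => by linarith
    rw [Real.rpow_two] at h1
    linarith [Real.rpow_nonneg hs q]
  · have h1 : s ^ p ≤ s ^ q := Real.rpow_le_rpow_of_exponent_le h hpq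
    linarith [sq_nonneg s]

/-- Interpolation of a power between three others. -/
theorem exists_rpow_le {p q p₀ ε : ℝ} (hp : 2 < p) (hpq : p < q) (hp₀ : 0 < p₀) (hε : 0 < ε) :
    ∃ C : ℝ, 0 ≤ C ∧ ∀ s : ℝ, 0 ≤ s → s ^ p ≤ ε * (s ^ 2 + s ^ q) + C * s ^ p₀ := by
  obtain ⟨a, ha0, ha⟩ : ∃ a > 0, a ^ (p - 2) ≤ ε :=
    ⟨ε ^ (p - 2)⁻¹, by positivity, by rw [Real.rpow_inv_rpow hε.le (by linarith)]⟩
  obtain ⟨b, hb0, hb⟩ : ∃ b > 0, b ^ (q - p) * ε ≥ 1 :=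
    ⟨(ε⁻¹) ^ (q - p)⁻¹, by positivity, by
      rw [Real.rpow_inv_rpow (by positivity) (by linarith), inv_mul_cancel₀ hε.ne']⟩
  refine ⟨b ^ p / a ^ p₀, by positivity, fun s hs => ?_⟩
  have h0 : 0 ≤ b ^ p / a ^ p₀ * s ^ p₀ := by positivity
  have h1 : 0 ≤ ε * s ^ 2 := by positivity
  have h2 : 0 ≤ ε * s ^ q := by positivity
  rcases le_total s a with h | h
  · have h3 : s ^ p ≤ ε * s ^ 2 := by
      rcases hs.eq_or_lt with h4 | h4
      · rw [← h4, Real.zero_rpow (by linarith)]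
        simp
      · have h5 : s ^ p = s ^ (p - 2) * s ^ 2 := by
          rw [← Real.rpow_natCast s 2, ← Real.rpow_add h4]
          congr 1
          push_cast
          ring
        rw [h5]
        gcongr
        exact (Real.rpow_le_rpow hs h (by linarith)).trans ha
    linarith
  · rcases le_total s b with h' | h'
    · have h3 : s ^ p ≤ b ^ p / a ^ p₀ * s ^ p₀ := by
        rw [div_mul_eq_mul_div, le_div_iff₀ (by positivity)]
        gcongr
      linarith
    · have hs' : 0 < s := hb0.trans_le h'
      have h3 : s ^ p ≤ ε * s ^ q := by
        have h4 : s ^ q = s ^ (q - p) * s ^ p := by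
          rw [← Real.rpow_add hs']
          congr 1
          ring
        rw [h4, ← mul_assoc]
        refine le_mul_of_one_le_left (by positivity) ?_
        calc 1 ≤ b ^ (q - p) * ε := hb
          _ ≤ s ^ (q - p) * ε := by gcongr
          _ = _ := mul_comm _ _
      linarith

theorem aesm_abs_rpow (u : H1 N) {p : ℝ} (hp : 0 ≤ p) :
    AEStronglyMeasurable (fun x => |fn u x| ^ p) volume :=
  ((Real.continuous_rpow_const hp).comp continuous_abs).comp_aestronglyMeasurable (fn_aesm u)

theorem integrable_sq (u : L2 N) : Integrable (fun x => |u x| ^ 2) volume := by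
  simp only [sq_abs]
  simpa only [sq] using L2.integrable_mul u u

/-- The embeddings `H¹ ⊆ L^p`. -/
theorem exists_Lp_bound (hN : 3 ≤ N) {p : ℝ} (hp : 2 ≤ p) (hp' : p ≤ critExp N) :
    ∃ C : ℝ, 0 < C ∧ ∀ u : H1 N, Integrable (fun x => |fn u x| ^ p) volume ∧
      ∫ x, |fn u x| ^ p ≤ C * ‖u‖ ^ p := by
  have hp0 : 0 < p := by linarith
  obtain ⟨S, hS0, hS⟩ := exists_sobolev hN
  have hi : ∀ u : H1 N, Integrable (fun x => |fn u x| ^ p) volume := fun u => by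
    refine ((integrable_sq (fn u)).add (hS u).1).mono' (aesm_abs_rpow u hp0.le)
      (Eventually.of_forall fun x => ?_)
    rw [Real.norm_of_nonneg (by positivity)]
    exact rpow_le_sq_add hp hp' (abs_nonneg _)
  -- The bound s^p ≤ s² + s^q is not homogeneous, so it is used on the unit ball only and the
  -- general case follows by scaling.
  have h1 : ∀ u : H1 N, ‖u‖ ≤ 1 → ∫ x, |fn u x| ^ p ≤ 1 + S := fun u hu => by
    refine (integral_mono (hi u) ((integrable_sq (fn u)).add (hS u).1)
      fun x => rpow_le_sq_add hp hp' (abs_nonneg _)).trans ?_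
    simp only [Pi.add_apply]
    rw [integral_add (integrable_sq (fn u)) (hS u).1]
    simp only [sq_abs]
    rw [← L2.norm_sq_eq]
    have h2 : ‖fn u‖ ^ 2 ≤ 1 := pow_le_one₀ (norm_nonneg _) ((norm_fn_le u).trans hu)
    have h3 : ‖grad u‖ ^ critExp N ≤ 1 := Real.rpow_le_one (norm_nonneg _)
      ((norm_grad_le u).trans hu) (by linarith)
    have h4 := (hS u).2
    nlinarith
  refine ⟨1 + S, by positivity, fun u => ⟨hi u, ?_⟩⟩
  rcases eq_or_ne u 0 with rfl | hu
  · rw [norm_zero, Real.zero_rpow hp0.ne', mul_zero]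
    refine le_of_eq (integral_eq_zero_of_ae ?_)
    rw [fn_zero]
    filter_upwards [Lp.coeFn_zero ℝ 2 (volume : Measure (Space N))] with x hx
    rw [hx]
    simp [Real.zero_rpow hp0.ne']
  · have hu' : 0 < ‖u‖ := norm_pos_iff.2 hu
    have h2 := h1 (‖u‖⁻¹ • u) (by rw [norm_smul, norm_inv, norm_norm, inv_mul_cancel₀ hu'.ne'])
    have h3 : ∫ x, |fn (‖u‖⁻¹ • u) x| ^ p = (‖u‖ ^ p)⁻¹ * ∫ x, |fn u x| ^ p := by
      rw [← integral_const_mul]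
      refine integral_congr_ae ?_
      filter_upwards [fn_smul_ae ‖u‖⁻¹ u] with x hx
      rw [hx, abs_mul, Real.mul_rpow (abs_nonneg _) (abs_nonneg _), abs_inv, abs_norm,
        Real.inv_rpow hu'.le]
    rw [h3, inv_mul_le_iff₀ (by positivity)] at h2
    linarith

/-- Hölder with exponents N/2 and N/(N − 2). The exponent 2 + 4/N is the one for which Sobolev turns
the last factor into ‖∇w‖² exactly, a quantity that adds up over translates. -/
theorem lintegral_interpolation (hN : 3 ≤ N) {w : Space N → ℝ≥0∞} (hw : AEMeasurable w volume) :
    ∫⁻ x, w x ^ (2 + 4 / (N : ℝ)) ≤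
      (∫⁻ x, w x ^ (2 : ℝ)) ^ (2 / (N : ℝ)) * (∫⁻ x, w x ^ critExp N) ^ (((N : ℝ) - 2) / N) := by
  have h3 : (3 : ℝ) ≤ N := by exact_mod_cast hN
  have hc : ((N : ℝ) / 2).HolderConjugate ((N : ℝ) / (N - 2)) := by
    rw [Real.holderConjugate_iff]
    refine ⟨by linarith, ?_⟩
    have : (N : ℝ) - 2 ≠ 0 := by linarith
    have : (N : ℝ) ≠ 0 := by linarith
    field_simp
    ring
  have h := ENNReal.lintegral_mul_le_Lp_mul_Lq (volume : Measure (Space N)) hc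
    (f := fun x => w x ^ (4 / (N : ℝ))) (g := fun x => w x ^ (2 : ℝ))
    (hw.pow_const _) (hw.pow_const _)
  have e1 : 4 / (N : ℝ) * ((N : ℝ) / 2) = 2 := by
    have : (N : ℝ) ≠ 0 := by linarith
    field_simp
    norm_num
  have e2 : 2 * ((N : ℝ) / (N - 2)) = critExp N := by
    rw [critExp]
    ring
  simp only [Pi.mul_apply, ← ENNReal.rpow_mul, e1, e2, one_div_div] at h
  refine le_trans (le_of_eq (lintegral_congr fun x => ?_)) h
  rw [add_comm, ENNReal.rpow_add_of_nonneg _ _ (by positivity) (by norm_num)]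

end LpBounds

/-! ### Lions' inequality, averaged over all translates. -/

section Lions

variable {N : ℕ}

/-- The energy density of an `H¹` function. -/
def density (u : H1 N) (x : Space N) : ℝ≥0∞ := ENNReal.ofReal (fn u x ^ 2 + ‖grad u x‖ ^ 2)

theorem measurable_fn (u : H1 N) : Measurable (fn u) := (Lp.stronglyMeasurable (fn u)).measurable

theorem measurable_density (u : H1 N) : Measurable (density u) :=
  ENNReal.measurable_ofReal.comp (((measurable_fn u).pow_const 2).add
    ((Lp.stronglyMeasurable (grad u)).measurable.norm.pow_const 2))

theorem lintegral_density (u : H1 N) : ∫⁻ x, density u x = ENNReal.ofReal (‖u‖ ^ 2) := by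
  have h1 : Integrable (fun x => fn u x ^ 2) volume := by
    simpa only [sq_abs] using integrable_sq (fn u)
  have h2 : Integrable (fun x => ‖grad u x‖ ^ 2) volume :=
    (Lp.memLp (grad u)).integrable_norm_pow two_ne_zero
  have h3 := ofReal_integral_eq_lintegral_ofReal (h1.add h2)
    (Eventually.of_forall fun x => by simp only [Pi.zero_apply, Pi.add_apply]; positivity)
  simp only [Pi.add_apply] at h3
  rw [integral_add h1 h2, ← L2.norm_sq_eq, ← L2Field.norm_sq_eq, ← H1.norm_sq_eq] at h3
  exact h3.symm

/-- Averaging over all translations replaces the usual covering by cubes and the counting of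
overlaps. -/
theorem lintegral_lintegral_shift {g h : Space N → ℝ≥0∞} (hg : Measurable g) (hh : Measurable h) :
    ∫⁻ y, ∫⁻ x, g x * h (x + y) = (∫⁻ x, g x) * ∫⁻ x, h x := by
  rw [lintegral_lintegral_swap]
  · have h1 : ∀ x, ∫⁻ y, g x * h (x + y) = g x * ∫⁻ y, h y := fun x => by
      rw [lintegral_const_mul _ (show Measurable fun y => h (x + y) from
        hh.comp (measurable_const_add x)),
        lintegral_add_left_eq_self]
    simp only [h1]
    exact lintegral_mul_const _ hg
  · exact ((hg.comp measurable_snd).mul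
      (hh.comp (measurable_snd.add measurable_fst))).aemeasurable

/-- Interpolate the localised function η u(· + y): the L² factor is bounded by a power of σ
uniformly in y, and the gradient factor by the energy density near y. Integration over y factors the
left side by Tonelli and turns the right side into a multiple of ‖u‖². -/
theorem lions_inequality (hN : 3 ≤ N) {η : Space N → ℝ} (hη : IsTestFunction η) :
    ∃ C : ℝ, 0 ≤ C ∧ ∀ (u : H1 N) (σ : ℝ), 0 ≤ σ →
      (∀ y, ∫⁻ x, ENNReal.ofReal ((η x * fn u (x + y)) ^ 2) ≤ ENNReal.ofReal σ) →
      (∫⁻ x, ‖η x‖ₑ ^ (2 + 4 / (N : ℝ))) * ∫⁻ x, ‖fn u x‖ₑ ^ (2 + 4 / (N : ℝ)) ≤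
        ENNReal.ofReal (C * σ ^ (2 / (N : ℝ)) * ‖u‖ ^ 2) := by
  have h3 : (3 : ℝ) ≤ N := by exact_mod_cast hN
  obtain ⟨S, hS0, hS⟩ := exists_sobolev hN
  obtain ⟨D, hD0, hD1, hD2⟩ := hη.exists_bound
  have hq0 : 0 ≤ critExp N := by linarith [two_lt_critExp hN]
  have hK : volume (tsupport η) < ⊤ := hη.2.isCompact.measure_lt_top
  obtain ⟨K, hKe⟩ : ∃ K, K = tsupport η := ⟨_, rfl⟩
  have hKm : MeasurableSet K := hKe ▸ (isClosed_tsupport η).measurableSet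
  obtain ⟨k, hk0, hKv⟩ : ∃ k : ℝ, 0 ≤ k ∧ volume K = ENNReal.ofReal k :=
    ⟨(volume K).toReal, ENNReal.toReal_nonneg, by
      rw [ENNReal.ofReal_toReal]
      exact hKe ▸ hK.ne⟩
  have hout : ∀ x, x ∉ K → η x = 0 ∧ fderiv ℝ η x = 0 := fun x hx => by
    rw [hKe] at hx
    exact ⟨image_eq_zero_of_notMem_tsupport hx, image_eq_zero_of_notMem_tsupport
      fun h => hx (tsupport_fderiv_subset ℝ h)⟩
  -- The factors come from Sobolev, from the gradient of the product η u (any constant from 2 on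
  -- would do for the 3), and from the volume k of the support of η.
  refine ⟨S ^ (((N : ℝ) - 2) / N) * (3 * D ^ 2) * k, by positivity,
    fun u σ hσ0 hσ => ?_⟩
  have hy : ∀ y, ∫⁻ x, ‖η x‖ₑ ^ (2 + 4 / (N : ℝ)) * ‖fn u (x + y)‖ₑ ^ (2 + 4 / (N : ℝ)) ≤
      ENNReal.ofReal (σ ^ (2 / (N : ℝ)) * (S ^ (((N : ℝ) - 2) / N) * (3 * D ^ 2))) *
        ∫⁻ x, K.indicator 1 x * density u (x + y) := by
    intro y
    obtain ⟨w, hw1, hw2⟩ := exists_mul hη.1 hD1 hD2 (translate y u)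
    have hw1' : fn w =ᵐ[volume] fun x => η x * fn u (x + y) := by
      filter_upwards [hw1, fn_translate y u] with x h1 h2
      rw [h1, h2]
    have h4 := lintegral_interpolation hN (w := fun x => ‖fn w x‖ₑ)
      (fn_aesm w).enorm
    have h5 : ∫⁻ x, ‖η x‖ₑ ^ (2 + 4 / (N : ℝ)) * ‖fn u (x + y)‖ₑ ^ (2 + 4 / (N : ℝ)) =
        ∫⁻ x, ‖fn w x‖ₑ ^ (2 + 4 / (N : ℝ)) := by
      refine lintegral_congr_ae ?_
      filter_upwards [hw1'] with x hx
      rw [hx, enorm_mul, ENNReal.mul_rpow_of_nonneg _ _ (by positivity)]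
    have h6 : ∫⁻ x, ‖fn w x‖ₑ ^ (2 : ℝ) ≤ ENNReal.ofReal σ := by
      refine le_trans (le_of_eq ?_) (hσ y)
      refine lintegral_congr_ae ?_
      filter_upwards [hw1'] with x hx
      rw [hx, ← ofReal_norm, ENNReal.ofReal_rpow_of_nonneg (norm_nonneg _) (by norm_num),
        Real.rpow_two, Real.norm_eq_abs, sq_abs]
    have h7 : ∫⁻ x, ‖fn w x‖ₑ ^ critExp N ≤ ENNReal.ofReal (S * ‖grad w‖ ^ critExp N) := by
      refine le_trans (le_of_eq ?_) (ENNReal.ofReal_le_ofReal (hS w).2)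
      rw [ofReal_integral_eq_lintegral_ofReal (hS w).1 (Eventually.of_forall fun x => by positivity)]
      refine lintegral_congr fun x => ?_
      rw [← ofReal_norm, ENNReal.ofReal_rpow_of_nonneg (norm_nonneg _) hq0, Real.norm_eq_abs]
    have h8 : ENNReal.ofReal (‖grad w‖ ^ 2) ≤ ENNReal.ofReal (3 * D ^ 2) *
        ∫⁻ x, K.indicator 1 x * density u (x + y) := by
      have h9 : ENNReal.ofReal (‖grad w‖ ^ 2) = ∫⁻ x, ENNReal.ofReal (‖grad w x‖ ^ 2) := by
        rw [L2Field.norm_sq_eq, ofReal_integral_eq_lintegral_ofReal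
          ((Lp.memLp (grad w)).integrable_norm_pow two_ne_zero)
          (Eventually.of_forall fun x => by positivity)]
      rw [h9, ← lintegral_const_mul' _ _ ENNReal.ofReal_ne_top]
      refine lintegral_mono_ae ?_
      filter_upwards [hw2, fn_translate y u, grad_translate y u] with x e1 e2 e3
      rw [e1, e2, e3]
      by_cases hx : x ∈ K
      · rw [indicator_of_mem hx, Pi.one_apply, one_mul, density, ← ENNReal.ofReal_mul (by positivity)]
        refine ENNReal.ofReal_le_ofReal ?_
        have e4 : ‖η x • grad u (x + y) + fn u (x + y) • gradient η x‖ ≤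
            D * ‖grad u (x + y)‖ + D * |fn u (x + y)| := by
          refine (norm_add_le _ _).trans (add_le_add ?_ ?_)
          · rw [norm_smul]
            exact mul_le_mul_of_nonneg_right (hD1 x) (norm_nonneg _)
          · rw [norm_smul, norm_gradient, mul_comm]
            exact mul_le_mul_of_nonneg_right (hD2 x) (norm_nonneg _)
        refine (pow_le_pow_left₀ (norm_nonneg _) e4 2).trans ?_
        rw [← sq_abs (fn u (x + y))]
        nlinarith [sq_nonneg (D * ‖grad u (x + y)‖ - D * |fn u (x + y)|),
          sq_nonneg (D * ‖grad u (x + y)‖), sq_nonneg (D * |fn u (x + y)|)]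
      · have e4 : gradient η x = 0 := by
          rw [← norm_eq_zero, norm_gradient, (hout x hx).2, norm_zero]
        rw [(hout x hx).1, e4]
        simp
    rw [h5]
    have h10 : (S * ‖grad w‖ ^ critExp N) ^ (((N : ℝ) - 2) / N) =
        S ^ (((N : ℝ) - 2) / N) * ‖grad w‖ ^ 2 := by
      rw [Real.mul_rpow hS0 (by positivity), ← Real.rpow_mul (norm_nonneg _)]
      congr 1
      have : critExp N * (((N : ℝ) - 2) / N) = 2 := by
        rw [critExp]
        have : (N : ℝ) - 2 ≠ 0 := by linarith
        have : (N : ℝ) ≠ 0 := by linarith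
        field_simp
      rw [this, Real.rpow_two]
    calc ∫⁻ x, ‖fn w x‖ₑ ^ (2 + 4 / (N : ℝ))
        ≤ (ENNReal.ofReal σ) ^ (2 / (N : ℝ)) *
          (ENNReal.ofReal (S * ‖grad w‖ ^ critExp N)) ^ (((N : ℝ) - 2) / N) := by
          refine h4.trans ?_
          gcongr
          exact div_nonneg (by linarith) (by linarith)
      _ = ENNReal.ofReal (σ ^ (2 / (N : ℝ)) * S ^ (((N : ℝ) - 2) / N)) *
          ENNReal.ofReal (‖grad w‖ ^ 2) := by
          rw [ENNReal.ofReal_rpow_of_nonneg hσ0 (by positivity),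
            ENNReal.ofReal_rpow_of_nonneg (by positivity) (div_nonneg (by linarith) (by linarith)),
            h10, ← ENNReal.ofReal_mul (by positivity), ← ENNReal.ofReal_mul (by positivity)]
          congr 1
          ring
      _ ≤ ENNReal.ofReal (σ ^ (2 / (N : ℝ)) * S ^ (((N : ℝ) - 2) / N)) *
          (ENNReal.ofReal (3 * D ^ 2) * ∫⁻ x, K.indicator 1 x * density u (x + y)) := by gcongr
      _ = _ := by
          rw [← mul_assoc, ← ENNReal.ofReal_mul (by positivity)]
          congr 2
          ring
  have hmη : Measurable fun x => ‖η x‖ₑ ^ (2 + 4 / (N : ℝ)) :=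
    (hη.1.continuous.measurable.enorm).pow_const _
  have hmu : Measurable fun x => ‖fn u x‖ₑ ^ (2 + 4 / (N : ℝ)) := (measurable_fn u).enorm.pow_const _
  rw [← lintegral_lintegral_shift hmη hmu]
  refine (lintegral_mono hy).trans ?_
  rw [lintegral_const_mul' _ _ ENNReal.ofReal_ne_top,
    lintegral_lintegral_shift (measurable_one.indicator hKm) (measurable_density u),
    lintegral_indicator_one hKm, lintegral_density, hKv, ← ENNReal.ofReal_mul (by positivity),
    ← ENNReal.ofReal_mul (by positivity)]
  refine ENNReal.ofReal_le_ofReal (le_of_eq ?_)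
  ring

end Lions

/-! ### Lions' alternative along lattice translates. -/

section Lions

variable {N : ℕ}

theorem exists_lattice_near (y : Space N) :
    ∃ z : Fin N → ℤ, ‖y - latticePoint z‖ ≤ Real.sqrt N := by
  refine ⟨fun i => ⌊y i⌋, ?_⟩
  rw [EuclideanSpace.norm_eq]
  refine Real.sqrt_le_sqrt ?_
  calc ∑ i, ‖(y - latticePoint fun i => ⌊y i⌋) i‖ ^ 2 ≤ ∑ _i : Fin N, (1 : ℝ) := by
        refine Finset.sum_le_sum fun i _ => ?_
        have h1 : (y - latticePoint fun i => ⌊y i⌋) i = Int.fract (y i) := by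
          simp [latticePoint]
        rw [h1, Real.norm_of_nonneg (Int.fract_nonneg _)]
        exact pow_le_one₀ (Int.fract_nonneg _) (Int.fract_lt_one _).le
    _ = N := by simp

theorem enorm_rpow_eq (u : Space N → ℝ) (x : Space N) {p : ℝ} (hp : 0 ≤ p) :
    ‖u x‖ₑ ^ p = ENNReal.ofReal (|u x| ^ p) := by
  rw [← ofReal_norm, ENNReal.ofReal_rpow_of_nonneg (norm_nonneg _) hp, Real.norm_eq_abs]

theorem two_le_lionsExp (N : ℕ) : 2 ≤ 2 + 4 / (N : ℝ) := by
  have : 0 ≤ 4 / (N : ℝ) := by positivity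
  linarith

theorem lionsExp_le (hN : 3 ≤ N) : 2 + 4 / (N : ℝ) ≤ critExp N := by
  have h3 : (3 : ℝ) ≤ N := by exact_mod_cast hN
  have h4 : critExp N = 2 + 4 / ((N : ℝ) - 2) := by
    have : (N : ℝ) - 2 ≠ 0 := by linarith
    rw [critExp]
    field_simp
    ring
  rw [h4]
  gcongr
  · linarith
  · linarith

/-- Lattice translates suffice because every point is within √N of the lattice: a bump of radius 2
at an arbitrary centre is dominated by the indicator of the ball of radius 2 + √N at a lattice
point. The weight w is that indicator. -/
theorem lions_lattice (hN : 3 ≤ N) : ∃ w : Space N → ℝ, Integrable w volume ∧ (∀ x, 0 ≤ w x) ∧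
    (∀ x, w x ≤ 1) ∧ ∃ C : ℝ, 0 ≤ C ∧ ∀ (u : H1 N) (σ : ℝ), 0 ≤ σ →
      (∀ z, ∫ x, w x * fn (translate (latticePoint z) u) x ^ 2 ≤ σ) →
      ∫ x, |fn u x| ^ (2 + 4 / (N : ℝ)) ≤ C * σ ^ (2 / (N : ℝ)) * ‖u‖ ^ 2 := by
  have h3 : (3 : ℝ) ≤ N := by exact_mod_cast hN
  let b : ContDiffBump (0 : Space N) := ⟨1, 2, by norm_num, by norm_num⟩
  have hb : IsTestFunction b := ⟨b.contDiff, b.hasCompactSupport⟩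
  obtain ⟨C, hC0, hC⟩ := lions_inequality hN hb
  set K : Set (Space N) := Metric.closedBall 0 (2 + Real.sqrt N) with hK
  have hKm : MeasurableSet K := Metric.isClosed_closedBall.measurableSet
  have hKv : volume K < ⊤ := measure_closedBall_lt_top
  have hwi : Integrable (K.indicator (1 : Space N → ℝ)) volume :=
    (integrable_indicator_iff hKm).2 (integrableOn_const hKv.ne)
  have hw0 : ∀ x, 0 ≤ K.indicator (1 : Space N → ℝ) x := fun x =>
    indicator_nonneg (fun _ _ => zero_le_one) x
  have hw1 : ∀ x, K.indicator (1 : Space N → ℝ) x ≤ 1 := fun x =>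
    indicator_le_self' (fun _ _ => zero_le_one) x
  have hk : 0 < (volume (Metric.ball (0 : Space N) 1)).toReal :=
    ENNReal.toReal_pos (Metric.measure_ball_pos volume _ one_pos).ne' measure_ball_lt_top.ne
  obtain ⟨k, hke⟩ : ∃ k, k = (volume (Metric.ball (0 : Space N) 1)).toReal := ⟨_, rfl⟩
  rw [← hke] at hk
  have hkv : ENNReal.ofReal k ≤ ∫⁻ x, ‖b x‖ₑ ^ (2 + 4 / (N : ℝ)) := by
    rw [hke, ENNReal.ofReal_toReal measure_ball_lt_top.ne, ← lintegral_indicator_one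
      Metric.isOpen_ball.measurableSet]
    refine lintegral_mono fun x => ?_
    by_cases hx : x ∈ Metric.ball (0 : Space N) 1
    · rw [indicator_of_mem hx, b.one_of_mem_closedBall (Metric.ball_subset_closedBall hx)]
      simp
    · simp [indicator_of_notMem hx]
  refine ⟨_, hwi, hw0, hw1, C / k, by positivity, fun u σ hσ0 hσ => ?_⟩
  have hp0 := two_le_lionsExp N
  have hp1 := lionsExp_le hN
  have hi := (exists_Lp_bound hN hp0 hp1).choose_spec.2 u
  have h4 := hC u σ hσ0 (fun y => by
    obtain ⟨z, hz⟩ := exists_lattice_near y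
    refine le_trans ?_ (ENNReal.ofReal_le_ofReal (hσ z))
    rw [ofReal_integral_eq_lintegral_ofReal (integrable_weight_mul_sq hwi hw0 hw1 _)
      (Eventually.of_forall fun x => mul_nonneg (hw0 x) (sq_nonneg _)),
      ← lintegral_sub_right_eq_self _ (y - latticePoint z)]
    refine lintegral_mono_ae ?_
    filter_upwards [fn_translate (latticePoint z) u] with x hx
    refine ENNReal.ofReal_le_ofReal ?_
    rw [hx, show x - (y - latticePoint z) + y = x + latticePoint z by abel, mul_pow]
    refine mul_le_mul_of_nonneg_right ?_ (sq_nonneg _)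
    by_cases hxK : x ∈ K
    · rw [indicator_of_mem hxK]
      exact pow_le_one₀ b.nonneg b.le_one
    · have h5 : b (x - (y - latticePoint z)) = 0 := by
        refine b.zero_of_le_dist ?_
        rw [hK, Metric.mem_closedBall, dist_zero_right, not_le] at hxK
        rw [dist_zero_right]
        have := norm_sub_norm_le x (y - latticePoint z)
        show (2 : ℝ) ≤ _
        linarith
      rw [h5, indicator_of_notMem hxK]
      simp)
  have h5 : ∫⁻ x, ‖fn u x‖ₑ ^ (2 + 4 / (N : ℝ)) =
      ENNReal.ofReal (∫ x, |fn u x| ^ (2 + 4 / (N : ℝ))) := by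
    rw [ofReal_integral_eq_lintegral_ofReal hi.1 (Eventually.of_forall fun x => by positivity)]
    exact lintegral_congr fun x => enorm_rpow_eq _ x (by linarith)
  have h6 : ENNReal.ofReal (k * ∫ x, |fn u x| ^ (2 + 4 / (N : ℝ))) ≤
      ENNReal.ofReal (C * σ ^ (2 / (N : ℝ)) * ‖u‖ ^ 2) := by
    rw [ENNReal.ofReal_mul hk.le, ← h5]
    exact (mul_le_mul_left hkv _).trans h4
  rw [ENNReal.ofReal_le_ofReal_iff (by positivity)] at h6
  rw [div_mul_eq_mul_div, div_mul_eq_mul_div, le_div_iff₀ hk]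
  linarith

/-- Lions' alternative: a bounded sequence in `H¹` vanishes in `L^p`, or it has a subsequence with
lattice translates that converge weakly to a nonzero limit. -/
theorem lions_alternative (hN : 3 ≤ N) {u : ℕ → H1 N} {M : ℝ} (hM : ∀ n, ‖u n‖ ≤ M) :
    (∀ p, 2 < p → p < critExp N → Tendsto (fun n => ∫ x, |fn (u n) x| ^ p) atTop (𝓝 0)) ∨
    ∃ (φ : ℕ → ℕ) (z : ℕ → Fin N → ℤ) (a : H1 N), StrictMono φ ∧ a ≠ 0 ∧
      WeakTendsto (fun k => translate (latticePoint (z k)) (u (φ k))) a := by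
  have h3 : (3 : ℝ) ≤ N := by exact_mod_cast hN
  have hM0 : 0 ≤ M := (norm_nonneg _).trans (hM 0)
  obtain ⟨w, hwi, hw0, hw1, C, hC0, hC⟩ := lions_lattice hN
  by_cases hσ : ∀ σ > 0, ∀ᶠ n in atTop, ∀ z,
      ∫ x, w x * fn (translate (latticePoint z) (u n)) x ^ 2 ≤ σ
  · left
    -- Vanishing is first obtained for the exponent 2 + 4/N; interpolation against the bounded L²
    -- and critical norms carries it to all p in between.
    have hp₀ : Tendsto (fun n => ∫ x, |fn (u n) x| ^ (2 + 4 / (N : ℝ))) atTop (𝓝 0) := by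
      rw [tendsto_order]
      refine ⟨fun a ha => Eventually.of_forall fun n => ha.trans_le
        (integral_nonneg fun x => by positivity), fun a ha => ?_⟩
      obtain ⟨σ, hσ0, hσa⟩ : ∃ σ > 0, C * σ ^ (2 / (N : ℝ)) * M ^ 2 < a := by
        have hc : Tendsto (fun σ : ℝ => C * σ ^ (2 / (N : ℝ)) * M ^ 2) (𝓝[>] 0)
            (𝓝 (C * 0 ^ (2 / (N : ℝ)) * M ^ 2)) := by
          have : Continuous fun σ : ℝ => C * σ ^ (2 / (N : ℝ)) * M ^ 2 :=
            (continuous_const.mul (Real.continuous_rpow_const (by positivity))).mul continuous_const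
          exact (this.tendsto _).mono_left nhdsWithin_le_nhds
        rw [Real.zero_rpow (by positivity), mul_zero, zero_mul] at hc
        obtain ⟨r, hr1, hr2⟩ := ((hc.eventually_lt_const ha).and self_mem_nhdsWithin).exists
        exact ⟨r, hr2, hr1⟩
      filter_upwards [hσ σ hσ0] with n hn
      refine (hC (u n) σ hσ0.le hn).trans_lt (lt_of_le_of_lt ?_ hσa)
      gcongr
      exact hM n
    intro p hp hp'
    obtain ⟨A, hA0, hA⟩ := exists_Lp_bound hN hp.le hp'.le
    obtain ⟨S, hS0, hS⟩ := exists_Lp_bound hN (two_lt_critExp hN).le le_rfl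
    have hq0 : (0 : ℝ) ≤ critExp N := by linarith
    obtain ⟨T, hTe⟩ : ∃ T, T = M ^ 2 + S * M ^ critExp N := ⟨_, rfl⟩
    have hT0 : 0 ≤ T := by rw [hTe]; positivity
    rw [tendsto_order]
    refine ⟨fun a ha => Eventually.of_forall fun n => ha.trans_le
      (integral_nonneg fun x => by positivity), fun a ha => ?_⟩
    have hε : 0 < a / (2 * (T + 1)) := by positivity
    obtain ⟨D, hD0, hD⟩ := exists_rpow_le hp hp' (p₀ := 2 + 4 / (N : ℝ)) (by positivity) hε
    have h4 : ∀ᶠ n in atTop, D * ∫ x, |fn (u n) x| ^ (2 + 4 / (N : ℝ)) < a / 2 := by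
      have := hp₀.const_mul D
      rw [mul_zero] at this
      exact this.eventually_lt_const (by positivity)
    obtain ⟨A', -, hA'⟩ := exists_Lp_bound hN (two_le_lionsExp N) (lionsExp_le hN)
    filter_upwards [h4] with n hn
    have hi : Integrable (fun x => |fn (u n) x| ^ 2 + |fn (u n) x| ^ critExp N) volume :=
      (integrable_sq _).add (hS _).1
    have h5 : ∫ x, |fn (u n) x| ^ p ≤ ∫ x, (a / (2 * (T + 1)) * (|fn (u n) x| ^ 2 +
        |fn (u n) x| ^ critExp N) + D * |fn (u n) x| ^ (2 + 4 / (N : ℝ))) :=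
      integral_mono (hA _).1 ((hi.const_mul _).add
        ((hA' _).1.const_mul D)) fun x => hD _ (abs_nonneg _)
    rw [integral_add (hi.const_mul _) ((hA' _).1.const_mul D),
      integral_const_mul, integral_const_mul, integral_add (integrable_sq _) (hS _).1] at h5
    simp only [sq_abs] at h5
    rw [← L2.norm_sq_eq] at h5
    have h6 : ‖fn (u n)‖ ^ 2 + ∫ x, |fn (u n) x| ^ critExp N ≤ T := by
      rw [hTe]
      refine add_le_add (pow_le_pow_left₀ (norm_nonneg _) ((norm_fn_le _).trans (hM n)) 2)
        ((hS _).2.trans ?_)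
      gcongr
      exact hM n
    have h7 : a / (2 * (T + 1)) * (‖fn (u n)‖ ^ 2 + ∫ x, |fn (u n) x| ^ critExp N) ≤ a / 2 := by
      calc _ ≤ a / (2 * (T + 1)) * (T + 1) :=
            mul_le_mul_of_nonneg_left (by linarith) hε.le
        _ = a / 2 := by field_simp
    linarith
  -- Local mass at least σ persists along a subsequence after translation, and Rellich forbids a
  -- zero weak limit.
  · right
    push Not at hσ
    obtain ⟨σ, hσ0, hfr⟩ := hσ
    obtain ⟨φ, hφ, hz⟩ := extraction_of_frequently_atTop hfr
    choose z hz using hz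
    obtain ⟨a, ψ, hψ, hlim⟩ := exists_weak_subseq
      (u := fun k => translate (latticePoint (z k)) (u (φ k))) (M := M)
      (fun k => by rw [LinearIsometry.norm_map]; exact hM _)
    refine ⟨φ ∘ ψ, z ∘ ψ, a, hφ.comp hψ, ?_, hlim⟩
    rintro rfl
    have h4 := rellich hlim (M := M)
      (fun k => by simp only [Function.comp_apply]; rw [LinearIsometry.norm_map]; exact hM _)
      hwi hw0 hw1
    exact not_le_of_gt hσ0 (ge_of_tendsto' h4 fun k => (hz (ψ k)).le)

end Lions

/-! ### The pointwise form of the Nehari–Pankov inequality. -/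

section Pointwise

theorem hasDerivAt_primitive {g : ℝ → ℝ} (hg : Continuous g) (s : ℝ) :
    HasDerivAt (fun s => ∫ t in (0 : ℝ)..s, g t) (g s) s :=
  intervalIntegral.integral_hasDerivAt_right (hg.intervalIntegrable _ _)
    hg.stronglyMeasurable.stronglyMeasurableAtFilter hg.continuousAt

/-- Monotonicity of `g(s)/s` on `(0, ∞)` puts the primitive above its quadratic contact function. -/
theorem contact_le_primitive {g : ℝ → ℝ} (hg : Continuous g)
    (hm : MonotoneOn (fun s => g s / |s|) (Ioi 0)) {u s : ℝ} (hu : 0 < u) (hs : 0 ≤ s) :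
    (∫ t in (0 : ℝ)..u, g t) + g u / u * (s ^ 2 - u ^ 2) / 2 ≤ ∫ t in (0 : ℝ)..s, g t := by
  obtain ⟨c, hc⟩ : ∃ c, c = g u / u := ⟨_, rfl⟩
  set D : ℝ → ℝ := fun s => (∫ t in (0 : ℝ)..s, g t) - c * s ^ 2 / 2 with hD
  have hd : ∀ s, HasDerivAt D (g s - c * s) s := fun s => by
    have h := (hasDerivAt_primitive hg s).sub (((hasDerivAt_pow 2 s).const_mul c).div_const 2)
    refine h.congr_deriv ?_
    norm_num
    ring
  have hDc : Continuous D := continuous_iff_continuousAt.2 fun s => (hd s).continuousAt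
  have hsign : ∀ t, 0 < t → (t ≤ u → g t - c * t ≤ 0) ∧ (u ≤ t → 0 ≤ g t - c * t) := fun t ht => by
    refine ⟨fun h => ?_, fun h => ?_⟩
    · have h1 := hm (mem_Ioi.2 ht) (mem_Ioi.2 hu) h
      simp only [abs_of_pos ht, abs_of_pos hu] at h1
      rw [← hc, div_le_iff₀ ht] at h1
      linarith
    · have h1 := hm (mem_Ioi.2 hu) (mem_Ioi.2 ht) h
      simp only [abs_of_pos ht, abs_of_pos hu] at h1
      rw [← hc, le_div_iff₀ ht] at h1
      linarith
  have h1 : AntitoneOn D (Icc 0 u) := by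
    refine antitoneOn_of_deriv_nonpos (convex_Icc 0 u) hDc.continuousOn
      (fun t _ => (hd t).differentiableAt.differentiableWithinAt) fun t ht => ?_
    rw [interior_Icc] at ht
    rw [(hd t).deriv]
    exact (hsign t ht.1).1 ht.2.le
  have h2 : MonotoneOn D (Ici u) := by
    refine monotoneOn_of_deriv_nonneg (convex_Ici u) hDc.continuousOn
      (fun t _ => (hd t).differentiableAt.differentiableWithinAt) fun t ht => ?_
    rw [interior_Ici] at ht
    rw [(hd t).deriv]
    exact (hsign t (hu.trans ht)).2 (le_of_lt ht)
  have h3 : D u ≤ D s := by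
    rcases le_total s u with h | h
    · exact h1 ⟨hs, h⟩ ⟨hu.le, le_rfl⟩ h
    · exact h2 (mem_Ici.2 le_rfl) h h
  simp only [hD] at h3
  rw [← hc]
  nlinarith

/-- A continuous function with `g(u) = o(u)` at `0` and `g(u)/|u|` non-decreasing on both half
lines. -/
structure IsPseudoMonotone (g : ℝ → ℝ) : Prop where
  continuous : Continuous g
  small : ∀ ε : ℝ, 0 < ε → ∃ δ : ℝ, 0 < δ ∧ ∀ u : ℝ, 0 < |u| → |u| < δ → |g u| ≤ ε * |u|
  monotone : MonotoneOn (fun u => g u / |u|) (Iio 0) ∧ MonotoneOn (fun u => g u / |u|) (Ioi 0)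

namespace IsPseudoMonotone

variable {g : ℝ → ℝ}

theorem reflect (h : IsPseudoMonotone g) : IsPseudoMonotone fun u => -g (-u) where
  continuous := (h.continuous.comp continuous_neg).neg
  small ε hε := by
    obtain ⟨δ, hδ, hh⟩ := h.small ε hε
    refine ⟨δ, hδ, fun u h0 h1 => ?_⟩
    rw [abs_neg]
    simpa using hh (-u) (by simpa using h0) (by simpa using h1)
  monotone := by
    refine ⟨fun a ha b hb hab => ?_, fun a ha b hb hab => ?_⟩
    · have := h.monotone.2 (mem_Ioi.2 (neg_pos.2 hb)) (mem_Ioi.2 (neg_pos.2 ha)) (neg_le_neg hab)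
      simp only [abs_neg, neg_div] at this ⊢
      linarith
    · have := h.monotone.1 (mem_Iio.2 (neg_lt_zero.2 hb)) (mem_Iio.2 (neg_lt_zero.2 ha))
        (neg_le_neg hab)
      simp only [abs_neg, neg_div] at this ⊢
      linarith

theorem nonneg_of_pos (h : IsPseudoMonotone g) {u : ℝ} (hu : 0 < u) : 0 ≤ g u := by
  refine le_of_forall_pos_le_add fun ε hε => ?_
  obtain ⟨δ, hδ, hh⟩ := h.small (ε / u) (by positivity)
  obtain ⟨s, hs0, hs1, hs2⟩ : ∃ s : ℝ, 0 < s ∧ s < δ ∧ s ≤ u :=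
    ⟨min (δ / 2) u, by positivity, (min_le_left _ _).trans_lt (by linarith), min_le_right _ _⟩
  have h1 := hh s (by rwa [abs_of_pos hs0]) (by rwa [abs_of_pos hs0])
  have h2 := h.monotone.2 (mem_Ioi.2 hs0) (mem_Ioi.2 hu) hs2
  simp only [abs_of_pos hs0, abs_of_pos hu] at h1 h2
  have h3 : -(ε / u) ≤ g s / s := by
    rw [le_div_iff₀ hs0]
    linarith [neg_abs_le (g s)]
  have h4 := h3.trans h2
  rw [le_div_iff₀ hu, neg_mul, div_mul_cancel₀ _ hu.ne'] at h4
  linarith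

theorem apply_zero (h : IsPseudoMonotone g) : g 0 = 0 := by
  have h1 : 0 ≤ g 0 := by
    refine ge_of_tendsto ((h.continuous.tendsto 0).mono_left (nhdsWithin_le_nhds (s := Ioi 0))) ?_
    filter_upwards [self_mem_nhdsWithin] with u hu using h.nonneg_of_pos hu
  have h2 : 0 ≤ -g (-0) := by
    refine ge_of_tendsto ((h.reflect.continuous.tendsto 0).mono_left
      (nhdsWithin_le_nhds (s := Ioi 0))) ?_
    filter_upwards [self_mem_nhdsWithin] with u hu using h.reflect.nonneg_of_pos hu
  rw [neg_zero] at h2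
  linarith

theorem primitive_reflect (g : ℝ → ℝ) (u : ℝ) :
    ∫ t in (0 : ℝ)..u, -g (-t) = ∫ t in (0 : ℝ)..(-u), g t := by
  rw [intervalIntegral.integral_neg, intervalIntegral.integral_comp_neg, neg_zero,
    ← intervalIntegral.integral_symm]

theorem primitive_nonneg (h : IsPseudoMonotone g) (u : ℝ) : 0 ≤ ∫ t in (0 : ℝ)..u, g t := by
  rcases le_total 0 u with hu | hu
  · refine intervalIntegral.integral_nonneg hu fun t ht => ?_
    rcases ht.1.eq_or_lt with h0 | h0
    · rw [← h0, h.apply_zero]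
    · exact h.nonneg_of_pos h0
  · rw [← neg_neg u, ← primitive_reflect]
    refine intervalIntegral.integral_nonneg (by linarith) fun t ht => ?_
    rcases ht.1.eq_or_lt with h0 | h0
    · rw [← h0, h.reflect.apply_zero]
    · exact h.reflect.nonneg_of_pos h0

/-- Put c = g(u)/u ≥ 0. For s ≥ 0 the contact inequality reduces the claim to c(t u − s)² ≥ 0. For s
≤ 0 the contact inequality at 0 gives ∫₀ᵘ g ≤ c u²/2, after which the left side is nonpositive and
the right side nonnegative. -/
theorem key_of_pos (h : IsPseudoMonotone g) {t s u : ℝ} (ht : 0 ≤ t) (hu : 0 < u) :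
    (∫ r in (0 : ℝ)..u, g r) + g u * (t * s - (t ^ 2 + 1) / 2 * u) ≤ ∫ r in (0 : ℝ)..s, g r := by
  obtain ⟨c, hc⟩ : ∃ c, c = g u / u := ⟨_, rfl⟩
  have hc0 : 0 ≤ c := hc ▸ div_nonneg (h.nonneg_of_pos hu) hu.le
  have hgu : g u = c * u := by rw [hc, div_mul_cancel₀ _ hu.ne']
  rw [hgu]
  rcases le_total 0 s with hs | hs
  · have h1 := contact_le_primitive h.continuous h.monotone.2 hu hs
    rw [← hc] at h1
    nlinarith [mul_nonneg hc0 (sq_nonneg (t * u - s))]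
  · have h1 := contact_le_primitive h.continuous h.monotone.2 hu (le_refl (0 : ℝ))
    rw [← hc, intervalIntegral.integral_same] at h1
    have h2 := h.primitive_nonneg s
    nlinarith [mul_nonneg hc0 (sq_nonneg (t * u)),
      mul_nonneg (mul_nonneg hc0 hu.le) (mul_nonneg ht (neg_nonneg.2 hs))]

theorem key (h : IsPseudoMonotone g) {t : ℝ} (ht : 0 ≤ t) (s u : ℝ) :
    (∫ r in (0 : ℝ)..u, g r) + g u * (t * s - (t ^ 2 + 1) / 2 * u) ≤ ∫ r in (0 : ℝ)..s, g r := by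
  rcases lt_trichotomy u 0 with hu | rfl | hu
  · have h1 := h.reflect.key_of_pos ht (neg_pos.2 hu) (s := -s)
    rw [primitive_reflect, primitive_reflect, neg_neg, neg_neg] at h1
    linarith
  · rw [h.apply_zero, intervalIntegral.integral_same]
    simpa using h.primitive_nonneg s
  · exact h.key_of_pos ht hu

theorem primitive_le (h : IsPseudoMonotone g) (u : ℝ) :
    ∫ t in (0 : ℝ)..u, g t ≤ 1 / 2 * (g u * u) := by
  have h1 := h.key le_rfl 0 u
  rw [intervalIntegral.integral_same] at h1
  linarith

end IsPseudoMonotone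

end Pointwise

/-! ### A regular representative of the nonlinearity and its elementary bounds. -/

section Nonlinearity

variable {N : ℕ}

/-- A nonlinearity that is continuous in `u` for every `x` and jointly measurable. -/
structure Nonlinearity (f : Space N → ℝ → ℝ) (p : ℝ) : Prop where
  measurable : Measurable (Function.uncurry f)
  continuous : ∀ x, Continuous (f x)
  periodic : ∀ z : Fin N → ℤ, ∀ᵐ x, f (x + latticePoint z) = f x
  two_lt : 2 < p
  lt_critExp : p < critExp N
  growth : ∃ a : ℝ, 0 < a ∧ ∀ (x : Space N) (u : ℝ), |f x u| ≤ a * (1 + |u| ^ (p - 1))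
  small : ∀ ε : ℝ, 0 < ε → ∃ δ : ℝ, 0 < δ ∧
    ∀ (x : Space N) (u : ℝ), 0 < |u| → |u| < δ → |f x u| ≤ ε * |u|
  superquadratic : ∀ K : ℝ, ∃ R : ℝ, 0 < R ∧
    ∀ (x : Space N) (u : ℝ), R < |u| → K ≤ primitive f x u / u ^ 2
  monotone : ∀ x : Space N, MonotoneOn (fun u => f x u / |u|) (Iio 0) ∧
    MonotoneOn (fun u => f x u / |u|) (Ioi 0)

/-- A nonlinearity with the assumptions (F1)–(F5) agrees for almost every `x` with one that is
continuous in `u` for every `x` and jointly measurable. -/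
theorem AssumptionF.exists_nonlinearity {f : Space N → ℝ → ℝ} (hf : AssumptionF f) :
    ∃ (g : Space N → ℝ → ℝ) (p : ℝ), Nonlinearity g p ∧ ∀ᵐ x, g x = f x := by
  classical
  obtain ⟨a, p, ha, hp, hp', hgr⟩ := hf.growth
  let k : ℚ → Space N → ℝ := fun q => (hf.measurable q).mk
  have hae : ∀ᵐ x, Continuous (f x) ∧ ∀ q : ℚ, f x q = k q x :=
    hf.continuous.and (ae_all_iff.2 fun q => (hf.measurable q).ae_eq_mk)
  obtain ⟨Ω', hΩ1, hΩ2, hΩ3⟩ := exists_measurable_superset_of_null (ae_iff.1 hae)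
  obtain ⟨Ω, hΩe⟩ : ∃ Ω, Ω = Ω'ᶜ := ⟨_, rfl⟩
  have hΩm : MeasurableSet Ω := hΩe ▸ hΩ2.compl
  have hΩ : ∀ x ∈ Ω, Continuous (f x) ∧ ∀ q : ℚ, f x q = k q x := fun x hx => by
    by_contra hc
    rw [hΩe] at hx
    exact hx (hΩ1 hc)
  have hΩae : ∀ᵐ x, x ∈ Ω := by
    rw [hΩe]
    exact compl_mem_ae_iff.2 hΩ3
  obtain ⟨x₀, hx₀⟩ := hΩae.exists
  -- Exceptional points are redirected to one good point x₀ instead of setting the nonlinearity to 0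
  -- there: the assumptions that hold for every x, in particular superquadraticity, survive.
  -- Measurability is checked at rational u, extended by density, and made joint by the Carathéodory
  -- property.
  let ι : Space N → Space N := fun x => if x ∈ Ω then x else x₀
  have hι : ∀ x, ι x ∈ Ω := fun x => by
    simp only [ι]
    split_ifs with h
    · exact h
    · exact hx₀
  have hιe : ∀ x ∈ Ω, ι x = x := fun x hx => if_pos hx
  have hmq : ∀ q : ℚ, Measurable fun x => f (ι x) q := fun q => by
    have : (fun x => f (ι x) q) = fun x => if x ∈ Ω then k q x else f x₀ q := by
      funext x
      simp only [ι]
      split_ifs with h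
      · exact (hΩ x h).2 q
      · rfl
    rw [this]
    exact Measurable.ite hΩm (hf.measurable q).measurable_mk measurable_const
  have hmu : ∀ u : ℝ, Measurable fun x => f (ι x) u := fun u => by
    obtain ⟨s, hs, hlim⟩ := mem_closure_iff_seq_limit.1 (Rat.denseRange_cast (𝕜 := ℝ) u)
    choose q hq using hs
    refine measurable_of_tendsto_metrizable (fun n => hmq (q n)) (tendsto_pi_nhds.2 fun x => ?_)
    simp only [hq]
    exact ((hΩ _ (hι x)).1.tendsto u).comp hlim
  refine ⟨fun x => f (ι x), p, ⟨?_, fun x => (hΩ _ (hι x)).1, fun z => ?_, hp, hp',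
    ⟨a, ha, fun x => hgr _⟩, fun ε hε => ?_, fun K => ?_, fun x => hf.monotone _⟩, ?_⟩
  · exact (measurable_uncurry_of_continuous_of_measurable (u := fun u x => f (ι x) u)
      (fun x => (hΩ _ (hι x)).1) hmu).comp measurable_swap
  · filter_upwards [hΩae, ae_shift hΩae (latticePoint z)] with x h1 h2
    rw [hιe x h1, hιe _ h2]
    funext u
    exact hf.periodic z x u
  · obtain ⟨δ, hδ, h⟩ := hf.small ε hε
    exact ⟨δ, hδ, fun x => h _⟩
  · obtain ⟨R, hR, h⟩ := hf.superquadratic K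
    exact ⟨R, hR, fun x => h _⟩
  · filter_upwards [hΩae] with x hx
    rw [hιe x hx]

namespace Nonlinearity

variable {f : Space N → ℝ → ℝ} {p : ℝ}

theorem isPseudoMonotone (hf : Nonlinearity f p) (x : Space N) : IsPseudoMonotone (f x) where
  continuous := hf.continuous x
  small ε hε := by
    obtain ⟨δ, hδ, h⟩ := hf.small ε hε
    exact ⟨δ, hδ, h x⟩
  monotone := hf.monotone x

theorem primitive_nonneg (hf : Nonlinearity f p) (x : Space N) (u : ℝ) : 0 ≤ primitive f x u :=
  (hf.isPseudoMonotone x).primitive_nonneg u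

theorem primitive_le (hf : Nonlinearity f p) (x : Space N) (u : ℝ) :
    primitive f x u ≤ 1 / 2 * (f x u * u) := (hf.isPseudoMonotone x).primitive_le u

theorem apply_zero (hf : Nonlinearity f p) (x : Space N) : f x 0 = 0 :=
  (hf.isPseudoMonotone x).apply_zero

theorem abs_le (hf : Nonlinearity f p) {ε : ℝ} (hε : 0 < ε) : ∃ C : ℝ, 0 < C ∧
    ∀ x u, |f x u| ≤ ε * |u| + C * |u| ^ (p - 1) := by
  obtain ⟨a, ha, hg⟩ := hf.growth
  obtain ⟨δ, hδ, hs⟩ := hf.small ε hε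
  have hp := hf.two_lt
  refine ⟨a * ((δ ^ (p - 1))⁻¹ + 1), by positivity, fun x u => ?_⟩
  rcases (abs_nonneg u).eq_or_lt with h0 | h0
  · rw [abs_eq_zero.1 h0.symm, hf.apply_zero, abs_zero]
    positivity
  · rcases lt_or_ge |u| δ with h1 | h1
    · have h2 := hs x u h0 h1
      have h3 : 0 ≤ a * ((δ ^ (p - 1))⁻¹ + 1) * |u| ^ (p - 1) := by positivity
      linarith
    · have h2 : 1 ≤ (δ ^ (p - 1))⁻¹ * |u| ^ (p - 1) := by
        rw [le_inv_mul_iff₀ (by positivity), mul_one]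
        exact Real.rpow_le_rpow hδ.le h1 (by linarith)
      have h3 := hg x u
      have h4 : a * (1 + |u| ^ (p - 1)) ≤ a * ((δ ^ (p - 1))⁻¹ + 1) * |u| ^ (p - 1) := by
        nlinarith
      have h5 : 0 ≤ ε * |u| := by positivity
      linarith

theorem measurable_comp (hf : Nonlinearity f p) {u : Space N → ℝ} (hu : Measurable u) :
    Measurable fun x => f x (u x) := hf.measurable.comp (measurable_id.prodMk hu)

theorem measurable_uncurry_primitive (hf : Nonlinearity f p) :
    Measurable (Function.uncurry (primitive f)) := by
  -- Rescaling to the fixed interval [0,1] exhibits F as a parameter integral, which gives joint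
  -- measurability.
  have h1 : ∀ x u, primitive f x u = u * ∫ t in (0 : ℝ)..1, f x (t * u) := fun x u => by
    rw [primitive]
    simp
  have h2 : Function.uncurry (primitive f) =
      fun q : Space N × ℝ => q.2 * ∫ t in Ioc (0 : ℝ) 1, f q.1 (t * q.2) := by
    funext q
    rw [Function.uncurry, h1, intervalIntegral.integral_of_le zero_le_one]
  rw [h2]
  refine measurable_snd.mul (StronglyMeasurable.integral_prod_right ?_).measurable
  refine Measurable.stronglyMeasurable ?_
  exact hf.measurable.comp ((measurable_fst.comp measurable_fst).prodMk
    (measurable_snd.mul (measurable_snd.comp measurable_fst)))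

theorem measurable_primitive_comp (hf : Nonlinearity f p) {u : Space N → ℝ} (hu : Measurable u) :
    Measurable fun x => primitive f x (u x) :=
  hf.measurable_uncurry_primitive.comp (measurable_id.prodMk hu)

theorem hasDerivAt_primitive (hf : Nonlinearity f p) (x : Space N) (u : ℝ) :
    HasDerivAt (primitive f x) (f x u) u :=
  HardySchrodinger.hasDerivAt_primitive (hf.continuous x) u

theorem continuous_primitive (hf : Nonlinearity f p) (x : Space N) : Continuous (primitive f x) :=
  continuous_iff_continuousAt.2 fun u => (hf.hasDerivAt_primitive x u).continuousAt

end Nonlinearity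

end Nonlinearity

/-! ### Young-type inequalities and the gauge dual to v² + vᵖ. -/

section RealInequalities

theorem add_rpow_le {p a b : ℝ} (hp : 0 ≤ p) (ha : 0 ≤ a) (hb : 0 ≤ b) :
    (a + b) ^ p ≤ 2 ^ p * (a ^ p + b ^ p) := by
  have h1 : (a + b) ^ p ≤ (2 * max a b) ^ p :=
    Real.rpow_le_rpow (by positivity) (by linarith [le_max_left a b, le_max_right a b]) hp
  rw [Real.mul_rpow zero_le_two (le_max_of_le_left ha)] at h1
  refine h1.trans (mul_le_mul_of_nonneg_left ?_ (by positivity))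
  rcases le_total a b with h | h
  · rw [max_eq_right h]
    linarith [Real.rpow_nonneg ha p]
  · rw [max_eq_left h]
    linarith [Real.rpow_nonneg hb p]

theorem rpow_sub_one_mul_le {p a b δ : ℝ} (hp : 1 < p) (ha : 0 ≤ a) (hb : 0 ≤ b) (hδ : 0 < δ) :
    a ^ (p - 1) * b ≤ δ * a ^ p + (δ ^ (p - 1))⁻¹ * b ^ p := by
  have hs : ∀ c : ℝ, 0 ≤ c → c ^ p = c ^ (p - 1) * c := fun c hc => by
    rcases hc.eq_or_lt with h | h
    · rw [← h, Real.zero_rpow (by linarith), mul_zero]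
    · rw [← Real.rpow_add_one h.ne', sub_add_cancel]
  rcases le_total b (δ * a) with h | h
  · have h1 : a ^ (p - 1) * b ≤ δ * a ^ p := by
      rw [hs a ha]
      calc a ^ (p - 1) * b ≤ a ^ (p - 1) * (δ * a) := by gcongr
        _ = _ := by ring
    have h2 : 0 ≤ (δ ^ (p - 1))⁻¹ * b ^ p := by positivity
    linarith
  · have h1 : a ^ (p - 1) * b ≤ (δ ^ (p - 1))⁻¹ * b ^ p := by
      rw [hs b hb, ← mul_assoc]
      refine mul_le_mul_of_nonneg_right ?_ hb
      rw [le_inv_mul_iff₀ (by positivity), ← Real.mul_rpow hδ.le ha]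
      exact Real.rpow_le_rpow (by positivity) h (by linarith)
    have h2 : 0 ≤ δ * a ^ p := by positivity
    linarith

theorem exists_rpow_sub_one_mul_le {p δ : ℝ} (hp : 1 < p) (hδ : 0 < δ) :
    ∃ C : ℝ, 0 ≤ C ∧ ∀ a b : ℝ, 0 ≤ a → 0 ≤ b → a ^ (p - 1) * b ≤ δ * b ^ p + C * a ^ p := by
  refine ⟨δ⁻¹ ^ (p - 1)⁻¹, by positivity, fun a b ha hb => ?_⟩
  have h := rpow_sub_one_mul_le hp ha hb (δ := δ⁻¹ ^ (p - 1)⁻¹) (by positivity)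
  rw [Real.rpow_inv_rpow (by positivity) (by linarith), inv_inv] at h
  linarith

/-- The gauge `min(e², e^{p/(p-1)})`, dual to `v² + v^p`. -/
def gauge (p e : ℝ) : ℝ := min (e ^ 2) ((e ^ (p - 1)⁻¹) ^ p)

theorem gauge_nonneg {p e : ℝ} (he : 0 ≤ e) : 0 ≤ gauge p e := le_min (by positivity) (by positivity)

theorem continuous_gauge {p : ℝ} (hp : 1 < p) : Continuous (gauge p) :=
  (continuous_id.pow 2).min ((Real.continuous_rpow_const (by linarith)).comp
    (Real.continuous_rpow_const (inv_nonneg.2 (by linarith))))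

theorem gauge_zero {p : ℝ} (hp : 1 < p) : gauge p 0 = 0 := by
  rw [gauge, Real.zero_rpow (inv_ne_zero (by linarith)), Real.zero_rpow (by linarith)]
  simp

theorem exists_mul_le_gauge {p δ : ℝ} (hp : 1 < p) (hδ : 0 < δ) : ∃ C : ℝ, 0 ≤ C ∧
    ∀ e v : ℝ, 0 ≤ e → 0 ≤ v → e * v ≤ δ * (v ^ 2 + v ^ p) + C * gauge p e := by
  obtain ⟨C, hC0, hC⟩ := exists_rpow_sub_one_mul_le hp hδ
  refine ⟨max C δ⁻¹, le_max_of_le_left hC0, fun e v he hv => ?_⟩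
  have hvp : 0 ≤ δ * v ^ p := by positivity
  have hv2 : 0 ≤ δ * v ^ 2 := by positivity
  rcases min_choice (e ^ 2) ((e ^ (p - 1)⁻¹) ^ p) with h | h
  · rw [gauge, h]
    have h1 : e * v ≤ δ * v ^ 2 + δ⁻¹ * e ^ 2 := by
      have h2 : 0 ≤ δ⁻¹ * (e - δ * v / 2) ^ 2 := by positivity
      have h3 : δ⁻¹ * (e - δ * v / 2) ^ 2 = δ⁻¹ * e ^ 2 - e * v + δ * v ^ 2 / 4 := by
        field_simp
        ring
      linarith
    have h2 : δ⁻¹ * e ^ 2 ≤ max C δ⁻¹ * e ^ 2 := by gcongr; exact le_max_right _ _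
    linarith
  · rw [gauge, h]
    have h1 := hC (e ^ (p - 1)⁻¹) v (by positivity) hv
    rw [Real.rpow_inv_rpow he (by linarith)] at h1
    have h2 : C * (e ^ (p - 1)⁻¹) ^ p ≤ max C δ⁻¹ * (e ^ (p - 1)⁻¹) ^ p := by
      gcongr
      exact le_max_left _ _
    linarith

/-- The growth s + s^(p−1) of f has gauge controlled by s² + s^p, which is integrable along H¹
functions. This handles the sum space dual to L² ∩ Lᵖ without splitting f. -/
theorem exists_gauge_le {p K : ℝ} (hp : 1 < p) (hK : 0 ≤ K) : ∃ C : ℝ, 0 ≤ C ∧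
    ∀ e s : ℝ, 0 ≤ e → 0 ≤ s → e ≤ K * (s + s ^ (p - 1)) → gauge p e ≤ C * (s ^ 2 + s ^ p) := by
  refine ⟨max ((2 * K) ^ 2) (((2 * K) ^ (p - 1)⁻¹) ^ p), le_max_of_le_left (by positivity),
    fun e s he hs h => ?_⟩
  have hs2 : 0 ≤ s ^ 2 := by positivity
  have hsp : 0 ≤ s ^ p := by positivity
  have hp' : 0 ≤ (p - 1)⁻¹ := inv_nonneg.2 (by linarith)
  rcases le_total (s ^ (p - 1)) s with h1 | h1
  · have h2 : e ≤ 2 * K * s := by nlinarith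
    calc gauge p e ≤ e ^ 2 := min_le_left _ _
      _ ≤ (2 * K * s) ^ 2 := by gcongr
      _ = (2 * K) ^ 2 * s ^ 2 := by ring
      _ ≤ max ((2 * K) ^ 2) (((2 * K) ^ (p - 1)⁻¹) ^ p) * (s ^ 2 + s ^ p) := by
        gcongr
        · exact le_max_left _ _
        · linarith
  · have h2 : e ≤ 2 * K * s ^ (p - 1) := by nlinarith
    calc gauge p e ≤ (e ^ (p - 1)⁻¹) ^ p := min_le_right _ _
      _ ≤ ((2 * K * s ^ (p - 1)) ^ (p - 1)⁻¹) ^ p := by gcongr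
      _ = ((2 * K) ^ (p - 1)⁻¹) ^ p * s ^ p := by
        rw [Real.mul_rpow (by positivity) (by positivity), Real.rpow_rpow_inv hs (by linarith),
          Real.mul_rpow (by positivity) hs]
      _ ≤ max ((2 * K) ^ 2) (((2 * K) ^ (p - 1)⁻¹) ^ p) * (s ^ 2 + s ^ p) := by
        gcongr
        · exact le_max_right _ _
        · linarith

end RealInequalities

/-! ### Dominated convergence up to a small error. -/

section Convergence

/-- A dominated convergence theorem in which the bound may be exceeded by a small amount. -/
theorem tendsto_integral_zero_of_le_add {α : Type*} [MeasurableSpace α] {ν : Measure α}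
    {g : ℕ → α → ℝ} (hg : ∀ n, Integrable (g n) ν) (hg0 : ∀ n x, 0 ≤ g n x)
    (hlim : ∀ᵐ x ∂ν, Tendsto (fun n => g n x) atTop (𝓝 0))
    (hb : ∀ δ : ℝ, 0 < δ → ∃ (h : α → ℝ) (s : ℕ → α → ℝ), Integrable h ν ∧
      (∀ n, Integrable (s n) ν) ∧ (∀ n x, 0 ≤ s n x) ∧ (∀ n, ∀ᵐ x ∂ν, g n x ≤ h x + s n x) ∧
      ∀ᶠ n in atTop, ∫ x, s n x ∂ν ≤ δ) :
    Tendsto (fun n => ∫ x, g n x ∂ν) atTop (𝓝 0) := by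
  rw [tendsto_order]
  refine ⟨fun a ha => Eventually.of_forall fun n => ha.trans_le (integral_nonneg (hg0 n)),
    fun a ha => ?_⟩
  obtain ⟨h, s, hh, hs, hs0, hle, hδ⟩ := hb (a / 2) (by positivity)
  -- The truncated excess (g_n − s_n)⁺ is dominated by |h| and tends to 0; the discarded part has
  -- integral at most δ.
  have hi : ∀ n, Integrable (fun x => max (g n x - s n x) 0) ν := fun n =>
    ((hg n).sub (hs n)).pos_part
  have h1 : Tendsto (fun n => ∫ x, max (g n x - s n x) 0 ∂ν) atTop (𝓝 (∫ _, (0 : ℝ) ∂ν)) := by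
    refine tendsto_integral_of_dominated_convergence (fun x => |h x|) (fun n => (hi n).1) hh.abs
      (fun n => ?_) ?_
    · filter_upwards [hle n] with x hx
      rw [Real.norm_of_nonneg (le_max_right _ _)]
      exact max_le (by linarith [le_abs_self (h x)]) (abs_nonneg _)
    · filter_upwards [hlim] with x hx
      refine squeeze_zero (fun n => le_max_right _ _) (fun n => ?_) hx
      exact max_le (by linarith [hs0 n x]) (hg0 n x)
  rw [integral_zero] at h1
  filter_upwards [hδ, h1.eventually_lt_const (half_pos ha)] with n hn1 hn2
  have h2 : ∫ x, g n x ∂ν ≤ ∫ x, (max (g n x - s n x) 0 + s n x) ∂ν :=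
    integral_mono (hg n) ((hi n).add (hs n)) fun x => by
      simp only
      linarith [le_max_left (g n x - s n x) 0]
  rw [integral_add (hi n) (hs n)] at h2
  linarith

end Convergence

/-! ### The potential ∫ F(x,u) as a C¹ functional on H¹. -/

section Nemytskii

variable {N : ℕ} {f : Space N → ℝ → ℝ} {p : ℝ}

theorem abs_le_of_unit_ball {E : Type*} [NormedAddCommGroup E] [NormedSpace ℝ E] (L : E →ₗ[ℝ] ℝ)
    {C : ℝ} (h : ∀ v, ‖v‖ ≤ 1 → |L v| ≤ C) (v : E) : ‖L v‖ ≤ C * ‖v‖ := by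
  rcases eq_or_ne v 0 with rfl | hv
  · simp
  · have hv' : 0 < ‖v‖ := norm_pos_iff.2 hv
    have h1 := h (‖v‖⁻¹ • v) (by rw [norm_smul, norm_inv, norm_norm, inv_mul_cancel₀ hv'.ne'])
    rw [map_smul, smul_eq_mul, abs_mul, abs_inv, abs_norm, inv_mul_le_iff₀ hv'] at h1
    rw [Real.norm_eq_abs, mul_comm]
    exact h1

theorem exists_subseq_ae_of_tendsto {u : ℕ → H1 N} {a : H1 N} (h : Tendsto u atTop (𝓝 a)) :
    ∃ φ : ℕ → ℕ, StrictMono φ ∧ ∀ᵐ x, Tendsto (fun n => fn (u (φ n)) x) atTop (𝓝 (fn a x)) := by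
  have h1 : Tendsto (fun n => fn (u n)) atTop (𝓝 (fn a)) :=
    ((fnL (N := N)).continuous.tendsto a).comp h
  exact (tendstoInMeasure_of_tendsto_Lp h1).exists_seq_tendsto_ae

/-- The potential `u ↦ ∫ F(x, u)`. -/
def potential (f : Space N → ℝ → ℝ) (u : H1 N) : ℝ := ∫ x, primitive f x (fn u x)

namespace Nonlinearity

theorem zero_le_p (hf : Nonlinearity f p) : 0 ≤ p := by linarith [hf.two_lt]

theorem Lp_bound (hf : Nonlinearity f p) (hN : 3 ≤ N) : ∃ C : ℝ, 0 < C ∧ ∀ u : H1 N,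
    Integrable (fun x => |fn u x| ^ p) volume ∧ ∫ x, |fn u x| ^ p ≤ C * ‖u‖ ^ p :=
  exists_Lp_bound hN hf.two_lt.le hf.lt_critExp.le

theorem integrable_rpow (hf : Nonlinearity f p) (hN : 3 ≤ N) (u : H1 N) :
    Integrable (fun x => |fn u x| ^ p) volume := (hf.Lp_bound hN).choose_spec.2 u |>.1

theorem aesm_comp (hf : Nonlinearity f p) (u : H1 N) :
    AEStronglyMeasurable (fun x => f x (fn u x)) volume :=
  (hf.measurable_comp (measurable_fn u)).aestronglyMeasurable

theorem exists_mul_le (hf : Nonlinearity f p) : ∃ C : ℝ, 0 < C ∧ ∀ x s t,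
    |f x s * t| ≤ |s| ^ 2 + |t| ^ 2 + C * (|s| ^ p + |t| ^ p) := by
  obtain ⟨C, hC0, hC⟩ := hf.abs_le one_pos
  refine ⟨C, hC0, fun x s t => ?_⟩
  have h1 := rpow_sub_one_mul_le (by linarith [hf.two_lt]) (abs_nonneg s) (abs_nonneg t) one_pos (p := p)
  rw [Real.one_rpow, inv_one, one_mul, one_mul] at h1
  rw [abs_mul]
  have h2 : |f x s| * |t| ≤ (1 * |s| + C * |s| ^ (p - 1)) * |t| :=
    mul_le_mul_of_nonneg_right (hC x s) (abs_nonneg _)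
  have h3 := mul_le_mul_of_nonneg_left h1 hC0.le
  nlinarith [sq_nonneg (|s| - |t|), sq_nonneg |s|, sq_nonneg |t|]

theorem integrable_mul (hf : Nonlinearity f p) (hN : 3 ≤ N) (u v : H1 N) :
    Integrable (fun x => f x (fn u x) * fn v x) volume := by
  obtain ⟨C, hC0, hC⟩ := hf.exists_mul_le
  exact Integrable.mono' (((integrable_sq (fn u)).add (integrable_sq (fn v))).add
    (((hf.integrable_rpow hN u).add (hf.integrable_rpow hN v)).const_mul C))
    ((hf.aesm_comp u).mul (fn_aesm v)) (Eventually.of_forall fun x => hC x _ _)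

theorem exists_integral_abs_mul_le (hf : Nonlinearity f p) (hN : 3 ≤ N) : ∃ K : ℝ, 0 < K ∧
    ∀ u v : H1 N, ‖v‖ ≤ 1 → |∫ x, f x (fn u x) * fn v x| ≤ K * (1 + ‖u‖ ^ 2 + ‖u‖ ^ p) := by
  obtain ⟨C, hC0, hC⟩ := hf.exists_mul_le
  obtain ⟨A, hA0, hA⟩ := hf.Lp_bound hN
  refine ⟨1 + C * A, by positivity, fun u v hv => ?_⟩
  have hi1 : Integrable (fun x => |fn u x| ^ 2 + |fn v x| ^ 2) volume :=
    (integrable_sq (fn u)).add (integrable_sq (fn v))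
  have hi2 : Integrable (fun x => C * (|fn u x| ^ p + |fn v x| ^ p)) volume :=
    ((hA u).1.add (hA v).1).const_mul C
  have h1 := norm_integral_le_of_norm_le (hi1.add hi2) (f := fun x => f x (fn u x) * fn v x)
    (Eventually.of_forall fun x => hC x (fn u x) (fn v x))
  simp only [Pi.add_apply] at h1
  rw [integral_add hi1 hi2, integral_const_mul, integral_add (hA u).1 (hA v).1,
    integral_add (integrable_sq _) (integrable_sq _)] at h1
  simp only [sq_abs] at h1
  rw [← L2.norm_sq_eq, ← L2.norm_sq_eq, Real.norm_eq_abs] at h1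
  have h2 : ‖fn u‖ ^ 2 ≤ ‖u‖ ^ 2 := pow_le_pow_left₀ (norm_nonneg _) (norm_fn_le u) 2
  have h3 : ‖fn v‖ ^ 2 ≤ 1 := pow_le_one₀ (norm_nonneg _) ((norm_fn_le v).trans hv)
  have h4 : ∫ x, |fn v x| ^ p ≤ A := (hA v).2.trans
    (mul_le_of_le_one_right hA0.le (Real.rpow_le_one (norm_nonneg _) hv hf.zero_le_p))
  have h5 := mul_le_mul_of_nonneg_left (add_le_add (hA u).2 h4) hC0.le
  have h6 : 0 ≤ ‖u‖ ^ p := by positivity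
  have h7 : 0 ≤ C * A := by positivity
  have h8 : 0 ≤ C * A * ‖u‖ ^ 2 := by positivity
  nlinarith

theorem exists_clm (hf : Nonlinearity f p) (hN : 3 ≤ N) (u : H1 N) :
    ∃ L : H1 N →L[ℝ] ℝ, ∀ v, L v = ∫ x, f x (fn u x) * fn v x := by
  let L : H1 N →ₗ[ℝ] ℝ :=
    { toFun := fun v => ∫ x, f x (fn u x) * fn v x
      map_add' := fun v w => by
        rw [← integral_add (hf.integrable_mul hN u v) (hf.integrable_mul hN u w)]
        refine integral_congr_ae ?_
        filter_upwards [fn_add_ae v w] with x hx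
        rw [hx, mul_add]
      map_smul' := fun c v => by
        rw [RingHom.id_apply, smul_eq_mul, ← integral_const_mul]
        refine integral_congr_ae ?_
        filter_upwards [fn_smul_ae c v] with x hx
        rw [hx]
        ring }
  obtain ⟨K, hK0, hK⟩ := hf.exists_integral_abs_mul_le hN
  exact ⟨L.mkContinuous _ (abs_le_of_unit_ball L fun v hv => hK u v hv), fun v => rfl⟩

/-- The derivative `v ↦ ∫ f(x, u) v` of the potential at `u`. -/
def deriv (hf : Nonlinearity f p) (hN : 3 ≤ N) (u : H1 N) : H1 N →L[ℝ] ℝ :=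
  (hf.exists_clm hN u).choose

theorem deriv_apply (hf : Nonlinearity f p) (hN : 3 ≤ N) (u v : H1 N) :
    hf.deriv hN u v = ∫ x, f x (fn u x) * fn v x := (hf.exists_clm hN u).choose_spec v

/-- Splits the bound into a part in s − t, small in norm when s → t in H¹, and a part in t, a fixed
dominating function. This is the shape required by `tendsto_integral_zero_of_le_add`. -/
theorem exists_gauge_sub_le (hf : Nonlinearity f p) : ∃ C : ℝ, 0 ≤ C ∧ ∀ x s t,
    gauge p |f x s - f x t| ≤ C * (|s - t| ^ 2 + |s - t| ^ p) + C * (|t| ^ 2 + |t| ^ p) := by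
  obtain ⟨K, hK0, hK⟩ := hf.abs_le one_pos
  have hp := hf.two_lt
  obtain ⟨C, hC0, hC⟩ := exists_gauge_le (p := p) (K := 2 * (1 + K)) (by linarith) (by positivity)
  refine ⟨C * (8 + 2 ^ p * (1 + 2 ^ p)), by positivity, fun x s t => ?_⟩
  have h1 := hC |f x s - f x t| (|s - t| + 2 * |t|) (abs_nonneg _) (by positivity) ?_
  · have h2 : (|s - t| + 2 * |t|) ^ p ≤ 2 ^ p * (|s - t| ^ p + 2 ^ p * |t| ^ p) := by
      rw [← Real.mul_rpow zero_le_two (abs_nonneg t)]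
      exact add_rpow_le hf.zero_le_p (abs_nonneg _) (by positivity)
    have h3 : (|s - t| + 2 * |t|) ^ 2 ≤ 8 * (|s - t| ^ 2 + |t| ^ 2) := by
      nlinarith [sq_nonneg (|s - t| - 2 * |t|), sq_nonneg |s - t|]
    have h4 : (0 : ℝ) < 2 ^ p := by positivity
    have h5 : 0 ≤ |s - t| ^ p := by positivity
    have h6 : 0 ≤ |t| ^ p := by positivity
    refine h1.trans ?_
    rw [mul_assoc C, mul_assoc C, ← mul_add]
    refine mul_le_mul_of_nonneg_left ?_ hC0
    nlinarith [mul_nonneg h4.le h5, mul_nonneg h4.le h6, mul_nonneg (mul_nonneg h4.le h4.le) h5,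
      mul_nonneg (mul_nonneg h4.le h4.le) h6, mul_nonneg h4.le (sq_nonneg |s - t|),
      mul_nonneg h4.le (sq_nonneg |t|), mul_nonneg (mul_nonneg h4.le h4.le) (sq_nonneg |s - t|),
      mul_nonneg (mul_nonneg h4.le h4.le) (sq_nonneg |t|)]
  · have hs : |s| ≤ |s - t| + 2 * |t| := by
      have := abs_sub_abs_le_abs_sub s t
      linarith [abs_nonneg t]
    have ht : |t| ≤ |s - t| + 2 * |t| := by linarith [abs_nonneg t, abs_nonneg (s - t)]
    have h2 : ∀ r, |r| ≤ |s - t| + 2 * |t| → |f x r| ≤ (1 + K) * ((|s - t| + 2 * |t|) +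
        (|s - t| + 2 * |t|) ^ (p - 1)) := fun r hr => by
      have h3 : |r| ^ (p - 1) ≤ (|s - t| + 2 * |t|) ^ (p - 1) :=
        Real.rpow_le_rpow (abs_nonneg _) hr (by linarith)
      have h4 := hK x r
      have h5 : 0 ≤ |r| ^ (p - 1) := by positivity
      have h6 := abs_nonneg r
      nlinarith [mul_le_mul_of_nonneg_left h3 hK0.le, mul_le_mul_of_nonneg_left hr hK0.le]
    have h3 := h2 s hs
    have h4 := h2 t ht
    have h5 : |f x s - f x t| ≤ |f x s| + |f x t| := abs_sub _ _
    linarith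

theorem integrable_gauge (hf : Nonlinearity f p) (hN : 3 ≤ N) (u v : H1 N) :
    Integrable (fun x => gauge p |f x (fn u x) - f x (fn v x)|) volume := by
  obtain ⟨C, hC0, hC⟩ := hf.exists_gauge_sub_le
  have h1 : ∀ w : H1 N, Integrable (fun x => C * (|fn w x| ^ 2 + |fn w x| ^ p)) volume := fun w =>
    ((integrable_sq (fn w)).add (hf.integrable_rpow hN w)).const_mul C
  refine Integrable.mono' ((h1 (u - v)).add (h1 v)) ?_ ?_
  · exact (continuous_gauge (by linarith [hf.two_lt])).comp_aestronglyMeasurable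
      ((hf.aesm_comp u).sub (hf.aesm_comp v)).norm
  · filter_upwards [fn_sub_ae u v] with x hx
    rw [Real.norm_of_nonneg (gauge_nonneg (abs_nonneg _)), Pi.add_apply, hx]
    exact hC x _ _

theorem exists_norm_deriv_sub_le (hf : Nonlinearity f p) (hN : 3 ≤ N) {δ : ℝ} (hδ : 0 < δ) :
    ∃ C : ℝ, 0 ≤ C ∧ ∀ u v : H1 N, ‖hf.deriv hN u - hf.deriv hN v‖ ≤
      δ + C * ∫ x, gauge p |f x (fn u x) - f x (fn v x)| := by
  obtain ⟨A, hA0, hA⟩ := hf.Lp_bound hN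
  obtain ⟨C, hC0, hC⟩ := exists_mul_le_gauge (p := p) (δ := δ / (1 + A))
    (by linarith [hf.two_lt]) (by positivity)
  refine ⟨C, hC0, fun u v => ?_⟩
  have hg : 0 ≤ ∫ x, gauge p |f x (fn u x) - f x (fn v x)| :=
    integral_nonneg fun x => gauge_nonneg (abs_nonneg _)
  refine ContinuousLinearMap.opNorm_le_bound _ (by positivity)
    (abs_le_of_unit_ball (hf.deriv hN u - hf.deriv hN v).toLinearMap fun w hw => ?_)
  have h1 : (hf.deriv hN u - hf.deriv hN v) w = ∫ x, (f x (fn u x) - f x (fn v x)) * fn w x := by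
    rw [sub_apply, hf.deriv_apply, hf.deriv_apply,
      ← integral_sub (hf.integrable_mul hN u w) (hf.integrable_mul hN v w)]
    simp only [sub_mul]
  have hi1 : Integrable (fun x => δ / (1 + A) * (|fn w x| ^ 2 + |fn w x| ^ p)) volume :=
    ((integrable_sq (fn w)).add (hA w).1).const_mul _
  have hi2 := (hf.integrable_gauge hN u v).const_mul C
  refine (congrArg abs h1).trans_le ?_
  have h2 := norm_integral_le_of_norm_le (hi1.add hi2) (f := fun x =>
    (f x (fn u x) - f x (fn v x)) * fn w x) (Eventually.of_forall fun x => by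
      rw [norm_mul]
      exact hC _ _ (norm_nonneg _) (norm_nonneg _))
  refine h2.trans ?_
  simp only [Pi.add_apply]
  rw [integral_add hi1 hi2, integral_const_mul, integral_const_mul,
    integral_add (integrable_sq _) (hA w).1]
  simp only [sq_abs]
  rw [← L2.norm_sq_eq]
  refine add_le_add_left ?_ _
  have h3 : ‖fn w‖ ^ 2 ≤ 1 := pow_le_one₀ (norm_nonneg _) ((norm_fn_le w).trans hw)
  have h4 : ∫ x, |fn w x| ^ p ≤ A := (hA w).2.trans
    (mul_le_of_le_one_right hA0.le (Real.rpow_le_one (norm_nonneg _) hw hf.zero_le_p))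
  calc δ / (1 + A) * (‖fn w‖ ^ 2 + ∫ x, |fn w x| ^ p) ≤ δ / (1 + A) * (1 + A) := by gcongr
    _ = δ := by field_simp

/-- Every subsequence has a further one that converges almost everywhere. Along it the gauge of
f(x,u_n) − f(x,a) tends to 0 in L¹, and Young's inequality converts this into convergence of
derivatives in operator norm. -/
theorem continuous_deriv (hf : Nonlinearity f p) (hN : 3 ≤ N) : Continuous (hf.deriv hN) := by
  have hp := hf.two_lt
  rw [continuous_iff_seqContinuous]
  intro u a hu
  refine tendsto_of_subseq_tendsto fun ns hns => ?_
  obtain ⟨ms, hms, hae⟩ := exists_subseq_ae_of_tendsto (hu.comp hns)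
  refine ⟨ms, ?_⟩
  have hw : Tendsto (fun n => u (ns (ms n))) atTop (𝓝 a) := (hu.comp hns).comp hms.tendsto_atTop
  simp only [Function.comp_apply] at hae ⊢
  obtain ⟨w, hwe⟩ : ∃ w : ℕ → H1 N, w = fun n => u (ns (ms n)) := ⟨_, rfl⟩
  have hwe' : ∀ n, u (ns (ms n)) = w n := fun n => by rw [hwe]
  simp only [hwe'] at hw hae ⊢
  obtain ⟨A, hA0, hA⟩ := hf.Lp_bound hN
  obtain ⟨C, hC0, hC⟩ := hf.exists_gauge_sub_le
  have hi : ∀ v : H1 N, Integrable (fun x => C * (|fn v x| ^ 2 + |fn v x| ^ p)) volume := fun v =>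
    ((integrable_sq (fn v)).add (hA v).1).const_mul C
  have hgauge : Tendsto (fun n => ∫ x, gauge p |f x (fn (w n) x) - f x (fn a x)|) atTop (𝓝 0) := by
    refine tendsto_integral_zero_of_le_add (fun n => hf.integrable_gauge hN _ _)
      (fun n x => gauge_nonneg (abs_nonneg _)) ?_ fun δ hδ => ?_
    · filter_upwards [hae] with x hx
      have h1 : Tendsto (fun n => |f x (fn (w n) x) - f x (fn a x)|) atTop (𝓝 0) := by
        have := ((((hf.continuous x).tendsto _).comp hx).sub_const (f x (fn a x))).abs
        simpa using this
      have h2 := ((continuous_gauge (p := p) (by linarith)).tendsto 0).comp h1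
      rwa [gauge_zero (by linarith)] at h2
    · refine ⟨_, fun n x => C * (|fn (w n - a) x| ^ 2 + |fn (w n - a) x| ^ p), hi a,
        fun n => hi _, fun n x => by positivity, fun n => ?_, ?_⟩
      · filter_upwards [fn_sub_ae (w n) a] with x hx
        rw [hx, add_comm]
        exact hC x _ _
      · have h1 : Tendsto (fun n => ‖w n - a‖) atTop (𝓝 0) :=
          tendsto_iff_norm_sub_tendsto_zero.1 hw
        have h2 : Tendsto (fun n => C * (‖w n - a‖ ^ 2 + A * ‖w n - a‖ ^ p)) atTop (𝓝 0) := by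
          have := ((h1.pow 2).add ((h1.rpow_const (p := p) (Or.inr hf.zero_le_p)).const_mul A)).const_mul C
          simpa [Real.zero_rpow (by linarith : p ≠ 0)] using this
        filter_upwards [h2.eventually_le_const hδ] with n hn
        refine le_trans ?_ hn
        rw [integral_const_mul, integral_add (integrable_sq _) (hA _).1]
        simp only [sq_abs]
        rw [← L2.norm_sq_eq]
        gcongr
        · exact norm_fn_le _
        · exact (hA _).2
  refine (tendsto_iff_norm_sub_tendsto_zero (E := H1 N →L[ℝ] ℝ)).2 (tendsto_order.2 ?_)
  refine ⟨fun b hb => Eventually.of_forall fun n => hb.trans_le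
    (norm_nonneg (hf.deriv hN (w n) - hf.deriv hN a)), fun b hb => ?_⟩
  obtain ⟨K, hK0, hK⟩ := hf.exists_norm_deriv_sub_le hN (half_pos hb)
  have h1 := hgauge.const_mul K
  rw [mul_zero] at h1
  filter_upwards [h1.eventually_lt_const (half_pos hb)] with n hn
  linarith [hK (w n) a]

theorem abs_primitive_le (hf : Nonlinearity f p) {ε : ℝ} (hε : 0 < ε) : ∃ C : ℝ, 0 < C ∧
    ∀ x u, primitive f x u ≤ ε * |u| ^ 2 + C * |u| ^ p := by
  obtain ⟨C, hC0, hC⟩ := hf.abs_le hε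
  refine ⟨C, hC0, fun x u => ?_⟩
  have h1 := hf.primitive_le x u
  have h2 : f x u * u ≤ ε * |u| ^ 2 + C * |u| ^ p := by
    have h3 : |u| ^ p = |u| ^ (p - 1) * |u| := by
      rcases (abs_nonneg u).eq_or_lt with h | h
      · rw [← h, Real.zero_rpow (by linarith [hf.two_lt]), mul_zero]
      · rw [← Real.rpow_add_one h.ne', sub_add_cancel]
    calc f x u * u ≤ |f x u| * |u| := by rw [← abs_mul]; exact le_abs_self _
      _ ≤ (ε * |u| + C * |u| ^ (p - 1)) * |u| := by gcongr; exact hC x u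
      _ = _ := by rw [h3]; ring
  have h4 : 0 ≤ ε * |u| ^ 2 + C * |u| ^ p := by positivity
  linarith

theorem integrable_primitive (hf : Nonlinearity f p) (hN : 3 ≤ N) (u : H1 N) :
    Integrable (fun x => primitive f x (fn u x)) volume := by
  obtain ⟨C, hC0, hC⟩ := hf.abs_primitive_le one_pos
  refine Integrable.mono' (((integrable_sq (fn u)).const_mul 1).add
    ((hf.integrable_rpow hN u).const_mul C))
    (hf.measurable_primitive_comp (measurable_fn u)).aestronglyMeasurable
    (Eventually.of_forall fun x => ?_)
  rw [Real.norm_of_nonneg (hf.primitive_nonneg x _)]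
  exact hC x _

theorem exists_potential_le (hf : Nonlinearity f p) (hN : 3 ≤ N) {ε : ℝ} (hε : 0 < ε) :
    ∃ C : ℝ, 0 < C ∧ ∀ u : H1 N, potential f u ≤ ε * ‖u‖ ^ 2 + C * ∫ x, |fn u x| ^ p := by
  obtain ⟨C, hC0, hC⟩ := hf.abs_primitive_le hε
  refine ⟨C, hC0, fun u => ?_⟩
  have h1 := integral_mono (hf.integrable_primitive hN u) (((integrable_sq (fn u)).const_mul ε).add
    ((hf.integrable_rpow hN u).const_mul C)) fun x => hC x (fn u x)
  simp only [Pi.add_apply] at h1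
  rw [integral_add ((integrable_sq (fn u)).const_mul ε) ((hf.integrable_rpow hN u).const_mul C),
    integral_const_mul, integral_const_mul] at h1
  simp only [sq_abs] at h1
  rw [← L2.norm_sq_eq] at h1
  have h2 : ε * ‖fn u‖ ^ 2 ≤ ε * ‖u‖ ^ 2 := by
    gcongr
    exact norm_fn_le u
  rw [potential]
  linarith

theorem potential_nonneg (hf : Nonlinearity f p) (u : H1 N) : 0 ≤ potential f u :=
  integral_nonneg fun x => hf.primitive_nonneg x _

theorem hasDerivAt_potential (hf : Nonlinearity f p) (hN : 3 ≤ N) (u v : H1 N) (s₀ : ℝ) :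
    HasDerivAt (fun s : ℝ => potential f (u + s • v)) (hf.deriv hN (u + s₀ • v) v) s₀ := by
  have hp := hf.two_lt
  have hae : ∀ s : ℝ, fn (u + s • v) =ᵐ[volume] fun x => fn u x + s * fn v x := fun s => by
    filter_upwards [fn_add_ae u (s • v), fn_smul_ae s v] with x h1 h2
    rw [h1, h2]
  have h1 : (fun s : ℝ => potential f (u + s • v)) =
      fun s => ∫ x, primitive f x (fn u x + s * fn v x) := by
    funext s
    refine integral_congr_ae ?_
    filter_upwards [hae s] with x hx
    rw [hx]
  have h2 : hf.deriv hN (u + s₀ • v) v = ∫ x, f x (fn u x + s₀ * fn v x) * fn v x := by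
    rw [hf.deriv_apply]
    refine integral_congr_ae ?_
    filter_upwards [hae s₀] with x hx
    rw [hx]
  have hm : ∀ s : ℝ, Measurable fun x => fn u x + s * fn v x := fun s =>
    (measurable_fn u).add ((measurable_fn v).const_mul s)
  obtain ⟨C, hC0, hC⟩ := hf.exists_mul_le
  obtain ⟨S, hS⟩ : ∃ S, S = |s₀| + 1 := ⟨_, rfl⟩
  have hS0 : 0 ≤ S := by rw [hS]; positivity
  rw [h1, h2]
  refine (hasDerivAt_integral_of_dominated_loc_of_deriv_le (s := Metric.ball s₀ 1)
    (F := fun s x => primitive f x (fn u x + s * fn v x))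
    (F' := fun s x => f x (fn u x + s * fn v x) * fn v x)
    (bound := fun x => (2 * |fn u x| ^ 2 + (2 * S ^ 2) * |fn v x| ^ 2 + |fn v x| ^ 2) +
      C * (2 ^ p * (|fn u x| ^ p + S ^ p * |fn v x| ^ p) + |fn v x| ^ p))
    (Metric.ball_mem_nhds s₀ one_pos) ?_ ?_ ?_ ?_ ?_ ?_).2
  · exact Eventually.of_forall fun s => (hf.measurable_primitive_comp (hm s)).aestronglyMeasurable
  · refine (hf.integrable_primitive hN (u + s₀ • v)).congr ?_
    filter_upwards [hae s₀] with x hx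
    rw [hx]
  · exact ((hf.measurable_comp (hm s₀)).mul (measurable_fn v)).aestronglyMeasurable
  · refine Eventually.of_forall fun x s hs => ?_
    have hs' : |s| ≤ S := by
      rw [Metric.mem_ball, Real.dist_eq] at hs
      rw [hS]
      linarith [abs_sub_abs_le_abs_sub s s₀]
    have h3 : |fn u x + s * fn v x| ≤ |fn u x| + S * |fn v x| := by
      refine (abs_add_le _ _).trans ?_
      rw [abs_mul]
      gcongr
    refine (hC x _ _).trans ?_
    have h4 : |fn u x + s * fn v x| ^ p ≤ 2 ^ p * (|fn u x| ^ p + S ^ p * |fn v x| ^ p) := by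
      rw [← Real.mul_rpow hS0 (abs_nonneg _)]
      exact (Real.rpow_le_rpow (abs_nonneg _) h3 hf.zero_le_p).trans
        (add_rpow_le hf.zero_le_p (abs_nonneg _) (by positivity))
    have h5 : |fn u x + s * fn v x| ^ 2 ≤ 2 * |fn u x| ^ 2 + 2 * S ^ 2 * |fn v x| ^ 2 := by
      refine (pow_le_pow_left₀ (abs_nonneg _) h3 2).trans ?_
      nlinarith [sq_nonneg (|fn u x| - S * |fn v x|)]
    gcongr
  · exact ((((integrable_sq (fn u)).const_mul 2).add ((integrable_sq (fn v)).const_mul _)).add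
      (integrable_sq (fn v))).add ((((hf.integrable_rpow hN u).add
      ((hf.integrable_rpow hN v).const_mul _)).const_mul _).add (hf.integrable_rpow hN v) |>.const_mul C)
  · refine Eventually.of_forall fun x s _ => ?_
    have h3 : HasDerivAt (fun s : ℝ => fn u x + s * fn v x) (fn v x) s := by
      simpa using ((hasDerivAt_id s).mul_const (fn v x)).const_add (fn u x)
    exact (hf.hasDerivAt_primitive x _).comp s h3

/-- Directional derivatives together with norm continuity of the candidate derivative: the mean
value inequality on the segment from u to u + v makes the remainder o(‖v‖). -/
theorem hasFDerivAt_potential (hf : Nonlinearity f p) (hN : 3 ≤ N) (u : H1 N) :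
    HasFDerivAt (potential f) (hf.deriv hN u) u := by
  rw [hasFDerivAt_iff_isLittleO_nhds_zero, Asymptotics.isLittleO_iff]
  intro ε hε
  obtain ⟨δ, hδ, h⟩ := (Metric.continuousAt_iff (f := hf.deriv hN) (a := u)).1
    (hf.continuous_deriv hN).continuousAt ε hε
  filter_upwards [Metric.ball_mem_nhds (0 : H1 N) hδ] with v hv
  rw [mem_ball_zero_iff] at hv
  have hd : ∀ s : ℝ, HasDerivAt (fun s : ℝ => potential f (u + s • v) - s * hf.deriv hN u v)
      (hf.deriv hN (u + s • v) v - hf.deriv hN u v) s := fun s => by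
    exact ((hf.hasDerivAt_potential hN u v s).fun_sub
      ((hasDerivAt_id s).mul_const (hf.deriv hN u v))).congr_deriv (by simp)
  have hb := norm_image_sub_le_of_norm_deriv_le_segment_01' (C := ε * ‖v‖)
    (fun s _ => (hd s).hasDerivWithinAt) fun s hs => by
      rw [← sub_apply]
      refine (ContinuousLinearMap.le_opNorm _ _).trans ?_
      gcongr
      have := h (x := u + s • v) (by
        rw [dist_eq_norm, add_sub_cancel_left, norm_smul, Real.norm_of_nonneg hs.1]
        exact (mul_le_of_le_one_left (norm_nonneg _) hs.2.le).trans_lt hv)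
      exact (dist_eq_norm (hf.deriv hN (u + s • v)) (hf.deriv hN u)).symm.trans_le this.le
  simp only [one_smul, zero_smul, add_zero, one_mul, zero_mul, sub_zero] at hb
  rwa [sub_right_comm] at hb

theorem potential_key (hf : Nonlinearity f p) (hN : 3 ≤ N) {t : ℝ} (ht : 0 ≤ t) (s u : H1 N) :
    potential f u + hf.deriv hN u (t • s - ((t ^ 2 + 1) / 2) • u) ≤ potential f s := by
  rw [hf.deriv_apply, potential, potential, ← integral_add (hf.integrable_primitive hN u)
    (hf.integrable_mul hN _ _)]
  refine integral_mono_ae ((hf.integrable_primitive hN u).add (hf.integrable_mul hN _ _))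
    (hf.integrable_primitive hN s) ?_
  filter_upwards [fn_sub_ae (t • s) (((t ^ 2 + 1) / 2) • u), fn_smul_ae t s,
    fn_smul_ae ((t ^ 2 + 1) / 2) u] with x h1 h2 h3
  rw [h1, h2, h3]
  exact (hf.isPseudoMonotone x).key ht _ _

theorem _root_.HardySchrodinger.potential_zero : potential f (0 : H1 N) = 0 := by
  refine integral_eq_zero_of_ae ?_
  rw [fn_zero]
  filter_upwards [Lp.coeFn_zero ℝ 2 (volume : Measure (Space N))] with x hx
  rw [hx]
  simp [primitive]

end Nonlinearity

end Nemytskii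

/-! ### Behaviour of the nonlinearity under weak limits and lattice translations. -/

section WeakLimits

variable {N : ℕ} {f : Space N → ℝ → ℝ} {p : ℝ}

theorem integral_le_of_fatou {α : Type*} [MeasurableSpace α] {ν : Measure α}
    {g : ℕ → α → ℝ} {g₀ : α → ℝ} (hg : ∀ n, Integrable (g n) ν) (hg0 : ∀ n x, 0 ≤ g n x)
    (hg₀ : Integrable g₀ ν) (hg₀0 : ∀ x, 0 ≤ g₀ x)
    (hlim : ∀ᵐ x ∂ν, Tendsto (fun n => g n x) atTop (𝓝 (g₀ x))) {c : ℕ → ℝ} {c₀ : ℝ}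
    (hc : ∀ n, ∫ x, g n x ∂ν ≤ c n) (hc₀ : Tendsto c atTop (𝓝 c₀)) : ∫ x, g₀ x ∂ν ≤ c₀ := by
  have hc0 : 0 ≤ c₀ := ge_of_tendsto' hc₀ fun n => (integral_nonneg (hg0 n)).trans (hc n)
  rw [← ENNReal.ofReal_le_ofReal_iff hc0,
    ofReal_integral_eq_lintegral_ofReal hg₀ (Eventually.of_forall hg₀0)]
  calc ∫⁻ x, ENNReal.ofReal (g₀ x) ∂ν = ∫⁻ x, liminf (fun n => ENNReal.ofReal (g n x)) atTop ∂ν := by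
        refine lintegral_congr_ae ?_
        filter_upwards [hlim] with x hx
        exact ((ENNReal.continuous_ofReal.tendsto _).comp hx).liminf_eq.symm
    _ ≤ liminf (fun n => ∫⁻ x, ENNReal.ofReal (g n x) ∂ν) atTop :=
        lintegral_liminf_le' fun n => (hg n).1.aemeasurable.ennreal_ofReal
    _ ≤ liminf (fun n => ENNReal.ofReal (c n)) atTop := by
        refine liminf_le_liminf (Eventually.of_forall fun n => ?_)
        rw [← ofReal_integral_eq_lintegral_ofReal (hg n) (Eventually.of_forall (hg0 n))]
        exact ENNReal.ofReal_le_ofReal (hc n)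
    _ = ENNReal.ofReal c₀ := ((ENNReal.continuous_ofReal.tendsto _).comp hc₀).liminf_eq

namespace Nonlinearity

/-- The small factor multiplies the argument that will be merely bounded in H¹; the large constant
multiplies the fixed test function. -/
theorem exists_mul_le_small (hf : Nonlinearity f p) {δ : ℝ} (hδ : 0 < δ) : ∃ C : ℝ, 0 ≤ C ∧
    ∀ x s t, |f x s * t| ≤ δ * (|s| ^ 2 + |s| ^ p) + C * (|t| ^ 2 + |t| ^ p) := by
  obtain ⟨K, hK0, hK⟩ := hf.abs_le one_pos
  have hp := hf.two_lt
  refine ⟨δ⁻¹ + K * ((δ / K) ^ (p - 1))⁻¹, by positivity, fun x s t => ?_⟩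
  have h1 := rpow_sub_one_mul_le (p := p) (by linarith) (abs_nonneg s) (abs_nonneg t)
    (div_pos hδ hK0)
  have h2 : |s| * |t| ≤ δ * |s| ^ 2 + δ⁻¹ * |t| ^ 2 := by
    have h3 : 0 ≤ δ⁻¹ * (δ * |s| - |t| / 2) ^ 2 := by positivity
    have h4 : δ⁻¹ * (δ * |s| - |t| / 2) ^ 2 = δ * |s| ^ 2 - |s| * |t| + δ⁻¹ * |t| ^ 2 / 4 := by
      field_simp
      ring
    have h5 : 0 ≤ δ⁻¹ * |t| ^ 2 := by positivity
    linarith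
  have h3 : |f x s * t| ≤ |s| * |t| + K * (|s| ^ (p - 1) * |t|) := by
    rw [abs_mul]
    calc |f x s| * |t| ≤ (1 * |s| + K * |s| ^ (p - 1)) * |t| := by gcongr; exact hK x s
      _ = _ := by ring
  have h4 := mul_le_mul_of_nonneg_left h1 hK0.le
  have h5 : K * (δ / K * |s| ^ p + ((δ / K) ^ (p - 1))⁻¹ * |t| ^ p) =
      δ * |s| ^ p + K * ((δ / K) ^ (p - 1))⁻¹ * |t| ^ p := by
    field_simp
  rw [h5] at h4
  have h6 : 0 ≤ δ⁻¹ * |t| ^ p := by positivity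
  have h7 : 0 ≤ K * ((δ / K) ^ (p - 1))⁻¹ * |t| ^ 2 := by positivity
  linarith

theorem tendsto_deriv_apply (hf : Nonlinearity f p) (hN : 3 ≤ N) {w : ℕ → H1 N} {a : H1 N} {M : ℝ}
    (hM : ∀ n, ‖w n‖ ≤ M) (hae : ∀ᵐ x, Tendsto (fun n => fn (w n) x) atTop (𝓝 (fn a x)))
    (v : H1 N) : Tendsto (fun n => hf.deriv hN (w n) v) atTop (𝓝 (hf.deriv hN a v)) := by
  have hp := hf.two_lt
  have hM0 : 0 ≤ M := (norm_nonneg _).trans (hM 0)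
  obtain ⟨A, hA0, hA⟩ := hf.Lp_bound hN
  have hi : ∀ u : H1 N, Integrable (fun x => |fn u x| ^ 2 + |fn u x| ^ p) volume := fun u =>
    (integrable_sq (fn u)).add (hA u).1
  have hi' : ∀ n, Integrable (fun x => f x (fn (w n) x) * fn v x - f x (fn a x) * fn v x) volume :=
    fun n => (hf.integrable_mul hN _ _).sub (hf.integrable_mul hN _ _)
  have h1 : Tendsto (fun n => ∫ x, |f x (fn (w n) x) * fn v x - f x (fn a x) * fn v x|) atTop
      (𝓝 0) := by
    refine tendsto_integral_zero_of_le_add (fun n => (hi' n).abs) (fun n x => abs_nonneg _) ?_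
      fun δ hδ => ?_
    · filter_upwards [hae] with x hx
      have h2 := (((((hf.continuous x).tendsto _).comp hx).mul_const (fn v x)).sub_const
        (f x (fn a x) * fn v x)).abs
      simpa using h2
    · obtain ⟨C, hC0, hC⟩ := hf.exists_mul_le_small (δ := δ / (M ^ 2 + A * M ^ p + 1)) (by positivity)
      refine ⟨fun x => |f x (fn a x) * fn v x| + C * (|fn v x| ^ 2 + |fn v x| ^ p),
        fun n x => δ / (M ^ 2 + A * M ^ p + 1) * (|fn (w n) x| ^ 2 + |fn (w n) x| ^ p),
        (hf.integrable_mul hN _ _).abs.add ((hi v).const_mul C), fun n => (hi _).const_mul _,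
        fun n x => by positivity, fun n => Eventually.of_forall fun x => ?_,
        Eventually.of_forall fun n => ?_⟩
      · have h2 := hC x (fn (w n) x) (fn v x)
        have h3 : |f x (fn (w n) x) * fn v x - f x (fn a x) * fn v x| ≤
          |f x (fn (w n) x) * fn v x| + |f x (fn a x) * fn v x| := abs_sub _ _
        linarith
      · rw [integral_const_mul, integral_add (integrable_sq _) (hA _).1]
        simp only [sq_abs]
        rw [← L2.norm_sq_eq]
        have h2 : ‖fn (w n)‖ ^ 2 + ∫ x, |fn (w n) x| ^ p ≤ M ^ 2 + A * M ^ p + 1 := by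
          have h3 : ‖fn (w n)‖ ^ 2 ≤ M ^ 2 :=
            pow_le_pow_left₀ (norm_nonneg _) ((norm_fn_le _).trans (hM n)) 2
          have h4 : ∫ x, |fn (w n) x| ^ p ≤ A * M ^ p := by
            refine (hA _).2.trans ?_
            gcongr
            exact hM n
          linarith
        refine (mul_le_mul_of_nonneg_left h2 (by positivity)).trans (le_of_eq ?_)
        field_simp
  rw [tendsto_iff_norm_sub_tendsto_zero]
  refine squeeze_zero (fun n => norm_nonneg _) (fun n => ?_) h1
  rw [hf.deriv_apply, hf.deriv_apply, ← integral_sub (hf.integrable_mul hN _ _)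
    (hf.integrable_mul hN _ _)]
  exact norm_integral_le_integral_norm _

/-- Superquadratic growth: the potential on a ray beats every quadratic bound. -/
theorem eq_zero_of_potential_le (hf : Nonlinearity f p) (hN : 3 ≤ N) {y : ℕ → H1 N} {a : H1 N}
    {t : ℕ → ℝ} (ht0 : ∀ n, 0 < t n) (ht : Tendsto t atTop atTop)
    (hae : ∀ᵐ x, Tendsto (fun n => fn (y n) x) atTop (𝓝 (fn a x))) {C : ℝ}
    (hC : ∀ n, potential f (t n • y n) ≤ C * t n ^ 2) : a = 0 := by
  have hi : ∀ n, Integrable (fun x => primitive f x (fn (t n • y n) x) / t n ^ 2) volume :=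
    fun n => (hf.integrable_primitive hN _).div_const _
  -- By Fatou the liminf of F(x, t_n y_n)/t_n² is finite almost everywhere; wherever a(x) ≠ 0,
  -- superquadraticity makes it infinite.
  have h1 : ∫⁻ x, liminf (fun n => ENNReal.ofReal (primitive f x (fn (t n • y n) x) / t n ^ 2))
      atTop ≤ ENNReal.ofReal C := by
    refine (lintegral_liminf_le' fun n => (hi n).1.aemeasurable.ennreal_ofReal).trans ?_
    refine (liminf_le_liminf (v := fun _ => ENNReal.ofReal C)
      (Eventually.of_forall fun n => ?_)).trans (by rw [liminf_const])
    rw [← ofReal_integral_eq_lintegral_ofReal (hi n) (Eventually.of_forall fun x =>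
      div_nonneg (hf.primitive_nonneg x _) (sq_nonneg _)), integral_div]
    refine ENNReal.ofReal_le_ofReal ?_
    rw [div_le_iff₀ (pow_pos (ht0 n) 2)]
    exact hC n
  have h2 : ∀ᵐ x, liminf (fun n => ENNReal.ofReal
      (primitive f x (fn (t n • y n) x) / t n ^ 2)) atTop < ⊤ := by
    refine ae_lt_top (Measurable.liminf fun n => ?_) (h1.trans_lt ENNReal.ofReal_lt_top).ne
    exact ((hf.measurable_primitive_comp (measurable_fn _)).div_const _).ennreal_ofReal
  apply fn_ext
  filter_upwards [h2, hae, ae_all_iff.2 fun n => fn_smul_ae (t n) (y n),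
    Lp.coeFn_zero ℝ 2 (volume : Measure (Space N))] with x hx1 hx2 hx3 hx4
  rw [fn_zero, hx4, Pi.zero_apply]
  by_contra hne
  refine hx1.ne (Tendsto.liminf_eq ?_)
  simp only [hx3]
  refine ENNReal.tendsto_ofReal_atTop.comp (tendsto_atTop.2 fun K => ?_)
  obtain ⟨δ, hδ0, hδ⟩ : ∃ δ > 0, δ < |fn a x| := ⟨|fn a x| / 2, by positivity, by
    have : 0 < |fn a x| := abs_pos.2 hne
    linarith⟩
  obtain ⟨R, hR0, hR⟩ := hf.superquadratic (|K| / δ ^ 2)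
  filter_upwards [hx2.abs.eventually_const_lt hδ, ht.eventually_gt_atTop (R / δ)] with n hn1 hn2
  have hs : 0 < t n := ht0 n
  have h3 : R < |t n * fn (y n) x| := by
    rw [abs_mul, abs_of_pos hs]
    rw [div_lt_iff₀ hδ0] at hn2
    nlinarith
  have h4 := hR x _ h3
  have hy : 0 < |fn (y n) x| := hδ0.trans hn1
  have hy2 : δ ^ 2 ≤ fn (y n) x ^ 2 := by
    rw [← sq_abs (fn (y n) x)]
    exact pow_le_pow_left₀ hδ0.le hn1.le 2
  have hy3 : 0 < fn (y n) x ^ 2 := (pow_pos hδ0 2).trans_le hy2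
  rw [mul_pow, le_div_iff₀ (by positivity)] at h4
  rw [le_div_iff₀ (by positivity)]
  calc K * t n ^ 2 ≤ |K| * t n ^ 2 := by gcongr; exact le_abs_self K
    _ = |K| / δ ^ 2 * (t n ^ 2 * δ ^ 2) := by field_simp
    _ ≤ |K| / δ ^ 2 * (t n ^ 2 * fn (y n) x ^ 2) := by gcongr
    _ ≤ _ := h4

theorem half_deriv_sub_eq (hf : Nonlinearity f p) (hN : 3 ≤ N) (u : H1 N) :
    1 / 2 * hf.deriv hN u u - potential f u =
      ∫ x, (1 / 2 * (f x (fn u x) * fn u x) - primitive f x (fn u x)) := by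
  rw [integral_sub ((hf.integrable_mul hN u u).const_mul _) (hf.integrable_primitive hN u),
    integral_const_mul, ← hf.deriv_apply, potential]

/-- The integrand ½ f(x,u)u − F(x,u) is nonnegative, so Fatou applies. At critical points this
integral is the energy, so levels do not increase in the weak limit. -/
theorem half_deriv_sub_le (hf : Nonlinearity f p) (hN : 3 ≤ N) {w : ℕ → H1 N} {a : H1 N}
    (hae : ∀ᵐ x, Tendsto (fun n => fn (w n) x) atTop (𝓝 (fn a x))) {c : ℕ → ℝ} {c₀ : ℝ}
    (hc : ∀ n, 1 / 2 * hf.deriv hN (w n) (w n) - potential f (w n) ≤ c n)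
    (hc₀ : Tendsto c atTop (𝓝 c₀)) : 1 / 2 * hf.deriv hN a a - potential f a ≤ c₀ := by
  have hi : ∀ u : H1 N, Integrable
      (fun x => 1 / 2 * (f x (fn u x) * fn u x) - primitive f x (fn u x)) volume := fun u =>
    ((hf.integrable_mul hN u u).const_mul _).sub (hf.integrable_primitive hN u)
  have h0 : ∀ (u : H1 N) x, 0 ≤ 1 / 2 * (f x (fn u x) * fn u x) - primitive f x (fn u x) :=
    fun u x => sub_nonneg.2 (hf.primitive_le x _)
  rw [hf.half_deriv_sub_eq]
  refine integral_le_of_fatou (fun n => hi (w n)) (fun n => h0 (w n)) (hi a) (h0 a) ?_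
    (fun n => by rw [← hf.half_deriv_sub_eq hN]; exact hc n) hc₀
  filter_upwards [hae] with x hx
  exact (((((hf.continuous x).tendsto _).comp hx).mul hx).const_mul (1 / 2)).sub
    (((hf.continuous_primitive x).tendsto _).comp hx)

theorem potential_translate (hf : Nonlinearity f p) (z : Fin N → ℤ) (u : H1 N) :
    potential f (translate (latticePoint z) u) = potential f u := by
  rw [potential, potential, ← integral_add_right_eq_self (fun x => primitive f x (fn u x))
    (latticePoint z)]
  refine integral_congr_ae ?_
  filter_upwards [fn_translate (latticePoint z) u, hf.periodic z] with x h1 h2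
  rw [h1, primitive, primitive, h2]

theorem deriv_translate (hf : Nonlinearity f p) (hN : 3 ≤ N) (z : Fin N → ℤ) (u v : H1 N) :
    hf.deriv hN (translate (latticePoint z) u) (translate (latticePoint z) v) = hf.deriv hN u v := by
  rw [hf.deriv_apply, hf.deriv_apply, ← integral_add_right_eq_self
    (fun x => f x (fn u x) * fn v x) (latticePoint z)]
  refine integral_congr_ae ?_
  filter_upwards [fn_translate (latticePoint z) u, fn_translate (latticePoint z) v,
    hf.periodic z] with x h1 h2 h3
  rw [h1, h2, h3]

end Nonlinearity

end WeakLimits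

/-! ### Invariance of the spectral subspaces under lattice translations. -/

section Translations

variable {N : ℕ} {V : Space N → ℝ}

theorem form_translate (hV : AssumptionV V) (z : Fin N → ℤ) (u v : H1 N) :
    form V (translate (latticePoint z) u) (translate (latticePoint z) v) = form V u v := by
  rw [form, form, ← integral_add_right_eq_self
    (fun x => inner ℝ (grad u x) (grad v x) + V x * (fn u x * fn v x)) (latticePoint z)]
  refine integral_congr_ae ?_
  filter_upwards [fn_translate (latticePoint z) u, fn_translate (latticePoint z) v,
    grad_translate (latticePoint z) u, grad_translate (latticePoint z) v,
    hV.periodic z] with x h1 h2 h3 h4 h5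
  rw [h1, h2, h3, h4, h5]

theorem inner_fn_translate (y : Space N) (u v : H1 N) :
    inner ℝ (fn (translate y u)) (fn (translate y v)) = inner ℝ (fn u) (fn v) := by
  rw [L2.inner_eq, L2.inner_eq, ← integral_add_right_eq_self (fun x => fn u x * fn v x) y]
  refine integral_congr_ae ?_
  filter_upwards [fn_translate y u, fn_translate y v] with x h1 h2
  rw [h1, h2]

/-- Translation as a linear equivalence. -/
def translateEquiv (y : Space N) : H1 N ≃ₗ[ℝ] H1 N :=
  LinearEquiv.ofLinearMap (translate y).toLinearMap (translate (-y)).toLinearMap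
    (LinearMap.ext fun u => translate_translate_neg y u)
    (LinearMap.ext fun u => translate_neg_translate y u)

theorem translateEquiv_apply (y : Space N) (u : H1 N) : translateEquiv y u = translate y u := rfl

theorem IsReducingPair.map_translate (hV : AssumptionV V) {Y Z : Submodule ℝ (H1 N)}
    (h : IsReducingPair V Y Z) (z : Fin N → ℤ) :
    IsReducingPair V (Y.map (translateEquiv (latticePoint z)).toLinearMap)
      (Z.map (translateEquiv (latticePoint z)).toLinearMap) := by
  refine ⟨(Submodule.orderIsoMapComap (translateEquiv (latticePoint z))).isCompl h.1, ?_⟩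
  rintro _ ⟨y, hy, rfl⟩ _ ⟨w, hw, rfl⟩
  simp only [LinearEquiv.coe_coe, translateEquiv_apply]
  rw [inner_fn_translate, form_translate hV]
  exact h.2 y hy w hw

/-- A translate of a reducing pair is again a reducing pair with the same sign of the form, so
maximality in the definition of X⁺ absorbs it. Commutation of P with translations will follow
without spectral calculus. -/
theorem translate_mem_XPlus (hV : AssumptionV V) (h : IsReducingPair V (XPlus V) (XMinus V))
    (h0 : ∀ u ∈ XPlus V, 0 ≤ form V u u) (z : Fin N → ℤ) {u : H1 N} (hu : u ∈ XPlus V) :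
    translate (latticePoint z) u ∈ XPlus V := by
  have h1 : (XPlus V).map (translateEquiv (latticePoint z)).toLinearMap ≤ XPlus V := by
    refine le_sSup ⟨⟨_, h.map_translate hV z⟩, ?_⟩
    rintro _ ⟨y, hy, rfl⟩
    simp only [LinearEquiv.coe_coe, translateEquiv_apply]
    rw [form_translate hV]
    exact h0 y hy
  exact h1 ⟨u, hu, rfl⟩

theorem IsReducingPair.symm {Y Z : Submodule ℝ (H1 N)} (h : IsReducingPair V Y Z) :
    IsReducingPair V Z Y :=
  ⟨h.1.symm, fun z hz y hy => ⟨by rw [real_inner_comm]; exact (h.2 y hy z hz).1,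
    by rw [form_symm]; exact (h.2 y hy z hz).2⟩⟩

theorem translate_mem_XMinus (hV : AssumptionV V) (h : IsReducingPair V (XPlus V) (XMinus V))
    (h0 : ∀ u ∈ XMinus V, form V u u ≤ 0) (z : Fin N → ℤ) {u : H1 N} (hu : u ∈ XMinus V) :
    translate (latticePoint z) u ∈ XMinus V := by
  have h1 : (XMinus V).map (translateEquiv (latticePoint z)).toLinearMap ≤ XMinus V := by
    refine le_sSup ⟨⟨_, h.symm.map_translate hV z⟩, ?_⟩
    rintro _ ⟨y, hy, rfl⟩
    simp only [LinearEquiv.coe_coe, translateEquiv_apply]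
    rw [form_translate hV]
    exact h0 y hy
  exact h1 ⟨u, hu, rfl⟩

theorem inner_translate (y : Space N) (u v : H1 N) :
    inner ℝ (translate y u) v = inner ℝ u (translate (-y) v) := by
  rw [← (translate (-y)).inner_map_map (translate y u) v, translate_neg_translate]

end Translations

/-! ### The Hardy form as a bounded form on H¹. -/

section HardyForm

variable {N : ℕ}

/-- Hardy's inequality makes u ↦ u/|x| bounded from H¹ to L²; Q is the pullback of the L² inner
product. -/
theorem exists_hardyForm (hN : 3 ≤ N) : ∃ Q : H1 N →L[ℝ] H1 N →L[ℝ] ℝ,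
    (∀ u v, Integrable (fun x => fn u x * fn v x / ‖x‖ ^ 2) volume ∧
      Q u v = ∫ x, fn u x * fn v x / ‖x‖ ^ 2) := by
  have h3 : (3 : ℝ) ≤ N := by exact_mod_cast hN
  have hmn : Measurable fun x : Space N => ‖x‖⁻¹ := measurable_norm.inv
  have hk : ∀ u : H1 N, MemLp (fun x => ‖x‖⁻¹ * fnL u x) 2 volume := fun u => by
    refine (memLp_two_iff_integrable_sq
      (hmn.aestronglyMeasurable.mul (Lp.aestronglyMeasurable (fnL u)))).2 ?_
    refine (hardy hN u).1.congr (Eventually.of_forall fun x => ?_)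
    simp only [fnL_apply, Pi.mul_apply]
    rw [mul_pow, inv_pow, div_eq_inv_mul]
  have hC : ∀ u : H1 N, ‖(hk u).toLp _‖ ≤ 2 / ((N : ℝ) - 2) * ‖u‖ := fun u => by
    have h4 : 0 < (N : ℝ) - 2 := by linarith
    refine le_of_sq_le_sq ?_ (by positivity)
    have h5 : ‖(hk u).toLp _‖ ^ 2 = ∫ x, fn u x ^ 2 / ‖x‖ ^ 2 := by
      rw [L2.norm_sq_eq]
      refine integral_congr_ae ?_
      filter_upwards [(hk u).coeFn_toLp] with x hx
      rw [hx, fnL_apply, mul_pow, inv_pow, div_eq_inv_mul]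
    rw [h5, mul_pow, div_pow]
    refine (hardy hN u).2.trans ?_
    norm_num
    gcongr
    exact norm_grad_le u
  obtain ⟨W, hW⟩ : ∃ W : H1 N →L[ℝ] L2 N, ∀ u, W u =ᵐ[volume] fun x => ‖x‖⁻¹ * fn u x :=
    ⟨weightL fnL _ _ hk hC, fun u => weightL_ae u⟩
  have hae : ∀ u v : H1 N, (fun x => W u x * W v x) =ᵐ[volume] fun x => fn u x * fn v x / ‖x‖ ^ 2 :=
    fun u v => by
      filter_upwards [hW u, hW v] with x h1 h2
      rw [h1, h2, div_eq_inv_mul, ← inv_pow]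
      ring
  refine ⟨pairL W W, fun u v => ⟨(L2.integrable_mul (W u) (W v)).congr (hae u v), ?_⟩⟩
  exact (L2.inner_eq (W u) (W v)).trans (integral_congr_ae (hae u v))

end HardyForm

/-! ### The functional with Hardy term: ray bounds, fibre maxima and mountain pass geometry. -/

section Setting

variable {N : ℕ}

/-- The form `B` of `-Δ + V` with its spectral projection `P`, the Hardy form `Q`, and a parameter
`μ` for which `B - μ Q` is coercive on the range of `P`. -/
structure SpectralData (V : Space N → ℝ) (B Q : H1 N →L[ℝ] H1 N →L[ℝ] ℝ) (P : H1 N →L[ℝ] H1 N)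
    (β μ θ : ℝ) : Prop where
  beta_pos : 0 < β
  symm : ∀ u v, B u v = B v u
  idem : ∀ u, P (P u) = P u
  orth : ∀ u v, P u = u → P v = 0 → B u v = 0
  pos : ∀ u, P u = u → β * ‖u‖ ^ 2 ≤ B u u
  neg : ∀ v, P v = 0 → B v v ≤ -(β * ‖v‖ ^ 2)
  translate_form : ∀ z u v, B (translate (latticePoint z) u) (translate (latticePoint z) v) = B u v
  translate_proj : ∀ z u, P (translate (latticePoint z) u) = translate (latticePoint z) (P u)
  integrable_hardy : ∀ u v : H1 N, Integrable (fun x => fn u x * fn v x / ‖x‖ ^ 2) volume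
  hardy_eq : ∀ u v : H1 N, Q u v = ∫ x, fn u x * fn v x / ‖x‖ ^ 2
  mu_nonneg : 0 ≤ μ
  theta_pos : 0 < θ
  coercive : ∀ w, P w = w → θ * ‖w‖ ^ 2 ≤ B w w - μ * Q w w

/-- The functional `½ μ Q(u, u) + ∫ F(x, u)`. -/
def hardyPotential (Q : H1 N →L[ℝ] H1 N →L[ℝ] ℝ) (f : Space N → ℝ → ℝ) (μ : ℝ) (u : H1 N) : ℝ :=
  μ / 2 * Q u u + potential f u

/-- The derivative of `hardyPotential`. -/
def hardyPotentialDeriv (Q : H1 N →L[ℝ] H1 N →L[ℝ] ℝ) {f : Space N → ℝ → ℝ} {p : ℝ}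
    (hf : Nonlinearity f p) (hN : 3 ≤ N) (μ : ℝ) (u : H1 N) : H1 N →L[ℝ] ℝ :=
  μ • Q u + hf.deriv hN u

variable {V : Space N → ℝ} {B Q : H1 N →L[ℝ] H1 N →L[ℝ] ℝ} {P : H1 N →L[ℝ] H1 N} {β μ θ : ℝ}
  {f : Space N → ℝ → ℝ} {p : ℝ}

namespace SpectralData

theorem hardy_symm (S : SpectralData V B Q P β μ θ) (u v : H1 N) : Q u v = Q v u := by
  rw [S.hardy_eq, S.hardy_eq]
  simp only [mul_comm]

theorem hardy_nonneg (S : SpectralData V B Q P β μ θ) (u : H1 N) : 0 ≤ Q u u := by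
  rw [S.hardy_eq]
  exact integral_nonneg fun x => div_nonneg (mul_self_nonneg _) (sq_nonneg _)

theorem eq_zero_of_hardy (S : SpectralData V B Q P β μ θ) (hN : 3 ≤ N) {u : H1 N}
    (h : Q u u = 0) : u = 0 := by
  rw [S.hardy_eq, integral_eq_zero_iff_of_nonneg
    (fun x => div_nonneg (mul_self_nonneg _) (sq_nonneg _)) (S.integrable_hardy u u)] at h
  have : Nontrivial (Space N) := by
    have : Nonempty (Fin N) := ⟨⟨0, by omega⟩⟩
    infer_instance
  apply fn_ext
  filter_upwards [h, Lp.coeFn_zero ℝ 2 (volume : Measure (Space N)),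
    (compl_mem_ae_iff.2 (measure_singleton (0 : Space N)) : {(0 : Space N)}ᶜ ∈ ae volume)]
    with x h1 h2 h3
  rw [fn_zero, h2, Pi.zero_apply]
  rw [Pi.zero_apply, div_eq_zero_iff] at h1
  rcases h1 with h1 | h1
  · exact mul_self_eq_zero.1 h1
  · exact absurd (norm_eq_zero.1 (pow_eq_zero_iff two_ne_zero |>.1 h1)) h3

theorem hardy_sq_le (S : SpectralData V B Q P β μ θ) (u v : H1 N) : Q u v ^ 2 ≤ Q u u * Q v v := by
  have h : ∀ s : ℝ, 0 ≤ Q u u * (s * s) + (2 * Q u v) * s + Q v v := fun s => by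
    have h1 := S.hardy_nonneg (s • u + v)
    simp only [map_add, map_smul, add_apply, smul_apply, smul_eq_mul, S.hardy_symm v u] at h1
    linarith
  have h2 := discrim_le_zero h
  rw [discrim] at h2
  linarith

/-- The Hardy term belongs to the nonlinear part because its defect in `key` is (ν/2) Q(s − t u, s −
t u) ≥ 0. The parameter ν is free so that ν = 0, the limit problem at infinity, is covered as well.
-/
theorem indefiniteData (S : SpectralData V B Q P β μ θ) (hf : Nonlinearity f p) (hN : 3 ≤ N) {ν : ℝ}
    (hν : 0 ≤ ν) : IndefiniteData B P β (hardyPotential Q f ν) (hardyPotentialDeriv Q hf hN ν) where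
  beta_pos := S.beta_pos
  symm := S.symm
  idem := S.idem
  orth := S.orth
  pos := S.pos
  neg := S.neg
  hasFDerivAt u := by
    have h : HasFDerivAt (fun u => Q u u) (Q u + Q.flip u) u := by
      have := Q.hasFDerivAt (x := u) |>.clm_apply (hasFDerivAt_id u)
      refine this.congr_fderiv ?_
      ext v
      simp
    refine ((h.const_mul (ν / 2)).add (hf.hasFDerivAt_potential hN u)).congr_fderiv ?_
    ext v
    simp only [hardyPotentialDeriv, add_apply, smul_apply, ContinuousLinearMap.flip_apply,
      smul_eq_mul, S.hardy_symm v u]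
    ring
  continuous_deriv := (Q.continuous.const_smul ν).add (hf.continuous_deriv hN)
  apply_zero := by simp [hardyPotential, potential_zero]
  key u s t ht := by
    have h1 := hf.potential_key hN ht s u
    have h2 := mul_nonneg hν (S.hardy_nonneg (s - t • u))
    simp only [hardyPotential, hardyPotentialDeriv, add_apply, smul_apply, map_sub, map_smul,
      sub_apply, smul_eq_mul, S.hardy_symm s u] at h1 h2 ⊢
    linarith

theorem potential_le_hardyPotential (S : SpectralData V B Q P β μ θ) {ν : ℝ} (hν : 0 ≤ ν)
    (u : H1 N) : potential f u ≤ hardyPotential Q f ν u := by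
  have := mul_nonneg (by linarith : 0 ≤ ν / 2) (S.hardy_nonneg u)
  simp only [hardyPotential]
  linarith

/-- If t_n → ∞ with nonnegative levels, the vectors w + v_n/t_n are bounded by negativity on ker P,
and every weak limit a has P a = w. The potential at t_n(w + v_n/t_n) is at most a multiple of t_n²,
so superquadraticity gives a = 0, contradicting w ≠ 0. -/
theorem exists_ray_bound (S : SpectralData V B Q P β μ θ) (hf : Nonlinearity f p) (hN : 3 ≤ N)
    {ν : ℝ} (hν : 0 ≤ ν) {w : H1 N} (hw : P w = w) (hw0 : w ≠ 0) :
    ∃ R : ℝ, 0 ≤ R ∧ ∀ t : ℝ, 0 ≤ t → ∀ v, P v = 0 →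
      0 ≤ quadMinus B (hardyPotential Q f ν) (t • w + v) → t ≤ R := by
  by_contra hcon
  push Not at hcon
  have D := S.indefiniteData hf hN hν
  choose t ht0 v hv hJ ht using fun n : ℕ => hcon (n + 1) (by positivity)
  have htp : ∀ n, 0 < t n := fun n => lt_trans (by positivity) (ht n)
  obtain ⟨K, hK⟩ : ∃ K, K = B w w := ⟨_, rfl⟩
  have h1 : ∀ n, β * ‖v n‖ ^ 2 ≤ K * t n ^ 2 ∧ potential f (t n • w + v n) ≤ 1 / 2 * K * t n ^ 2 := by
    intro n
    have h2 := D.form_add (t n • w) (v n) (by rw [map_smul, hw]) (hv n)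
    have h3 := hJ n
    have h4 := S.potential_le_hardyPotential (f := f) hν (t n • w + v n)
    have h5 := hf.potential_nonneg (t n • w + v n)
    have h6 := S.neg _ (hv n)
    have h7 : 0 ≤ β * ‖v n‖ ^ 2 := mul_nonneg S.beta_pos.le (sq_nonneg _)
    simp only [quadMinus] at h3
    rw [h2] at h3
    simp only [map_smul, smul_apply, smul_eq_mul, ← hK] at h3
    constructor <;> linarith
  have hK0 : 0 ≤ K := by
    have := S.pos w hw
    rw [hK]
    exact (mul_nonneg S.beta_pos.le (sq_nonneg _)).trans this
  obtain ⟨y, hy⟩ : ∃ y : ℕ → H1 N, ∀ n, y n = w + (t n)⁻¹ • v n := ⟨_, fun _ => rfl⟩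
  have hty : ∀ n, t n • y n = t n • w + v n := fun n => by
    rw [hy, smul_add, smul_smul, mul_inv_cancel₀ (htp n).ne', one_smul]
  have hyb : ∀ n, ‖y n‖ ≤ ‖w‖ + Real.sqrt (K / β) := fun n => by
    rw [hy]
    refine (norm_add_le _ _).trans (add_le_add le_rfl ?_)
    rw [norm_smul, norm_inv, Real.norm_of_nonneg (ht0 n)]
    apply Real.le_sqrt_of_sq_le
    rw [mul_pow, inv_pow, le_div_iff₀ S.beta_pos, mul_assoc, inv_mul_le_iff₀ (pow_pos (htp n) 2)]
    linarith [(h1 n).1]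
  obtain ⟨a, φ, hφ, hlim⟩ := exists_weak_subseq hyb
  obtain ⟨ψ, hψ, hae⟩ := hlim.exists_subseq_ae fun n => hyb _
  have hPa : P a = w := by
    refine (hlim.map P).unique ?_
    have : (fun n => P ((y ∘ φ) n)) = fun _ => w := by
      funext n
      simp only [Function.comp_apply]
      rw [hy, map_add, map_smul, hw, hv, smul_zero, add_zero]
    rw [this]
    exact weakTendsto_const w
  have htt : Tendsto t atTop atTop :=
    tendsto_atTop_mono (fun n => by linarith [ht n]) tendsto_natCast_atTop_atTop
  have ha := hf.eq_zero_of_potential_le hN (y := fun n => y (φ (ψ n))) (t := fun n => t (φ (ψ n)))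
    (C := 1 / 2 * K) (fun n => htp _) (htt.comp (hφ.comp hψ).tendsto_atTop) hae fun n => by
      rw [hty]
      exact (h1 _).2
  rw [ha, map_zero] at hPa
  exact hw0 hPa.symm

/-- The functional attains its maximum on `ℝ₊ w ⊕ ker P`. -/
theorem exists_max (S : SpectralData V B Q P β μ θ) (hf : Nonlinearity f p) (hN : 3 ≤ N)
    {ν : ℝ} (hν : 0 ≤ ν) {w : H1 N} (hw : P w = w) (hw0 : w ≠ 0) :
    ∃ t₀ : ℝ, 0 ≤ t₀ ∧ ∃ v₀, P v₀ = 0 ∧ ∀ t : ℝ, 0 ≤ t → ∀ v, P v = 0 →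
      quadMinus B (hardyPotential Q f ν) (t • w + v) ≤
        quadMinus B (hardyPotential Q f ν) (t₀ • w + v₀) := by
  have D := S.indefiniteData hf hN hν
  obtain ⟨R, hR0, hR⟩ := S.exists_ray_bound hf hN hν hw hw0
  choose h hPh hmax using D.exists_argmax
  have hc : Continuous h := D.continuous_argmax hPh hmax
  have hk : Continuous fun t : ℝ => quadMinus B (hardyPotential Q f ν) (t • w + h (t • w)) :=
    D.continuous_quadMinus.comp ((continuous_id.smul continuous_const).add
      (hc.comp (continuous_id.smul continuous_const)))
  obtain ⟨t₀, ht₀, hmt⟩ := isCompact_Icc.exists_isMaxOn (nonempty_Icc.2 hR0) hk.continuousOn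
  refine ⟨t₀, ht₀.1, h (t₀ • w), hPh _, fun t ht v hv => ?_⟩
  have h0 : 0 ≤ quadMinus B (hardyPotential Q f ν) (t₀ • w + h (t₀ • w)) := by
    have h1 := hmt (show (0 : ℝ) ∈ Icc 0 R from ⟨le_rfl, hR0⟩)
    have h2 := hmax ((0 : ℝ) • w) 0 (map_zero P)
    have h3 : quadMinus B (hardyPotential Q f ν) ((0 : ℝ) • w + 0) = 0 := by
      simp [quadMinus, D.apply_zero]
    rw [h3] at h2
    exact h2.trans h1
  rcases lt_or_ge (quadMinus B (hardyPotential Q f ν) (t • w + v)) 0 with h1 | h1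
  · linarith
  · refine (hmax (t • w) v hv).trans (hmt (show t ∈ Icc 0 R from ⟨ht, hR t ht v hv h1⟩))

/-- Coercivity gives (θ/2)ρ². The quadratic part of the potential, its power part and the quartic
term cost θρ²/8 each, which leaves α = θρ²/8 uniformly for ε in [0, 1]. -/
theorem exists_geometry (S : SpectralData V B Q P β μ θ) (hf : Nonlinearity f p) (hN : 3 ≤ N) :
    ∃ ρ α : ℝ, 0 < ρ ∧ 0 < α ∧ ∀ ε : ℝ, 0 ≤ ε → ε ≤ 1 → ∀ w, P w = w → ‖w‖ = ρ →
      α ≤ quadMinus B (quartic (hardyPotential Q f μ) ε) w := by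
  have hp := hf.two_lt
  have hθ := S.theta_pos
  obtain ⟨C, hC0, hC⟩ := hf.exists_potential_le hN (ε := θ / 8) (by positivity)
  obtain ⟨A, hA0, hA⟩ := hf.Lp_bound hN
  obtain ⟨ρ, hρ0, hρ1, hρ2⟩ : ∃ ρ : ℝ, 0 < ρ ∧ C * A * ρ ^ (p - 2) < θ / 8 ∧ ρ ^ 2 / 4 < θ / 8 := by
    have h1 : Tendsto (fun ρ : ℝ => C * A * ρ ^ (p - 2)) (𝓝[>] 0) (𝓝 (C * A * 0 ^ (p - 2))) :=
      ((continuous_const.mul (Real.continuous_rpow_const (by linarith))).tendsto _).mono_left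
        nhdsWithin_le_nhds
    have h2 : Tendsto (fun ρ : ℝ => ρ ^ 2 / 4) (𝓝[>] 0) (𝓝 (0 ^ 2 / 4)) :=
      (Continuous.tendsto (by fun_prop) _).mono_left nhdsWithin_le_nhds
    rw [Real.zero_rpow (by linarith), mul_zero] at h1
    norm_num at h2
    obtain ⟨ρ, ⟨h3, h4⟩, h5⟩ := ((h1.eventually_lt_const (by positivity : 0 < θ / 8)).and
      (h2.eventually_lt_const (by positivity : 0 < θ / 8))).and self_mem_nhdsWithin |>.exists
    exact ⟨ρ, h5, h3, h4⟩
  refine ⟨ρ, θ / 8 * ρ ^ 2, hρ0, by positivity, fun ε hε0 hε1 w hw hwρ => ?_⟩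
  have h1 := S.coercive w hw
  have h2 := hC w
  have h3 := (hA w).2
  have h4 : ρ ^ p = ρ ^ (p - 2) * ρ ^ 2 := by
    rw [← Real.rpow_natCast ρ 2, ← Real.rpow_add hρ0]
    congr 1
    push_cast
    ring
  rw [hwρ] at h1 h2 h3
  rw [h4] at h3
  have h5 : C * ∫ x, |fn w x| ^ p ≤ θ / 8 * ρ ^ 2 := by
    calc C * ∫ x, |fn w x| ^ p ≤ C * (A * (ρ ^ (p - 2) * ρ ^ 2)) := by gcongr
      _ = C * A * ρ ^ (p - 2) * ρ ^ 2 := by ring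
      _ ≤ θ / 8 * ρ ^ 2 := by gcongr
  have h6 : ε / 4 * ρ ^ 4 ≤ θ / 8 * ρ ^ 2 := by
    calc ε / 4 * ρ ^ 4 ≤ 1 / 4 * ρ ^ 4 := by gcongr
      _ = ρ ^ 2 / 4 * ρ ^ 2 := by ring
      _ ≤ θ / 8 * ρ ^ 2 := by gcongr
  simp only [quadMinus, quartic, hardyPotential, hwρ]
  linarith

end SpectralData

end Setting

/-! ### Cerami-type sequences. -/

section AlmostCritical

variable {X : Type*} [NormedAddCommGroup X] [InnerProductSpace ℝ X]

theorem exists_form_self_le (B : X →L[ℝ] X →L[ℝ] ℝ) : ∃ b : ℝ, 0 ≤ b ∧ ∀ u, B u u ≤ b * ‖u‖ ^ 2 :=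
  ⟨‖B‖, norm_nonneg B, IndefiniteData.form_self_le B⟩

theorem WeakTendsto.smul_of_abs_le_one {w : ℕ → X} {c : ℕ → ℝ} (hw : WeakTendsto w 0)
    (hc : ∀ n, |c n| ≤ 1) : WeakTendsto (fun n => c n • w n) 0 := fun v => by
  have h1 := hw v
  rw [inner_zero_left] at h1 ⊢
  refine squeeze_zero_norm (fun n => ?_) (tendsto_zero_iff_norm_tendsto_zero.1 h1)
  rw [real_inner_smul_left, norm_mul]
  exact mul_le_of_le_one_left (norm_nonneg _) (hc n)

/-- `C` bounds the functional on `ℝ₊ w ⊕ ker P` for some nonzero `w` in the range of `P`. -/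
def IsRayBound (B : X →L[ℝ] X →L[ℝ] ℝ) (P : X →L[ℝ] X) (G : X → ℝ) (C : ℝ) : Prop :=
  ∃ w, P w = w ∧ w ≠ 0 ∧ ∀ t : ℝ, 0 ≤ t → ∀ v, P v = 0 → quadMinus B G (t • w + v) ≤ C

/-- A Cerami-type sequence for perturbations of a functional by vanishing multiples of `‖u‖⁴`,
with levels between `α` and every ray bound. -/
structure AlmostCritical (B : X →L[ℝ] X →L[ℝ] ℝ) (P : X →L[ℝ] X) (G : X → ℝ)
    (G' : X → X →L[ℝ] ℝ) (α : ℝ) (ε : ℕ → ℝ) (u : ℕ → X) : Prop where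
  eps_pos : ∀ n, 0 < ε n
  eps_tendsto : Tendsto ε atTop (𝓝 0)
  le_level : ∀ n, α ≤ quadMinus B (quartic G (ε n)) (u n)
  slope_le : ∀ n, (1 + ‖u n‖) * ‖B (u n) - quarticDeriv G' (ε n) (u n)‖ ≤ ε n
  level_le : ∀ n C, IsRayBound B P G C → quadMinus B (quartic G (ε n)) (u n) ≤ C + ε n

namespace AlmostCritical

variable {B : X →L[ℝ] X →L[ℝ] ℝ} {P : X →L[ℝ] X} {β α : ℝ} {G : X → ℝ}
  {G' : X → X →L[ℝ] ℝ} {ε : ℕ → ℝ} {u : ℕ → X}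

theorem comp (A : AlmostCritical B P G G' α ε u) {φ : ℕ → ℕ} (hφ : StrictMono φ) :
    AlmostCritical B P G G' α (ε ∘ φ) (u ∘ φ) :=
  ⟨fun _ => A.eps_pos _, A.eps_tendsto.comp hφ.tendsto_atTop, fun _ => A.le_level _,
    fun _ => A.slope_le _, fun _ => A.level_le _⟩

theorem abs_slope_le (A : AlmostCritical B P G G' α ε u) (n : ℕ) (v : X) {c : ℝ}
    (hv : ‖v‖ ≤ c * (1 + ‖u n‖)) : |(B (u n) - quarticDeriv G' (ε n) (u n)) v| ≤ c * ε n := by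
  have h0 : 0 < 1 + ‖u n‖ := by positivity
  have hc : 0 ≤ c := nonneg_of_mul_nonneg_left ((norm_nonneg v).trans hv) h0
  have h1 := (B (u n) - quarticDeriv G' (ε n) (u n)).le_opNorm v
  rw [Real.norm_eq_abs] at h1
  refine h1.trans ?_
  calc ‖B (u n) - quarticDeriv G' (ε n) (u n)‖ * ‖v‖
      ≤ ‖B (u n) - quarticDeriv G' (ε n) (u n)‖ * (c * (1 + ‖u n‖)) :=
        mul_le_mul_of_nonneg_left hv (norm_nonneg (B (u n) - quarticDeriv G' (ε n) (u n)))
    _ = c * ((1 + ‖u n‖) * ‖B (u n) - quarticDeriv G' (ε n) (u n)‖) := by ring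
    _ ≤ c * ε n := mul_le_mul_of_nonneg_left (A.slope_le n) hc

/-- The component in the range of `P` controls the sequence. -/
theorem exists_le_proj (A : AlmostCritical B P G G' α ε u) (D : IndefiniteData B P β G G')
    (hα : 0 < α) : ∃ K : ℝ, 0 < K ∧ ∀ n, 1 + ‖u n‖ ≤ K * ‖P (u n)‖ := by
  have hβ := D.beta_pos
  obtain ⟨b, hb0, hb⟩ := exists_form_self_le B
  refine ⟨Real.sqrt (b / (2 * α)) + (1 + Real.sqrt (b / β)), by positivity, fun n => ?_⟩
  have D' := D.perturb (A.eps_pos n).le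
  have h1 := A.le_level n
  have h2 := D'.quadMinus_le_form (u n)
  have h3 := hb (P (u n))
  have h4 := D'.nonneg (u n)
  have h5 := D.form_add (P (u n)) (u n - P (u n)) (D.idem _) (D.map_sub_proj _)
  have h6 := D.neg _ (D.map_sub_proj (u n))
  rw [add_sub_cancel] at h5
  simp only [quadMinus] at h1
  have h7 : 1 ≤ Real.sqrt (b / (2 * α)) * ‖P (u n)‖ := by
    rw [← abs_of_nonneg (norm_nonneg (P (u n))), ← Real.sqrt_sq_eq_abs, ← Real.sqrt_mul (by positivity)]
    apply Real.le_sqrt_of_sq_le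
    rw [div_mul_eq_mul_div, le_div_iff₀ (by positivity)]
    simp only [quadMinus] at h2
    linarith
  have h8 : ‖u n - P (u n)‖ ≤ Real.sqrt (b / β) * ‖P (u n)‖ := by
    rw [← abs_of_nonneg (norm_nonneg (P (u n))), ← Real.sqrt_sq_eq_abs, ← Real.sqrt_mul (by positivity)]
    apply Real.le_sqrt_of_sq_le
    rw [div_mul_eq_mul_div, le_div_iff₀ hβ]
    linarith
  have h9 : ‖u n‖ ≤ ‖P (u n)‖ + ‖u n - P (u n)‖ := by
    have := norm_add_le (P (u n)) (u n - P (u n))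
    rwa [add_sub_cancel] at this
  linarith

/-- The point s P(u_n/(1 + ‖u_n‖)) equals t u_n + v with t = s/(1 + ‖u_n‖) and v ∈ ker P, so
`quadMinus_le` compares its level with that of u_n. The slope acts on a vector of size O(1 + ‖u_n‖),
which the Cerami weight compensates. This step replaces an Ambrosetti–Rabinowitz condition. -/
theorem quadMinus_proj_le (A : AlmostCritical B P G G' α ε u) (D : IndefiniteData B P β G G')
    {C s : ℝ} (hs : 0 ≤ s) (hC : IsRayBound B P G C) (n : ℕ) :
    quadMinus B (quartic G (ε n)) (s • P ((1 + ‖u n‖)⁻¹ • u n)) ≤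
      C + ε n + ((s ^ 2 + 1) / 2 + s ^ 2 * (1 + ‖P‖)) * ε n := by
  have D' := D.perturb (A.eps_pos n).le
  have h0 : 0 < 1 + ‖u n‖ := by positivity
  obtain ⟨t, ht⟩ : ∃ t, t = s * (1 + ‖u n‖)⁻¹ := ⟨_, rfl⟩
  have ht0 : 0 ≤ t := by rw [ht]; positivity
  have hts : t ≤ s := by
    rw [ht]
    exact mul_le_of_le_one_right hs (inv_le_one_of_one_le₀ (by linarith [norm_nonneg (u n)]))
  have ht2 : t ^ 2 ≤ s ^ 2 := by gcongr
  have e : s • P ((1 + ‖u n‖)⁻¹ • u n) = t • u n + -(t • (u n - P (u n))) := by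
    rw [map_smul, smul_smul, ← ht]
    module
  have hP : P (-(t • (u n - P (u n)))) = 0 := by rw [map_neg, map_smul, D.map_sub_proj, smul_zero, neg_zero]
  have h1 := D'.quadMinus_le (u n) (-(t • (u n - P (u n)))) ht0
  rw [← e] at h1
  have h2 := D.neg _ hP
  have h3 := mul_nonneg D.beta_pos.le (sq_nonneg ‖-(t • (u n - P (u n)))‖)
  have h4 := A.level_le n C hC
  have h5 : ‖u n - P (u n)‖ ≤ (1 + ‖P‖) * ‖u n‖ := by
    refine (norm_sub_le _ _).trans ?_
    have := P.le_opNorm (u n)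
    linarith
  have h6 : ‖((t ^ 2 - 1) / 2) • u n + t • -(t • (u n - P (u n)))‖ ≤
      ((s ^ 2 + 1) / 2 + s ^ 2 * (1 + ‖P‖)) * (1 + ‖u n‖) := by
    have h7 : ‖((t ^ 2 - 1) / 2) • u n‖ ≤ (s ^ 2 + 1) / 2 * ‖u n‖ := by
      rw [norm_smul, Real.norm_eq_abs]
      refine mul_le_mul_of_nonneg_right (abs_le.2 ⟨?_, ?_⟩) (norm_nonneg _) <;>
        nlinarith [sq_nonneg t, sq_nonneg s]
    have h8 : ‖t • -(t • (u n - P (u n)))‖ ≤ s ^ 2 * (1 + ‖P‖) * ‖u n‖ := by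
      rw [norm_smul, norm_neg, norm_smul, Real.norm_of_nonneg ht0]
      calc t * (t * ‖u n - P (u n)‖) = t ^ 2 * ‖u n - P (u n)‖ := by ring
        _ ≤ s ^ 2 * ((1 + ‖P‖) * ‖u n‖) := by gcongr
        _ = _ := by ring
    refine (norm_add_le _ _).trans ?_
    have h9 : 0 ≤ (s ^ 2 + 1) / 2 + s ^ 2 * (1 + ‖P‖) := by
      have := norm_nonneg P
      positivity
    nlinarith
  have h7 := (abs_le.1 (A.abs_slope_le n _ h6)).2
  linarith

/-- Along a bounded sequence the unperturbed slope tends to zero on bounded sequences. -/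
theorem tendsto_slope (A : AlmostCritical B P G G' α ε u) {M c : ℝ} (hM : ∀ n, ‖u n‖ ≤ M)
    {v : ℕ → X} (hv : ∀ n, ‖v n‖ ≤ c) :
    Tendsto (fun n => (B (u n) - G' (u n)) (v n)) atTop (𝓝 0) := by
  have hM0 : 0 ≤ M := (norm_nonneg _).trans (hM 0)
  have hc0 : 0 ≤ c := (norm_nonneg _).trans (hv 0)
  have h0 : Tendsto (fun n => (c + M ^ 3 * c) * ε n) atTop (𝓝 0) := by
    simpa using A.eps_tendsto.const_mul (c + M ^ 3 * c)
  refine squeeze_zero_norm (fun n => ?_) h0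
  have h1 := A.abs_slope_le n (v n) (c := c) (by
    have := norm_nonneg (u n)
    nlinarith [hv n])
  have h2 : (B (u n) - G' (u n)) (v n) = (B (u n) - quarticDeriv G' (ε n) (u n)) (v n) +
      ε n * ‖u n‖ ^ 2 * inner ℝ (u n) (v n) := by
    simp only [quarticDeriv, sub_apply, add_apply, smul_apply, smul_eq_mul, innerSL_apply_apply]
    ring
  have h3 : |ε n * ‖u n‖ ^ 2 * inner ℝ (u n) (v n)| ≤ M ^ 3 * c * ε n := by
    have hε := (A.eps_pos n).le
    rw [abs_mul, abs_of_nonneg (by positivity)]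
    calc ε n * ‖u n‖ ^ 2 * |inner ℝ (u n) (v n)| ≤ ε n * M ^ 2 * (M * c) := by
          gcongr
          · exact hM n
          · exact (abs_real_inner_le_norm _ _).trans (mul_le_mul (hM n) (hv n) (norm_nonneg _) hM0)
      _ = _ := by ring
  rw [Real.norm_eq_abs, h2]
  refine (abs_add_le _ _).trans ?_
  linarith

end AlmostCritical

end AlmostCritical

/-! ### Nonvanishing, boundedness and weak limits of almost critical sequences. -/

section Limits

variable {N : ℕ} {V : Space N → ℝ} {B Q : H1 N →L[ℝ] H1 N →L[ℝ] ℝ} {P : H1 N →L[ℝ] H1 N}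
  {β μ θ α p : ℝ} {f : Space N → ℝ → ℝ} {ε : ℕ → ℝ} {u : ℕ → H1 N}

/-- Normalized almost critical sequences do not vanish in the sense of Lions. -/
theorem AlmostCritical.exists_translate_limit (S : SpectralData V B Q P β μ θ)
    (hf : Nonlinearity f p) (hN : 3 ≤ N) (hα : 0 < α)
    (A : AlmostCritical B P (hardyPotential Q f μ) (hardyPotentialDeriv Q hf hN μ) α ε u)
    {C : ℝ} (hC : IsRayBound B P (hardyPotential Q f μ) C) :
    ∃ (φ : ℕ → ℕ) (z : ℕ → Fin N → ℤ) (b : H1 N), StrictMono φ ∧ b ≠ 0 ∧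
      WeakTendsto (fun k => translate (latticePoint (z k)) ((1 + ‖u (φ k)‖)⁻¹ • u (φ k))) b := by
  have D := S.indefiniteData hf hN S.mu_nonneg
  have hθ := S.theta_pos
  obtain ⟨K, hK0, hK⟩ := A.exists_le_proj D hα
  -- With K‖P y_n‖ ≥ 1 this choice yields (θ/2)‖s P y_n‖² ≥ |C| + 1, above the ray bound C by a
  -- margin.
  obtain ⟨s, hs⟩ : ∃ s, s = Real.sqrt (2 * K ^ 2 * (|C| + 1) / θ) := ⟨_, rfl⟩
  have hs0 : 0 ≤ s := by rw [hs]; positivity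
  have hs2 : s ^ 2 = 2 * K ^ 2 * (|C| + 1) / θ := by rw [hs, Real.sq_sqrt (by positivity)]
  obtain ⟨y, hy⟩ : ∃ y : ℕ → H1 N, ∀ n, y n = (1 + ‖u n‖)⁻¹ • u n := ⟨_, fun _ => rfl⟩
  have hy1 : ∀ n, ‖y n‖ ≤ 1 := fun n => by
    rw [hy, norm_smul, norm_inv, Real.norm_of_nonneg (by positivity), inv_mul_le_iff₀ (by positivity)]
    linarith
  obtain ⟨m, hm⟩ : ∃ m, m = ‖P‖ := ⟨_, rfl⟩
  have hm0 : 0 ≤ m := by rw [hm]; exact norm_nonneg P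
  have hPy : ∀ n, ‖P (y n)‖ ≤ m := fun n => by
    have h1 := P.le_opNorm (y n)
    have := hy1 n
    rw [← hm] at h1
    nlinarith
  have hKy : ∀ n, 1 ≤ K * ‖P (y n)‖ := fun n => by
    have h0 : 0 < 1 + ‖u n‖ := by positivity
    rw [hy, map_smul, norm_smul, norm_inv, Real.norm_of_nonneg h0.le, mul_left_comm,
      le_inv_mul_iff₀ h0, mul_one]
    exact hK n
  have hw : ∀ n, ‖s • P (y n)‖ ≤ s * m := fun n => by
    rw [norm_smul, Real.norm_of_nonneg hs0]
    exact mul_le_mul_of_nonneg_left (hPy n) hs0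
  have hz : ∀ n z, s • P (translate (latticePoint z) (y n)) =
      translate (latticePoint z) (s • P (y n)) := fun n z => by rw [S.translate_proj, map_smul]
  rcases lions_alternative hN hw with hvan | ⟨φ, z, a, hφ, ha, hlim⟩
  -- In the vanishing case the potential at s P y_n is at most ½ + o(1), so the level there is at
  -- least |C| + ½ − o(1), while `quadMinus_proj_le` bounds it by C + o(1).
  · exfalso
    obtain ⟨η, hη0, hη⟩ : ∃ η : ℝ, 0 < η ∧ η * (s * m) ^ 2 ≤ 1 / 2 :=
      ⟨1 / (2 * ((s * m) ^ 2 + 1)), by positivity, by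
        rw [div_mul_eq_mul_div, div_le_iff₀ (by positivity)]
        nlinarith [sq_nonneg (s * m)]⟩
    obtain ⟨c, hc0, hc⟩ := hf.exists_potential_le hN hη0
    have hlow : ∀ n, |C| + 1 - 1 / 2 - c * ∫ x, |fn (s • P (y n)) x| ^ p ≤
        C + (1 + ((s ^ 2 + 1) / 2 + s ^ 2 * (1 + m)) + (s * m) ^ 4 / 4) * ε n := fun n => by
      have h1 := A.quadMinus_proj_le D hs0 hC n
      rw [← hy, ← hm] at h1
      have h2 := S.coercive (s • P (y n)) (by rw [map_smul, S.idem])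
      have h3 := hc (s • P (y n))
      have h4 : η * ‖s • P (y n)‖ ^ 2 ≤ 1 / 2 := by
        refine le_trans ?_ hη
        gcongr
        exact hw n
      have h5 : ε n / 4 * ‖s • P (y n)‖ ^ 4 ≤ ε n / 4 * (s * m) ^ 4 := by
        have := (A.eps_pos n).le
        gcongr
        exact hw n
      have h6 : 2 * (|C| + 1) ≤ θ * ‖s • P (y n)‖ ^ 2 := by
        rw [norm_smul, Real.norm_of_nonneg hs0, mul_pow, hs2]
        have : 1 ≤ (K * ‖P (y n)‖) ^ 2 := one_le_pow₀ (hKy n)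
        calc 2 * (|C| + 1) ≤ 2 * (|C| + 1) * (K * ‖P (y n)‖) ^ 2 :=
              le_mul_of_one_le_right (by positivity) this
          _ = θ * (2 * K ^ 2 * (|C| + 1) / θ * ‖P (y n)‖ ^ 2) := by field_simp
      simp only [quadMinus, quartic, hardyPotential] at h1
      linarith
    have hl := le_of_tendsto_of_tendsto'
      (((hvan p hf.two_lt hf.lt_critExp).const_mul c).const_sub (|C| + 1 - 1 / 2))
      ((A.eps_tendsto.const_mul (1 + ((s ^ 2 + 1) / 2 + s ^ 2 * (1 + m)) + (s * m) ^ 4 / 4)).const_add C)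
      hlow
    have := le_abs_self C
    linarith
  -- Translations commute with P: the nonzero limit a of the translated s P y_n is the image under s
  -- P of the limit b of the translated y_n, so b ≠ 0.
  · obtain ⟨b, ψ, hψ, hb⟩ := exists_weak_subseq
      (u := fun k => translate (latticePoint (z k)) (y (φ k))) (M := 1) fun k => by
        rw [LinearIsometry.norm_map]
        exact hy1 _
    refine ⟨φ ∘ ψ, z ∘ ψ, b, hφ.comp hψ, fun hb0 => ha ?_, ?_⟩
    · refine (hlim.comp hψ.tendsto_atTop).unique ?_
      have h1 := hb.map (s • P)
      simp only [hb0, map_zero, Function.comp_def, smul_apply, hz] at h1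
      exact h1
    · simp only [hy] at hb
      exact hb

/-- Along an unbounded subsequence the translated normalised functions have a nonzero weak limit,
while positivity of the level bounds ∫ F(x,u_n) by a multiple of ‖u_n‖², against superquadraticity.
The Hardy term has a sign and is dropped, so its lack of translation invariance is harmless. -/
theorem AlmostCritical.exists_bound (S : SpectralData V B Q P β μ θ)
    (hf : Nonlinearity f p) (hN : 3 ≤ N) (hα : 0 < α)
    (A : AlmostCritical B P (hardyPotential Q f μ) (hardyPotentialDeriv Q hf hN μ) α ε u)
    {C : ℝ} (hC : IsRayBound B P (hardyPotential Q f μ) C) : ∃ M, ∀ n, ‖u n‖ ≤ M := by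
  by_contra hcon
  have hfr : ∀ n : ℕ, ∃ᶠ k in atTop, (n : ℝ) < ‖u k‖ := fun n => by
    by_contra hn
    rw [not_frequently] at hn
    have hb : IsBoundedUnder (· ≤ ·) atTop fun k => ‖u k‖ :=
      ⟨n, eventually_map.2 (hn.mono fun k hk => not_lt.1 hk)⟩
    obtain ⟨M, hM⟩ := hb.bddAbove_range
    exact hcon ⟨M, fun k => hM ⟨k, rfl⟩⟩
  obtain ⟨ψ, hψ, hbig⟩ := extraction_forall_of_frequently hfr
  obtain ⟨φ, z, b, hφ, hb0, hb⟩ := (A.comp hψ).exists_translate_limit S hf hN hα hC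
  have hbd : ∀ k, ‖translate (latticePoint (z k))
      ((1 + ‖(u ∘ ψ) (φ k)‖)⁻¹ • (u ∘ ψ) (φ k))‖ ≤ 1 := fun k => by
    rw [LinearIsometry.norm_map, norm_smul, norm_inv, Real.norm_of_nonneg (by positivity),
      inv_mul_le_iff₀ (by positivity)]
    linarith
  obtain ⟨χ, hχ, hae⟩ := hb.exists_subseq_ae hbd
  have ht : Tendsto (fun k => 1 + ‖(u ∘ ψ) (φ (χ k))‖) atTop atTop := by
    refine tendsto_atTop_mono (fun k => ?_) ((tendsto_natCast_atTop_atTop (R := ℝ)).comp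
      (hφ.comp hχ).tendsto_atTop)
    have := hbig (φ (χ k))
    simp only [Function.comp_apply]
    linarith
  obtain ⟨K, hK0, hK⟩ := exists_form_self_le B
  refine hb0 (hf.eq_zero_of_potential_le hN (fun k => by positivity) ht hae (C := 1 / 2 * K)
    fun k => ?_)
  obtain ⟨x, hx⟩ : ∃ x, x = (u ∘ ψ) (φ (χ k)) := ⟨_, rfl⟩
  rw [← hx, ← map_smul, smul_smul, mul_inv_cancel₀ (by positivity), one_smul,
    hf.potential_translate]
  have h1 := (A.comp (hψ.comp (hφ.comp hχ))).le_level k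
  have h2 := quadMinus_quartic_le B (hardyPotential Q f μ)
    ((A.comp (hψ.comp (hφ.comp hχ))).eps_pos k).le x
  have e : (u ∘ (ψ ∘ φ ∘ χ)) k = x := by rw [hx]; rfl
  rw [e] at h1
  have h3 := S.potential_le_hardyPotential (f := f) S.mu_nonneg x
  have h4 := hK x
  have h5 : K * ‖x‖ ^ 2 ≤ K * (1 + ‖x‖) ^ 2 :=
    mul_le_mul_of_nonneg_left (pow_le_pow_left₀ (norm_nonneg _) (by linarith) 2) hK0
  have h6 := h1.trans h2
  simp only [quadMinus] at h6
  linarith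

/-- Up to a subsequence, an almost critical sequence converges weakly, and suitable lattice
translates of it converge weakly to a nonzero limit. -/
theorem AlmostCritical.exists_limits (S : SpectralData V B Q P β μ θ)
    (hf : Nonlinearity f p) (hN : 3 ≤ N) (hα : 0 < α)
    (A : AlmostCritical B P (hardyPotential Q f μ) (hardyPotentialDeriv Q hf hN μ) α ε u)
    {C : ℝ} (hC : IsRayBound B P (hardyPotential Q f μ) C) :
    ∃ (φ : ℕ → ℕ) (z : ℕ → Fin N → ℤ) (a b : H1 N) (M : ℝ), StrictMono φ ∧ b ≠ 0 ∧
      (∀ k, ‖u (φ k)‖ ≤ M) ∧ WeakTendsto (fun k => u (φ k)) a ∧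
      WeakTendsto (fun k => translate (latticePoint (z k)) (u (φ k))) b ∧
      (∀ᵐ x, Tendsto (fun k => fn (u (φ k)) x) atTop (𝓝 (fn a x))) ∧
      ∀ᵐ x, Tendsto (fun k => fn (translate (latticePoint (z k)) (u (φ k))) x) atTop
        (𝓝 (fn b x)) := by
  obtain ⟨M, hM⟩ := A.exists_bound S hf hN hα hC
  obtain ⟨φ, z, y, hφ, hy0, hy⟩ := A.exists_translate_limit S hf hN hα hC
  have hM' : ∀ k, ‖translate (latticePoint (z k)) (u (φ k))‖ ≤ M := fun k => by
    rw [LinearIsometry.norm_map]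
    exact hM _
  obtain ⟨a, φ₁, hφ₁, ha⟩ := exists_weak_subseq (u := fun k => u (φ k)) fun k => hM _
  obtain ⟨φ₂, hφ₂, ha'⟩ := ha.exists_subseq_ae fun k => hM _
  obtain ⟨b, φ₃, hφ₃, hb⟩ := exists_weak_subseq
    (u := fun k => translate (latticePoint (z (φ₁ (φ₂ k)))) (u (φ (φ₁ (φ₂ k))))) fun k => hM' _
  obtain ⟨φ₄, hφ₄, hb'⟩ := hb.exists_subseq_ae fun k => hM' _
  have h34 := (hφ₃.comp hφ₄).tendsto_atTop
  have hall := hφ₁.comp (hφ₂.comp (hφ₃.comp hφ₄))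
  -- If b were 0, multiplication by the factors (1 + ‖u‖)⁻¹ ≤ 1 would make the normalised limit y
  -- vanish too.
  refine ⟨φ ∘ φ₁ ∘ φ₂ ∘ φ₃ ∘ φ₄, z ∘ φ₁ ∘ φ₂ ∘ φ₃ ∘ φ₄, a, b, M, hφ.comp hall, fun hb0 => hy0 ?_,
    fun k => hM _, ha.comp (hφ₂.tendsto_atTop.comp h34), hb.comp hφ₄.tendsto_atTop, ?_, hb'⟩
  · refine (hy.comp hall.tendsto_atTop).unique ?_
    have h1 := hb.comp hφ₄.tendsto_atTop
    rw [hb0] at h1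
    have h2 := h1.smul_of_abs_le_one (c := fun k => (1 + ‖u (φ (φ₁ (φ₂ (φ₃ (φ₄ k)))))‖)⁻¹) fun k => by
      rw [abs_of_nonneg (by positivity)]
      exact inv_le_one_of_one_le₀ (by linarith [norm_nonneg (u (φ (φ₁ (φ₂ (φ₃ (φ₄ k))))))])
    simp only [Function.comp_def, ← map_smul] at h2 ⊢
    exact h2
  · filter_upwards [ha'] with x hx
    exact hx.comp h34

end Limits

/-! ### Existence of a critical point below every ray bound. -/

section GroundState

variable {N : ℕ} {V : Space N → ℝ} {B Q : H1 N →L[ℝ] H1 N →L[ℝ] ℝ} {P : H1 N →L[ℝ] H1 N}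
  {β μ θ α p : ℝ} {f : Space N → ℝ → ℝ} {ε : ℕ → ℝ} {u : ℕ → H1 N}

theorem SpectralData.hardy_translate_test_le (S : SpectralData V B Q P β μ θ) {φ : Space N → ℝ}
    (hφ : IsTestFunction φ) {R : ℝ} (hR : tsupport φ ⊆ Metric.closedBall 0 R) {y : Space N}
    (hy : R < ‖y‖) :
    Q (translate y hφ.toH1) (translate y hφ.toH1) ≤ ‖hφ.toH1‖ ^ 2 / (‖y‖ - R) ^ 2 := by
  have hd : 0 < ‖y‖ - R := sub_pos.2 hy
  have h1 : ∫ x, fn (translate y hφ.toH1) x * fn (translate y hφ.toH1) x / ‖x‖ ^ 2 ≤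
      ∫ x, fn (translate y hφ.toH1) x * fn (translate y hφ.toH1) x / (‖y‖ - R) ^ 2 := by
    refine integral_mono_ae (S.integrable_hardy _ _) ((L2.integrable_mul _ _).div_const _) ?_
    filter_upwards [fn_translate y hφ.toH1, ae_shift hφ.fn_toH1 y] with x h2 h3
    rw [h2, h3]
    by_cases h4 : x + y ∈ tsupport φ
    · have h5 := hR h4
      rw [mem_closedBall_zero_iff] at h5
      have h6 : ‖y‖ - R ≤ ‖x‖ := by
        have := norm_sub_le (x + y) x
        rw [add_sub_cancel_left] at this
        linarith
      exact div_le_div_of_nonneg_left (mul_self_nonneg _) (pow_pos hd 2)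
        (pow_le_pow_left₀ hd.le h6 2)
    · rw [image_eq_zero_of_notMem_tsupport h4]
      simp
  rw [S.hardy_eq]
  refine h1.trans ?_
  rw [integral_div, ← L2.inner_eq, real_inner_self_eq_norm_sq]
  have h2 := norm_fn_le (translate y hφ.toH1)
  rw [LinearIsometry.norm_map] at h2
  exact div_le_div_of_nonneg_right (pow_le_pow_left₀ (norm_nonneg _) h2 2) (sq_nonneg _)

/-- The Hardy form vanishes on translates escaping to infinity. -/
theorem SpectralData.tendsto_hardy_translate (S : SpectralData V B Q P β μ θ) (v : H1 N)
    {y : ℕ → Space N} (hy : Tendsto (fun k => ‖y k‖) atTop atTop) :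
    Tendsto (fun k => Q (translate (y k) v) (translate (y k) v)) atTop (𝓝 0) := by
  obtain ⟨q, hq0, hq⟩ := exists_form_self_le Q
  rw [Metric.tendsto_atTop]
  intro η hη
  obtain ⟨r, hr, hrη⟩ : ∃ r > 0, 2 * (q * r ^ 2) < η / 2 := by
    have hc : Tendsto (fun r : ℝ => 2 * (q * r ^ 2)) (𝓝[>] 0) (𝓝 (2 * (q * 0 ^ 2))) :=
      (Continuous.tendsto (by fun_prop) _).mono_left nhdsWithin_le_nhds
    norm_num at hc
    obtain ⟨r, h1, h2⟩ := ((hc.eventually_lt_const (by positivity : 0 < η / 2)).and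
      self_mem_nhdsWithin).exists
    exact ⟨r, h2, h1⟩
  obtain ⟨_, hvφ, φ, hφ, rfl⟩ := Metric.dense_iff.1 (dense_testSet (N := N)) v r hr
  rw [Metric.mem_ball, dist_eq_norm, norm_sub_rev] at hvφ
  obtain ⟨R, hR⟩ := hφ.2.isBounded.subset_closedBall (0 : Space N)
  have hlim : Tendsto (fun k => 2 * (‖hφ.toH1‖ ^ 2 / (‖y k‖ - R) ^ 2)) atTop (𝓝 (2 * 0)) := by
    refine Tendsto.const_mul 2 (Tendsto.div_atTop tendsto_const_nhds ?_)
    exact (tendsto_pow_atTop two_ne_zero).comp (tendsto_atTop_add_const_right _ (-R) hy)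
  rw [mul_zero] at hlim
  obtain ⟨k₀, hk₀⟩ := eventually_atTop.1 ((hlim.eventually_lt_const (by positivity : 0 < η / 2)).and
    (hy.eventually_gt_atTop R))
  refine ⟨k₀, fun k hk => ?_⟩
  obtain ⟨h1, h2⟩ := hk₀ k hk
  have h3 := S.hardy_translate_test_le hφ hR h2
  rw [Real.dist_eq, sub_zero, abs_of_nonneg (S.hardy_nonneg _)]
  obtain ⟨a, ha⟩ : ∃ a, a = translate (y k) hφ.toH1 := ⟨_, rfl⟩
  obtain ⟨b, hb⟩ : ∃ b, b = translate (y k) (v - hφ.toH1) := ⟨_, rfl⟩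
  have e : translate (y k) v = a + b := by rw [ha, hb, ← map_add, add_sub_cancel]
  rw [e]
  rw [← ha] at h3
  have h4 := S.hardy_nonneg (a - b)
  have h5 := hq b
  have h6 : q * ‖b‖ ^ 2 ≤ q * r ^ 2 := by
    rw [hb, LinearIsometry.norm_map]
    exact mul_le_mul_of_nonneg_left (pow_le_pow_left₀ (norm_nonneg _) hvφ.le 2) hq0
  simp only [map_add, map_sub, add_apply, sub_apply] at h4 ⊢
  linarith

/-- If a bounded sequence converges weakly to zero and its translates do not, then the
translations escape to infinity. -/
theorem tendsto_norm_of_weakTendsto {M : ℝ} (hM : ∀ k, ‖u k‖ ≤ M) (hu : WeakTendsto u 0)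
    {y : ℕ → Space N} {b : H1 N} (hb : WeakTendsto (fun k => translate (y k) (u k)) b) (hb0 : b ≠ 0) :
    Tendsto (fun k => ‖y k‖) atTop atTop := by
  by_contra hcon
  obtain ⟨R, hR⟩ : ∃ R, ∃ᶠ k in atTop, ‖y k‖ < R := by
    by_contra h
    push Not at h
    exact hcon (tendsto_atTop.2 h)
  obtain ⟨a, -, φ, hφ, ha⟩ := (isCompact_closedBall (0 : Space N) R).tendsto_subseq'
    (hR.mono fun k hk => by rw [mem_closedBall_zero_iff]; exact hk.le)
  refine hb0 ((hb.comp hφ.tendsto_atTop).unique fun v => ?_)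
  rw [inner_zero_left]
  have h1 : Tendsto (fun k => translate (-y (φ k)) v) atTop (𝓝 (translate (-a) v)) :=
    ((continuous_translate v).tendsto _).comp ha.neg
  have h2 := (hu.comp hφ.tendsto_atTop) (translate (-a) v)
  rw [inner_zero_left] at h2
  have h3 : Tendsto (fun k => inner ℝ (u (φ k)) (translate (-y (φ k)) v - translate (-a) v)) atTop
      (𝓝 0) := by
    have h4 : Tendsto (fun k => M * ‖translate (-y (φ k)) v - translate (-a) v‖) atTop (𝓝 0) := by
      have := (tendsto_iff_norm_sub_tendsto_zero.1 h1).const_mul M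
      rwa [mul_zero] at this
    refine squeeze_zero_norm (fun k => ?_) h4
    exact (norm_inner_le_norm _ _).trans (mul_le_mul_of_nonneg_right (hM _) (norm_nonneg _))
  have h5 := h2.add h3
  rw [add_zero] at h5
  refine h5.congr fun k => ?_
  simp only [Function.comp_apply]
  rw [← inner_add_right, add_sub_cancel, inner_translate]

theorem quadMinus_eq_of_critical (hf : Nonlinearity f p) (hN : 3 ≤ N) {ν : ℝ} {u : H1 N}
    (h : (B u - hardyPotentialDeriv Q hf hN ν u) u = 0) :
    quadMinus B (hardyPotential Q f ν) u = 1 / 2 * hf.deriv hN u u - potential f u := by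
  simp only [hardyPotentialDeriv, sub_apply, add_apply, smul_apply, smul_eq_mul] at h
  simp only [quadMinus, hardyPotential]
  linarith

/-- Level minus half the slope at u_n cancels B and Q; the quartic term contributes −(ε/4)‖u_n‖⁴, a
favourable sign. -/
theorem AlmostCritical.half_deriv_sub_le (hf : Nonlinearity f p) (hN : 3 ≤ N)
    (A : AlmostCritical B P (hardyPotential Q f μ) (hardyPotentialDeriv Q hf hN μ) α ε u)
    {C : ℝ} (hC : IsRayBound B P (hardyPotential Q f μ) C) (n : ℕ) :
    1 / 2 * hf.deriv hN (u n) (u n) - potential f (u n) ≤ C + 2 * ε n := by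
  have h1 := A.level_le n C hC
  have h2 := (abs_le.1 (A.abs_slope_le n (u n) (c := 1) (by linarith))).1
  have h3 : 0 ≤ ε n * ‖u n‖ ^ 4 := mul_nonneg (A.eps_pos n).le (by positivity)
  have h4 := A.eps_pos n
  simp only [quadMinus, quartic, hardyPotential] at h1
  simp only [quarticDeriv, hardyPotentialDeriv, sub_apply, add_apply, smul_apply, smul_eq_mul,
    innerSL_apply_apply, real_inner_self_eq_norm_sq] at h2
  nlinarith

/-- A critical point below every ray bound, when the weak limit is nonzero. -/
theorem AlmostCritical.critical_of_weak (hf : Nonlinearity f p) (hN : 3 ≤ N)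
    (S : SpectralData V B Q P β μ θ)
    (A : AlmostCritical B P (hardyPotential Q f μ) (hardyPotentialDeriv Q hf hN μ) α ε u)
    {M : ℝ} (hM : ∀ n, ‖u n‖ ≤ M) {a : H1 N} (ha : WeakTendsto u a)
    (hae : ∀ᵐ x, Tendsto (fun n => fn (u n) x) atTop (𝓝 (fn a x))) :
    B a - hardyPotentialDeriv Q hf hN μ a = 0 ∧
      ∀ C, IsRayBound B P (hardyPotential Q f μ) C → quadMinus B (hardyPotential Q f μ) a ≤ C := by
  have hcrit : ∀ v, (B a - hardyPotentialDeriv Q hf hN μ a) v = 0 := fun v => by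
    refine tendsto_nhds_unique ?_ (A.tendsto_slope hM (v := fun _ => v) (c := ‖v‖) fun _ => le_rfl)
    have h1 := ha.apply (B v)
    have h2 := (ha.apply (Q v)).const_mul μ
    have h3 := hf.tendsto_deriv_apply hN hM hae v
    simp only [S.symm v, S.hardy_symm v] at h1 h2
    simp only [hardyPotentialDeriv, sub_apply, add_apply, smul_apply, smul_eq_mul]
    exact h1.sub (h2.add h3)
  refine ⟨ContinuousLinearMap.ext hcrit, fun C hC => ?_⟩
  rw [quadMinus_eq_of_critical hf hN (hcrit a)]
  refine hf.half_deriv_sub_le hN hae (fun n => A.half_deriv_sub_le hf hN hC n) ?_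
  simpa using (A.eps_tendsto.const_mul 2).const_add C

/-- A critical point of the translation invariant functional below every ray bound, when the
sequence vanishes locally. -/
theorem AlmostCritical.critical_of_translate (hf : Nonlinearity f p) (hN : 3 ≤ N)
    (S : SpectralData V B Q P β μ θ)
    (A : AlmostCritical B P (hardyPotential Q f μ) (hardyPotentialDeriv Q hf hN μ) α ε u)
    {M : ℝ} (hM : ∀ n, ‖u n‖ ≤ M) (hu : WeakTendsto u 0) {z : ℕ → Fin N → ℤ} {b : H1 N}
    (hb0 : b ≠ 0) (hb : WeakTendsto (fun k => translate (latticePoint (z k)) (u k)) b)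
    (hae : ∀ᵐ x, Tendsto (fun k => fn (translate (latticePoint (z k)) (u k)) x) atTop
      (𝓝 (fn b x))) :
    B b - hardyPotentialDeriv Q hf hN 0 b = 0 ∧
      ∀ C, IsRayBound B P (hardyPotential Q f μ) C → quadMinus B (hardyPotential Q f 0) b ≤ C := by
  obtain ⟨q, hq0, hq⟩ := exists_form_self_le Q
  have hz := tendsto_norm_of_weakTendsto hM hu hb hb0
  have hM' : ∀ k, ‖translate (latticePoint (z k)) (u k)‖ ≤ M := fun k => by
    rw [LinearIsometry.norm_map]
    exact hM k
  have hcrit : ∀ v, (B b - hardyPotentialDeriv Q hf hN 0 b) v = 0 := fun v => by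
    have h0 := A.tendsto_slope hM (v := fun k => translate (-latticePoint (z k)) v) (c := ‖v‖)
      fun k => by rw [LinearIsometry.norm_map]
    have h1 := hb.apply (B v)
    have h3 := hf.tendsto_deriv_apply hN hM' hae v
    -- Cauchy–Schwarz for Q: the sequence is bounded, and the test function is translated to
    -- infinity, where the weight 1/|x|² decays.
    have h4 : Tendsto (fun k => Q (u k) (translate (-latticePoint (z k)) v)) atTop (𝓝 0) := by
      have h5 := (S.tendsto_hardy_translate v (y := fun k => -latticePoint (z k))
        (by simpa only [norm_neg] using hz)).const_mul (q * M ^ 2)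
      rw [mul_zero] at h5
      have h6 : Tendsto (fun k => Q (u k) (translate (-latticePoint (z k)) v) ^ 2) atTop (𝓝 0) := by
        refine squeeze_zero (fun k => sq_nonneg _) (fun k => ?_) h5
        refine (S.hardy_sq_le _ _).trans (mul_le_mul_of_nonneg_right ((hq _).trans ?_)
          (S.hardy_nonneg _))
        exact mul_le_mul_of_nonneg_left (pow_le_pow_left₀ (norm_nonneg _) (hM k) 2) hq0
      have h7 := h6.sqrt
      simp only [Real.sqrt_sq_eq_abs, Real.sqrt_zero] at h7
      exact (tendsto_zero_iff_abs_tendsto_zero _).2 h7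
    refine tendsto_nhds_unique ?_ h0
    have h8 := (h1.sub ((h4.const_mul μ).add h3))
    rw [S.symm v b] at h8
    simp only [hardyPotentialDeriv, sub_apply, add_apply, smul_apply, smul_eq_mul, zero_mul, zero_add]
    simp only [mul_zero, zero_add] at h8
    refine h8.congr fun k => ?_
    obtain ⟨v', hv'⟩ : ∃ v', v' = translate (-latticePoint (z k)) v := ⟨_, rfl⟩
    have e : v = translate (latticePoint (z k)) v' := by rw [hv', translate_translate_neg]
    rw [← hv', e, S.symm, S.translate_form, hf.deriv_translate]
  refine ⟨ContinuousLinearMap.ext hcrit, fun C hC => ?_⟩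
  rw [quadMinus_eq_of_critical hf hN (hcrit b)]
  refine hf.half_deriv_sub_le hN hae (fun n => ?_)
    (by simpa using (A.eps_tendsto.const_mul 2).const_add C)
  rw [hf.deriv_translate, hf.potential_translate]
  exact A.half_deriv_sub_le hf hN hC n

theorem SpectralData.pos_of_max (S : SpectralData V B Q P β μ θ) (hf : Nonlinearity f p) (hN : 3 ≤ N)
    {w : H1 N} (hw : P w = w) (hw0 : w ≠ 0) {C : ℝ}
    (h : ∀ t : ℝ, 0 ≤ t → quadMinus B (hardyPotential Q f μ) (t • w) ≤ C) : 0 < C := by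
  obtain ⟨ρ, α, hρ, hα, hgeo⟩ := S.exists_geometry hf hN
  have hw' := norm_pos_iff.2 hw0
  have h1 := hgeo 0 le_rfl zero_le_one ((ρ / ‖w‖) • w) (by rw [map_smul, hw]) (by
    rw [norm_smul, Real.norm_of_nonneg (by positivity), div_mul_cancel₀ _ hw'.ne'])
  have h2 := quadMinus_quartic_le B (hardyPotential Q f μ) (le_refl 0) ((ρ / ‖w‖) • w)
  linarith [h (ρ / ‖w‖) (by positivity)]

/-- Testing the equation with u gives B(u,u) = ν Q(u,u) + ∫ f(x,u)u ≥ 0, whereas B is negative on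
nonzero elements of ker P. -/
theorem SpectralData.proj_ne_zero (S : SpectralData V B Q P β μ θ) (hf : Nonlinearity f p)
    (hN : 3 ≤ N) {ν : ℝ} (hν : 0 ≤ ν) {u : H1 N}
    (hu : (B u - hardyPotentialDeriv Q hf hN ν u) u = 0) (hu0 : u ≠ 0) : P u ≠ 0 := fun h => by
  have h1 := S.neg u h
  have h2 : 0 ≤ hf.deriv hN u u := by
    rw [hf.deriv_apply]
    exact integral_nonneg fun x => by
      have := hf.primitive_le x (fn u x)
      have := hf.primitive_nonneg x (fn u x)
      simp only [Pi.zero_apply]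
      linarith
  have h3 := mul_pos S.beta_pos (pow_pos (norm_pos_iff.2 hu0) 2)
  have h4 := mul_nonneg hν (S.hardy_nonneg u)
  simp only [hardyPotentialDeriv, sub_apply, add_apply, smul_apply, smul_eq_mul] at hu
  linarith

/-- A nontrivial critical point whose level is below every ray bound. -/
theorem SpectralData.exists_critical (S : SpectralData V B Q P β μ θ) (hf : Nonlinearity f p)
    (hN : 3 ≤ N) (hne : ∃ w, P w = w ∧ w ≠ 0) :
    ∃ u : H1 N, u ≠ 0 ∧ B u - hardyPotentialDeriv Q hf hN μ u = 0 ∧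
      ∀ C, IsRayBound B P (hardyPotential Q f μ) C → quadMinus B (hardyPotential Q f μ) u ≤ C := by
  have D := S.indefiniteData hf hN S.mu_nonneg
  obtain ⟨ρ, α, hρ, hα, hgeo⟩ := S.exists_geometry hf hN
  have hex := fun n : ℕ => D.exists_almost_critical (ε := 1 / ((n : ℝ) + 1)) (by positivity) hα hρ hne
    (hgeo _ (by positivity) (by
      rw [div_le_one (by positivity)]
      have := Nat.cast_nonneg (α := ℝ) n
      linarith))
  choose u hu1 hu2 hu3 using hex
  have A : AlmostCritical B P (hardyPotential Q f μ) (hardyPotentialDeriv Q hf hN μ) α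
      (fun n : ℕ => 1 / ((n : ℝ) + 1)) u :=
    ⟨fun n => by positivity, tendsto_one_div_add_atTop_nhds_zero_nat, hu1, hu2,
      fun n C ⟨w, h1, h2, h3⟩ => hu3 n w C h1 h2 h3⟩
  have hray : ∀ w, P w = w → w ≠ 0 → ∃ t₀ : ℝ, 0 ≤ t₀ ∧ ∃ v₀, P v₀ = 0 ∧
      IsRayBound B P (hardyPotential Q f μ) (quadMinus B (hardyPotential Q f μ) (t₀ • w + v₀)) ∧
      0 < quadMinus B (hardyPotential Q f μ) (t₀ • w + v₀) := fun w hw hw0 => by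
    obtain ⟨t₀, ht₀, v₀, hv₀, hmax⟩ := S.exists_max hf hN S.mu_nonneg hw hw0
    refine ⟨t₀, ht₀, v₀, hv₀, ⟨w, hw, hw0, hmax⟩, S.pos_of_max hf hN hw hw0 fun t ht => ?_⟩
    have := hmax t ht 0 (map_zero P)
    rwa [add_zero] at this
  obtain ⟨w, hw, hw0⟩ := hne
  obtain ⟨t₀, -, v₀, -, hC, -⟩ := hray w hw hw0
  obtain ⟨φ, z, a, b, M, hφ, hb0, hM, ha, hb, ha', hb'⟩ := A.exists_limits S hf hN hα hC
  have A' := A.comp hφ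
  by_cases ha0 : a = 0
  · rw [ha0] at ha
    obtain ⟨hcrit, hlev⟩ := A'.critical_of_translate hf hN S hM ha hb0 hb hb'
    have D0 := S.indefiniteData hf hN le_rfl
    have hPb : P b ≠ 0 := S.proj_ne_zero hf hN le_rfl (by rw [hcrit]; rfl) hb0
    -- The maximum point e of J_μ on the half space through P b gives an admissible ray bound, so
    -- J₀(b) ≤ J_μ(e). Since b is critical for J₀, also J₀(e) ≤ J₀(b); the two differ only if the
    -- Hardy term contributes.
    obtain ⟨s, hs, v, hv, hCs, hpos⟩ := hray (P b) (S.idem b) hPb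
    obtain ⟨e, he⟩ : ∃ e, e = s • P b + v := ⟨_, rfl⟩
    rw [← he] at hCs hpos
    have h1 := hlev _ hCs
    have h2 : quadMinus B (hardyPotential Q f 0) e ≤ quadMinus B (hardyPotential Q f 0) b := by
      have e2 : e = s • b + (v - s • (b - P b)) := by rw [he]; module
      rw [e2]
      refine D0.le_of_nehari (by rw [hcrit]; rfl) (fun v _ => by rw [hcrit]; rfl) ?_ hs
      rw [map_sub, map_smul, D0.map_sub_proj, hv, smul_zero, sub_zero]
    have h3 : quadMinus B (hardyPotential Q f μ) e =
        quadMinus B (hardyPotential Q f 0) e - μ / 2 * Q e e := by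
      simp only [quadMinus, hardyPotential]
      ring
    have h4 : μ * Q e e ≤ 0 := by linarith
    -- For μ = 0 the problem is translation invariant and b solves it. For μ > 0 the comparison
    -- forces Q(e,e) = 0, hence e = 0, at positive level.
    rcases S.mu_nonneg.eq_or_lt with hμ | hμ
    · refine ⟨b, hb0, ?_, ?_⟩
      · rw [← hμ]; exact hcrit
      · intro C hC
        have := hlev C hC
        rw [← hμ]; exact this
    · exfalso
      have h5 : Q e e = 0 := le_antisymm (nonpos_of_mul_nonpos_right h4 hμ) (S.hardy_nonneg e)
      rw [S.eq_zero_of_hardy hN h5] at hpos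
      simp [quadMinus, D.apply_zero] at hpos
  · exact ⟨a, ha0, A'.critical_of_weak hf hN S hM ha ha'⟩

end GroundState

/-! ### Use of the bound on μ, and identification of the abstract critical point with a ground
state. -/

section Conclusion

variable {N : ℕ} {V : Space N → ℝ} {μ : ℝ}

/-- A real supremum takes the default value 0 for empty or unbounded sets, so positivity of μ(V)⁺
carries information: X⁺ ≠ 0, since otherwise every M > 0 would be admissible, and some admissible M
already satisfies the strict bound. -/
theorem exists_lt_of_lt_muPlus (hN : 3 ≤ N) (hμ0 : 0 ≤ μ)
    (hμ : μ < ((N : ℝ) - 2) ^ 2 / 4 * muPlus V) :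
    (∃ w ∈ XPlus V, w ≠ 0) ∧ ∃ M, 0 < M ∧ μ < ((N : ℝ) - 2) ^ 2 / 4 * M ∧
      ∀ u ∈ XPlus V, M * ‖grad u‖ ^ 2 ≤ form V u u := by
  have h3 : (3 : ℝ) ≤ N := by exact_mod_cast hN
  have hc : 0 < ((N : ℝ) - 2) ^ 2 / 4 := by
    have : 0 < (N : ℝ) - 2 := by linarith
    positivity
  have hpos : 0 < muPlus V := pos_of_mul_pos_right (hμ0.trans_lt hμ) hc.le
  obtain ⟨T, hT⟩ : ∃ T, T = {M : ℝ | 0 < M ∧ ∀ u ∈ XPlus V, M * (∫ x, ‖grad u x‖ ^ 2) ≤ form V u u} :=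
    ⟨_, rfl⟩
  have hmu : muPlus V = sSup T := by rw [hT, muPlus]
  refine ⟨?_, ?_⟩
  · by_contra hcon
    push Not at hcon
    have h1 : ¬ BddAbove T := by
      rintro ⟨K, hK⟩
      have h2 : |K| + 1 ∈ T := by
        rw [hT]
        refine ⟨by positivity, fun u hu => ?_⟩
        rw [hcon u hu, ← L2Field.norm_sq_eq]
        have h3 : grad (0 : H1 N) = 0 := rfl
        have h4 : form V (0 : H1 N) 0 = 0 := by
          have h5 : fn (0 : H1 N) = 0 := rfl
          rw [form, h3, h5]
          refine integral_eq_zero_of_ae ?_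
          filter_upwards [Lp.coeFn_zero (Space N) 2 (volume : Measure (Space N)),
            Lp.coeFn_zero ℝ 2 (volume : Measure (Space N))] with x h6 h7
          rw [h6, h7]
          simp
        rw [h3, h4, norm_zero]
        simp
      have := hK h2
      linarith [le_abs_self K]
    rw [hmu, Real.sSup_of_not_bddAbove h1] at hpos
    exact lt_irrefl _ hpos
  · have hne : T.Nonempty := by
      by_contra h
      rw [hmu, not_nonempty_iff_eq_empty.1 h, Real.sSup_empty] at hpos
      exact lt_irrefl _ hpos
    have h1 : μ / (((N : ℝ) - 2) ^ 2 / 4) < sSup T := by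
      rw [div_lt_iff₀' hc, ← hmu]
      exact hμ
    obtain ⟨M, hM, hlt⟩ := exists_lt_of_lt_csSup hne h1
    rw [hT] at hM
    refine ⟨M, hM.1, (div_lt_iff₀' hc).1 hlt, fun u hu => ?_⟩
    rw [L2Field.norm_sq_eq]
    exact hM.2 u hu

theorem AssumptionV.exists_spectralData (hV : AssumptionV V) (hN : 3 ≤ N) (hμ0 : 0 ≤ μ)
    (hμ : μ < ((N : ℝ) - 2) ^ 2 / 4 * muPlus V) :
    ∃ (B Q : H1 N →L[ℝ] H1 N →L[ℝ] ℝ) (P : H1 N →L[ℝ] H1 N) (β θ : ℝ),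
      SpectralData V B Q P β μ θ ∧ (∀ u v, B u v = form V u v) ∧
      (∀ u, u ∈ XPlus V ↔ P u = u) ∧ (∀ u, u ∈ XMinus V ↔ P u = 0) ∧
      IsReducingPair V (XPlus V) (XMinus V) ∧ ∃ w, P w = w ∧ w ≠ 0 := by
  obtain ⟨B, P, β, hβ, hB, hidem, horth, hpos, hneg, hXp, hXm, hred⟩ := hV.exists_projection
  obtain ⟨Q, hQ⟩ := exists_hardyForm hN
  obtain ⟨⟨w, hw, hw0⟩, M, hM0, hμM, hM⟩ := exists_lt_of_lt_muPlus hN hμ0 hμ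
  have h3 : (3 : ℝ) ≤ N := by exact_mod_cast hN
  have hc : 0 < (N : ℝ) - 2 := by linarith
  -- Hardy's constant 4/(N − 2)² and the gradient bound with M give μ Q ≤ k B on X⁺ with k < 1, so
  -- the fraction 1 − k of B survives.
  obtain ⟨k, hk⟩ : ∃ k, k = μ / (((N : ℝ) - 2) ^ 2 / 4 * M) := ⟨_, rfl⟩
  have hk0 : 0 ≤ k := by rw [hk]; positivity
  have hk1 : k < 1 := by rw [hk, div_lt_one (by positivity)]; exact hμM
  have hp : ∀ u ∈ XPlus V, 0 ≤ form V u u := fun u hu => by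
    rw [← hB]
    exact (mul_nonneg hβ.le (sq_nonneg _)).trans (hpos u ((hXp u).1 hu))
  have hm : ∀ u ∈ XMinus V, form V u u ≤ 0 := fun u hu => by
    rw [← hB]
    exact (hneg u ((hXm u).1 hu)).trans (neg_nonpos.2 (mul_nonneg hβ.le (sq_nonneg _)))
  refine ⟨B, Q, P, β, (1 - k) * β, ?_, hB, hXp, hXm, hred, w, (hXp w).1 hw, hw0⟩
  exact {
    beta_pos := hβ
    symm := fun u v => by rw [hB, hB, form_symm]
    idem := hidem
    orth := horth
    pos := hpos
    neg := hneg
    translate_form := fun z u v => by rw [hB, hB, form_translate hV]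
    translate_proj := fun z u => by
      have h1 := (hXp _).1 (translate_mem_XPlus hV hred hp z ((hXp _).2 (hidem u)))
      have h2 := (hXm _).1 (translate_mem_XMinus hV hred hm z
        ((hXm (u - P u)).2 (by rw [map_sub, hidem, sub_self])))
      rw [map_sub, map_sub, sub_eq_zero] at h2
      rw [h2, h1]
    integrable_hardy := fun u v => (hQ u v).1
    hardy_eq := fun u v => (hQ u v).2
    mu_nonneg := hμ0
    theta_pos := mul_pos (by linarith) hβ
    coercive := fun w hw => by
      have h1 := hpos w hw
      have h2 := hM w ((hXp w).2 hw)
      have h4 := (hardy hN w).2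
      have h5 : Q w w ≤ 4 / ((N : ℝ) - 2) ^ 2 * ‖grad w‖ ^ 2 := by
        rw [(hQ w w).2]
        simpa only [sq] using h4
      rw [← hB] at h2
      have h6 : μ * Q w w ≤ k * B w w := by
        calc μ * Q w w ≤ μ * (4 / ((N : ℝ) - 2) ^ 2 * ‖grad w‖ ^ 2) := by gcongr
          _ = k * (M * ‖grad w‖ ^ 2) := by
            rw [hk]
            field_simp
          _ ≤ k * B w w := by gcongr
      nlinarith [mul_le_mul_of_nonneg_left h1 (by linarith : 0 ≤ 1 - k)] }

variable {B Q : H1 N →L[ℝ] H1 N →L[ℝ] ℝ} {P : H1 N →L[ℝ] H1 N} {β θ p : ℝ} {f g : Space N → ℝ → ℝ}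

theorem SpectralData.form_sub_hardy (S : SpectralData V B Q P β μ θ) (hV : AssumptionV V)
    (hB : ∀ u v, B u v = form V u v) (u v : H1 N) :
    B u v - μ * Q u v =
      ∫ x, (inner ℝ (grad u x) (grad v x) + (V x - μ / ‖x‖ ^ 2) * (fn u x * fn v x)) := by
  obtain ⟨-, -, -, -, -, hint⟩ := exists_formL hV.bounded
  have h1 : Integrable (fun x => inner ℝ (grad u x) (grad v x) + V x * (fn u x * fn v x)) volume :=
    (MeasureTheory.L2.integrable_inner (grad u) (grad v)).add (hint u v)
  rw [hB, form, S.hardy_eq, ← integral_const_mul, ← integral_sub h1 ((S.integrable_hardy u v).const_mul μ)]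
  refine integral_congr_ae (Eventually.of_forall fun x => ?_)
  simp only []
  ring

theorem SpectralData.energy_eq (S : SpectralData V B Q P β μ θ) (hV : AssumptionV V)
    (hB : ∀ u v, B u v = form V u v) (hg : ∀ᵐ x, g x = f x) :
    energy V f μ = quadMinus B (hardyPotential Q g μ) := by
  funext u
  have h1 : ∫ x, primitive f x (fn u x) = potential g u := by
    rw [potential]
    refine integral_congr_ae ?_
    filter_upwards [hg] with x hx
    rw [primitive, primitive, hx]
  have h2 := S.form_sub_hardy hV hB u u
  simp only [real_inner_self_eq_norm_sq, ← sq] at h2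
  rw [energy, h1, ← h2]
  simp only [quadMinus, hardyPotential]
  ring

theorem SpectralData.isWeakSolution (S : SpectralData V B Q P β μ θ) (hV : AssumptionV V)
    (hB : ∀ u v, B u v = form V u v) (hg : Nonlinearity g p) (hN : 3 ≤ N) (hgf : ∀ᵐ x, g x = f x)
    {u : H1 N} (hu : B u - hardyPotentialDeriv Q hg hN μ u = 0) : IsWeakSolution V f μ u := by
  intro φ hφ _
  have h1 : (B u - hardyPotentialDeriv Q hg hN μ u) hφ.toH1 = 0 := by rw [hu]; rfl
  simp only [hardyPotentialDeriv, sub_apply, add_apply, smul_apply, smul_eq_mul, hg.deriv_apply] at h1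
  have h2 := S.form_sub_hardy hV hB u hφ.toH1
  have h3 : ∫ x, (fderiv ℝ φ x (grad u x) + (V x - μ / ‖x‖ ^ 2) * (fn u x * φ x)) =
      B u hφ.toH1 - μ * Q u hφ.toH1 := by
    rw [h2]
    refine integral_congr_ae ?_
    filter_upwards [hφ.fn_toH1, hφ.grad_toH1] with x h4 h5
    rw [h4, h5, real_inner_comm, inner_gradient]
  have h4 : ∫ x, f x (fn u x) * φ x = ∫ x, g x (fn u x) * fn hφ.toH1 x := by
    refine integral_congr_ae ?_
    filter_upwards [hφ.fn_toH1, hgf] with x h4 h5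
    rw [h4, h5]
  rw [h3, h4]
  linarith

/-- A nontrivial critical point below every ray bound minimizes over the Nehari–Pankov set. -/
theorem SpectralData.isGroundState (S : SpectralData V B Q P β μ θ) (hg : Nonlinearity g p)
    (hN : 3 ≤ N) (he : energy V f μ = quadMinus B (hardyPotential Q g μ))
    (hXm : ∀ u, u ∈ XMinus V ↔ P u = 0) {u : H1 N} (hu0 : u ≠ 0)
    (hu : B u - hardyPotentialDeriv Q hg hN μ u = 0)
    (hlev : ∀ C, IsRayBound B P (hardyPotential Q g μ) C →
      quadMinus B (hardyPotential Q g μ) u ≤ C) : IsGroundState V f μ u := by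
  have D := S.indefiniteData hg hN S.mu_nonneg
  have hd : ∀ v, fderiv ℝ (energy V f μ) v = B v - hardyPotentialDeriv Q hg hN μ v := fun v => by
    rw [he]
    exact (D.hasFDerivAt_quadMinus v).fderiv
  have huv : ∀ v, (B u - hardyPotentialDeriv Q hg hN μ u) v = 0 := fun v => by rw [hu]; rfl
  have hray : ∀ v, (B v - hardyPotentialDeriv Q hg hN μ v) v = 0 →
      (∀ v', P v' = 0 → (B v - hardyPotentialDeriv Q hg hN μ v) v' = 0) →
      ∀ t : ℝ, 0 ≤ t → ∀ v', P v' = 0 → quadMinus B (hardyPotential Q g μ) (t • P v + v') ≤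
        quadMinus B (hardyPotential Q g μ) v := fun v h1 h2 t ht v' hv' => by
    have e : t • P v + v' = t • v + (v' - t • (v - P v)) := by module
    rw [e]
    refine D.le_of_nehari h1 h2 ?_ ht
    rw [map_sub, map_smul, D.map_sub_proj, hv', smul_zero, sub_zero]
  have hPu : P u ≠ 0 := S.proj_ne_zero hg hN S.mu_nonneg (huv u) hu0
  have hmem : u ∈ nehariPankov V f μ :=
    ⟨fun h => hPu ((hXm u).1 h), by rw [hd]; exact huv u, fun v _ => by rw [hd]; exact huv v⟩
  refine ⟨hu0, ?_, hmem, ⟨⟨u, hmem, rfl⟩, ?_⟩, ?_⟩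
  · rw [he, ← hu]
    exact D.hasFDerivAt_quadMinus u
  -- Any competitor v maximises the functional on ℝ₊ P v ⊕ ker P, so its level is a ray bound and
  -- cannot be less than the level of u.
  · rintro _ ⟨v, ⟨hv1, hv2, hv3⟩, rfl⟩
    rw [hd] at hv2
    simp only [hd] at hv3
    rw [he]
    exact hlev _ ⟨P v, S.idem v, fun h => hv1 ((hXm v).2 h),
      hray v hv2 fun v' hv' => hv3 v' ((hXm v').2 hv')⟩
  · rw [he]
    refine S.pos_of_max hg hN (S.idem u) hPu fun t ht => ?_
    have := hray u (huv u) (fun v' _ => huv v') t ht 0 (map_zero P)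
    rwa [add_zero] at this

end Conclusion

end HardySchrodinger

end

open HardySchrodinger

theorem theorem1p1 (N : ℕ) (hN : 3 ≤ N)
    (V : Space N → ℝ) (hV : AssumptionV V)
    (f : Space N → ℝ → ℝ) (hf : AssumptionF f)
    (μ : ℝ) (hμ0 : 0 ≤ μ) (hμ : μ < ((N : ℝ) - 2) ^ 2 / 4 * muPlus V) :
    IsSpectralDecomposition V (XPlus V) (XMinus V) ∧
      ContDiff ℝ 1 (energy V f μ) ∧
      ∃ u : H1 N, IsGroundState V f μ u ∧ IsWeakSolution V f μ u := by
  obtain ⟨B, Q, P, β, θ, S, hB, hXp, hXm, hred, hne⟩ := hV.exists_spectralData hN hμ0 hμ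
  obtain ⟨g, p, hg, hgf⟩ := hf.exists_nonlinearity
  have D := S.indefiniteData hg hN hμ0
  have he := S.energy_eq hV hB hgf
  refine ⟨⟨hred, fun u hu hu0 => ?_, fun u hu hu0 => ?_⟩, ?_, ?_⟩
  · rw [← hB]
    exact (mul_pos S.beta_pos (pow_pos (norm_pos_iff.2 hu0) 2)).trans_le (S.pos u ((hXp u).1 hu))
  · rw [← hB]
    exact (S.neg u ((hXm u).1 hu)).trans_lt
      (neg_lt_zero.2 (mul_pos S.beta_pos (pow_pos (norm_pos_iff.2 hu0) 2)))
  · rw [he, contDiff_one_iff_fderiv]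
    refine ⟨fun u => (D.hasFDerivAt_quadMinus u).differentiableAt, ?_⟩
    exact D.continuous_slope.congr fun u => (D.hasFDerivAt_quadMinus u).fderiv.symm
  · obtain ⟨u, hu0, hu, hlev⟩ := S.exists_critical hg hN hne
    exact ⟨u, S.isGroundState hg hN he hXm hu0 hu hlev, S.isWeakSolution hV hB hg hN hgf hu⟩
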